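/- Let $G$ be a compact Lie group of dimension $2n$ with Lie algebra $\mathfrak g$, and let $B$ be a positive definite inner product on $\mathfrak g$ that defines a bi-invariant metric on $G$; extend $B$ complex bilinearly to $\mathfrak g^{\mathbb C}=\mathfrak g\otimes\mathbb C$. Let $\mathfrak t\subset\mathfrak g$ be a Cartan subalgebra, $\mathfrak h=\mathfrak t\otimes\mathbb C$, $\mathfrak g^{\mathbb C}=\mathfrak h\oplus\bigoplus_\alpha\mathfrak g_\alpha$ the root decomposition with a choice of positive roots, and $I_{\mathfrak h}$ a $B$-orthogonal complex structure on $\mathfrak t$, with $\mathfrak h=\mathfrak h^{1,0}\oplus\mathfrak h^{0,1}$. Put $\mathfrak g^{1,0}=\mathfrak h^{1,0}\oplus\bigoplus_{\alpha>0}\mathfrak g_\alpha$ and $\mathfrak g^{0,1}=\mathfrak h^{0,1}\oplus\bigoplus_{\alpha<0}\mathfrak g_\alpha$. Let $\theta^L,\theta^R$ be the Maurer--Cartan forms, $\xi^L,\xi^R$ the left- and right-invariant vector fields with value $\xi$ at the identity, $H=\frac1{12}B(\theta^L,[\theta^L,\theta^L])$ the Cartan $3$-form, and $$s(\xi,\xi')=\bigl(\xi^L+\tfrac12B(\theta^L,\xi)\bigr)+\bigl(-\xi'^R+\tfrac12B(\theta^R,\xi')\bigr),\qquad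 (\xi,\xi')\in\mathfrak g\oplus\overline{\mathfrak g}.$$ Then there are endomorphisms $\mathcal J_\phi,\mathcal J_\psi$ of $TG\oplus T^*G$ whose $-\sqrt{-1}$-eigenbundles are spanned by $s(\mathfrak g^{1,0}\oplus\mathfrak g^{1,0})$ and $s(\mathfrak g^{1,0}\oplus\mathfrak g^{0,1})$ respectively, and $(\mathcal J_\phi,\mathcal J_\psi)$ is an $H$-twisted generalized Kähler structure on $G$: $H$ is closed, $\mathcal J_\phi,\mathcal J_\psi$ commute, are orthogonal with square $-1$ and integrable for the $H$-twisted Courant bracket, and $\langle-\mathcal J_\phi\mathcal J_\psi e,e\rangle$ is positive definite, where $\langle v+\xi,u+\eta\rangle=\frac12(\xi(u)+\eta(v))$. For a volume form $\mathrm{vol}$, the scalar curvature $S=S(\mathcal J_\phi,\mathcal J_\psi)$ is the function such that $$S\,\mathrm{vol}=\mathrm{Re}\bigl(i^{-n}\langle\psi,L^H_\eta\overline\psi\rangle_s+i^{-n}\langle\phi,L^H_\zeta\overline\phi\rangle_s\bigr)+2\langle\zeta,\eta\rangle\,\mathrm{vol}$$ for all local nondegenerate pure spinors $\phi,\psi$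 (complex forms annihilated, under $(v+\xi)\cdot\beta=i_v\beta+\xi\wedge\beta$, exactly by the $-\sqrt{-1}$-eigenbundles of $\mathcal J_\phi,\mathcal J_\psi$) normalized by $\mathrm{vol}=i^{-n}\langle\phi,\overline\phi\rangle_s=i^{-n}\langle\psi,\overline\psi\rangle_s$, where $\eta,\zeta$ are the purely imaginary sections of $(TG\oplus T^*G)\otimes\mathbb C$ with $d_H\phi=\eta\cdot\phi$, $d_H\psi=\zeta\cdot\psi$. Here $d_H=d+H\wedge$, $L^H_e=d_H e+e\,d_H$, $\langle\alpha,\beta\rangle_s=(\alpha\wedge\sigma\beta)_{[2n]}$, and $\sigma=(-1)^{k(k-1)/2}$ on $k$-forms. Let $\Xi\in\wedge^3\mathfrak g^{\mathbb C}$ be the Cartan $3$-form, $i_zi_yi_x\Xi=B(x,[y,z])$. For root vectors $\theta_\alpha\in\mathfrak g_\alpha$ ($\alpha>0$) with $B(\theta_\alpha,\overline{\theta_\alpha})=1$, let $P_\alpha\in\mathfrak h$ be the coefficients in $\Xi=\sum_{\alpha>0}2P_\alpha\wedge\theta_\alpha\wedge\overline{\theta_\alpha}+(\text{terms without factor in }\mathfrak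 h)$, i.e. $B(2P_\alpha,h)=B(h,[\overline{\theta_\alpha},\theta_\alpha])$ for $h\in\mathfrak h$. Put $P=\sum_{\alpha>0}P_\alpha$ and $\|P\|^2=B(P,\overline P)$. Then $G$ has a volume form $\mathrm{vol}_G$ (a smooth nowhere vanishing real $2n$-form) with invariant density $|\mathrm{vol}_G|$ such that local spinors $\phi,\psi$ normalized by $\mathrm{vol}_G$ as above exist around every point, and the scalar curvature of $(\mathcal J_\phi,\mathcal J_\psi)$ with respect to $\mathrm{vol}_G$ is the constant $$S(\mathcal J_\phi,\mathcal J_\psi)=2\|P\|^2 .$$ -/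

import Mathlib

open scoped Manifold ContDiff TensorProduct

noncomputable section

/-! ### Linear algebra of `T ⊕ T*` and of its spin representation

Throughout, `E` is the model space of a manifold, so that (as in Mathlib) every tangent space
`TangentSpace 𝓘(ℝ, E) x` is, by definition, a copy of `E`. -/

section Pointwise

variable (E : Type*) [NormedAddCommGroup E] [NormedSpace ℝ E]

/-- The fibre `T ⊕ T*` of the generalized tangent bundle. -/
abbrev GenTangent : Type _ := E × (E →L[ℝ] ℝ)

/-- Complex forms of mixed degree, `⊕ₖ ⋀ᵏ T* ⊗ ℂ`: the component in degree `k` is a `ℂ`-valued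
alternating `k`-form (it vanishes automatically for `k > dim E`). -/
abbrev Spinor : Type _ := ∀ k : ℕ, E [⋀^Fin k]→L[ℝ] ℂ

variable {E}

/-- The pairing `⟨v + ξ, u + η⟩ = ½ (ξ(u) + η(v))` on `T ⊕ T*`. -/
def genPairing : LinearMap.BilinForm ℝ (GenTangent E) :=
  LinearMap.mk₂ ℝ (fun e f => (1 / 2 : ℝ) * (e.2 f.1 + f.2 e.1))
    (by intro a b c; simp; ring) (by intro r a b; simp; ring)
    (by intro a b c; simp; ring) (by intro r a b; simp; ring)

/-- The complex bilinear extension of the pairing to `(T ⊕ T*) ⊗ ℂ`. -/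
def genPairingC : LinearMap.BilinForm ℂ (ℂ ⊗[ℝ] GenTangent E) :=
  LinearMap.BilinForm.baseChange ℂ genPairing

/-- `θ ∧ β` for a real `1`-form `θ`. -/
def wedgeOne {k : ℕ} (θ : E →L[ℝ] ℝ) (β : E [⋀^Fin k]→L[ℝ] ℂ) : E [⋀^Fin (k + 1)]→L[ℝ] ℂ :=
  ContinuousAlternatingMap.alternatizeUncurryFin (θ.smulRight β)

/-- The action of `v + ξ ∈ T ⊕ T*` on forms, `(v + ξ) · β = i_v β + ξ ∧ β`. -/
def cliffordFun (e : GenTangent E) (β : Spinor E) : Spinor E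
  | 0 => (β 1).curryLeft e.1
  | k + 1 => (β (k + 2)).curryLeft e.1 + wedgeOne e.2 (β k)

/-- The real Clifford action of `T ⊕ T*` on complex forms. -/
def cliffordReal : GenTangent E →ₗ[ℝ] Module.End ℂ (Spinor E) where
  toFun e :=
    { toFun := cliffordFun e
      map_add' := by
        intro a b; funext k
        cases k <;> ext v <;>
          simp [cliffordFun, wedgeOne, ContinuousAlternatingMap.alternatizeUncurryFin_apply,
            Finset.sum_add_distrib, smul_add]
        ring
      map_smul' := by
        intro c a; funext k
        cases k <;> ext v <;>
          simp [cliffordFun, wedgeOne, ContinuousAlternatingMap.alternatizeUncurryFin_apply,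
            Finset.mul_sum]
        refine Finset.sum_congr rfl fun i _ => ?_
        ring }
  map_add' := by
    intro e f; ext a k v
    cases k <;>
      simp [cliffordFun, wedgeOne, ContinuousAlternatingMap.alternatizeUncurryFin_apply,
        Finset.sum_add_distrib, add_smul]
    ring
  map_smul' := by
    intro r e; ext a k v
    cases k <;>
      simp [cliffordFun, wedgeOne, ContinuousAlternatingMap.alternatizeUncurryFin_apply,
        Finset.mul_sum]
    refine Finset.sum_congr rfl fun i _ => ?_
    ring

/-- The Clifford action of `(T ⊕ T*) ⊗ ℂ` on complex forms. -/
def clifford : (ℂ ⊗[ℝ] GenTangent E) →ₗ[ℂ] Module.End ℂ (Spinor E) :=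
  LinearMap.liftBaseChange ℂ cliffordReal

/-- `ker β = {e ∈ (T ⊕ T*) ⊗ ℂ | e · β = 0}`. -/
def spinorKer (β : Spinor E) : Submodule ℂ (ℂ ⊗[ℝ] GenTangent E) :=
  LinearMap.ker (clifford.flip β)

/-- Complex conjugation of forms. -/
def Spinor.conj (β : Spinor E) : Spinor E := fun k =>
  (Complex.conjCLE : ℂ →L[ℝ] ℂ).compContinuousAlternatingMap (β k)

/-- The tensor product `α ⊗ β` of forms, `(v₁, …, vₘ) ↦ α (v₁, …, vₖ) β (vₖ₊₁, …, vₘ)`, where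
`m = k + l`. -/
def formTensor {k l m : ℕ} (h : k + l = m) (α : E [⋀^Fin k]→L[ℝ] ℂ) (β : E [⋀^Fin l]→L[ℝ] ℂ) :
    ContinuousMultilinearMap ℝ (fun _ : Fin m => E) ℂ where
  toMultilinearMap := ((LinearMap.mul' ℝ ℂ).compMultilinearMap
    (MultilinearMap.domCoprod α.toMultilinearMap β.toMultilinearMap)).domDomCongr
      (finSumFinEquiv.trans (finCongr h))
  cont := by
    have : Continuous fun v : Fin m → E =>
        α (fun i => v (Fin.cast h (Fin.castAdd l i))) *
          β (fun i => v (Fin.cast h (Fin.natAdd k i))) := by fun_prop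
    exact this

/-- The wedge product `α ∧ β` as a form of degree `m = k + l`, with the normalization
`(α ∧ β)(v) = 1/(k! l!) ∑_σ sign(σ) α(v_{σ(1)}, …, v_{σ(k)}) β(v_{σ(k+1)}, …, v_{σ(m)})`. -/
def wedge {k l m : ℕ} (h : k + l = m) (α : E [⋀^Fin k]→L[ℝ] ℂ) (β : E [⋀^Fin l]→L[ℝ] ℂ) :
    E [⋀^Fin m]→L[ℝ] ℂ :=
  ((k.factorial * l.factorial : ℂ)⁻¹) •
    ContinuousMultilinearMap.alternatization (formTensor h α β)

/-- The degree `m` component of `α ∧ σ β`, where the Clifford involution `σ` acts on degree `l` by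
`(-1)^{l(l-1)/2}`, i.e. by `+1` if `l ≡ 0, 1` and by `-1` if `l ≡ 2, 3` modulo `4`.
With `m = dim E` this is the pairing `⟨α, β⟩ₛ` of the spin representation. -/
def spinorPairing (m : ℕ) (α β : Spinor E) : E [⋀^Fin m]→L[ℝ] ℂ :=
  ∑ p : Finset.HasAntidiagonal.antidiagonal m, ((-1 : ℂ) ^ (p.1.2 * (p.1.2 - 1) / 2)) •
    wedge (Finset.HasAntidiagonal.mem_antidiagonal.1 p.2) (α p.1.1) (β p.1.2)

/-- `H ∧ β` for a real `3`-form `H`. -/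
def wedgeThree (H : E [⋀^Fin 3]→L[ℝ] ℝ) (β : Spinor E) : Spinor E
  | 0 => 0
  | 1 => 0
  | 2 => 0
  | k + 3 => wedge (Nat.add_comm 3 k) (Complex.ofRealCLM.compContinuousAlternatingMap H) (β k)

/-- The `-√-1`-eigenspace of (the complexification of) a real endomorphism of `T ⊕ T*`. -/
def eigenbundle (J : GenTangent E →ₗ[ℝ] GenTangent E) : Submodule ℂ (ℂ ⊗[ℝ] GenTangent E) :=
  Module.End.eigenspace (J.baseChange ℂ) (-Complex.I)

end Pointwise

/-! ### Forms and sections of `T ⊕ T*` on a manifold -/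

section Manifold

variable {E : Type*} [NormedAddCommGroup E] [NormedSpace ℝ E]
  {M : Type*} [TopologicalSpace M] [ChartedSpace E M]
  {F : Type*} [NormedAddCommGroup F] [NormedSpace ℝ F]

/-- The local expression, in the chart at `x₀`, of a field of `k`-forms: its pull-back under the
inverse of the chart. -/
def formInChart {k : ℕ} (x₀ : M) (w : M → E [⋀^Fin k]→L[ℝ] F) (y : E) : E [⋀^Fin k]→L[ℝ] F :=
  (w ((extChartAt 𝓘(ℝ, E) x₀).symm y)).compContinuousLinearMap
    (mfderiv 𝓘(ℝ, E) 𝓘(ℝ, E) (extChartAt 𝓘(ℝ, E) x₀).symm y : E →L[ℝ] E)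

/-- Smoothness of a field of `k`-forms at a point. -/
def FormSmoothAt {k : ℕ} (w : M → E [⋀^Fin k]→L[ℝ] F) (x : M) : Prop :=
  ContDiffAt ℝ ∞ (formInChart x w) (extChartAt 𝓘(ℝ, E) x x)

/-- The exterior derivative of a field of `k`-forms at `x`, computed in the chart at `x` and pulled
back to the manifold. -/
def formDeriv {k : ℕ} (w : M → E [⋀^Fin k]→L[ℝ] F) (x : M) : E [⋀^Fin (k + 1)]→L[ℝ] F :=
  (extDeriv (formInChart x w) (extChartAt 𝓘(ℝ, E) x x)).compContinuousLinearMap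
    (mfderiv 𝓘(ℝ, E) 𝓘(ℝ, E) (extChartAt 𝓘(ℝ, E) x) x : E →L[ℝ] E)

/-- The exterior derivative of a form of mixed degree. -/
def spinorDeriv (φ : M → Spinor E) (x : M) : Spinor E
  | 0 => 0
  | k + 1 => formDeriv (fun y => φ y k) x

/-- `d_H = d + H ∧`. -/
def twistedDeriv (H : M → E [⋀^Fin 3]→L[ℝ] ℝ) (φ : M → Spinor E) (x : M) : Spinor E :=
  spinorDeriv φ x + wedgeThree (H x) (φ x)

/-- The `H`-twisted Lie derivative `L^H_e φ = d_H (e · φ) + e · d_H φ`. -/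
def twistedLieDeriv (H : M → E [⋀^Fin 3]→L[ℝ] ℝ) (e : M → ℂ ⊗[ℝ] GenTangent E)
    (φ : M → Spinor E) (x : M) : Spinor E :=
  twistedDeriv H (fun y => clifford (e y) (φ y)) x + clifford (e x) (twistedDeriv H φ x)

/-- A covector as a form of degree one. -/
def covectorForm (ξ : E →L[ℝ] ℝ) : E [⋀^Fin 1]→L[ℝ] ℝ :=
  ContinuousAlternatingMap.ofSubsingleton ℝ E ℝ (0 : Fin 1) ξ

/-- A form of degree one as a covector. -/
def formCovector (w : E [⋀^Fin 1]→L[ℝ] ℝ) : E →L[ℝ] ℝ :=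
  (ContinuousAlternatingMap.ofSubsingleton ℝ E ℝ (0 : Fin 1)).symm w

/-- Smoothness at a point of a section of `T ⊕ T*`. -/
def SectionSmoothAt [IsManifold 𝓘(ℝ, E) ∞ M] (e : M → GenTangent E) (x : M) : Prop :=
  ContMDiffAt 𝓘(ℝ, E) 𝓘(ℝ, E).tangent ∞
      (fun y => (⟨y, (e y).1⟩ : TangentBundle 𝓘(ℝ, E) M)) x ∧
    FormSmoothAt (fun y => covectorForm (e y).2) x

/-- The differential of a real function. -/
def funDeriv (f : M → ℝ) (x : M) : E →L[ℝ] ℝ := mfderiv 𝓘(ℝ, E) 𝓘(ℝ, ℝ) f x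

/-- The Lie derivative `L_u η = d (i_u η) + i_u dη` of a `1`-form. -/
def lieDerivCovector (u : M → E) (η : M → E →L[ℝ] ℝ) (x : M) : E →L[ℝ] ℝ :=
  funDeriv (fun y => η y (u y)) x +
    formCovector ((formDeriv (fun y => covectorForm (η y)) x).curryLeft (u x))

/-- The `H`-twisted Courant bracket
`[u + ξ, v + η] = [u, v] + L_u η - L_v ξ - ½ (d i_u η - d i_v ξ) - i_v i_u H`. -/
def courantBracket (H : M → E [⋀^Fin 3]→L[ℝ] ℝ) (e f : M → GenTangent E) (x : M) :
    GenTangent E :=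
  ((VectorField.mlieBracket 𝓘(ℝ, E) (fun y => ((e y).1 : TangentSpace 𝓘(ℝ, E) y))
      (fun y => ((f y).1 : TangentSpace 𝓘(ℝ, E) y)) x : E),
    lieDerivCovector (fun y => (e y).1) (fun y => (f y).2) x
      - lieDerivCovector (fun y => (f y).1) (fun y => (e y).2) x
      - (1 / 2 : ℝ) • (funDeriv (fun y => (f y).2 (e y).1) x
          - funDeriv (fun y => (e y).2 (f y).1) x)
      - formCovector (((H x).curryLeft (e x).1).curryLeft (f x).1))

/-- `a + √-1 b` as an element of `(T ⊕ T*) ⊗ ℂ`. -/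
def cplx (a b : GenTangent E) : ℂ ⊗[ℝ] GenTangent E :=
  (1 : ℂ) ⊗ₜ[ℝ] a + Complex.I ⊗ₜ[ℝ] b

/-- An `H`-twisted generalized complex structure: a smooth field of orthogonal endomorphisms `J` of
`T ⊕ T*` with `J² = -1`, such that the smooth local sections of its `-√-1`-eigenbundle are closed
under the (complex bilinearly extended) `H`-twisted Courant bracket. -/
structure IsTwistedGenComplex [IsManifold 𝓘(ℝ, E) ∞ M] (H : M → E [⋀^Fin 3]→L[ℝ] ℝ)
    (J : M → GenTangent E →ₗ[ℝ] GenTangent E) : Prop where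
  smooth : ∀ (e : M → GenTangent E) (x : M),
    SectionSmoothAt e x → SectionSmoothAt (fun y => J y (e y)) x
  sq : ∀ x e, J x (J x e) = -e
  orthogonal : ∀ x e f, genPairing (J x e) (J x f) = genPairing e f
  involutive : ∀ (U : Set M), IsOpen U → ∀ a b a' b' : M → GenTangent E,
    (∀ x ∈ U, SectionSmoothAt a x ∧ SectionSmoothAt b x ∧
      SectionSmoothAt a' x ∧ SectionSmoothAt b' x) →
    (∀ x ∈ U, cplx (a x) (b x) ∈ eigenbundle (J x)) →
    (∀ x ∈ U, cplx (a' x) (b' x) ∈ eigenbundle (J x)) →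
    ∀ x ∈ U, cplx (courantBracket H a a' x - courantBracket H b b' x)
      (courantBracket H a b' x + courantBracket H b a' x) ∈ eigenbundle (J x)

/-- An `H`-twisted generalized Kähler structure: `H` is a smooth closed `3`-form, and `J₁`, `J₂` are
commuting `H`-twisted generalized complex structures for which `⟨-J₁ J₂ e, e⟩` is positive
definite. -/
structure IsTwistedGenKahler [IsManifold 𝓘(ℝ, E) ∞ M] (H : M → E [⋀^Fin 3]→L[ℝ] ℝ)
    (J₁ J₂ : M → GenTangent E →ₗ[ℝ] GenTangent E) : Prop where
  smooth_form : ∀ x, FormSmoothAt H x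
  closed_form : ∀ x, formDeriv H x = 0
  left : IsTwistedGenComplex H J₁
  right : IsTwistedGenComplex H J₂
  commute : ∀ x e, J₁ x (J₂ x e) = J₂ x (J₁ x e)
  pos : ∀ x e, e ≠ 0 → 0 < genPairing (-(J₁ x (J₂ x e))) e

/-- Local trivializations, on an open set `U`, of the canonical line bundles of a generalized Kähler
structure `(J₁, J₂)` on a manifold of dimension `2n`: smooth spinors `φ`, `ψ` on `U` whose kernels
are the `-√-1`-eigenbundles of `J₁`, `J₂` (so `φ`, `ψ` are nondegenerate pure spinors), normalized by
`vol = i⁻ⁿ⟨φ, φ̄⟩ = i⁻ⁿ⟨ψ, ψ̄⟩`, together with the purely imaginary sections `η = √-1 a` and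
`ζ = √-1 b` of `(T ⊕ T*) ⊗ ℂ` for which `d_H φ = η · φ` and `d_H ψ = ζ · ψ`. -/
structure NormalizedTrivialization [IsManifold 𝓘(ℝ, E) ∞ M] (n : ℕ) (H : M → E [⋀^Fin 3]→L[ℝ] ℝ)
    (J₁ J₂ : M → GenTangent E →ₗ[ℝ] GenTangent E) (vol : M → E [⋀^Fin (2 * n)]→L[ℝ] ℝ) where
  U : Set M
  isOpen : IsOpen U
  φ : M → Spinor E
  ψ : M → Spinor E
  φ_smooth : ∀ x ∈ U, ∀ k, FormSmoothAt (fun y => φ y k) x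
  ψ_smooth : ∀ x ∈ U, ∀ k, FormSmoothAt (fun y => ψ y k) x
  φ_ker : ∀ x ∈ U, spinorKer (φ x) = eigenbundle (J₁ x)
  ψ_ker : ∀ x ∈ U, spinorKer (ψ x) = eigenbundle (J₂ x)
  φ_norm : ∀ x ∈ U, (Complex.I ^ n)⁻¹ • spinorPairing (2 * n) (φ x) (φ x).conj =
    Complex.ofRealCLM.compContinuousAlternatingMap (vol x)
  ψ_norm : ∀ x ∈ U, (Complex.I ^ n)⁻¹ • spinorPairing (2 * n) (ψ x) (ψ x).conj =
    Complex.ofRealCLM.compContinuousAlternatingMap (vol x)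
  a : M → GenTangent E
  b : M → GenTangent E
  a_smooth : ∀ x ∈ U, SectionSmoothAt a x
  b_smooth : ∀ x ∈ U, SectionSmoothAt b x
  φ_deriv : ∀ x ∈ U, twistedDeriv H φ x = clifford (Complex.I ⊗ₜ[ℝ] a x) (φ x)
  ψ_deriv : ∀ x ∈ U, twistedDeriv H ψ x = clifford (Complex.I ⊗ₜ[ℝ] b x) (ψ x)

namespace NormalizedTrivialization

variable [IsManifold 𝓘(ℝ, E) ∞ M] {n : ℕ} {H : M → E [⋀^Fin 3]→L[ℝ] ℝ} {J₁ J₂ : M → GenTangent E →ₗ[ℝ] GenTangent E}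
  {vol : M → E [⋀^Fin (2 * n)]→L[ℝ] ℝ}

/-- The purely imaginary section `η` with `d_H φ = η · φ`. -/
def η (T : NormalizedTrivialization n H J₁ J₂ vol) (x : M) : ℂ ⊗[ℝ] GenTangent E :=
  Complex.I ⊗ₜ[ℝ] T.a x

/-- The purely imaginary section `ζ` with `d_H ψ = ζ · ψ`. -/
def ζ (T : NormalizedTrivialization n H J₁ J₂ vol) (x : M) : ℂ ⊗[ℝ] GenTangent E :=
  Complex.I ⊗ₜ[ℝ] T.b x

/-- The `2n`-form
`Re (i⁻ⁿ ⟨ψ, L^H_η ψ̄⟩ + i⁻ⁿ ⟨φ, L^H_ζ φ̄⟩) + 2 ⟨ζ, η⟩ vol`,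
which is the scalar curvature times `vol`. -/
def curvatureForm (T : NormalizedTrivialization n H J₁ J₂ vol) (x : M) :
    E [⋀^Fin (2 * n)]→L[ℝ] ℝ :=
  Complex.reCLM.compContinuousAlternatingMap
      ((Complex.I ^ n)⁻¹ • spinorPairing (2 * n) (T.ψ x)
          (twistedLieDeriv H T.η (fun y => (T.ψ y).conj) x)
        + (Complex.I ^ n)⁻¹ • spinorPairing (2 * n) (T.φ x)
          (twistedLieDeriv H T.ζ (fun y => (T.φ y).conj) x))
    + (2 * (genPairingC (T.ζ x) (T.η x)).re) • vol x

end NormalizedTrivialization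

/-- The function `S` is the scalar curvature `S(J₁, J₂)` of the `H`-twisted generalized Kähler
structure `(J₁, J₂)` with respect to the volume form `vol`: normalized trivializations of the
canonical line bundles exist around every point, and each of them computes `S`. -/
def IsScalarCurvature [IsManifold 𝓘(ℝ, E) ∞ M] (n : ℕ) (H : M → E [⋀^Fin 3]→L[ℝ] ℝ)
    (J₁ J₂ : M → GenTangent E →ₗ[ℝ] GenTangent E) (vol : M → E [⋀^Fin (2 * n)]→L[ℝ] ℝ)
    (S : M → ℝ) : Prop :=
  (∀ x, ∃ T : NormalizedTrivialization n H J₁ J₂ vol, x ∈ T.U) ∧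
    ∀ T : NormalizedTrivialization n H J₁ J₂ vol, ∀ x ∈ T.U, S x • vol x = T.curvatureForm x

end Manifold

/-! ### Root decomposition of the complexification of a real Lie algebra -/

section Roots

variable {L : Type*} [LieRing L] [LieAlgebra ℝ L]

/-- Complex conjugation on `ℂ ⊗ L`. -/
def conjC : (ℂ ⊗[ℝ] L) →ₗ[ℝ] (ℂ ⊗[ℝ] L) :=
  LinearMap.rTensor L Complex.conjAe.toLinearMap

/-- The complex bilinear extension of a real bilinear form. -/
def formC (B : LinearMap.BilinForm ℝ L) : LinearMap.BilinForm ℂ (ℂ ⊗[ℝ] L) :=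
  LinearMap.BilinForm.baseChange ℂ B

/-- The square `‖x‖² = B(x, x̄)` of the Hermitian norm defined by `B`. -/
def hermNormSq (B : LinearMap.BilinForm ℝ L) (x : ℂ ⊗[ℝ] L) : ℝ :=
  (formC B x (conjC x)).re

/-- The Cartan `3`-form `Ξ(x, y, z) = B(x, [y, z])` on `ℂ ⊗ L`. -/
def cartanXi (B : LinearMap.BilinForm ℝ L) (x y z : ℂ ⊗[ℝ] L) : ℂ :=
  formC B x ⁅y, z⁆

/-- The complexification `𝔥 = 𝔱 ⊗ ℂ ⊆ L ⊗ ℂ` of a real subalgebra `𝔱 = 𝔥 ∩ L`. -/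
def complexCartan (𝔱 : LieSubalgebra ℝ L) : Submodule ℂ (ℂ ⊗[ℝ] L) :=
  𝔱.toSubmodule.baseChange ℂ

/-- The space `{x ∈ ℂ ⊗ L | [h, x] = α(h) x for all h ∈ 𝔱}`. -/
def rootSpaceC (𝔱 : LieSubalgebra ℝ L) (α : 𝔱 →ₗ[ℝ] ℂ) : Submodule ℂ (ℂ ⊗[ℝ] L) :=
  ⨅ h : 𝔱, Module.End.eigenspace (LieAlgebra.ad ℂ (ℂ ⊗[ℝ] L) ((1 : ℂ) ⊗ₜ[ℝ] (h : L))) (α h)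

/-- The roots of `ℂ ⊗ L` with respect to `𝔱`. -/
def IsRoot (𝔱 : LieSubalgebra ℝ L) (α : 𝔱 →ₗ[ℝ] ℂ) : Prop :=
  α ≠ 0 ∧ rootSpaceC 𝔱 α ≠ ⊥

/-- A system of positive roots. -/
structure IsPositiveSystem (𝔱 : LieSubalgebra ℝ L) (pos : Finset (𝔱 →ₗ[ℝ] ℂ)) : Prop where
  isRoot : ∀ α ∈ pos, IsRoot 𝔱 α
  pos_or_neg : ∀ α, IsRoot 𝔱 α → Xor (α ∈ pos) (-α ∈ pos)
  add_mem : ∀ α ∈ pos, ∀ β ∈ pos, IsRoot 𝔱 (α + β) → α + β ∈ pos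

/-- `𝔥^{1,0}`, the `√-1`-eigenspace in `𝔥` of a complex structure `J` on `𝔱`. -/
def cartanOneZero (𝔱 : LieSubalgebra ℝ L) (J : 𝔱 →ₗ[ℝ] 𝔱) : Submodule ℂ (ℂ ⊗[ℝ] L) :=
  (Module.End.eigenspace (J.baseChange ℂ) Complex.I).map (𝔱.toSubmodule.subtype.baseChange ℂ)

/-- `𝔥^{0,1}`, the `-√-1`-eigenspace in `𝔥` of a complex structure `J` on `𝔱`. -/
def cartanZeroOne (𝔱 : LieSubalgebra ℝ L) (J : 𝔱 →ₗ[ℝ] 𝔱) : Submodule ℂ (ℂ ⊗[ℝ] L) :=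
  (Module.End.eigenspace (J.baseChange ℂ) (-Complex.I)).map (𝔱.toSubmodule.subtype.baseChange ℂ)

/-- `𝔤^{1,0} = 𝔥^{1,0} ⊕ ⨁_{α > 0} 𝔤_α`. -/
def oneZero (𝔱 : LieSubalgebra ℝ L) (pos : Finset (𝔱 →ₗ[ℝ] ℂ)) (J : 𝔱 →ₗ[ℝ] 𝔱) :
    Submodule ℂ (ℂ ⊗[ℝ] L) :=
  cartanOneZero 𝔱 J ⊔ ⨆ α ∈ pos, rootSpaceC 𝔱 α

/-- `𝔤^{0,1} = 𝔥^{0,1} ⊕ ⨁_{α < 0} 𝔤_α`. -/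
def zeroOne (𝔱 : LieSubalgebra ℝ L) (pos : Finset (𝔱 →ₗ[ℝ] ℂ)) (J : 𝔱 →ₗ[ℝ] 𝔱) :
    Submodule ℂ (ℂ ⊗[ℝ] L) :=
  cartanZeroOne 𝔱 J ⊔ ⨆ α ∈ pos, rootSpaceC 𝔱 (-α)

/-- `P α ∈ 𝔥` is defined by the expansion
`Ξ = ∑_{α > 0} 2 P_α ∧ θ_α ∧ θ̄_α + (terms without a factor in 𝔥)`
of `Ξ ∈ ⋀³ (ℂ ⊗ L)`, where `θ α ∈ 𝔤_α` are root vectors with `B(θ_α, θ̄_α) = 1`. Contracting with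
`h ∈ 𝔥`, then with `θ̄_α`, then with `θ_α`, this says that `B(2 P_α, h) = Ξ(h, θ̄_α, θ_α)`. -/
structure IsCartanCoefficient (B : LinearMap.BilinForm ℝ L) (𝔱 : LieSubalgebra ℝ L)
    (pos : Finset (𝔱 →ₗ[ℝ] ℂ)) (θ P : (𝔱 →ₗ[ℝ] ℂ) → ℂ ⊗[ℝ] L) : Prop where
  root_mem : ∀ α ∈ pos, θ α ∈ rootSpaceC 𝔱 α
  unitary : ∀ α ∈ pos, formC B (θ α) (conjC (θ α)) = 1
  mem : ∀ α ∈ pos, P α ∈ complexCartan 𝔱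
  coeff : ∀ α ∈ pos, ∀ h ∈ complexCartan 𝔱,
    2 * formC B (P α) h = cartanXi B h (conjC (θ α)) (θ α)

end Roots

/-! ### The generalized Kähler structure on a Lie group -/

section LieGroup

variable {E : Type*} [NormedAddCommGroup E] [NormedSpace ℝ E] [FiniteDimensional ℝ E]
  {G : Type*} [TopologicalSpace G] [ChartedSpace E G] [Group G]

theorem continuous_trilinear (f : E →ₗ[ℝ] E →ₗ[ℝ] E →ₗ[ℝ] ℝ) :
    Continuous fun v : Fin 3 → E => f (v 0) (v 1) (v 2) := by
  let b := Module.finBasis ℝ E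
  have hc : ∀ i, Continuous fun u : E => b.repr u i := fun i =>
    (b.coord i).continuous_of_finiteDimensional
  have hf : ∀ i j, Continuous fun w : E => f (b i) (b j) w := fun i j =>
    (f (b i) (b j)).continuous_of_finiteDimensional
  have key : ∀ u v w : E, f u v w = ∑ i, ∑ j, b.repr u i * (b.repr v j * f (b i) (b j) w) := by
    intro u v w
    conv_lhs => rw [← b.sum_repr u, ← b.sum_repr v]
    simp only [map_sum, map_smul, LinearMap.sum_apply, LinearMap.smul_apply, smul_eq_mul,
      Finset.mul_sum]
    rw [Finset.sum_comm]
    exact Finset.sum_congr rfl fun i _ => Finset.sum_congr rfl fun j _ => by ring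
  refine Continuous.congr ?_ fun v => (key (v 0) (v 1) (v 2)).symm
  refine continuous_finsetSum _ fun i _ => continuous_finsetSum _ fun j _ => ?_
  exact ((hc i).comp (continuous_apply 0)).mul
    (((hc j).comp (continuous_apply 1)).mul ((hf i j).comp (continuous_apply 2)))

instance lieGroupMinSmoothness [LieGroup 𝓘(ℝ, E) ∞ G] :
    LieGroup 𝓘(ℝ, E) (minSmoothness ℝ 3) G :=
  LieGroup.of_le (n := ∞) (by
    rw [minSmoothness_of_isRCLikeNormedField]
    exact WithTop.coe_le_coe.2 (le_top : (3 : ℕ∞) ≤ ⊤))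

/-- The left Maurer–Cartan form `θ^L`, with `θ^L(ξ^L) = ξ`. -/
def thetaL (g : G) : E →ₗ[ℝ] GroupLieAlgebra 𝓘(ℝ, E) G :=
  (mfderiv 𝓘(ℝ, E) 𝓘(ℝ, E) (fun x : G => g⁻¹ * x) g : E →L[ℝ] E).toLinearMap

/-- The right Maurer–Cartan form `θ^R`, with `θ^R(ξ^R) = ξ`. -/
def thetaR (g : G) : E →ₗ[ℝ] GroupLieAlgebra 𝓘(ℝ, E) G :=
  (mfderiv 𝓘(ℝ, E) 𝓘(ℝ, E) (fun x : G => x * g⁻¹) g : E →L[ℝ] E).toLinearMap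

/-- The value `ξ^L_g` of the left-invariant vector field with value `ξ` at `1`. -/
def leftField (g : G) : GroupLieAlgebra 𝓘(ℝ, E) G →ₗ[ℝ] E :=
  (mfderiv 𝓘(ℝ, E) 𝓘(ℝ, E) (fun x : G => g * x) 1 : E →L[ℝ] E).toLinearMap

/-- The value `ξ^R_g` of the right-invariant vector field with value `ξ` at `1`. -/
def rightField (g : G) : GroupLieAlgebra 𝓘(ℝ, E) G →ₗ[ℝ] E :=
  (mfderiv 𝓘(ℝ, E) 𝓘(ℝ, E) (fun x : G => x * g) 1 : E →L[ℝ] E).toLinearMap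

/-- The bilinear form `B` on the Lie algebra defines a bi-invariant Riemannian metric on `G`: it is
symmetric and positive definite, and the left-invariant and the right-invariant metric that extend
it coincide. -/
structure IsBiinvariantMetric (B : LinearMap.BilinForm ℝ (GroupLieAlgebra 𝓘(ℝ, E) G)) : Prop where
  symm : ∀ x y, B x y = B y x
  pos : ∀ x, x ≠ 0 → 0 < B x x
  invariant : ∀ (g : G) (u v : E), B (thetaL g u) (thetaL g v) = B (thetaR g u) (thetaR g v)

/-- `s^L(ξ) = ξ^L ⊕ ½ B(θ^L, ξ)` at the point `g`. -/
def sL (B : LinearMap.BilinForm ℝ (GroupLieAlgebra 𝓘(ℝ, E) G)) (g : G) :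
    GroupLieAlgebra 𝓘(ℝ, E) G →ₗ[ℝ] GenTangent E :=
  (leftField g).prod ((1 / 2 : ℝ) •
    ((LinearMap.toContinuousLinearMap : (E →ₗ[ℝ] ℝ) ≃ₗ[ℝ] (E →L[ℝ] ℝ)).toLinearMap ∘ₗ
      (B.compl₁₂ (thetaL g) LinearMap.id).flip))

/-- `s^R(ξ) = -ξ^R ⊕ ½ B(θ^R, ξ)` at the point `g`. -/
def sR (B : LinearMap.BilinForm ℝ (GroupLieAlgebra 𝓘(ℝ, E) G)) (g : G) :
    GroupLieAlgebra 𝓘(ℝ, E) G →ₗ[ℝ] GenTangent E :=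
  (-rightField g).prod ((1 / 2 : ℝ) •
    ((LinearMap.toContinuousLinearMap : (E →ₗ[ℝ] ℝ) ≃ₗ[ℝ] (E →L[ℝ] ℝ)).toLinearMap ∘ₗ
      (B.compl₁₂ (thetaR g) LinearMap.id).flip))

/-- The subspace `s(V ⊕ W)` of `(T_g G ⊕ T*_g G) ⊗ ℂ`, for subspaces `V`, `W` of `𝔤 ⊗ ℂ`, where
`s(ξ, ξ') = s^L(ξ) + s^R(ξ')` on the double `𝔤 ⊕ 𝔤`. -/
def doubleSubspace (B : LinearMap.BilinForm ℝ (GroupLieAlgebra 𝓘(ℝ, E) G)) (g : G)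
    (V W : Submodule ℂ (ℂ ⊗[ℝ] GroupLieAlgebra 𝓘(ℝ, E) G)) :
    Submodule ℂ (ℂ ⊗[ℝ] GenTangent E) :=
  (V.prod W).map (((sL B g).baseChange ℂ).coprod ((sR B g).baseChange ℂ))

variable [LieGroup 𝓘(ℝ, E) ∞ G]

/-- The trilinear form `(u, v, w) ↦ B(θ^L(u), [θ^L(v), θ^L(w)])` on `T_g G`. -/
def cartanTrilinear (B : LinearMap.BilinForm ℝ (GroupLieAlgebra 𝓘(ℝ, E) G)) (g : G) :
    ContinuousMultilinearMap ℝ (fun _ : Fin 3 => E) ℝ where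
  toFun v := B (thetaL g (v 0)) ⁅thetaL g (v 1), thetaL g (v 2)⁆
  map_update_add' := by
    intro inst m i x y
    obtain rfl : inst = instDecidableEqFin 3 := Subsingleton.elim _ _
    fin_cases i <;> simp
  map_update_smul' := by
    intro inst m i c x
    obtain rfl : inst = instDecidableEqFin 3 := Subsingleton.elim _ _
    fin_cases i <;> simp
  cont := by
    let f : E →ₗ[ℝ] E →ₗ[ℝ] E →ₗ[ℝ] ℝ :=
      { toFun := fun u => LinearMap.mk₂ ℝ
          (fun v w => B (thetaL g u) ⁅thetaL g v, thetaL g w⁆)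
          (by intro a b c; simp) (by intro r a b; simp)
          (by intro a b c; simp) (by intro r a b; simp)
        map_add' := by intro x y; ext; simp
        map_smul' := by intro c x; ext; simp }
    exact continuous_trilinear f

/-- The Cartan `3`-form `H = (1/12) B(θ^L, [θ^L, θ^L])` of `G`, where
`B(θ^L, [θ^L, θ^L])(u₁, u₂, u₃) = ∑_σ sign(σ) B(θ^L(u_{σ1}), [θ^L(u_{σ2}), θ^L(u_{σ3})])`. -/
def cartanH (B : LinearMap.BilinForm ℝ (GroupLieAlgebra 𝓘(ℝ, E) G)) (g : G) :
    E [⋀^Fin 3]→L[ℝ] ℝ :=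
  (1 / 12 : ℝ) • ContinuousMultilinearMap.alternatization (cartanTrilinear B g)

end LieGroup

end

noncomputable section

set_option linter.unusedSectionVars false

open Finset (sum_congr sum_add_distrib sum_neg_distrib sum_sub_distrib smul_sum mul_sum
  sum_eq_zero sum_comm sum_insert sum_const_zero sum_eq_single mem_insert_of_mem mem_insert_self
  sum_coe_sort)
open Finset.HasAntidiagonal (antidiagonal mem_antidiagonal)
open Complex (I I_mul_I conj_I ofRealCLM real_smul add_re I_ne_zero ofReal_zero normSq ofReal_re
  mul_re)
open Module (Basis End finrank finBasisOfFinrankEq finBasis)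
open LinearMap (BilinForm baseChange_tmul baseChange_comp toContinuousLinearMap mk₂ ker range
  mem_ker mem_range comp_apply)
open TensorProduct (smul_tmul' induction_on tmul_add neg_tmul smul_tmul tmul_smul tmul_sub
  tmul_sum add_tmul tmul_neg tmul_zero)
open ContinuousAlternatingMap (alternatizeUncurryFin alternatizeUncurryFin_apply
  alternatizeUncurryFinCLM curryLeft_apply_apply)
open ContinuousMultilinearMap (alternatization alternatization_apply_apply)
open ContinuousLinearMap (fst snd compL comp_assoc id_comp comp_id smulRightL)
open LieAlgebra.ExtendScalars (bracket_tmul)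
open Fintype (sum_sum_type)
open Equiv (Perm swap)
open Sum (elim_inl elim_inr)
open Submodule (mem_sup_left mem_sup_right mem_inf)
open Matrix (vecCons)
open LinearEquiv (apply_symm_apply)
open DFunLike (congr_fun)

/-! ### Notation -/

notation:max "Lie(" E "," G ")" => GroupLieAlgebra 𝓘(ℝ, E) G
notation:max "Lieℂ(" E "," G ")" => TensorProduct ℝ ℂ (GroupLieAlgebra 𝓘(ℝ, E) G)
notation:max "chart[" E "]" => extChartAt 𝓘(ℝ, E)
notation:max "C∞[" E "," F "]" => ContMDiffAt 𝓘(ℝ, E) 𝓘(ℝ, F) ∞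
notation:max "MD[" E "," F "]" => MDifferentiableAt 𝓘(ℝ, E) 𝓘(ℝ, F)
notation "ofRealForm" => ContinuousLinearMap.compContinuousAlternatingMap Complex.ofRealCLM

/-! ### Exterior algebra of mixed forms -/

section MixedForms

variable {E : Type*} [NormedAddCommGroup E] [NormedSpace ℝ E]

open Finset in
theorem sum_perm_succ_eq {A : Type*} [AddCommGroup A] {X : Type*} {m : ℕ}
    (f : (Fin (m + 1) → X) → A) (x : X) (v : Fin m → X) :
    ∑ σ : Perm (Fin (m + 1)), Perm.sign σ • f ((Fin.cons x v : Fin (m + 1) → X) ∘ σ) =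
      ∑ p : Fin (m + 1), (-1 : ℤˣ) ^ (p : ℕ) •
        ∑ e : Perm (Fin m), Perm.sign e • f (p.insertNth x (v ∘ e)) := by
  simp_rw [smul_sum]
  rw [← Fintype.sum_prod_type']
  symm
  let F : Fin (m + 1) × Perm (Fin m) → Perm (Fin (m + 1)) := fun q =>
    Perm.decomposeFin.symm (0, q.2) * q.1.cycleRange
  have hF : Function.Injective F := by
    rintro ⟨p, e⟩ ⟨p', e'⟩ h
    have h0 : p = p' := by
      have := congrArg (fun s : Perm (Fin (m + 1)) => s p) h
      simp only [F, Perm.mul_apply, Fin.cycleRange_self, Perm.decomposeFin_symm_apply_zero] at this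
      have h2 : p'.cycleRange p = 0 := by
        apply (Perm.decomposeFin.symm ((0 : Fin (m + 1)), e')).injective
        rw [← this, Perm.decomposeFin_symm_apply_zero]
      rw [← Fin.cycleRange_self p'] at h2
      exact p'.cycleRange.injective h2
    subst h0
    have h1 := mul_right_cancel h
    have := Perm.decomposeFin.symm.injective h1
    simpa using this
  have hbij : Function.Bijective F := by
    rw [Fintype.bijective_iff_injective_and_card]
    refine ⟨hF, ?_⟩
    simp [Fintype.card_perm, Nat.factorial_succ]
  refine Fintype.sum_bijective F hbij _ _ ?_
  rintro ⟨p, e⟩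
  have h1 : Perm.sign (F (p, e)) = (-1) ^ (p : ℕ) * Perm.sign e := by
    simp [F, Perm.decomposeFin.symm_sign, mul_comm]
  have h2 : (Fin.cons x v : Fin (m + 1) → X) ∘ (F (p, e)) = p.insertNth x (v ∘ e) := by
    rw [← Fin.cons_comp_cycleRange]
    have h3 : (Fin.cons x (v ∘ e) : Fin (m + 1) → X) =
        (Fin.cons x v : Fin (m + 1) → X) ∘ (Perm.decomposeFin.symm ((0 : Fin (m + 1)), e)) := by
      funext j
      refine Fin.cases ?_ (fun i => ?_) j
      · simp
      · simp
    rw [h3]; rfl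
  rw [h1, h2, mul_smul]

theorem formTensor_apply {k l m : ℕ} (h : k + l = m) (α : E [⋀^Fin k]→L[ℝ] ℂ)
    (β : E [⋀^Fin l]→L[ℝ] ℂ) (v : Fin m → E) :
    formTensor h α β v = α (fun i => v (Fin.cast h (Fin.castAdd l i))) *
      β (fun i => v (Fin.cast h (Fin.natAdd k i))) := rfl

theorem wedge_apply {k l m : ℕ} (h : k + l = m) (α : E [⋀^Fin k]→L[ℝ] ℂ)
    (β : E [⋀^Fin l]→L[ℝ] ℂ) (v : Fin m → E) : wedge h α β v = (k.factorial * l.factorial : ℂ)⁻¹ *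
      ∑ σ : Perm (Fin m), Perm.sign σ • formTensor h α β (v ∘ σ) := by
  simp only [wedge, ContinuousAlternatingMap.smul_apply, smul_eq_mul]
  rw [alternatization_apply_apply]

theorem wedge_cons {k l m : ℕ} (h : k + l = m + 1) (α : E [⋀^Fin k]→L[ℝ] ℂ)
    (β : E [⋀^Fin l]→L[ℝ] ℂ) (x : E) (v : Fin m → E) :
    wedge h α β (vecCons x v) = (k.factorial * l.factorial : ℂ)⁻¹ *
      ∑ p : Fin (m + 1), (-1 : ℤˣ) ^ (p : ℕ) • ∑ e : Perm (Fin m), Perm.sign e •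
        formTensor h α β (p.insertNth x (v ∘ e)) := by
  rw [wedge_apply]
  congr 1
  exact sum_perm_succ_eq (fun w => formTensor h α β w) x v

theorem formTensor_insertNth_left {k l m : ℕ} (h : k + 1 + l = m + 1) (h' : k + l = m)
    (α : E [⋀^Fin (k + 1)]→L[ℝ] ℂ) (β : E [⋀^Fin l]→L[ℝ] ℂ) (x : E) (u : Fin m → E)
    (p : Fin (k + 1)) : formTensor h α β ((Fin.cast h (Fin.castAdd l p)).insertNth x u) =
      (-1) ^ (p : ℕ) * formTensor h' (α.curryLeft x) β u := by
  subst h'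
  rw [formTensor_apply, formTensor_apply]
  have h1 : (fun i => ((Fin.cast h (Fin.castAdd l p)).insertNth x u : Fin (k + l + 1) → E)
      (Fin.cast h (Fin.castAdd l i))) = p.insertNth x (fun i => u (Fin.castAdd l i)) := by
    rw [Fin.eq_insertNth_iff]
    refine ⟨by simp, ?_⟩
    funext j
    have : Fin.cast h (Fin.castAdd l (p.succAbove j)) =
        (Fin.cast h (Fin.castAdd l p)).succAbove (Fin.castAdd l j) := by
      ext
      simp only [Fin.succAbove, Fin.lt_def, Fin.val_cast, Fin.val_castAdd, Fin.val_castSucc]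
      split_ifs <;> simp
    simp only [Fin.removeNth, this, Fin.insertNth_apply_succAbove]
  have h2 : (fun i => ((Fin.cast h (Fin.castAdd l p)).insertNth x u : Fin (k + l + 1) → E)
      (Fin.cast h (Fin.natAdd (k + 1) i))) = fun i => u (Fin.natAdd k i) := by
    funext j
    have : Fin.cast h (Fin.natAdd (k + 1) j) =
        (Fin.cast h (Fin.castAdd l p)).succAbove (Fin.natAdd k j) := by
      ext
      have := p.2
      rw [Fin.succAbove_of_le_castSucc]
      · simp; omega
      · simp [Fin.le_def]; omega
    rw [this, Fin.insertNth_apply_succAbove]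
  rw [h1, h2, ContinuousAlternatingMap.map_insertNth]
  simp only [Fin.cast_eq_self, curryLeft_apply_apply]
  rcases Nat.even_or_odd (p : ℕ) with hp | hp <;> simp [hp.neg_one_pow]

theorem formTensor_insertNth_right {k l m : ℕ} (h : k + (l + 1) = m + 1) (h' : k + l = m)
    (α : E [⋀^Fin k]→L[ℝ] ℂ) (β : E [⋀^Fin (l + 1)]→L[ℝ] ℂ) (x : E) (u : Fin m → E)
    (p : Fin (l + 1)) : formTensor h α β ((Fin.cast h (Fin.natAdd k p)).insertNth x u) =
      (-1) ^ (p : ℕ) * formTensor h' α (β.curryLeft x) u := by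
  subst h'
  rw [formTensor_apply, formTensor_apply]
  have h1 : (fun i => ((Fin.cast h (Fin.natAdd k p)).insertNth x u : Fin (k + l + 1) → E)
      (Fin.cast h (Fin.natAdd k i))) = p.insertNth x (fun i => u (Fin.natAdd k i)) := by
    rw [Fin.eq_insertNth_iff]
    refine ⟨by simp, ?_⟩
    funext j
    have : Fin.cast h (Fin.natAdd k (p.succAbove j)) =
        (Fin.cast h (Fin.natAdd k p)).succAbove (Fin.natAdd k j) := by
      ext
      simp only [Fin.succAbove, Fin.lt_def, Fin.val_cast, Fin.val_natAdd, Fin.val_castSucc]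
      split_ifs <;> simp <;> omega
    simp only [Fin.removeNth, this, Fin.insertNth_apply_succAbove]
  have h2 : (fun i => ((Fin.cast h (Fin.natAdd k p)).insertNth x u : Fin (k + l + 1) → E)
      (Fin.cast h (Fin.castAdd (l + 1) i))) = fun i => u (Fin.castAdd l i) := by
    funext j
    have : Fin.cast h (Fin.castAdd (l + 1) j) =
        (Fin.cast h (Fin.natAdd k p)).succAbove (Fin.castAdd l j) := by
      ext
      have := j.2
      rw [Fin.succAbove_of_castSucc_lt]
      · simp
      · simp [Fin.lt_def]; omega
    rw [this, Fin.insertNth_apply_succAbove]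
  rw [h1, h2, ContinuousAlternatingMap.map_insertNth]
  simp only [Fin.cast_eq_self, curryLeft_apply_apply]
  rcases Nat.even_or_odd (p : ℕ) with hp | hp <;> simp [hp.neg_one_pow]

theorem sum_fin_eq_add {A : Type*} [AddCommMonoid A] {k l m : ℕ} (h : k + l = m) (f : Fin m → A) :
    ∑ p, f p = ∑ p, f (Fin.cast h (Fin.castAdd l p)) + ∑ p, f (Fin.cast h (Fin.natAdd k p)) := by
  subst h
  simp [Fin.sum_univ_add]

theorem intUnits_smul_complex (n : ℕ) (z : ℂ) : ((-1 : ℤˣ) ^ n) • z = (-1) ^ n * z := by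
  rcases Nat.even_or_odd n with h | h <;> simp [h.neg_one_pow]

theorem curryLeft_wedge_left_sum {k l m : ℕ} (h : k + 1 + l = m + 1) (h' : k + l = m)
    (α : E [⋀^Fin (k + 1)]→L[ℝ] ℂ) (β : E [⋀^Fin l]→L[ℝ] ℂ) (x : E) (v : Fin m → E) :
    ((k + 1).factorial * l.factorial : ℂ)⁻¹ *
      ∑ p : Fin (k + 1), (-1 : ℤˣ) ^ (p : ℕ) • ∑ e : Perm (Fin m), Perm.sign e •
        formTensor h α β ((Fin.cast h (Fin.castAdd l p)).insertNth x (v ∘ e)) =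
      wedge h' (α.curryLeft x) β v := by
  have key : ∀ p : Fin (k + 1), (-1 : ℤˣ) ^ (p : ℕ) • ∑ e : Perm (Fin m), Perm.sign e •
        formTensor h α β ((Fin.cast h (Fin.castAdd l p)).insertNth x (v ∘ e)) =
      ∑ e : Perm (Fin m), Perm.sign e • formTensor h' (α.curryLeft x) β (v ∘ e) := by
    intro p
    simp_rw [formTensor_insertNth_left h h', ← mul_smul_comm, ← mul_sum]
    rw [intUnits_smul_complex, ← mul_assoc, ← mul_pow]
    simp
  rw [sum_congr rfl fun p _ => key p, wedge_apply]
  simp only [Finset.sum_const, Finset.card_univ, Fintype.card_fin, nsmul_eq_mul, Nat.factorial_succ]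
  have : ((k : ℂ) + 1) ≠ 0 := by exact_mod_cast k.succ_ne_zero
  have h2 : (k.factorial : ℂ) ≠ 0 := by exact_mod_cast k.factorial_ne_zero
  have h3 : (l.factorial : ℂ) ≠ 0 := by exact_mod_cast l.factorial_ne_zero
  push_cast
  field_simp

theorem curryLeft_wedge_right_sum {k l m : ℕ} (h : k + (l + 1) = m + 1) (h' : k + l = m)
    (α : E [⋀^Fin k]→L[ℝ] ℂ) (β : E [⋀^Fin (l + 1)]→L[ℝ] ℂ) (x : E) (v : Fin m → E) :
    (k.factorial * (l + 1).factorial : ℂ)⁻¹ *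
      ∑ p : Fin (l + 1), (-1 : ℤˣ) ^ (k + p : ℕ) • ∑ e : Perm (Fin m), Perm.sign e •
        formTensor h α β ((Fin.cast h (Fin.natAdd k p)).insertNth x (v ∘ e)) =
      (-1) ^ k * wedge h' α (β.curryLeft x) v := by
  have key : ∀ p : Fin (l + 1), (-1 : ℤˣ) ^ (k + p : ℕ) • ∑ e : Perm (Fin m), Perm.sign e •
        formTensor h α β ((Fin.cast h (Fin.natAdd k p)).insertNth x (v ∘ e)) =
      (-1) ^ k *
      ∑ e : Perm (Fin m), Perm.sign e • formTensor h' α (β.curryLeft x) (v ∘ e) := by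
    intro p
    simp_rw [formTensor_insertNth_right h h', ← mul_smul_comm, ← mul_sum]
    rw [intUnits_smul_complex, ← mul_assoc, pow_add, mul_assoc ((-1 : ℂ) ^ k), ← mul_pow]
    simp
  rw [sum_congr rfl fun p _ => key p, wedge_apply]
  simp only [Finset.sum_const, Finset.card_univ, Fintype.card_fin, nsmul_eq_mul, Nat.factorial_succ]
  have : ((l : ℂ) + 1) ≠ 0 := by exact_mod_cast l.succ_ne_zero
  have h2 : (k.factorial : ℂ) ≠ 0 := by exact_mod_cast k.factorial_ne_zero
  have h3 : (l.factorial : ℂ) ≠ 0 := by exact_mod_cast l.factorial_ne_zero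
  push_cast
  field_simp

theorem curryLeft_wedge_succ_succ {k l m : ℕ} (h : k + 1 + (l + 1) = m + 1)
    (h₁ : k + (l + 1) = m) (h₂ : k + 1 + l = m)
    (α : E [⋀^Fin (k + 1)]→L[ℝ] ℂ) (β : E [⋀^Fin (l + 1)]→L[ℝ] ℂ) (x : E) :
    (wedge h α β).curryLeft x =
      wedge h₁ (α.curryLeft x) β + (-1 : ℂ) ^ (k + 1) • wedge h₂ α (β.curryLeft x) := by
  ext v
  simp only [curryLeft_apply_apply, ContinuousAlternatingMap.add_apply,
    ContinuousAlternatingMap.smul_apply, smul_eq_mul]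
  rw [wedge_cons, sum_fin_eq_add h, mul_add, ← curryLeft_wedge_left_sum h,
    ← curryLeft_wedge_right_sum h]
  rfl

theorem curryLeft_wedge_zero_succ {l m : ℕ} (h : 0 + (l + 1) = m + 1) (h₂ : 0 + l = m)
    (α : E [⋀^Fin 0]→L[ℝ] ℂ) (β : E [⋀^Fin (l + 1)]→L[ℝ] ℂ) (x : E) :
    (wedge h α β).curryLeft x = wedge h₂ α (β.curryLeft x) := by
  ext v
  simp only [curryLeft_apply_apply]
  rw [wedge_cons, sum_fin_eq_add h]
  have := curryLeft_wedge_right_sum h h₂ α β x v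
  simp only [pow_zero, one_mul] at this
  rw [← this]
  simp

theorem curryLeft_wedge_succ_zero {k m : ℕ} (h : k + 1 + 0 = m + 1) (h₁ : k + 0 = m)
    (α : E [⋀^Fin (k + 1)]→L[ℝ] ℂ) (β : E [⋀^Fin 0]→L[ℝ] ℂ) (x : E) :
    (wedge h α β).curryLeft x = wedge h₁ (α.curryLeft x) β := by
  ext v
  simp only [curryLeft_apply_apply]
  rw [wedge_cons, sum_fin_eq_add h, ← curryLeft_wedge_left_sum h]
  simp

/-- Contraction of mixed forms with a vector. -/
def contr (x : E) : End ℂ (Spinor E) := cliffordReal (x, 0)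

/-- Exterior multiplication of mixed forms with a covector. -/
def extMul (θ : E →L[ℝ] ℝ) : End ℂ (Spinor E) := cliffordReal (0, θ)

theorem cliffordReal_eq (e : GenTangent E) : cliffordReal e = contr e.1 + extMul e.2 := by
  rw [contr, extMul, ← map_add]; simp

theorem contr_apply (x : E) (β : Spinor E) (k : ℕ) : contr x β k = (β (k + 1)).curryLeft x := by
  cases k with
  | zero => rfl
  | succ k =>
    change (β (k + 2)).curryLeft x + wedgeOne 0 (β k) = _
    have : wedgeOne (0 : E →L[ℝ] ℝ) (β k) = 0 := by
      ext v; simp [wedgeOne, alternatizeUncurryFin_apply]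
    rw [this, add_zero]

theorem extMul_zero_apply (θ : E →L[ℝ] ℝ) (β : Spinor E) : extMul θ β 0 = 0 := by
  change (β 1).curryLeft 0 = 0
  simp

theorem extMul_succ_apply (θ : E →L[ℝ] ℝ) (β : Spinor E) (k : ℕ) :
    extMul θ β (k + 1) = wedgeOne θ (β k) := by
  change (β (k + 2)).curryLeft 0 + wedgeOne θ (β k) = _
  simp

theorem form_zero_ext {k : ℕ} {F : Type*} [NormedAddCommGroup F] [NormedSpace ℝ F]
    {γ : E [⋀^Fin (k + 1)]→L[ℝ] F} (h : ∀ x, γ.curryLeft x = 0) : γ = 0 := by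
  ext v
  have := congrArg (fun f : E [⋀^Fin k]→L[ℝ] F => f (Fin.tail v)) (h (v 0))
  simp only [curryLeft_apply_apply] at this
  have h2 : vecCons (v 0) (Fin.tail v) = v := Fin.cons_self_tail v
  rw [h2] at this
  exact this

/-- A family of mixed forms vanishes if its components of degree zero do, and if its contractions
vanish in every degree in which the whole family does. -/
theorem mixed_induction {X : Type*} (Δ : X → Spinor E) (h0 : ∀ a, Δ a 0 = 0)
    (h : ∀ m, (∀ b, Δ b m = 0) → ∀ a x, contr x (Δ a) m = 0) (a : X) : Δ a = 0 := by
  have key : ∀ m a, Δ a m = 0 := by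
    intro m
    induction m with
    | zero => exact h0
    | succ m ih =>
      intro a
      refine form_zero_ext fun x => ?_
      rw [← contr_apply]
      exact h m ih a x
  funext m
  exact key m a

theorem contr_contr (x y : E) (β : Spinor E) : contr x (contr y β) = - contr y (contr x β) := by
  have h1 : ∀ (z : E) (γ : Spinor E), contr z (contr z γ) = 0 := by
    intro z γ
    funext k
    rw [contr_apply, contr_apply]
    exact ContinuousAlternatingMap.curryLeft_same _ _
  have h2 : contr (x + y) = (contr x + contr y : End ℂ (Spinor E)) := by
    rw [contr, contr, contr, ← map_add]; simp
  have := h1 (x + y) β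
  rw [h2] at this
  simp only [LinearMap.add_apply, map_add, h1, zero_add, add_zero] at this
  exact eq_neg_of_add_eq_zero_left (by rw [add_comm]; exact this)

theorem curryLeft_wedgeOne_succ {k : ℕ} (θ : E →L[ℝ] ℝ) (β : E [⋀^Fin (k + 1)]→L[ℝ] ℂ) (x : E) :
    (wedgeOne θ β).curryLeft x = θ x • β - wedgeOne θ (β.curryLeft x) := by
  ext v
  simp only [curryLeft_apply_apply, wedgeOne,
    alternatizeUncurryFin_apply, ContinuousAlternatingMap.sub_apply,
    ContinuousAlternatingMap.smul_apply]
  rw [Fin.sum_univ_succ, sub_eq_add_neg, ← sum_neg_distrib]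
  congr 1
  · simp [vecCons]
  · refine sum_congr rfl fun i _ => ?_
    have : (i.succ.removeNth (vecCons x v) : Fin (k + 1) → E) =
        vecCons x (i.removeNth v) := by
      funext j
      refine Fin.cases ?_ (fun j => ?_) j <;> simp [Fin.removeNth, vecCons]
    simp [this, pow_succ]

theorem curryLeft_wedgeOne_zero (θ : E →L[ℝ] ℝ) (β : E [⋀^Fin 0]→L[ℝ] ℂ) (x : E) :
    (wedgeOne θ β).curryLeft x = θ x • β := by
  ext v
  simp only [curryLeft_apply_apply, wedgeOne, alternatizeUncurryFin_apply, smul_apply]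
  simp

theorem contr_extMul (x : E) (θ : E →L[ℝ] ℝ) (β : Spinor E) :
    contr x (extMul θ β) = (θ x : ℂ) • β - extMul θ (contr x β) := by
  funext k
  rw [contr_apply, extMul_succ_apply]
  cases k with
  | zero =>
    rw [curryLeft_wedgeOne_zero, Pi.sub_apply, extMul_zero_apply, sub_zero]
    rfl
  | succ k =>
    rw [curryLeft_wedgeOne_succ, Pi.sub_apply, extMul_succ_apply, contr_apply]
    rfl

theorem extMul_extMul (θ η : E →L[ℝ] ℝ) (β : Spinor E) :
    extMul θ (extMul η β) = - extMul η (extMul θ β) := by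
  rw [← add_eq_zero_iff_eq_neg]
  refine mixed_induction (fun β => extMul θ (extMul η β) + extMul η (extMul θ β)) ?_ ?_ β
  · intro a; simp [extMul_zero_apply]
  · intro m hm a x
    have := hm (contr x a)
    simp only [map_add, contr_extMul, map_sub, map_smul, Pi.add_apply, Pi.sub_apply,
      Pi.smul_apply] at this ⊢
    linear_combination (norm := module) this

theorem cliffordReal_anticomm (e f : GenTangent E) (β : Spinor E) :
    cliffordReal e (cliffordReal f β) + cliffordReal f (cliffordReal e β) =
      ((2 * genPairing e f : ℝ) : ℂ) • β := by
  rw [cliffordReal_eq e, cliffordReal_eq f]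
  simp only [LinearMap.add_apply, map_add, contr_extMul, contr_contr e.1 f.1, extMul_extMul e.2 f.2]
  have : (2 * genPairing e f : ℝ) = e.2 f.1 + f.2 e.1 := by simp [genPairing]
  rw [this]
  push_cast
  module

/-- The grading involution of mixed forms. -/
def gradeInv : End ℂ (Spinor E) where
  toFun β := fun k => (-1 : ℂ) ^ k • β k
  map_add' := by intro a b; funext k; simp
  map_smul' := by intro c a; funext k; exact smul_comm _ c (a k)

/-- The reversal of mixed forms. -/
def revForm : End ℂ (Spinor E) where
  toFun β := fun k => (-1 : ℂ) ^ (k * (k - 1) / 2) • β k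
  map_add' := by intro a b; funext k; simp
  map_smul' := by intro c a; funext k; exact smul_comm _ c (a k)

theorem gradeInv_apply (β : Spinor E) (k : ℕ) : gradeInv β k = (-1 : ℂ) ^ k • β k := rfl

theorem revForm_apply (β : Spinor E) (k : ℕ) :
    revForm β k = (-1 : ℂ) ^ (k * (k - 1) / 2) • β k := rfl

theorem gradeInv_gradeInv (β : Spinor E) : gradeInv (gradeInv β) = β := by
  funext k; simp [gradeInv_apply, smul_smul, ← mul_pow]

theorem revForm_revForm (β : Spinor E) : revForm (revForm β) = β := by
  funext k; simp [revForm_apply, smul_smul, ← mul_pow]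

theorem gradeInv_revForm (β : Spinor E) : gradeInv (revForm β) = revForm (gradeInv β) := by
  funext k; simp [revForm_apply, gradeInv_apply, smul_smul, mul_comm]

theorem triangle_succ (k : ℕ) : (k + 1) * (k + 1 - 1) / 2 = k * (k - 1) / 2 + k := by
  rw [← Finset.sum_range_id_mul_two (k + 1) |> fun h => Nat.eq_div_of_mul_eq_left two_ne_zero h,
    ← Finset.sum_range_id_mul_two k |> fun h => Nat.eq_div_of_mul_eq_left two_ne_zero h,
    Finset.sum_range_succ]

theorem contr_gradeInv (x : E) (β : Spinor E) : contr x (gradeInv β) = - gradeInv (contr x β) := by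
  funext k
  rw [contr_apply, Pi.neg_apply, gradeInv_apply, gradeInv_apply, contr_apply]
  ext v
  simp [pow_succ]

theorem contr_revForm (x : E) (β : Spinor E) :
    contr x (revForm β) = gradeInv (revForm (contr x β)) := by
  funext k
  rw [contr_apply, gradeInv_apply, revForm_apply, revForm_apply, contr_apply, triangle_succ]
  ext v
  simp [pow_add]; ring

theorem revForm_extMul (θ : E →L[ℝ] ℝ) (β : Spinor E) :
    revForm (extMul θ β) = extMul θ (gradeInv (revForm β)) := by
  funext k
  cases k with
  | zero => rw [revForm_apply, extMul_zero_apply, extMul_zero_apply]; simp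
  | succ k =>
    rw [revForm_apply, extMul_succ_apply, extMul_succ_apply, gradeInv_apply, revForm_apply,
      triangle_succ]
    ext v
    simp [wedgeOne, alternatizeUncurryFin_apply, pow_add, mul_sum]
    refine sum_congr rfl fun i _ => ?_
    ring

theorem wedge_add_left {k l m : ℕ} (h : k + l = m) (α α' : E [⋀^Fin k]→L[ℝ] ℂ)
    (β : E [⋀^Fin l]→L[ℝ] ℂ) : wedge h (α + α') β = wedge h α β + wedge h α' β := by
  ext v
  simp [wedge_apply, formTensor_apply, add_mul, sum_add_distrib, mul_add]

theorem wedge_add_right {k l m : ℕ} (h : k + l = m) (α : E [⋀^Fin k]→L[ℝ] ℂ)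
    (β β' : E [⋀^Fin l]→L[ℝ] ℂ) : wedge h α (β + β') = wedge h α β + wedge h α β' := by
  ext v
  simp [wedge_apply, formTensor_apply, sum_add_distrib, mul_add]

theorem wedge_smul_left {k l m : ℕ} (h : k + l = m) (c : ℂ) (α : E [⋀^Fin k]→L[ℝ] ℂ)
    (β : E [⋀^Fin l]→L[ℝ] ℂ) : wedge h (c • α) β = c • wedge h α β := by
  ext v
  simp only [wedge_apply, formTensor_apply, ContinuousAlternatingMap.smul_apply, smul_eq_mul,
    mul_assoc, ← mul_smul_comm, ← mul_sum]
  ring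

theorem wedge_smul_right {k l m : ℕ} (h : k + l = m) (c : ℂ) (α : E [⋀^Fin k]→L[ℝ] ℂ)
    (β : E [⋀^Fin l]→L[ℝ] ℂ) : wedge h α (c • β) = c • wedge h α β := by
  ext v
  simp only [wedge_apply, formTensor_apply, ContinuousAlternatingMap.smul_apply, smul_eq_mul,
    mul_left_comm _ c, ← mul_smul_comm, ← mul_sum]

/-- The wedge product of mixed forms. -/
def mixedWedge : Spinor E →ₗ[ℂ] Spinor E →ₗ[ℂ] Spinor E :=
  mk₂ ℂ (fun α β m => ∑ p : antidiagonal m, wedge (mem_antidiagonal.1 p.2) (α p.1.1) (β p.1.2))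
    (by intro a b c; funext m; simp [wedge_add_left, sum_add_distrib])
    (by intro r a b; funext m; simp [wedge_smul_left, smul_sum])
    (by intro a b c; funext m; simp [wedge_add_right, sum_add_distrib])
    (by intro r a b; funext m; simp [wedge_smul_right, smul_sum])

theorem mixedWedge_apply (α β : Spinor E) (m : ℕ) : mixedWedge α β m = ∑ p : antidiagonal m,
      wedge (mem_antidiagonal.1 p.2) (α p.1.1) (β p.1.2) := rfl

/-- `wedge`, extended by zero to all triples of degrees. -/
def wedgeTotal (k l m : ℕ) (α : E [⋀^Fin k]→L[ℝ] ℂ) (β : E [⋀^Fin l]→L[ℝ] ℂ) : E [⋀^Fin m]→L[ℝ] ℂ :=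
  if h : k + l = m then wedge h α β else 0

theorem mixedWedge_apply_total (α β : Spinor E) (m : ℕ) : mixedWedge α β m = ∑ p ∈ antidiagonal m,
      wedgeTotal p.1 p.2 m (α p.1) (β p.2) := by
  rw [mixedWedge_apply, ← sum_coe_sort (antidiagonal m)
    (fun p => wedgeTotal p.1 p.2 m (α p.1) (β p.2))]
  refine sum_congr rfl fun p _ => ?_
  rw [wedgeTotal, dif_pos (mem_antidiagonal.1 p.2)]

theorem spinorPairing_eq (m : ℕ) (α β : Spinor E) :
    spinorPairing m α β = mixedWedge α (revForm β) m := by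
  rw [spinorPairing, mixedWedge_apply]
  refine sum_congr rfl fun p _ => ?_
  rw [revForm_apply, wedge_smul_right]

theorem contr_mixedWedge (x : E) (α β : Spinor E) :
    contr x (mixedWedge α β) = mixedWedge (contr x α) β + mixedWedge (gradeInv α) (contr x β) := by
  funext m
  rw [contr_apply, Pi.add_apply, mixedWedge_apply_total, mixedWedge_apply_total,
    mixedWedge_apply_total]
  let A : ℕ × ℕ → E [⋀^Fin m]→L[ℝ] ℂ := fun p => match p with
    | (0, _) => 0
    | (k + 1, l) => wedgeTotal k l m ((α (k + 1)).curryLeft x) (β l)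
  let B : ℕ × ℕ → E [⋀^Fin m]→L[ℝ] ℂ := fun p => match p with
    | (_, 0) => 0
    | (k, l + 1) => wedgeTotal k l m ((-1 : ℂ) ^ k • α k) ((β (l + 1)).curryLeft x)
  have hsum : (∑ p ∈ antidiagonal (m + 1), wedgeTotal p.1 p.2 (m + 1) (α p.1) (β p.2)).curryLeft x =
      ∑ p ∈ antidiagonal (m + 1), (A p + B p) := by
    have : ∀ s : Finset (ℕ × ℕ), (∑ p ∈ s, wedgeTotal p.1 p.2 (m + 1) (α p.1) (β p.2)).curryLeft x =
        ∑ p ∈ s, (wedgeTotal p.1 p.2 (m + 1) (α p.1) (β p.2)).curryLeft x := by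
      intro s
      ext v
      simp [sum_apply]
    rw [this]
    refine sum_congr rfl fun p hp => ?_
    obtain ⟨k, l⟩ := p
    have hkl : k + l = m + 1 := mem_antidiagonal.1 hp
    rw [wedgeTotal, dif_pos hkl]
    cases k with
    | zero =>
      cases l with
      | zero => omega
      | succ l =>
        have h2 : 0 + l = m := by omega
        rw [curryLeft_wedge_zero_succ hkl h2]
        simp [A, B, wedgeTotal, h2]
    | succ k =>
      cases l with
      | zero =>
        have h2 : k + 0 = m := by omega
        rw [curryLeft_wedge_succ_zero hkl h2]
        simp only [A, B, wedgeTotal, h2, dif_pos, add_zero]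
      | succ l =>
        have h1 : k + (l + 1) = m := by omega
        have h2 : k + 1 + l = m := by omega
        rw [curryLeft_wedge_succ_succ hkl h1 h2]
        simp only [A, B, wedgeTotal, h1, h2, dif_pos, wedge_smul_left]
  rw [hsum, sum_add_distrib, Finset.Nat.sum_antidiagonal_succ, Finset.Nat.sum_antidiagonal_succ']
  simp only [A, B, zero_add]
  congr 1
  · refine sum_congr rfl fun p _ => ?_
    rw [contr_apply]
  · refine sum_congr rfl fun p _ => ?_
    rw [contr_apply, gradeInv_apply]

theorem wedge_zero_zero_apply (h : 0 + 0 = 0) (α β : E [⋀^Fin 0]→L[ℝ] ℂ) (v : Fin 0 → E) :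
    wedge h α β v = α v * β v := by
  rw [wedge_apply]
  simp [formTensor_apply]

theorem mixedWedge_zero_apply (α β : Spinor E) (v : Fin 0 → E) :
    mixedWedge α β 0 v = α 0 v * β 0 v := by
  rw [mixedWedge_apply_total]
  simp [wedgeTotal, wedge_zero_zero_apply]

theorem extMul_mixedWedge (θ : E →L[ℝ] ℝ) (α β : Spinor E) :
    extMul θ (mixedWedge α β) = mixedWedge (extMul θ α) β := by
  rw [← sub_eq_zero]
  refine mixed_induction (fun p : Spinor E × Spinor E =>
    extMul θ (mixedWedge p.1 p.2) - mixedWedge (extMul θ p.1) p.2) ?_ ?_ (α, β)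
  · rintro ⟨a, b⟩
    ext v
    simp [extMul_zero_apply, mixedWedge_zero_apply]
  · rintro m hm ⟨a, b⟩ x
    have h1 := hm (contr x a, b)
    have h2 := hm (gradeInv a, contr x b)
    have h3 : gradeInv (extMul θ a) = - extMul θ (gradeInv a) := by
      funext k
      cases k with
      | zero => simp [gradeInv_apply, extMul_zero_apply]
      | succ k =>
        rw [gradeInv_apply, extMul_succ_apply, Pi.neg_apply, extMul_succ_apply, gradeInv_apply]
        ext v
        simp [wedgeOne, alternatizeUncurryFin_apply, pow_succ, mul_sum]
        refine sum_congr rfl fun i _ => ?_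
        ring
    simp only [map_sub, contr_extMul, contr_mixedWedge, map_add, LinearMap.sub_apply,
      LinearMap.smul_apply, map_smul, Pi.sub_apply, Pi.add_apply, Pi.smul_apply, h3, map_neg,
      LinearMap.neg_apply, Pi.neg_apply] at h1 h2 ⊢
    linear_combination (norm := module) -h1 - h2

theorem mixedWedge_extMul (θ : E →L[ℝ] ℝ) (α β : Spinor E) :
    mixedWedge α (extMul θ β) = extMul θ (mixedWedge (gradeInv α) β) := by
  rw [← sub_eq_zero]
  refine mixed_induction (fun p : Spinor E × Spinor E =>
    mixedWedge p.1 (extMul θ p.2) - extMul θ (mixedWedge (gradeInv p.1) p.2)) ?_ ?_ (α, β)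
  · rintro ⟨a, b⟩
    ext v
    simp [extMul_zero_apply, mixedWedge_zero_apply]
  · rintro m hm ⟨a, b⟩ x
    have h1 := hm (contr x a, b)
    have h2 := hm (gradeInv a, contr x b)
    simp only [map_sub, contr_extMul, contr_mixedWedge, map_add, map_smul, Pi.sub_apply,
      Pi.add_apply, Pi.smul_apply, map_neg, contr_gradeInv, LinearMap.neg_apply, Pi.neg_apply] at h1 h2 ⊢
    linear_combination (norm := module) h1 - h2

theorem gradeInv_mixedWedge (α β : Spinor E) :
    gradeInv (mixedWedge α β) = mixedWedge (gradeInv α) (gradeInv β) := by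
  funext m
  rw [gradeInv_apply, mixedWedge_apply, mixedWedge_apply, smul_sum]
  refine sum_congr rfl fun p _ => ?_
  have hp := mem_antidiagonal.1 p.2
  rw [gradeInv_apply, gradeInv_apply, wedge_smul_left, wedge_smul_right, smul_smul, ← pow_add]
  congr 2
  exact hp.symm

theorem revForm_mixedWedge (α β : Spinor E) :
    revForm (mixedWedge α β) = mixedWedge (revForm β) (revForm α) := by
  rw [← sub_eq_zero]
  refine mixed_induction (fun p : Spinor E × Spinor E =>
    revForm (mixedWedge p.1 p.2) - mixedWedge (revForm p.2) (revForm p.1)) ?_ ?_ (α, β)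
  · rintro ⟨a, b⟩
    ext v
    simp [revForm_apply, mixedWedge_zero_apply, mul_comm]
  · rintro m hm ⟨a, b⟩ x
    have h1 := hm (contr x a, b)
    have h2 := hm (gradeInv a, contr x b)
    have h3 : ∀ c : Spinor E, c m = 0 → gradeInv c m = 0 := by
      intro c hc; ext v; rw [gradeInv_apply, ContinuousAlternatingMap.smul_apply, hc]; simp
    have h1' := h3 _ h1
    have h2' := h3 _ h2
    simp only [map_sub, contr_mixedWedge, map_add, contr_revForm, Pi.sub_apply, Pi.add_apply,
      gradeInv_mixedWedge, gradeInv_revForm, gradeInv_gradeInv] at h1' h2' ⊢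
    linear_combination (norm := module) h1' + h2'

section Pairing

variable {V : Type*} [AddCommGroup V] [Module ℝ V]

/-- Complex conjugation on the complexification of a real vector space. -/
def conjT : (ℂ ⊗[ℝ] V) →ₗ[ℝ] (ℂ ⊗[ℝ] V) := LinearMap.rTensor V Complex.conjAe.toLinearMap

@[simp] theorem conjT_tmul (c : ℂ) (v : V) : conjT (c ⊗ₜ[ℝ] v) = (starRingEnd ℂ c) ⊗ₜ[ℝ] v := rfl

theorem conjT_conjT (z : ℂ ⊗[ℝ] V) : conjT (conjT z) = z := by
  induction z using induction_on with
  | zero => simp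
  | tmul c v => simp
  | add a b ha hb => simp [ha, hb]

theorem conjT_smul (c : ℂ) (z : ℂ ⊗[ℝ] V) : conjT (c • z) = starRingEnd ℂ c • conjT z := by
  induction z using induction_on with
  | zero => simp
  | tmul d v => simp [smul_tmul']
  | add a b ha hb => simp [ha, hb]

theorem Spinor.smul_add' (c : ℂ) (α β : Spinor E) : c • (α + β) = c • α + c • β := smul_add c α β

theorem Spinor.add_smul' (c d : ℂ) (β : Spinor E) : (c + d) • β = c • β + d • β := add_smul c d β

theorem Spinor.zero_smul' (β : Spinor E) : (0 : ℂ) • β = 0 := zero_smul ℂ β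

theorem clifford_tmul (c : ℂ) (e : GenTangent E) (β : Spinor E) :
    clifford (c ⊗ₜ[ℝ] e) β = c • cliffordReal e β := by
  simp [clifford]

theorem clifford_anticomm (z z' : ℂ ⊗[ℝ] GenTangent E) (β : Spinor E) :
    clifford z (clifford z' β) + clifford z' (clifford z β) = (2 * genPairingC z z') • β := by
  induction z using induction_on with
  | zero => simp [Spinor.zero_smul']
  | add a b ha hb =>
    simp only [map_add, LinearMap.add_apply, mul_add, Spinor.add_smul', ← ha, ← hb]
    abel
  | tmul c e =>
    induction z' using induction_on with
    | zero => simp [Spinor.zero_smul']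
    | add a b ha hb =>
      simp only [map_add, LinearMap.add_apply, mul_add, Spinor.add_smul', ← ha, ← hb]
      abel
    | tmul d f =>
      have := cliffordReal_anticomm e f β
      simp only [clifford_tmul, map_smul, smul_smul]
      rw [mul_comm d c, ← Spinor.smul_add', this, genPairingC, BilinForm.baseChange_tmul, smul_smul]
      congr 1
      simp
      ring

theorem Spinor.conj_apply (β : Spinor E) (k : ℕ) (v : Fin k → E) :
    β.conj k v = starRingEnd ℂ (β k v) := rfl

theorem Spinor.conj_add (α β : Spinor E) : (α + β).conj = α.conj + β.conj := by
  funext k; ext v; simp [Spinor.conj_apply]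

theorem Spinor.conj_smul (c : ℂ) (β : Spinor E) : (c • β).conj = starRingEnd ℂ c • β.conj := by
  funext k; ext v; simp [Spinor.conj_apply]

theorem Spinor.conj_conj (β : Spinor E) : β.conj.conj = β := by
  funext k; ext v; simp [Spinor.conj_apply]

theorem conj_cliffordReal (e : GenTangent E) (β : Spinor E) :
    (cliffordReal e β).conj = cliffordReal e β.conj := by
  rw [cliffordReal_eq, LinearMap.add_apply, LinearMap.add_apply, Spinor.conj_add]
  congr 1
  · funext k; ext v
    rw [Spinor.conj_apply, contr_apply, contr_apply]
    rfl
  · funext k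
    cases k with
    | zero => ext v; simp [Spinor.conj_apply, extMul_zero_apply]
    | succ k =>
      ext v
      rw [Spinor.conj_apply, extMul_succ_apply, extMul_succ_apply]
      simp only [wedgeOne, alternatizeUncurryFin_apply, map_sum]
      refine sum_congr rfl fun i _ => ?_
      rcases Nat.even_or_odd (i : ℕ) with hp | hp <;> simp [hp.neg_one_pow, Spinor.conj_apply]

theorem conj_clifford (z : ℂ ⊗[ℝ] GenTangent E) (β : Spinor E) :
    (clifford z β).conj = clifford (conjT z) β.conj := by
  induction z using induction_on with
  | zero => simp; funext k; ext v; simp [Spinor.conj_apply]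
  | add a b ha hb => simp [Spinor.conj_add, ha, hb]
  | tmul c e => rw [conjT_tmul, clifford_tmul, clifford_tmul, Spinor.conj_smul, conj_cliffordReal]

theorem conj_mixedWedge (α β : Spinor E) : (mixedWedge α β).conj = mixedWedge α.conj β.conj := by
  funext m; ext v
  rw [Spinor.conj_apply, mixedWedge_apply, mixedWedge_apply]
  simp only [ContinuousAlternatingMap.sum_apply, map_sum]
  refine sum_congr rfl fun p _ => ?_
  rw [wedge_apply, wedge_apply]
  simp only [map_mul, map_inv₀, Complex.conj_natCast, map_sum]
  congr 1
  refine sum_congr rfl fun σ _ => ?_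
  rcases Int.units_eq_one_or (Perm.sign σ) with h | h <;>
    simp [h, formTensor_apply, Spinor.conj_apply]

theorem conj_revForm (β : Spinor E) : (revForm β).conj = revForm β.conj := by
  funext k; ext v
  simp [Spinor.conj_apply, revForm_apply]

theorem conj_spinorPairing (m : ℕ) (α β : Spinor E) (v : Fin m → E) :
    starRingEnd ℂ (spinorPairing m α β v) = spinorPairing m α.conj β.conj v := by
  rw [spinorPairing_eq, spinorPairing_eq, ← conj_revForm, ← conj_mixedWedge, Spinor.conj_apply]

theorem form_eq_zero_of_finrank_lt [FiniteDimensional ℝ E] {k : ℕ} {F : Type*}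
    [NormedAddCommGroup F] [NormedSpace ℝ F]
    (hk : finrank ℝ E < k) (w : E [⋀^Fin k]→L[ℝ] F) : w = 0 := by
  ext v
  refine w.toAlternatingMap.map_linearDependent v fun h => ?_
  have := h.fintype_card_le_finrank
  simp at this
  omega

variable {n : ℕ}

theorem spinorPairing_extMul (hn : 1 ≤ n) (θ : E →L[ℝ] ℝ) (α β : Spinor E) :
    spinorPairing (2 * n) (extMul θ α) β = - spinorPairing (2 * n) α (extMul θ β) := by
  obtain ⟨m, rfl⟩ : ∃ m, n = m + 1 := ⟨n - 1, by omega⟩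
  rw [spinorPairing_eq, spinorPairing_eq, revForm_extMul, mixedWedge_extMul,
    ← gradeInv_mixedWedge, ← extMul_mixedWedge]
  have h : 2 * (m + 1) = (2 * m + 1) + 1 := by ring
  have key : ∀ (γ : Spinor E) (j : ℕ), j = 2 * m + 1 + 1 →
      extMul θ γ j = - extMul θ (gradeInv γ) j := by
    rintro γ _ rfl
    rw [extMul_succ_apply, extMul_succ_apply, gradeInv_apply]
    ext v
    simp [wedgeOne, alternatizeUncurryFin_apply, pow_succ, pow_mul]
  exact key _ _ h

theorem extMul_eq_zero_of_subsingleton [Subsingleton E] (θ : E →L[ℝ] ℝ) :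
    (extMul θ : End ℂ (Spinor E)) = 0 := by
  have : θ = 0 := by ext x; simp [Subsingleton.elim x 0]
  rw [this, extMul]
  exact map_zero _

theorem spinorPairing_symm (α β : Spinor E) :
    spinorPairing (2 * n) β α = (-1 : ℂ) ^ n • spinorPairing (2 * n) α β := by
  have h1 : mixedWedge β (revForm α) = revForm (mixedWedge α (revForm β)) := by
    rw [revForm_mixedWedge, revForm_revForm]
  rw [spinorPairing_eq, spinorPairing_eq, h1, revForm_apply]
  congr 1
  have : 2 * n * (2 * n - 1) / 2 = n * (2 * n - 1) := by
    rw [mul_assoc, Nat.mul_div_cancel_left _ two_pos]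
  rw [this]
  rcases Nat.eq_zero_or_pos n with rfl | hpos
  · simp
  · have h2 : Odd (2 * n - 1) := ⟨n - 1, by omega⟩
    rw [mul_comm, pow_mul, h2.neg_one_pow]

variable [FiniteDimensional ℝ E]

theorem spinorPairing_contr (hn : finrank ℝ E = 2 * n) (x : E) (α β : Spinor E) :
    spinorPairing (2 * n) (contr x α) β = - spinorPairing (2 * n) α (contr x β) := by
  have h3 : mixedWedge (contr x α) (revForm β) (2 * n) +
      mixedWedge α (revForm (contr x β)) (2 * n) = 0 := by
    have h4 : contr x (mixedWedge α (revForm β)) (2 * n) = 0 := by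
      rw [contr_apply, form_eq_zero_of_finrank_lt (by omega) (mixedWedge _ _ _)]
      simp
    rw [contr_mixedWedge, contr_revForm, ← gradeInv_mixedWedge, Pi.add_apply, gradeInv_apply] at h4
    simpa using h4
  rw [spinorPairing_eq, spinorPairing_eq]
  exact eq_neg_of_add_eq_zero_left h3

theorem spinorPairing_cliffordReal (hn : finrank ℝ E = 2 * n) (e : GenTangent E) (α β : Spinor E) :
    spinorPairing (2 * n) (cliffordReal e α) β = - spinorPairing (2 * n) α (cliffordReal e β) := by
  have h1 := spinorPairing_contr hn e.1 α β
  have h2 : spinorPairing (2 * n) (extMul e.2 α) β = - spinorPairing (2 * n) α (extMul e.2 β) := by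
    rcases Nat.eq_zero_or_pos n with rfl | hpos
    · have : Subsingleton E := Module.finrank_zero_iff.1 (by simpa using hn)
      rw [extMul_eq_zero_of_subsingleton]
      simp [spinorPairing_eq]
    · exact spinorPairing_extMul hpos _ _ _
  rw [cliffordReal_eq]
  simp only [spinorPairing_eq, LinearMap.add_apply, map_add, Pi.add_apply] at h1 h2 ⊢
  rw [h1, h2]; abel

theorem spinorPairing_clifford (hn : finrank ℝ E = 2 * n) (z : ℂ ⊗[ℝ] GenTangent E)
    (α β : Spinor E) :
    spinorPairing (2 * n) (clifford z α) β = - spinorPairing (2 * n) α (clifford z β) := by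
  induction z using induction_on with
  | zero => simp [spinorPairing_eq]
  | add a b ha hb =>
    simp only [spinorPairing_eq, LinearMap.add_apply, map_add, Pi.add_apply] at ha hb ⊢
    rw [ha, hb]; abel
  | tmul c e =>
    have := spinorPairing_cliffordReal hn e α β
    simp only [clifford_tmul, spinorPairing_eq, map_smul, LinearMap.smul_apply,
      Pi.smul_apply] at this ⊢
    rw [this, smul_neg]

end Pairing

section Nondegenerate

variable {n : ℕ}

theorem wedge_zero_left_apply {l m : ℕ} (h : 0 + l = m) (α : E [⋀^Fin 0]→L[ℝ] ℂ)
    (β : E [⋀^Fin m]→L[ℝ] ℂ) (β' : E [⋀^Fin l]→L[ℝ] ℂ) (hβ : HEq β β') :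
    wedge h α β' = α 0 • β := by
  have : l = m := by omega
  subst this
  obtain rfl := eq_of_heq hβ
  ext v
  rw [wedge_apply]
  have : ∀ σ : Perm (Fin l), Perm.sign σ • formTensor h α β (v ∘ σ) = α 0 * β v := by
    intro σ
    rw [formTensor_apply]
    have h1 : (fun i => (v ∘ σ) (Fin.cast h (Fin.natAdd 0 i))) = v ∘ σ := by
      funext i
      have : Fin.cast h (Fin.natAdd 0 i) = i := by ext; simp
      rw [this]
    have h2 : (fun i => (v ∘ σ) (Fin.cast h (Fin.castAdd l i))) = (0 : Fin 0 → E) :=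
      Subsingleton.elim _ _
    have h3 : β (v ∘ σ) = Perm.sign σ • β v := β.toAlternatingMap.map_perm v σ
    rw [h1, h2, h3]
    rcases Int.units_eq_one_or (Perm.sign σ) with h | h <;> simp [h]
  rw [sum_congr rfl fun σ _ => this σ]
  have h4 : (l.factorial : ℂ) ≠ 0 := by exact_mod_cast l.factorial_ne_zero
  simp [Fintype.card_perm]
  field_simp

variable [FiniteDimensional ℝ E]

/-- The continuous alternating form which takes the value `1` on a basis. -/
def basisVol {m : ℕ} (b : Basis (Fin m) ℝ E) : E [⋀^Fin m]→L[ℝ] ℝ :=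
  { b.det with
    cont := by
      have : Continuous fun v : Fin m → E => Matrix.det (b.toMatrix v) := by
        refine Continuous.matrix_det (continuous_matrix fun i j => ?_)
        exact ((b.coord i).continuous_of_finiteDimensional).comp (continuous_apply j)
      exact this }

theorem basisVol_self {m : ℕ} (b : Basis (Fin m) ℝ E) : basisVol b b = 1 := b.det_self

/-- The nondegeneracy of the spinor pairing. -/
theorem eq_zero_of_spinorPairing_eq_zero (hn : finrank ℝ E = 2 * n) (φ : Spinor E)
    (h : ∀ β, spinorPairing (2 * n) φ β = 0) : φ = 0 := by
  have hrad : ∀ (x : E) (φ : Spinor E), (∀ β, spinorPairing (2 * n) φ β = 0) →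
      ∀ β, spinorPairing (2 * n) (contr x φ) β = 0 := by
    intro x φ hφ β
    rw [spinorPairing_contr hn, hφ, neg_zero]
  have hzero : ∀ φ : Spinor E, (∀ β, spinorPairing (2 * n) φ β = 0) →
      (∀ k, 0 < k → φ k = 0) → φ 0 = 0 := by
    intro φ hφ hk
    obtain ⟨μ, hμ⟩ : ∃ μ : E [⋀^Fin (2 * n)]→L[ℝ] ℂ, μ ≠ 0 := by
      let b : Basis (Fin (2 * n)) ℝ E := finBasisOfFinrankEq ℝ E hn
      refine ⟨ofRealForm (basisVol b), fun h0 => ?_⟩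
      have := congrArg (fun f : E [⋀^Fin (2 * n)]→L[ℝ] ℂ => f b) h0
      simp [basisVol_self] at this
    have h1 := hφ (revForm (Pi.single (2 * n) μ))
    rw [spinorPairing_eq, revForm_revForm, mixedWedge_apply_total, sum_eq_single (0, 2 * n)] at h1
    · have h2 : wedgeTotal 0 (2 * n) (2 * n) (φ 0)
          ((Pi.single (2 * n) μ : Spinor E) (2 * n)) = φ 0 0 • μ := by
        rw [wedgeTotal, dif_pos (zero_add _)]
        exact wedge_zero_left_apply _ _ _ _ (by simp)
      rw [h2] at h1
      have h3 := (smul_eq_zero.1 h1).resolve_right hμ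
      ext v
      rw [Subsingleton.elim v 0, h3]; rfl
    · rintro ⟨k, l⟩ hkl hne
      have : k + l = 2 * n := mem_antidiagonal.1 hkl
      have hk0 : 0 < k := by
        rcases Nat.eq_zero_or_pos k with rfl | h
        · exact absurd (by simp at this; simp [this]) hne
        · exact h
      rw [hk k hk0, wedgeTotal, dif_pos this]
      ext v; simp [wedge_apply, formTensor_apply]
    · intro h; exact absurd (mem_antidiagonal.2 (by simp)) h
  have key : ∀ (K : ℕ) (φ : Spinor E), (∀ β, spinorPairing (2 * n) φ β = 0) →
      (∀ k, K < k → φ k = 0) → φ = 0 := by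
    intro K
    induction K with
    | zero =>
      intro φ hφ hk
      funext k
      rcases Nat.eq_zero_or_pos k with rfl | hpos
      · exact hzero φ hφ hk
      · exact hk k hpos
    | succ K ih =>
      intro φ hφ hk
      have hc : ∀ x, contr x φ = 0 := by
        intro x
        refine ih _ (hrad x φ hφ) fun k hkK => ?_
        rw [contr_apply, hk (k + 1) (by omega)]; simp
      have hpos : ∀ k, 0 < k → φ k = 0 := by
        intro k hk
        obtain ⟨j, rfl⟩ : ∃ j, k = j + 1 := ⟨k - 1, by omega⟩
        refine form_zero_ext fun x => ?_
        rw [← contr_apply, hc]; rfl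
      funext k
      rcases Nat.eq_zero_or_pos k with rfl | hpos'
      · exact hzero φ hφ hpos
      · exact hpos k hpos'
  exact key (2 * n) φ h fun k hk => form_eq_zero_of_finrank_lt (by omega) _

end Nondegenerate

/-- The pull-back of mixed forms under a linear map. -/
def Spinor.pull (A : E →L[ℝ] E) : Spinor E →ₗ[ℂ] Spinor E where
  toFun β := fun k => (β k).compContinuousLinearMap A
  map_add' := by intro a b; funext k; ext v; simp
  map_smul' := by intro c a; funext k; ext v; simp

theorem Spinor.pull_apply (A : E →L[ℝ] E) (β : Spinor E) (k : ℕ) (v : Fin k → E) :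
    Spinor.pull A β k v = β k (fun i => A (v i)) := rfl

theorem pull_cliffordReal (A : E →L[ℝ] E) (v : E) (ξ : E →L[ℝ] ℝ) (β : Spinor E) :
    Spinor.pull A (cliffordReal (A v, ξ) β) = cliffordReal (v, ξ.comp A) (Spinor.pull A β) := by
  rw [cliffordReal_eq, cliffordReal_eq]
  simp only [LinearMap.add_apply, map_add]
  congr 1
  · funext k; ext u
    rw [Spinor.pull_apply, contr_apply, contr_apply]
    simp only [curryLeft_apply_apply, Spinor.pull_apply]
    congr 1
    funext i
    refine Fin.cases ?_ (fun j => ?_) i <;> simp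
  · funext k
    cases k with
    | zero => ext u; simp [Spinor.pull_apply, extMul_zero_apply]
    | succ k =>
      ext u
      rw [Spinor.pull_apply, extMul_succ_apply, extMul_succ_apply]
      simp only [wedgeOne, alternatizeUncurryFin_apply]
      rfl

theorem pull_mixedWedge (A : E →L[ℝ] E) (α β : Spinor E) :
    Spinor.pull A (mixedWedge α β) = mixedWedge (Spinor.pull A α) (Spinor.pull A β) := by
  funext m; ext v
  rw [Spinor.pull_apply, mixedWedge_apply, mixedWedge_apply]
  simp only [ContinuousAlternatingMap.sum_apply]
  refine sum_congr rfl fun p _ => ?_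
  rw [wedge_apply, wedge_apply]
  rfl

theorem pull_revForm (A : E →L[ℝ] E) (β : Spinor E) :
    Spinor.pull A (revForm β) = revForm (Spinor.pull A β) := rfl

theorem pull_conj (A : E →L[ℝ] E) (β : Spinor E) :
    (Spinor.pull A β).conj = Spinor.pull A β.conj := rfl

theorem pull_spinorPairing (A : E →L[ℝ] E) (m : ℕ) (α β : Spinor E) :
    (spinorPairing m α β).compContinuousLinearMap A =
      spinorPairing m (Spinor.pull A α) (Spinor.pull A β) := by
  rw [spinorPairing_eq, spinorPairing_eq, ← pull_revForm, ← pull_mixedWedge]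
  rfl

end MixedForms

open Spinor (pull zero_smul' smul_add' add_smul' conj_apply conj_add conj_smul pull_apply)

section Vacuum

variable {S : Type*} [AddCommGroup S] [Module ℂ S]

/-- The vectors annihilated by the operators `e i`. -/
def vacuum {ι : Type*} (e : ι → End ℂ S) : Submodule ℂ S := ⨅ i, ker (e i)

theorem mem_vacuum {ι : Type*} {e : ι → End ℂ S} {φ : S} : φ ∈ vacuum e ↔ ∀ i, e i φ = 0 := by
  simp [vacuum]

theorem finrank_eq_two_mul_of_car [FiniteDimensional ℂ S] (V : Submodule ℂ S)
    (e f : End ℂ S) (he : ∀ φ, e (e φ) = 0) (hef : ∀ φ, e (f φ) + f (e φ) = φ)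
    (heV : ∀ φ ∈ V, e φ ∈ V) (hfV : ∀ φ ∈ V, f φ ∈ V) :
    finrank ℂ V = 2 * finrank ℂ (V ⊓ ker e : Submodule ℂ S) := by
  let g : V →ₗ[ℂ] V := e.restrict heV
  have h1 := g.finrank_range_add_finrank_ker
  have h2 : (range g).map V.subtype = V ⊓ ker e := by
    ext φ
    simp only [Submodule.mem_map, mem_range, mem_inf, mem_ker]
    constructor
    · rintro ⟨_, ⟨y, rfl⟩, rfl⟩
      exact ⟨(g y).2, he _⟩
    · rintro ⟨hφ, hφ'⟩
      refine ⟨⟨φ, hφ⟩, ⟨⟨f φ, hfV φ hφ⟩, ?_⟩, rfl⟩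
      ext
      have := hef φ
      rw [hφ', map_zero, add_zero] at this
      exact this
  have h3 : (ker g).map V.subtype = V ⊓ ker e := by
    ext φ
    simp only [Submodule.mem_map, mem_inf, mem_ker]
    constructor
    · rintro ⟨y, hy, rfl⟩
      exact ⟨y.2, congrArg Subtype.val hy⟩
    · rintro ⟨hφ, hφ'⟩
      exact ⟨⟨φ, hφ⟩, Subtype.ext hφ', rfl⟩
  have h4 := Submodule.finrank_map_subtype_eq V (range g)
  have h5 := Submodule.finrank_map_subtype_eq V (ker g)
  rw [h2] at h4
  rw [h3] at h5
  omega

theorem finrank_eq_two_pow_mul_vacuum [FiniteDimensional ℂ S] (N : ℕ)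
    (e f : Fin N → End ℂ S) (he : ∀ i j φ, e i (e j φ) + e j (e i φ) = 0)
    (hef : ∀ i j φ, e i (f j φ) + f j (e i φ) = if i = j then φ else 0) :
    finrank ℂ S = 2 ^ N * finrank ℂ (vacuum e) := by
  have key : ∀ k (hk : k ≤ N), finrank ℂ S = 2 ^ k *
      finrank ℂ (vacuum fun i : Fin k => e (Fin.castLE hk i)) := by
    intro k
    induction k with
    | zero =>
      intro hk
      have : vacuum (fun i : Fin 0 => e (Fin.castLE hk i)) = ⊤ := by simp [vacuum]
      rw [this]; simp
    | succ k ih =>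
      intro hk
      rw [ih (by omega)]
      have hlast : vacuum (fun i : Fin (k + 1) => e (Fin.castLE hk i)) =
          vacuum (fun i : Fin k => e (Fin.castLE (by omega) i)) ⊓
            ker (e ⟨k, by omega⟩) := by
        ext φ
        simp only [mem_vacuum, mem_inf, mem_ker]
        constructor
        · intro h
          exact ⟨fun i => h i.castSucc, h (Fin.last k)⟩
        · rintro ⟨h1, h2⟩ i
          refine Fin.lastCases ?_ (fun j => ?_) i
          · exact h2
          · exact h1 j
      rw [hlast, finrank_eq_two_mul_of_car _ (e ⟨k, by omega⟩) (f ⟨k, by omega⟩)]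
      · ring
      · intro φ
        have := he ⟨k, by omega⟩ ⟨k, by omega⟩ φ
        rw [← two_smul ℂ] at this
        exact (smul_eq_zero.1 this).resolve_left two_ne_zero
      · intro φ
        simpa using hef ⟨k, by omega⟩ ⟨k, by omega⟩ φ
      · intro φ hφ
        rw [mem_vacuum] at hφ ⊢
        intro i
        have := he (Fin.castLE (by omega) i) ⟨k, by omega⟩ φ
        rw [hφ i, map_zero, add_zero] at this
        exact this
      · intro φ hφ
        rw [mem_vacuum] at hφ ⊢
        intro i
        have := hef (Fin.castLE (by omega) i) ⟨k, by omega⟩ φ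
        rw [hφ i, map_zero, add_zero, if_neg] at this
        · exact this
        · intro h
          have := congrArg Fin.val h
          simp at this
          omega
  exact key N le_rfl

/-- A functional that kills the ranges of the operators `e i` is determined by its values on the
vectors annihilated by the `f i`. -/
theorem linearMap_eq_zero_of_car {ι : Type*} [Fintype ι] [DecidableEq ι]
    {T : Type*} [AddCommGroup T] [Module ℂ T]
    (e f : ι → End ℂ S) (hf : ∀ i j φ, f i (f j φ) + f j (f i φ) = 0)
    (hef : ∀ i j φ, e i (f j φ) + f j (e i φ) = if i = j then φ else 0)
    (ℓ : S →ₗ[ℂ] T) (hℓ : ∀ i φ, ℓ (e i φ) = 0) (hvac : ∀ φ ∈ vacuum f, ℓ φ = 0) : ℓ = 0 := by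
  have key : ∀ s : Finset ι, ∀ φ : S, (∀ i ∉ s, f i φ = 0) → ℓ φ = 0 := by
    intro s
    induction s using Finset.induction_on with
    | empty => intro φ hφ; exact hvac φ (mem_vacuum.2 fun i => hφ i (by simp))
    | insert a s ha ih =>
      intro φ hφ
      have h1 := hef a a φ
      rw [if_pos rfl] at h1
      rw [← h1, map_add, hℓ, zero_add]
      refine ih _ fun i hi => ?_
      by_cases hia : i = a
      · subst hia
        have := hf i i (e i φ)
        rw [← two_smul ℂ] at this
        exact (smul_eq_zero.1 this).resolve_left two_ne_zero
      · have h2 := hf i a (e a φ)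
        have h3 := hef a i φ
        rw [if_neg (Ne.symm hia), hφ i (by simp [hia, hi]), map_zero, zero_add] at h3
        rw [h3, map_zero, add_zero] at h2
        exact h2
  ext φ
  exact key Finset.univ φ (by simp)

end Vacuum

section CliffordLie

variable {S : Type*} [AddCommGroup S] [Module ℂ S] {V : Type*} [LieRing V] [LieAlgebra ℂ V]

/-- A pair of bases dual to each other with respect to a symmetric bilinear form, in the form of
the expansion of vectors that they provide. -/
structure IsDualFrame {ι : Type*} [Fintype ι] (Q : BilinForm ℂ V) (b d : ι → V) :
    Prop where
  left : ∀ x, x = ∑ i, Q x (d i) • b i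
  right : ∀ x, x = ∑ i, Q x (b i) • d i

/-- The Clifford relations for a symmetric bilinear form `Q`, normalized by
`v x * v y + v y * v x = Q x y`, where `Q` is invariant. -/
structure IsCliffordMap (Q : BilinForm ℂ V) (v : V →ₗ[ℂ] End ℂ S) : Prop where
  symm : ∀ x y, Q x y = Q y x
  invariant : ∀ x y z, Q ⁅x, y⁆ z = Q x ⁅y, z⁆
  anticomm : ∀ x y φ, v x (v y φ) + v y (v x φ) = Q x y • φ

variable {ι κ : Type*} [Fintype ι] [Fintype κ] {Q : BilinForm ℂ V} {b d : ι → V}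
  {v : V →ₗ[ℂ] End ℂ S}

/-- The quadratic element `C y = ∑ v(dᵢ) v([y, bᵢ])` of the Clifford algebra. -/
def quadElt (v : V →ₗ[ℂ] End ℂ S) (b d : ι → V) : V →ₗ[ℂ] End ℂ S where
  toFun y := ∑ i, v (d i) * v ⁅y, b i⁆
  map_add' := by intro x y; simp [mul_add, sum_add_distrib]
  map_smul' := by intro c x; simp [smul_sum]

theorem quadElt_apply (y : V) (φ : S) : quadElt v b d y φ = ∑ i, v (d i) (v ⁅y, b i⁆ φ) := by
  simp [quadElt, sum_apply]

/-- The cubic element `q = ∑ v(dᵢ) C(bᵢ)` of the Clifford algebra. -/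
def cubicElt (v : V →ₗ[ℂ] End ℂ S) (b d : ι → V) : End ℂ S := ∑ i, v (d i) * quadElt v b d (b i)

theorem cubicElt_apply (φ : S) : cubicElt v b d φ = ∑ i, v (d i) (quadElt v b d (b i) φ) := by
  simp [cubicElt, sum_apply]

namespace IsDualFrame

theorem sum_bilin (h : IsDualFrame Q b d) {x y : κ → V} (h' : IsDualFrame Q x y) {A : Type*}
    [AddCommGroup A] [Module ℂ A] (F : V →ₗ[ℂ] V →ₗ[ℂ] A) (hQ : ∀ x y, Q x y = Q y x) :
    ∑ i, F (d i) (b i) = ∑ j, F (y j) (x j) := by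
  have h1 : ∀ i, F (d i) (b i) = ∑ j, Q (d i) (x j) • F (y j) (b i) := by
    intro i
    conv_lhs => rw [h'.right (d i)]
    simp
  simp_rw [h1]
  rw [sum_comm]
  refine sum_congr rfl fun j _ => ?_
  conv_rhs => rw [h.left (x j)]
  simp [hQ]

end IsDualFrame

namespace IsCliffordMap

theorem quadElt_comm (hv : IsCliffordMap Q v) (hb : IsDualFrame Q b d) (y z : V) (φ : S) :
    quadElt v b d y (v z φ) - v z (quadElt v b d y φ) = -(2 : ℂ) • v ⁅y, z⁆ φ := by
  rw [quadElt_apply, quadElt_apply, map_sum, ← sum_sub_distrib]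
  have h1 : ∀ i, v (d i) (v ⁅y, b i⁆ (v z φ)) - v z (v (d i) (v ⁅y, b i⁆ φ)) =
      Q ⁅y, b i⁆ z • v (d i) φ - Q z (d i) • v ⁅y, b i⁆ φ := by
    intro i
    have e1 := hv.anticomm ⁅y, b i⁆ z φ
    have e2 := hv.anticomm z (d i) (v ⁅y, b i⁆ φ)
    rw [← map_smul, ← e1, map_add, ← e2]
    abel
  rw [sum_congr rfl fun i _ => h1 i, sum_sub_distrib]
  have h2 : ∑ i, Q ⁅y, b i⁆ z • v (d i) φ = - v ⁅y, z⁆ φ := by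
    conv_rhs => rw [hb.right ⁅y, z⁆]
    simp only [map_sum, map_smul, LinearMap.sum_apply, LinearMap.smul_apply,
      ← sum_neg_distrib, ← neg_smul]
    refine sum_congr rfl fun i _ => ?_
    congr 1
    rw [hv.symm ⁅y, z⁆, ← hv.invariant, ← lie_skew, map_neg, LinearMap.neg_apply]
  have h3 : ∑ i, Q z (d i) • v ⁅y, b i⁆ φ = v ⁅y, z⁆ φ := by
    conv_rhs => rw [hb.left z]
    simp only [lie_sum, lie_smul, map_sum, map_smul, LinearMap.sum_apply, LinearMap.smul_apply]
  rw [h2, h3]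
  module

/-- The action of the quadratic elements on a vector annihilated by `v K`, for `K` an isotropic
subspace with a dual frame. -/
theorem quadElt_vacuum (hv : IsCliffordMap Q v) (hb : IsDualFrame Q b d)
    {K : Submodule ℂ V} {x x' : κ → V}
    (hx : IsDualFrame Q (Sum.elim x x') (Sum.elim x' x)) (hxK : ∀ j, x j ∈ K)
    {φ : S} (hφ : ∀ k ∈ K, v k φ = 0) (y : V) (hy : ∀ j, ⁅y, x j⁆ ∈ K) :
    quadElt v b d y φ = - Q (∑ j, ⁅x j, x' j⁆) y • φ := by
  let F : V →ₗ[ℂ] V →ₗ[ℂ] S := mk₂ ℂ (fun a c => v a (v ⁅y, c⁆ φ))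
    (by intros; simp) (by intros; simp) (by intros; simp) (by intros; simp)
  have h := hb.sum_bilin hx F hv.symm
  rw [quadElt_apply]
  change ∑ i, F (d i) (b i) = _
  rw [h, sum_sum_type]
  simp only [elim_inl, elim_inr, F, LinearMap.mk₂_apply]
  have h1 : ∀ j, v (x' j) (v ⁅y, x j⁆ φ) = 0 := fun j => by rw [hφ _ (hy j), map_zero]
  have h2 : ∀ j, v (x j) (v ⁅y, x' j⁆ φ) = - Q ⁅x j, x' j⁆ y • φ := by
    intro j
    have := hv.anticomm (x j) ⁅y, x' j⁆ φ
    rw [hφ _ (hxK j), map_zero, add_zero] at this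
    rw [this]
    congr 1
    rw [hv.invariant, ← lie_skew, map_neg]
  rw [sum_congr rfl fun j _ => h1 j, sum_congr rfl fun j _ => h2 j]
  simp [Finset.sum_smul]

theorem cubicElt_vacuum (hv : IsCliffordMap Q v) (hb : IsDualFrame Q b d)
    {K : Submodule ℂ V} {x x' : κ → V}
    (hx : IsDualFrame Q (Sum.elim x x') (Sum.elim x' x)) (hxK : ∀ j, x j ∈ K)
    (hK : ∀ k ∈ K, ∀ l ∈ K, ⁅k, l⁆ ∈ K) {φ : S} (hφ : ∀ k ∈ K, v k φ = 0) :
    cubicElt v b d φ = -(3 : ℂ) • v (∑ j, ⁅x j, x' j⁆) φ := by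
  let F : V →ₗ[ℂ] V →ₗ[ℂ] S := mk₂ ℂ (fun a c => v a (quadElt v b d c φ))
    (by intros; simp) (by intros; simp) (by intros; simp) (by intros; simp)
  have h := hb.sum_bilin hx F hv.symm
  rw [cubicElt_apply]
  change ∑ i, F (d i) (b i) = _
  rw [h, sum_sum_type]
  simp only [elim_inl, elim_inr, F, LinearMap.mk₂_apply]
  set W := ∑ j, ⁅x j, x' j⁆ with hW
  have h1 : ∑ j, v (x' j) (quadElt v b d (x j) φ) = - v W φ := by
    have h2 : ∀ j, v (x' j) (quadElt v b d (x j) φ) = -(Q W (x j) • v (x' j) φ) := by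
      intro j
      rw [hv.quadElt_vacuum hb hx hxK hφ (x j) (fun i => hK _ (hxK j) _ (hxK i)), map_smul,
        neg_smul]
    rw [sum_congr rfl fun j _ => h2 j]
    conv_rhs => rw [hx.right W]
    rw [sum_sum_type]
    simp only [elim_inl, elim_inr, map_add, map_sum, map_smul, LinearMap.add_apply,
      LinearMap.sum_apply, LinearMap.smul_apply, sum_neg_distrib]
    rw [sum_eq_zero (fun j _ => by rw [hφ _ (hxK j), smul_zero]) (s := Finset.univ)
      (f := fun j => Q W (x' j) • v (x j) φ), add_zero]
  have h3 : ∑ j, v (x j) (quadElt v b d (x' j) φ) = -(2 : ℂ) • v W φ := by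
    have h4 : ∀ j, v (x j) (quadElt v b d (x' j) φ) = -(2 : ℂ) • v ⁅x j, x' j⁆ φ := by
      intro j
      have := hv.quadElt_comm hb (x' j) (x j) φ
      rw [hφ _ (hxK j), map_zero, zero_sub, ← lie_skew, map_neg, LinearMap.neg_apply] at this
      rw [← neg_inj, this]
      module
    rw [sum_congr rfl fun j _ => h4 j, hW]
    simp [smul_sum]
  rw [h1, h3]
  module

theorem cubicElt_anticomm (hv : IsCliffordMap Q v) (hb : IsDualFrame Q b d) (z : V) (φ : S) :
    cubicElt v b d (v z φ) + v z (cubicElt v b d φ) = (3 : ℂ) • quadElt v b d z φ := by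
  rw [cubicElt_apply, cubicElt_apply, map_sum, ← sum_add_distrib]
  have h1 : ∀ i, v (d i) (quadElt v b d (b i) (v z φ)) + v z (v (d i) (quadElt v b d (b i) φ)) =
      Q z (d i) • quadElt v b d (b i) φ + (2 : ℂ) • v (d i) (v ⁅z, b i⁆ φ) := by
    intro i
    have e1 := hv.quadElt_comm hb (b i) z φ
    have e2 := hv.anticomm z (d i) (quadElt v b d (b i) φ)
    rw [sub_eq_iff_eq_add] at e1
    rw [e1, ← e2, ← lie_skew]
    simp only [map_add, map_smul, map_neg, LinearMap.neg_apply]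
    module
  rw [sum_congr rfl fun i _ => h1 i, sum_add_distrib, ← smul_sum, ← quadElt_apply]
  have h2 : ∑ i, Q z (d i) • quadElt v b d (b i) φ = quadElt v b d z φ := by
    conv_rhs => rw [hb.left z]
    simp [LinearMap.sum_apply]
  rw [h2]
  module

end IsCliffordMap

end CliffordLie

/-! ### Calculus on manifolds modelled on a vector space -/

section ManifoldCalculus

open Filter Topology

variable {E : Type*} [NormedAddCommGroup E] [NormedSpace ℝ E]
  {M : Type*} [TopologicalSpace M] [ChartedSpace E M]
  {E' : Type*} [NormedAddCommGroup E'] [NormedSpace ℝ E']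
  {N : Type*} [TopologicalSpace N] [ChartedSpace E' N]
  {E'' : Type*} [NormedAddCommGroup E''] [NormedSpace ℝ E'']
  {N' : Type*} [TopologicalSpace N'] [ChartedSpace E'' N']
  {F : Type*} [NormedAddCommGroup F] [NormedSpace ℝ F]
  {F' : Type*} [NormedAddCommGroup F'] [NormedSpace ℝ F']
  {F'' : Type*} [NormedAddCommGroup F''] [NormedSpace ℝ F'']

theorem ContMDiffAt.mdiff {f : M → N} {x : M} (h : ContMDiffAt 𝓘(ℝ, E) 𝓘(ℝ, E') ∞ f x) :
    MDifferentiableAt 𝓘(ℝ, E) 𝓘(ℝ, E') f x := h.mdifferentiableAt (by simp)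

variable (E E') in
/-- The derivative of a map between manifolds, as a map between the model spaces. -/
def modelDeriv (f : M → N) (x : M) : E →L[ℝ] E' := mfderiv 𝓘(ℝ, E) 𝓘(ℝ, E') f x

theorem modelDeriv_comp {f : M → N} {g : N → N'} (x : M)
    (hg : MDifferentiableAt 𝓘(ℝ, E') 𝓘(ℝ, E'') g (f x)) (hf : MD[E, E'] f x) :
    modelDeriv E E'' (g ∘ f) x = (modelDeriv E' E'' g (f x)).comp (modelDeriv E E' f x) :=
  mfderiv_comp x hg hf

theorem modelDeriv_id (x : M) : modelDeriv E E (id : M → M) x = .id ℝ E := mfderiv_id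

theorem modelDeriv_congr {f g : M → N} {x : M} (h : f =ᶠ[𝓝 x] g) :
    modelDeriv E E' f x = modelDeriv E E' g x := by
  unfold modelDeriv
  by_cases hf : MD[E, E'] f x
  · have : HasMFDerivAt 𝓘(ℝ, E) 𝓘(ℝ, E') g x (mfderiv 𝓘(ℝ, E) 𝓘(ℝ, E') f x : E →L[ℝ] E') :=
      (hf.hasMFDerivAt).congr_of_eventuallyEq h.symm
    exact this.mfderiv.symm
  · have hg : ¬ MD[E, E'] g x := fun hg =>
      hf (hg.congr_of_eventuallyEq h)
    rw [mfderiv_zero_of_not_mdifferentiableAt hf, mfderiv_zero_of_not_mdifferentiableAt hg]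
    rfl

theorem modelDeriv_eq_fderiv_space (f : E → E') (x : E) :
    modelDeriv E E' f x = fderiv ℝ f x := mfderiv_eq_fderiv

section Chart

variable [IsManifold 𝓘(ℝ, E) ∞ M]

instance isManifold_one_of_infty : IsManifold 𝓘(ℝ, E) 1 M :=
  IsManifold.of_le (n := ∞) (by norm_cast)

theorem contMDiffAt_chart {x z : M} (hz : z ∈ (chart[E] x).source) : C∞[E, E] (chart[E] x) z :=
  contMDiffAt_extChartAt' (by simpa using hz)

theorem contMDiffAt_chart_symm {x : M} {y : E} (hy : y ∈ (chart[E] x).target) :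
    C∞[E, E] (chart[E] x).symm y :=
  (contMDiffOn_extChartAt_symm x).contMDiffAt
    ((isOpen_extChartAt_target x).mem_nhds hy)

theorem target_mem_nhds (x : M) :
    (chart[E] x).target ∈ 𝓝 (chart[E] x x) := extChartAt_target_mem_nhds x

theorem modelDeriv_chart_comp_symm {x : M} {y : E} (hy : y ∈ (chart[E] x).target) :
    (modelDeriv E E (chart[E] x) ((chart[E] x).symm y)).comp
      (modelDeriv E E (chart[E] x).symm y) = .id ℝ E := by
  have hs := (chart[E] x).map_target hy
  rw [← modelDeriv_comp y ((contMDiffAt_chart hs).mdiff)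
    ((contMDiffAt_chart_symm hy).mdiff), ← modelDeriv_id y]
  refine modelDeriv_congr ?_
  filter_upwards [(isOpen_extChartAt_target x).mem_nhds hy] with z hz
  exact (chart[E] x).right_inv hz

theorem modelDeriv_symm_comp_chart {x : M} {y : E} (hy : y ∈ (chart[E] x).target) :
    (modelDeriv E E (chart[E] x).symm y).comp (modelDeriv E E (chart[E] x) ((chart[E] x).symm y)) =
      .id ℝ E := by
  have h := mfderivWithin_extChartAt_symm_comp_mfderiv_extChartAt (I := 𝓘(ℝ, E)) hy
  rw [show Set.range 𝓘(ℝ, E) = Set.univ by simp, mfderivWithin_univ] at h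
  exact h

theorem modelDeriv_chart_self (x : M) : modelDeriv E E (chart[E] x) x = .id ℝ E :=
  mfderiv_extChartAt_self

theorem modelDeriv_chart_symm_self (x : M) : modelDeriv E E (chart[E] x).symm (chart[E] x x) =
      .id ℝ E := by
  have h := modelDeriv_chart_comp_symm (mem_extChartAt_target (I := 𝓘(ℝ, E)) x)
  rw [extChartAt_to_inv, modelDeriv_chart_self] at h
  simpa using h

theorem contMDiffAt_iff_comp_symm {f : M → N} {x z : M} {n : WithTop ℕ∞} (hn : n ≤ ∞)
    (hz : z ∈ (chart[E] x).source) : ContMDiffAt 𝓘(ℝ, E) 𝓘(ℝ, E') n f z ↔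
      ContMDiffAt 𝓘(ℝ, E) 𝓘(ℝ, E') n (f ∘ (chart[E] x).symm) (chart[E] x z) := by
  have : IsManifold 𝓘(ℝ, E) n M := IsManifold.of_le (n := ∞) hn
  rw [contMDiffAt_iff_source_of_mem_source (x := x) (by simpa using hz),
    show Set.range 𝓘(ℝ, E) = Set.univ by simp, contMDiffWithinAt_univ]

theorem contMDiffAt_iff_contDiffAt_chart {f : M → F} {x : M} {n : WithTop ℕ∞} (hn : n ≤ ∞) :
    ContMDiffAt 𝓘(ℝ, E) 𝓘(ℝ, F) n f x ↔ ContDiffAt ℝ n (f ∘ (chart[E] x).symm) (chart[E] x x) := by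
  rw [contMDiffAt_iff_comp_symm hn (mem_extChartAt_source x), contMDiffAt_iff_contDiffAt]

theorem modelDeriv_chart_symm {f : M → F} {x : M} {y : E} (hy : y ∈ (chart[E] x).target)
    (hf : MD[E, F] f ((chart[E] x).symm y)) : modelDeriv E F f ((chart[E] x).symm y) =
      (fderiv ℝ (f ∘ (chart[E] x).symm) y).comp
        (modelDeriv E E (chart[E] x) ((chart[E] x).symm y)) := by
  rw [← modelDeriv_eq_fderiv_space, modelDeriv_comp y hf
    ((contMDiffAt_chart_symm hy).mdiff), comp_assoc, modelDeriv_symm_comp_chart hy, comp_id]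

theorem modelDeriv_eq_fderiv {f : M → F} {x : M} (hf : MD[E, F] f x) : modelDeriv E F f x =
      fderiv ℝ (f ∘ (chart[E] x).symm) (chart[E] x x) := by
  rw [← modelDeriv_eq_fderiv_space, modelDeriv_comp _ (by rwa [extChartAt_to_inv])
    ((contMDiffAt_chart_symm (mem_extChartAt_target x)).mdiff),
    modelDeriv_chart_symm_self, extChartAt_to_inv]
  simp

theorem differentiableAt_chart {f : M → F} {x : M} (hf : MD[E, F] f x) :
    DifferentiableAt ℝ (f ∘ (chart[E] x).symm) (chart[E] x x) := by
  rw [← mdifferentiableAt_iff_differentiableAt]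
  exact MDifferentiableAt.comp _ (by rwa [extChartAt_to_inv])
    ((contMDiffAt_chart_symm (mem_extChartAt_target x)).mdiff)

theorem ContMDiffAt.clm_comp_space (T : F →L[ℝ] F') {f : M → F} {x : M} {n : WithTop ℕ∞}
    (hf : ContMDiffAt 𝓘(ℝ, E) 𝓘(ℝ, F) n f x) :
    ContMDiffAt 𝓘(ℝ, E) 𝓘(ℝ, F') n (fun y => T (f y)) x :=
  (T.contDiff.contMDiff.contMDiffAt (x := f x)).comp x hf

theorem ContMDiffAt.bilin (T : F →L[ℝ] F' →L[ℝ] F'') {f : M → F} {h : M → F'} {x : M}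
    {n : WithTop ℕ∞} (hf : ContMDiffAt 𝓘(ℝ, E) 𝓘(ℝ, F) n f x)
    (hh : ContMDiffAt 𝓘(ℝ, E) 𝓘(ℝ, F') n h x) :
    ContMDiffAt 𝓘(ℝ, E) 𝓘(ℝ, F'') n (fun y => T (f y) (h y)) x :=
  ContMDiffAt.clm_apply (hf.clm_comp_space T) hh

theorem modelDeriv_clm_comp (T : F →L[ℝ] F') {f : M → F} {x : M} (hf : MD[E, F] f x) :
    modelDeriv E F' (fun y => T (f y)) x = T.comp (modelDeriv E F f x) := by
  have h := modelDeriv_comp (g := T) x (T.differentiableAt.mdifferentiableAt) hf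
  rw [modelDeriv_eq_fderiv_space, T.fderiv] at h
  exact h

theorem modelDeriv_bilin (T : F →L[ℝ] F' →L[ℝ] F'') {f : M → F} {h : M → F'} {x : M}
    (hf : MD[E, F] f x) (hh : MD[E, F'] h x) (v : E) :
    modelDeriv E F'' (fun y => T (f y) (h y)) x v =
      T (modelDeriv E F f x v) (h x) + T (f x) (modelDeriv E F' h x v) := by
  have hb : MD[E, F''] (fun y => T (f y) (h y)) x :=
    MDifferentiableAt.clm_apply
      (MDifferentiableAt.comp x (T.differentiableAt.mdifferentiableAt) hf) hh
  rw [modelDeriv_eq_fderiv hb, modelDeriv_eq_fderiv hf, modelDeriv_eq_fderiv hh]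
  have := T.fderiv_of_bilinear (differentiableAt_chart hf) (differentiableAt_chart hh)
  have e : ((fun y => (T (f y)) (h y)) ∘ (chart[E] x).symm) = fun y =>
      T ((f ∘ (chart[E] x).symm) y) ((h ∘ (chart[E] x).symm) y) := rfl
  rw [e, this]
  simp [ContinuousLinearMap.precompR, ContinuousLinearMap.precompL, add_comm]

end Chart

end ManifoldCalculus

/-! ### Left trivialization of a Lie group -/

section LeftTrivialization

open Filter Topology

variable {E : Type*} [NormedAddCommGroup E] [NormedSpace ℝ E] [CompleteSpace E]
  {G : Type*} [TopologicalSpace G] [ChartedSpace E G] [Group G] [LieGroup 𝓘(ℝ, E) ∞ G]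
  {F : Type*} [NormedAddCommGroup F] [NormedSpace ℝ F]
  {F' : Type*} [NormedAddCommGroup F'] [NormedSpace ℝ F']
  {F'' : Type*} [NormedAddCommGroup F''] [NormedSpace ℝ F'']

theorem mdifferentiableAt_mul_left' (g h : G) : MD[E, E] (fun x : G => g * x) h :=
  (contMDiff_mul_left (n := ∞)).contMDiffAt.mdiff

theorem mdifferentiableAt_mul_right' (g h : G) : MD[E, E] (fun x : G => x * g) h :=
  (contMDiff_mul_right (n := ∞)).contMDiffAt.mdiff

variable (E) in
/-- The derivative at `1` of the left translation by `g`. -/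
def lTrans (g : G) : E →L[ℝ] E := modelDeriv E E (fun x : G => g * x) 1

variable (E) in
/-- The left Maurer-Cartan form. -/
def lMC (g : G) : E →L[ℝ] E := modelDeriv E E (fun x : G => g⁻¹ * x) g

variable (E) in
/-- The derivative at `1` of the right translation by `g`. -/
def rTrans (g : G) : E →L[ℝ] E := modelDeriv E E (fun x : G => x * g) 1

variable (E) in
/-- The right Maurer-Cartan form. -/
def rMC (g : G) : E →L[ℝ] E := modelDeriv E E (fun x : G => x * g⁻¹) g

theorem lMC_comp_lTrans (g : G) : (lMC E g).comp (lTrans E g) = .id ℝ E := by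
  have h := modelDeriv_comp (1 : G) (mdifferentiableAt_mul_left' (E := E) g⁻¹ (g * 1))
    (mdifferentiableAt_mul_left' g 1)
  rw [mul_one] at h
  rw [lMC, lTrans, ← h, ← modelDeriv_id (1 : G)]
  congr 1
  ext x; simp

theorem lTrans_comp_lMC (g : G) : (lTrans E g).comp (lMC E g) = .id ℝ E := by
  have h := modelDeriv_comp g (mdifferentiableAt_mul_left' (E := E) g (g⁻¹ * g))
    (mdifferentiableAt_mul_left' g⁻¹ g)
  rw [inv_mul_cancel] at h
  rw [lMC, lTrans, ← h, ← modelDeriv_id g]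
  congr 1
  ext x; simp

theorem rMC_comp_rTrans (g : G) : (rMC E g).comp (rTrans E g) = .id ℝ E := by
  have h := modelDeriv_comp (1 : G) (mdifferentiableAt_mul_right' (E := E) g⁻¹ (1 * g))
    (mdifferentiableAt_mul_right' g 1)
  rw [one_mul] at h
  rw [rMC, rTrans, ← h, ← modelDeriv_id (1 : G)]
  congr 1
  ext x; simp

@[simp] theorem lMC_lTrans (g : G) (v : E) : lMC E g (lTrans E g v) = v :=
  congr_fun (lMC_comp_lTrans g) v
@[simp] theorem lTrans_lMC (g : G) (v : E) : lTrans E g (lMC E g v) = v :=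
  congr_fun (lTrans_comp_lMC g) v
@[simp] theorem rMC_rTrans (g : G) (v : E) : rMC E g (rTrans E g v) = v :=
  congr_fun (rMC_comp_rTrans g) v
@[simp] theorem lTrans_one : lTrans E (1 : G) = .id ℝ E := by
  rw [lTrans, ← modelDeriv_id (1 : G)]; congr 1; ext x; simp

@[simp] theorem rTrans_one : rTrans E (1 : G) = .id ℝ E := by
  rw [rTrans, ← modelDeriv_id (1 : G)]; congr 1; ext x; simp

variable (E) in
/-- The product of the Lie group in the charts at `x` and at `1`. -/
def chartMul (x : G) (y q : E) : E :=
  chart[E] x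
    ((chart[E] x).symm y * (chart[E] (1 : G)).symm q)

theorem contDiffAt_chartMul (x : G) : ContDiffAt ℝ ∞ (Function.uncurry (chartMul E x))
    (chart[E] x x, chart[E] (1 : G) 1) := by
  rw [← contMDiffAt_iff_contDiffAt]
  have h1 : ContMDiffAt 𝓘(ℝ, E × E) 𝓘(ℝ, E) ∞ (fun p : E × E => (chart[E] x).symm p.1)
      (chart[E] x x, chart[E] (1 : G) 1) :=
    ContMDiffAt.comp (I' := 𝓘(ℝ, E))
      (chart[E] x x, chart[E] (1 : G) 1)
      (contMDiffAt_chart_symm (mem_extChartAt_target x)) contDiff_fst.contMDiff.contMDiffAt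
  have h2 : ContMDiffAt 𝓘(ℝ, E × E) 𝓘(ℝ, E) ∞
      (fun p : E × E => (chart[E] (1 : G)).symm p.2)
      (chart[E] x x, chart[E] (1 : G) 1) :=
    ContMDiffAt.comp (I' := 𝓘(ℝ, E))
      (chart[E] x x, chart[E] (1 : G) 1)
      (contMDiffAt_chart_symm (mem_extChartAt_target 1)) contDiff_snd.contMDiff.contMDiffAt
  refine ContMDiffAt.comp (I' := 𝓘(ℝ, E)) _ (contMDiffAt_chart ?_) (h1.mul h2)
  simp

variable (E) in
/-- The left-invariant frame in the chart at `x`. -/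
def chartFrame (x : G) (y : E) : E →L[ℝ] E :=
  (modelDeriv E E (chart[E] x) ((chart[E] x).symm y)).comp
    (lTrans E ((chart[E] x).symm y))

variable (E) in
/-- The left Maurer-Cartan form in the chart at `x`. -/
def chartCoframe (x : G) (y : E) : E →L[ℝ] E :=
  (lMC E ((chart[E] x).symm y)).comp (modelDeriv E E (chart[E] x).symm y)

theorem chartFrame_eq_fderiv {x : G} {y : E} (hy : y ∈ (chart[E] x).target) :
    chartFrame E x y = fderiv ℝ (chartMul E x y) (chart[E] (1 : G) 1) := by
  have hs := (chart[E] x).map_target hy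
  set g := (chart[E] x).symm y with hg
  have e : chartMul E x y = chart[E] x ∘ (fun z => g * z) ∘ (chart[E] (1 : G)).symm := rfl
  have c1 : MD[E, E] (chart[E] (1 : G)).symm
      (chart[E] (1 : G) 1) :=
    (contMDiffAt_chart_symm (mem_extChartAt_target 1)).mdiff
  have c2 : MD[E, E] (fun z => g * z)
      ((chart[E] (1 : G)).symm (chart[E] (1 : G) 1)) :=
    mdifferentiableAt_mul_left' _ _
  have c3 : MD[E, E] (chart[E] x)
      (g * ((chart[E] (1 : G)).symm (chart[E] (1 : G) 1))) := by
    rw [extChartAt_to_inv, mul_one]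
    exact (contMDiffAt_chart hs).mdiff
  rw [← modelDeriv_eq_fderiv_space, e, modelDeriv_comp (E' := E)
    (f := (fun z => g * z) ∘ (chart[E] (1 : G)).symm) _ c3 (c2.comp _ c1),
    modelDeriv_comp _ c2 c1, modelDeriv_chart_symm_self, extChartAt_to_inv]
  simp only [Function.comp_apply, extChartAt_to_inv, mul_one, comp_id]
  rfl

theorem contDiffAt_chartFrame (x : G) : ContDiffAt ℝ ∞ (chartFrame E x) (chart[E] x x) := by
  have h : ContDiffAt ℝ ∞ (fun y => fderiv ℝ (chartMul E x y) (chart[E] (1 : G) 1))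
      (chart[E] x x) :=
    ContDiffAt.fderiv (contDiffAt_chartMul x) contDiffAt_const (by simp)
  refine h.congr_of_eventuallyEq ?_
  filter_upwards [target_mem_nhds x] with y hy
  exact chartFrame_eq_fderiv hy

theorem chartFrame_comp_chartCoframe {x : G} {y : E} (hy : y ∈ (chart[E] x).target) :
    (chartFrame E x y).comp (chartCoframe E x y) = .id ℝ E := by
  rw [chartFrame, chartCoframe, comp_assoc, ← comp_assoc (lTrans E _), lTrans_comp_lMC, id_comp,
    modelDeriv_chart_comp_symm hy]

theorem chartCoframe_comp_chartFrame {x : G} {y : E} (hy : y ∈ (chart[E] x).target) :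
    (chartCoframe E x y).comp (chartFrame E x y) = .id ℝ E := by
  rw [chartFrame, chartCoframe, comp_assoc,
    ← comp_assoc (modelDeriv E E _ _), modelDeriv_symm_comp_chart hy, id_comp, lMC_comp_lTrans]

theorem contDiffAt_chartCoframe (x : G) : ContDiffAt ℝ ∞ (chartCoframe E x) (chart[E] x x) := by
  have hx := mem_extChartAt_target (I := 𝓘(ℝ, E)) x
  let e : E ≃L[ℝ] E := ContinuousLinearEquiv.equivOfInverse (chartFrame E x _) (chartCoframe E x _)
    (congr_fun (chartCoframe_comp_chartFrame hx))
    (congr_fun (chartFrame_comp_chartCoframe hx))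
  have h := (contDiffAt_map_inverse (n := ∞) e).comp (chart[E] x x)
    (f := chartFrame E x) (contDiffAt_chartFrame x)
  refine h.congr_of_eventuallyEq ?_
  filter_upwards [target_mem_nhds x] with y hy
  exact (ContinuousLinearMap.inverse_eq (chartFrame_comp_chartCoframe hy)
    (chartCoframe_comp_chartFrame hy)).symm

theorem chartFrame_self (x : G) : chartFrame E x (chart[E] x x) = lTrans E x := by
  rw [chartFrame, extChartAt_to_inv, modelDeriv_chart_self, id_comp]

variable (E) in
/-- The derivatives of `f` along the left-invariant vector fields. -/
def lDeriv (f : G → F) (g : G) : E →L[ℝ] F := (modelDeriv E F f g).comp (lTrans E g)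

theorem lDeriv_chart_symm {f : G → F} {x : G} {y : E} (hy : y ∈ (chart[E] x).target)
    (hf : MD[E, F] f ((chart[E] x).symm y)) : lDeriv E f ((chart[E] x).symm y) =
      (fderiv ℝ (f ∘ (chart[E] x).symm) y).comp (chartFrame E x y) := by
  rw [lDeriv, modelDeriv_chart_symm hy hf, chartFrame, comp_assoc]

theorem lDeriv_congr {f f' : G → F} {x : G} (h : f =ᶠ[𝓝 x] f') : lDeriv E f x = lDeriv E f' x := by
  rw [lDeriv, lDeriv, modelDeriv_congr h]

theorem eventually_chart_symm {x : G} {p : G → Prop} (h : ∀ᶠ z in 𝓝 x, p z) :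
    ∀ᶠ y in 𝓝 (chart[E] x x), p ((chart[E] x).symm y) := by
  have := (contMDiffAt_chart_symm (mem_extChartAt_target (I := 𝓘(ℝ, E)) x)).continuousAt
  rw [ContinuousAt, extChartAt_to_inv] at this
  exact this.eventually h

theorem ContMDiffAt.eventually_mdifferentiableAt {f : G → F} {x : G} (hf : C∞[E, F] f x) :
    ∀ᶠ z in 𝓝 x, MD[E, F] f z := by
  have h1 : ContMDiffAt 𝓘(ℝ, E) 𝓘(ℝ, F) 1 f x := hf.of_le (by norm_cast)
  filter_upwards [(contMDiffAt_iff_contMDiffAt_nhds (by simp)).1 h1] with z hz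
  exact hz.mdifferentiableAt (by simp)

theorem ContMDiffAt.lDeriv {f : G → F} {x : G} (hf : C∞[E, F] f x) :
    C∞[E, E →L[ℝ] F] (lDeriv E f) x := by
  rw [contMDiffAt_iff_contDiffAt_chart le_rfl] at hf ⊢
  have h1 : ContDiffAt ℝ ∞ (fderiv ℝ (f ∘ (chart[E] x).symm))
      (chart[E] x x) := hf.fderiv_right (by simp)
  refine (h1.clm_comp (contDiffAt_chartFrame x)).congr_of_eventuallyEq ?_
  have hf' := (contMDiffAt_iff_contDiffAt_chart le_rfl).2 hf
  filter_upwards [target_mem_nhds x, eventually_chart_symm hf'.eventually_mdifferentiableAt]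
    with y hy hfy
  exact lDeriv_chart_symm hy hfy

theorem mlieBracket_eq_lieBracket_chart {M : Type*} [TopologicalSpace M] [ChartedSpace E M]
    [IsManifold 𝓘(ℝ, E) ∞ M] (V W : ∀ z : M, TangentSpace 𝓘(ℝ, E) z) (x : M) {V' W' : E → E}
    (hV : (fun y => (mfderiv 𝓘(ℝ, E) 𝓘(ℝ, E) (chart[E] x)
        ((chart[E] x).symm y) (V ((chart[E] x).symm y)) : E)) =ᶠ[𝓝 (chart[E] x x)] V')
    (hW : (fun y => (mfderiv 𝓘(ℝ, E) 𝓘(ℝ, E) (chart[E] x)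
        ((chart[E] x).symm y) (W ((chart[E] x).symm y)) : E)) =ᶠ[𝓝 (chart[E] x x)] W') :
    (VectorField.mlieBracket 𝓘(ℝ, E) V W x : E) =
    VectorField.lieBracket ℝ V' W' (chart[E] x x) := by
  have hpull : ∀ {U : ∀ z : M, TangentSpace 𝓘(ℝ, E) z} {U' : E → E},
      ((fun y => (mfderiv 𝓘(ℝ, E) 𝓘(ℝ, E) (chart[E] x)
        ((chart[E] x).symm y) (U ((chart[E] x).symm y)) : E))
          =ᶠ[𝓝 (chart[E] x x)] U') →
      (VectorField.mpullbackWithin 𝓘(ℝ, E) 𝓘(ℝ, E) (chart[E] x).symm U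
        (Set.range 𝓘(ℝ, E)) : E → E) =ᶠ[𝓝 (chart[E] x x)] U' := by
    intro U U' hU
    filter_upwards [target_mem_nhds x, hU] with y hy hUy
    refine Eq.trans ?_ hUy
    have h1 : (mfderiv[Set.range 𝓘(ℝ, E)] (chart[E] x).symm y) =
        mfderiv 𝓘(ℝ, E) 𝓘(ℝ, E) (chart[E] x).symm y := by
      rw [show Set.range 𝓘(ℝ, E) = Set.univ by simp, mfderivWithin_univ]
    have : (modelDeriv E E (chart[E] x).symm y).inverse =
        modelDeriv E E (chart[E] x) ((chart[E] x).symm y) :=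
      ContinuousLinearMap.inverse_eq (modelDeriv_symm_comp_chart hy) (modelDeriv_chart_comp_symm hy)
    refine Eq.trans ?_ (congr_fun this _)
    exact congrArg (fun T : E →L[ℝ] E => T.inverse (U ((chart[E] x).symm y))) h1
  have hi : (modelDeriv E E (chart[E] x) x).inverse = .id ℝ E := by
    rw [modelDeriv_chart_self, ContinuousLinearMap.inverse_id]
  have hs : ((chart[E] x).symm ⁻¹' Set.univ ∩ Set.range 𝓘(ℝ, E)) = Set.univ := by simp
  have e := EventuallyEq.lieBracket_vectorField_eq (𝕜 := ℝ) (hpull hV) (hpull hW)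
  rw [← VectorField.mlieBracketWithin_univ, VectorField.mlieBracketWithin_apply, hs]
  refine (congr_fun hi _).trans ?_
  refine Eq.trans ?_ e
  exact congrFun (VectorField.lieBracketWithin_univ (𝕜 := ℝ)
    (V := (VectorField.mpullbackWithin 𝓘(ℝ, E) 𝓘(ℝ, E) (chart[E] x).symm V
      (Set.range 𝓘(ℝ, E)) : E → E))
    (W := (VectorField.mpullbackWithin 𝓘(ℝ, E) 𝓘(ℝ, E) (chart[E] x).symm W
      (Set.range 𝓘(ℝ, E)) : E → E))) _

variable (G) in
/-- The Lie algebra of `G` is the model space. -/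
def toLie : E ≃ₗ[ℝ] Lie(E, G) := LinearEquiv.refl ℝ E

variable (G) in
/-- The Lie bracket of the Lie algebra of `G`, on the model space. -/
def modelBracket (v w : E) : E := (toLie G).symm ⁅toLie G v, toLie G w⁆

theorem lieBracket_chartFrame (x : G) (v w : E) :
    VectorField.lieBracket ℝ (fun y => chartFrame E x y v) (fun y => chartFrame E x y w)
      (chart[E] x x) = lTrans E x (modelBracket G v w) := by
  have h := congrFun (mulInvariantVector_mlieBracket (toLie G v) (toLie G w)) x
  rw [← GroupLieAlgebra.bracket_def] at h
  refine Eq.trans ?_ h.symm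
  exact (mlieBracket_eq_lieBracket_chart (mulInvariantVectorField (toLie G v))
    (mulInvariantVectorField (toLie G w)) x
    (Eventually.of_forall fun y => rfl) (Eventually.of_forall fun y => rfl)).symm

theorem lDeriv_eq_fderiv {u : G → F} {x : G} (hu : MD[E, F] u x) (t : E) :
    lDeriv E u x t = fderiv ℝ (u ∘ (chart[E] x).symm) (chart[E] x x) (lTrans E x t) := by
  rw [lDeriv, modelDeriv_eq_fderiv hu]; rfl

/-- The Lie bracket of vector fields, in the left trivialization. -/
theorem mlieBracket_lTrans {a b : G → E} {x : G} (ha : MD[E, E] a x) (hb : MD[E, E] b x) :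
    (VectorField.mlieBracket 𝓘(ℝ, E) (fun y => (lTrans E y (a y) : TangentSpace 𝓘(ℝ, E) y))
      (fun y => (lTrans E y (b y) : TangentSpace 𝓘(ℝ, E) y)) x : E) =
    lTrans E x (lDeriv E b x (a x) - lDeriv E a x (b x) + modelBracket G (a x) (b x)) := by
  have hΛ : DifferentiableAt ℝ (chartFrame E x) (chart[E] x x) :=
    (contDiffAt_chartFrame x).differentiableAt (by simp)
  have key : ∀ {u : G → E}, MD[E, E] u x → ∀ t,
      fderiv ℝ (fun y => chartFrame E x y ((u ∘ (chart[E] x).symm) y))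
        (chart[E] x x) (lTrans E x t) =
        lTrans E x (lDeriv E u x t) + fderiv ℝ (fun y => chartFrame E x y (u x))
          (chart[E] x x) (lTrans E x t) := by
    intro u hu t
    rw [fderiv_clm_apply hΛ (differentiableAt_chart hu),
      fderiv_clm_apply hΛ (differentiableAt_const _), chartFrame_self, lDeriv_eq_fderiv hu]
    simp only [add_apply, ContinuousLinearMap.comp_apply, fderiv_fun_const,
      Pi.zero_apply, zero_apply, map_zero, zero_add, Function.comp_apply, extChartAt_to_inv]
  refine (mlieBracket_eq_lieBracket_chart (fun z : G => lTrans E z (a z)) (fun z => lTrans E z (b z)) x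
    (V' := fun y => chartFrame E x y ((a ∘ (chart[E] x).symm) y))
    (W' := fun y => chartFrame E x y ((b ∘ (chart[E] x).symm) y))
    (Eventually.of_forall fun y => rfl) (Eventually.of_forall fun y => rfl)).trans ?_
  rw [map_add, ← lieBracket_chartFrame, VectorField.lieBracket_eq, VectorField.lieBracket_eq]
  have h1 := key hb (a x)
  have h2 := key ha (b x)
  simp only [chartFrame_self, Function.comp_apply, extChartAt_to_inv] at h1 h2 ⊢
  rw [h1, h2, map_sub]
  abel

end LeftTrivialization

/-! ### Smooth fields of forms -/

section SmoothForms

open Filter Topology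

variable {E : Type*} [NormedAddCommGroup E] [NormedSpace ℝ E] [FiniteDimensional ℝ E]
  {F : Type*} [NormedAddCommGroup F] [NormedSpace ℝ F]

instance finiteDimensional_form [FiniteDimensional ℝ F] (k : ℕ) :
    FiniteDimensional ℝ (E [⋀^Fin k]→L[ℝ] F) := by
  let T : (E [⋀^Fin k]→L[ℝ] F) →ₗ[ℝ] MultilinearMap ℝ (fun _ : Fin k => E) F :=
    { toFun := fun w => w.toMultilinearMap
      map_add' := fun _ _ => rfl
      map_smul' := fun _ _ => rfl }
  refine FiniteDimensional.of_injective T fun a b h => ?_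
  ext v
  exact congr_fun h v

/-- Evaluation of a form, as a continuous linear map. -/
def formEval [FiniteDimensional ℝ F] {k : ℕ} (v : Fin k → E) : (E [⋀^Fin k]→L[ℝ] F) →L[ℝ] F :=
  toContinuousLinearMap
    { toFun := fun u => u v
      map_add' := fun _ _ => rfl
      map_smul' := fun _ _ => rfl }

/-- Contraction with the first argument, as a continuous bilinear map. -/
def formCurry (k : ℕ) : (E [⋀^Fin (k + 1)]→L[ℝ] F) →L[ℝ] E →L[ℝ] E [⋀^Fin k]→L[ℝ] F :=
  (ContinuousAlternatingMap.curryLeftLI (𝕜 := ℝ) (E := E) (F := F) (n := k)).toContinuousLinearMap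

theorem contDiffAt_form_apply [FiniteDimensional ℝ F] {X : Type*} [NormedAddCommGroup X]
    [NormedSpace ℝ X] {n : WithTop ℕ∞} {x : X} {k : ℕ} {w : X → E [⋀^Fin k]→L[ℝ] F}
    {v : Fin k → X → E} (hw : ContDiffAt ℝ n w x) (hv : ∀ i, ContDiffAt ℝ n (v i) x) :
    ContDiffAt ℝ n (fun y => w y fun i => v i y) x := by
  induction k with
  | zero =>
    refine ((formEval (F := F) ![]).contDiff.contDiffAt.comp x hw).congr_of_eventuallyEq
      (Eventually.of_forall fun y => congrArg (w y) (Subsingleton.elim _ _))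
  | succ k ih =>
    have hc : ContDiff ℝ n (fun u : E [⋀^Fin (k + 1)]→L[ℝ] F => u.curryLeft) :=
      ContinuousLinearMap.contDiff (𝕜 := ℝ) (E := E [⋀^Fin (k + 1)]→L[ℝ] F)
        (F := E →L[ℝ] E [⋀^Fin k]→L[ℝ] F)
        (formCurry k)
    have h0 : ContDiffAt ℝ n (fun y => (w y).curryLeft) x := hc.contDiffAt.comp x hw
    have h1 : ContDiffAt ℝ n (fun y => (w y).curryLeft (v 0 y)) x := h0.clm_apply (hv 0)
    have := ih (w := fun y => (w y).curryLeft (v 0 y)) (v := fun i => v i.succ) h1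
      (fun i => hv i.succ)
    refine this.congr_of_eventuallyEq (Eventually.of_forall fun y => ?_)
    simp only [curryLeft_apply_apply]
    congr 1
    ext i
    refine Fin.cases rfl (fun j => rfl) i

theorem contDiffAt_form_iff [FiniteDimensional ℝ F] {X : Type*} [NormedAddCommGroup X]
    [NormedSpace ℝ X] {n : WithTop ℕ∞} {x : X} {k : ℕ} {w : X → E [⋀^Fin k]→L[ℝ] F} :
    ContDiffAt ℝ n w x ↔ ∀ v, ContDiffAt ℝ n (fun y => w y v) x := by
  refine ⟨fun h v => contDiffAt_form_apply h fun i => contDiffAt_const, fun h => ?_⟩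
  let b := finBasis ℝ E
  let T : (E [⋀^Fin k]→L[ℝ] F) →ₗ[ℝ] ((Fin k → Fin (finrank ℝ E)) → F) :=
    { toFun := fun w s => w fun i => b (s i)
      map_add' := fun _ _ => rfl
      map_smul' := fun _ _ => rfl }
  have hT : Function.Injective T := by
    intro u w huw
    have : u.toAlternatingMap = w.toAlternatingMap :=
      Basis.ext_alternating b fun s _ => congrFun huw s
    ext v
    exact congr_fun this v
  obtain ⟨S, hS⟩ := LinearMap.exists_leftInverse_of_injective T (LinearMap.ker_eq_bot.2 hT)
  have h1 : ContDiffAt ℝ n (fun y => T (w y)) x := contDiffAt_pi.2 fun s => h _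
  have h2 := ((toContinuousLinearMap S).contDiff.contDiffAt).comp x h1
  refine h2.congr_of_eventuallyEq (Eventually.of_forall fun y => ?_)
  exact (congr_fun hS (w y)).symm

theorem ContDiffAt.form_comp [FiniteDimensional ℝ F] {X : Type*} [NormedAddCommGroup X]
    [NormedSpace ℝ X] {n : WithTop ℕ∞} {x : X} {k : ℕ} {w : X → E [⋀^Fin k]→L[ℝ] F}
    {A : X → E →L[ℝ] E} (hw : ContDiffAt ℝ n w x) (hA : ContDiffAt ℝ n A x) :
    ContDiffAt ℝ n (fun y => (w y).compContinuousLinearMap (A y)) x := by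
  refine contDiffAt_form_iff.2 fun v => ?_
  exact contDiffAt_form_apply (v := fun i y => A y (v i)) hw
    fun i => hA.clm_apply contDiffAt_const

end SmoothForms

section InvariantCalculus

open Filter Topology

variable {E : Type*} [NormedAddCommGroup E] [NormedSpace ℝ E] [FiniteDimensional ℝ E]
  {G : Type*} [TopologicalSpace G] [ChartedSpace E G] [Group G] [LieGroup 𝓘(ℝ, E) ∞ G]
  {F : Type*} [NormedAddCommGroup F] [NormedSpace ℝ F]
  {F' : Type*} [NormedAddCommGroup F'] [NormedSpace ℝ F']
  {F'' : Type*} [NormedAddCommGroup F''] [NormedSpace ℝ F'']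

theorem lDeriv_const (c : F) (x : G) : lDeriv E (fun _ : G => c) x = 0 := by
  have : modelDeriv E F (fun _ : G => c) x = 0 := mfderiv_const
  rw [lDeriv, this, ContinuousLinearMap.zero_comp]

theorem lDeriv_clm_comp (T : F →L[ℝ] F') {f : G → F} {x : G} (hf : MD[E, F] f x) (c : E) :
    lDeriv E (fun y => T (f y)) x c = T (lDeriv E f x c) := by
  rw [lDeriv, modelDeriv_clm_comp T hf]; rfl

theorem lDeriv_bilin (T : F →L[ℝ] F' →L[ℝ] F'') {f : G → F} {h : G → F'} {x : G} (hf : MD[E, F] f x)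
    (hh : MD[E, F'] h x) (c : E) : lDeriv E (fun y => T (f y) (h y)) x c =
      T (lDeriv E f x c) (h x) + T (f x) (lDeriv E h x c) :=
  modelDeriv_bilin T hf hh _

theorem lDeriv_add {f h : G → F} {x : G} (hf : MD[E, F] f x) (hh : MD[E, F] h x) (c : E) :
    lDeriv E (fun y => f y + h y) x c = lDeriv E f x c + lDeriv E h x c := by
  have hp : MD[E, F × F] (fun y => (f y, h y)) x := hf.prodMk_space hh
  have h1 := lDeriv_clm_comp (fst ℝ F F) hp c
  have h2 := lDeriv_clm_comp (snd ℝ F F) hp c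
  have h3 := lDeriv_clm_comp (fst ℝ F F + snd ℝ F F) hp c
  exact h3.trans (congrArg₂ (· + ·) h1.symm h2.symm)

/-- The commutator of two left-invariant derivatives. -/
theorem lDeriv_lDeriv_sub {f : G → F} {x : G} (hf : C∞[E, F] f x) (c d : E) :
    lDeriv E (fun y => lDeriv E f y d) x c - lDeriv E (fun y => lDeriv E f y c) x d =
      lDeriv E f x (modelBracket G c d) := by
  have hf' := (contMDiffAt_iff_contDiffAt_chart le_rfl).1 hf
  have hΛ : DifferentiableAt ℝ (chartFrame E x) (chart[E] x x) :=
    (contDiffAt_chartFrame x).differentiableAt (by simp)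
  have hDf : DifferentiableAt ℝ (fderiv ℝ (f ∘ (chart[E] x).symm))
      (chart[E] x x) :=
    (hf'.fderiv_right (m := 1) (by norm_cast)).differentiableAt (by simp)
  have hΛd : ∀ d : E, DifferentiableAt ℝ (fun y => chartFrame E x y d)
      (chart[E] x x) := fun d => hΛ.clm_apply (differentiableAt_const _)
  have key : ∀ c d : E, lDeriv E (fun y => lDeriv E f y d) x c =
      fderiv ℝ (fderiv ℝ (f ∘ (chart[E] x).symm)) (chart[E] x x)
        (lTrans E x c) (lTrans E x d) +
      fderiv ℝ (f ∘ (chart[E] x).symm) (chart[E] x x)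
        (fderiv ℝ (fun y => chartFrame E x y d) (chart[E] x x) (lTrans E x c)) := by
    intro c d
    have h1 : MD[E, F] (fun y => lDeriv E f y d) x :=
      (hf.lDeriv.clm_comp_space (ContinuousLinearMap.apply ℝ F d)).mdiff
    rw [lDeriv_eq_fderiv h1]
    have e : ((fun y => lDeriv E f y d) ∘ (chart[E] x).symm)
        =ᶠ[𝓝 (chart[E] x x)] fun y =>
          fderiv ℝ (f ∘ (chart[E] x).symm) y (chartFrame E x y d) := by
      filter_upwards [target_mem_nhds x, eventually_chart_symm hf.eventually_mdifferentiableAt]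
        with y hy hfy
      exact congr_fun (lDeriv_chart_symm hy hfy) d
    rw [e.fderiv_eq, fderiv_clm_apply hDf (hΛd d), chartFrame_self]
    simp [add_comm]
  rw [key, key, lDeriv_eq_fderiv (hf.mdiff), ← lieBracket_chartFrame, VectorField.lieBracket_eq]
  have hs : IsSymmSndFDerivAt ℝ (f ∘ (chart[E] x).symm) (chart[E] x x) :=
    hf'.isSymmSndFDerivAt (by rw [minSmoothness_of_isRCLikeNormedField]; norm_cast)
  rw [hs.eq (lTrans E x d)]
  simp only [chartFrame_self, map_sub]
  abel

theorem contMDiffAt_form_iff [FiniteDimensional ℝ F] {x : G} {k : ℕ} {w : G → E [⋀^Fin k]→L[ℝ] F} :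
    C∞[E, E [⋀^Fin k]→L[ℝ] F] w x ↔ ∀ v, C∞[E, F] (fun y => w y v) x := by
  simp only [contMDiffAt_iff_contDiffAt_chart le_rfl, contDiffAt_form_iff (F := F)]
  rfl

theorem formInChart_comp_chartFrame {k : ℕ} (w : G → E [⋀^Fin k]→L[ℝ] F) {x : G} {y : E}
    (hy : y ∈ (chart[E] x).target) :
    (formInChart x w y).compContinuousLinearMap (chartFrame E x y) =
      (w ((chart[E] x).symm y)).compContinuousLinearMap (lTrans E ((chart[E] x).symm y)) := by
  have : (modelDeriv E E (chart[E] x).symm y).comp (chartFrame E x y) =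
      lTrans E ((chart[E] x).symm y) := by
    rw [chartFrame, ← comp_assoc, modelDeriv_symm_comp_chart hy, id_comp]
  rw [← this]
  rfl

theorem formInChart_eq_comp_chartCoframe {k : ℕ} (w : G → E [⋀^Fin k]→L[ℝ] F) {x : G} {y : E}
    (hy : y ∈ (chart[E] x).target) :
    formInChart x w y = ((w ((chart[E] x).symm y)).compContinuousLinearMap
        (lTrans E ((chart[E] x).symm y))).compContinuousLinearMap (chartCoframe E x y) := by
  rw [← formInChart_comp_chartFrame w hy]
  ext v
  simp only [ContinuousAlternatingMap.compContinuousLinearMap_apply]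
  congr 1
  ext i
  exact (congr_fun (chartFrame_comp_chartCoframe hy) (v i)).symm

/-- A field of forms, in the left trivialization. -/
def leftForm {k : ℕ} (w : G → E [⋀^Fin k]→L[ℝ] F) (z : G) : E [⋀^Fin k]→L[ℝ] F :=
  (w z).compContinuousLinearMap (lTrans E z)

theorem formSmoothAt_iff [FiniteDimensional ℝ F] {k : ℕ} {w : G → E [⋀^Fin k]→L[ℝ] F} {x : G} :
    FormSmoothAt w x ↔ C∞[E, E [⋀^Fin k]→L[ℝ] F] (leftForm w) x := by
  rw [contMDiffAt_iff_contDiffAt_chart le_rfl, FormSmoothAt]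
  constructor
  · intro h
    refine (h.form_comp (contDiffAt_chartFrame x)).congr_of_eventuallyEq ?_
    filter_upwards [target_mem_nhds x] with y hy
    exact (formInChart_comp_chartFrame w hy).symm
  · intro h
    refine (h.form_comp (contDiffAt_chartCoframe x)).congr_of_eventuallyEq ?_
    filter_upwards [target_mem_nhds x] with y hy
    exact formInChart_eq_comp_chartCoframe w hy

theorem formDeriv_eq {k : ℕ} (w : G → E [⋀^Fin k]→L[ℝ] F) (x : G) :
    formDeriv w x = extDeriv (formInChart x w) (chart[E] x x) := by
  have h := modelDeriv_chart_self (E := E) x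
  have e : formDeriv w x = (extDeriv (formInChart x w) (chart[E] x
    x)).compContinuousLinearMap (modelDeriv E E (chart[E] x) x) := rfl
  rw [e, h]
  rfl

theorem formInChart_apply_chartFrame {k : ℕ} (w : G → E [⋀^Fin k]→L[ℝ] F) {x : G} {y : E}
    (hy : y ∈ (chart[E] x).target) (v : Fin k → E) :
    formInChart x w y (fun i => chartFrame E x y (v i)) = leftForm w ((chart[E] x).symm y) v :=
  congr_fun (formInChart_comp_chartFrame w hy) v

theorem fderiv_formInChart_chartFrame [FiniteDimensional ℝ F] {k : ℕ}
    {w : G → E [⋀^Fin k]→L[ℝ] F} {x : G} (hw : FormSmoothAt w x) (v : Fin k → E) (t : E) :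
    fderiv ℝ (fun y => formInChart x w y (fun i => chartFrame E x y (v i)))
      (chart[E] x x) (lTrans E x t) = lDeriv E (leftForm w) x t v := by
  have h := (formSmoothAt_iff.1 hw).mdiff
  have e : (fun y => formInChart x w y (fun i => chartFrame E x y (v i)))
      =ᶠ[𝓝 (chart[E] x x)] fun y =>
        (leftForm w ∘ (chart[E] x).symm) y v := by
    filter_upwards [target_mem_nhds x] with y hy
    exact formInChart_apply_chartFrame w hy v
  rw [e.fderiv_eq, lDeriv_eq_fderiv h]
  have := (formEval v).hasFDerivAt.comp _ (differentiableAt_chart h).hasFDerivAt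
  exact congr_fun this.fderiv _

/-- The exterior derivative in the left trivialization, in degree zero. -/
theorem formDeriv_zero_apply_lTrans [FiniteDimensional ℝ F] {w : G → E [⋀^Fin 0]→L[ℝ] F} {x : G}
    (hw : FormSmoothAt w x) (v : Fin 1 → E) :
    formDeriv w x (fun i => lTrans E x (v i)) = lDeriv E (leftForm w) x (v 0) ![] := by
  rw [formDeriv_eq, extDeriv_apply (hw.differentiableAt (by simp)),
    ← fderiv_formInChart_chartFrame hw]
  rw [Fin.sum_univ_one, Fin.val_zero, pow_zero, one_smul]
  have e : (fun y => formInChart x w y (fun i => chartFrame E x y ((![] : Fin 0 → E) i))) =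
      fun y => formInChart x w y (Fin.removeNth 0 fun i => lTrans E x (v i)) := by
    funext y
    exact congrArg _ (Subsingleton.elim _ _)
  rw [e]

/-- The exterior derivative in the left trivialization, in positive degree. -/
theorem formDeriv_succ_apply_lTrans [FiniteDimensional ℝ F] {k : ℕ}
    {w : G → E [⋀^Fin (k + 1)]→L[ℝ] F} {x : G} (hw : FormSmoothAt w x) (v : Fin (k + 2) → E) :
    formDeriv w x (fun i => lTrans E x (v i)) =
      (∑ i, (-1) ^ i.val • lDeriv E (leftForm w) x (v i) (i.removeNth v)) -
        ∑ i : Fin (k + 1), ∑ j ≥ i, (-1) ^ (i + j : ℕ) •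
          leftForm w x (vecCons (modelBracket G (v i.castSucc) (v j.succ))
            (j.removeNth <| i.castSucc.removeNth v)) := by
  have hV : ∀ i, DifferentiableAt ℝ (fun y => chartFrame E x y (v i))
      (chart[E] x x) := fun i =>
    ((contDiffAt_chartFrame x).differentiableAt (by simp)).clm_apply (differentiableAt_const _)
  have h := extDeriv_apply_vectorField (V := fun i y => chartFrame E x y (v i))
    (hw.differentiableAt (by simp)) hV
  have hx := mem_extChartAt_target (I := 𝓘(ℝ, E)) x
  simp only [chartFrame_self, lieBracket_chartFrame] at h
  rw [formDeriv_eq, h]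
  congr 1
  · refine sum_congr rfl fun i _ => ?_
    rw [← fderiv_formInChart_chartFrame hw]
    rfl
  · refine sum_congr rfl fun i _ => sum_congr rfl fun j _ => ?_
    have := formInChart_apply_chartFrame w hx (vecCons
      (modelBracket G (v i.castSucc) (v j.succ)) (j.removeNth <| i.castSucc.removeNth v))
    rw [chartFrame_self, extChartAt_to_inv] at this
    rw [← this]
    congr 2
    ext m
    refine Fin.cases rfl (fun l => rfl) m

/-! ### The adjoint action -/

variable (E) in
/-- The adjoint action of `g⁻¹`. -/
def adInv (g : G) : E →L[ℝ] E := (lMC E g).comp (rTrans E g)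

theorem lTrans_adInv (g : G) (v : E) : lTrans E g (adInv E g v) = rTrans E g v := by simp [adInv]

theorem adInv_eq_modelDeriv (g : G) :
    adInv E g = modelDeriv E E (fun x : G => g⁻¹ * (x * g)) 1 := by
  have h := modelDeriv_comp (1 : G) (mdifferentiableAt_mul_left' (E := E) g⁻¹ (1 * g))
    (mdifferentiableAt_mul_right' g 1)
  rw [one_mul] at h
  exact h.symm

theorem adInv_mul (z h : G) : adInv E (z * h) = (adInv E h).comp (adInv E z) := by
  have hd : ∀ g x : G, MD[E, E] (fun x : G => g⁻¹ * (x * g)) x :=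
    fun g x => (mdifferentiableAt_mul_left' g⁻¹ (x * g)).comp x (mdifferentiableAt_mul_right' g x)
  have := modelDeriv_comp (1 : G) (hd h (z⁻¹ * (1 * z))) (hd z 1)
  rw [adInv_eq_modelDeriv, adInv_eq_modelDeriv h, adInv_eq_modelDeriv z]
  rw [one_mul, inv_mul_cancel] at this
  rw [← this]
  congr 1
  ext x
  simp [mul_assoc]

@[simp] theorem adInv_one : adInv E (1 : G) = .id ℝ E := by
  rw [adInv_eq_modelDeriv, ← modelDeriv_id (1 : G)]
  congr 1
  ext x
  simp

theorem adInv_adInv_inv (g : G) (v : E) : adInv E g (adInv E g⁻¹ v) = v := by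
  have := adInv_mul (E := E) g⁻¹ g
  rw [inv_mul_cancel, adInv_one] at this
  exact (congr_fun this v).symm

variable (E) in
/-- The right-invariant frame in the chart at `1`. -/
def chartRightFrame (y : E) : E →L[ℝ] E :=
  fderiv ℝ (fun p => chartMul E (1 : G) p y) (chart[E] (1 : G) 1)

theorem chartRightFrame_eq {y : E} (hy : y ∈ (chart[E] (1 : G)).target) :
    chartRightFrame E (G := G) y =
      (modelDeriv E E (chart[E] (1 : G)) ((chart[E] (1 : G)).symm y)).comp
        (rTrans E ((chart[E] (1 : G)).symm y)) := by
  have hs := (chart[E] (1 : G)).map_target hy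
  set g := (chart[E] (1 : G)).symm y with hg
  have e : (fun p => chartMul E (1 : G) p y) = chart[E] (1 : G) ∘ (fun z => z * g) ∘
    (chart[E] (1 : G)).symm := rfl
  have c1 : MD[E, E] (chart[E] (1 : G)).symm
      (chart[E] (1 : G) 1) :=
    (contMDiffAt_chart_symm (mem_extChartAt_target 1)).mdiff
  have c2 : MD[E, E] (fun z => z * g)
      ((chart[E] (1 : G)).symm (chart[E] (1 : G) 1)) :=
    mdifferentiableAt_mul_right' _ _
  have c3 : MD[E, E] (chart[E] (1 : G))
      (((chart[E] (1 : G)).symm (chart[E] (1 : G) 1)) * g) := by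
    rw [extChartAt_to_inv, one_mul]
    exact (contMDiffAt_chart hs).mdiff
  rw [chartRightFrame, ← modelDeriv_eq_fderiv_space, e, modelDeriv_comp (E' := E)
    (f := (fun z => z * g) ∘ (chart[E] (1 : G)).symm) _ c3 (c2.comp _ c1),
    modelDeriv_comp _ c2 c1, modelDeriv_chart_symm_self, extChartAt_to_inv]
  simp only [Function.comp_apply, extChartAt_to_inv, one_mul, comp_id]
  rfl

theorem adInv_chart_symm {y : E} (hy : y ∈ (chart[E] (1 : G)).target) :
    adInv E ((chart[E] (1 : G)).symm y) =
      (chartCoframe E (1 : G) y).comp (chartRightFrame E (G := G) y) := by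
  rw [chartRightFrame_eq hy, chartCoframe, comp_assoc,
    ← comp_assoc (modelDeriv E E _ _), modelDeriv_symm_comp_chart hy, id_comp, adInv]

theorem contDiffAt_chartRightFrame : ContDiffAt ℝ ∞ (chartRightFrame E (G := G))
    (chart[E] (1 : G) 1) := by
  refine ContDiffAt.fderiv (f := fun y p => chartMul E (1 : G) p y) (n := ∞) ?_
    contDiffAt_const (by simp)
  exact ContDiffAt.comp (f := fun p : E × E => (p.2, p.1))
    (chart[E] (1 : G) 1, chart[E] (1 : G) 1)
    (contDiffAt_chartMul (E := E) (1 : G)) (contDiff_snd.prodMk contDiff_fst).contDiffAt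

theorem contMDiffAt_adInv_one : C∞[E, E →L[ℝ] E] (adInv E) (1 : G) := by
  rw [contMDiffAt_iff_contDiffAt_chart le_rfl]
  refine ((contDiffAt_chartCoframe (1 : G)).clm_comp
    contDiffAt_chartRightFrame).congr_of_eventuallyEq ?_
  filter_upwards [target_mem_nhds (1 : G)] with y hy
  exact adInv_chart_symm hy

theorem contMDiffAt_adInv (x : G) : C∞[E, E →L[ℝ] E] (adInv E) x := by
  have h1 : C∞[E, E →L[ℝ] E] (fun z : G => adInv E (x⁻¹ * z)) x := by
    refine ContMDiffAt.comp (I' := 𝓘(ℝ, E)) x (g := adInv E) (f := fun z : G => x⁻¹ * z) ?_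
      contMDiff_mul_left.contMDiffAt
    rw [inv_mul_cancel]
    exact contMDiffAt_adInv_one
  have h2 := h1.clm_comp_space ((compL ℝ E E E).flip (adInv E x))
  refine h2.congr_of_eventuallyEq (Eventually.of_forall fun z => ?_)
  have := adInv_mul (E := E) x (x⁻¹ * z)
  rw [mul_inv_cancel_left] at this
  exact this

theorem contMDiffAt_adInv_apply (x : G) (v : E) : C∞[E, E] (fun z : G => adInv E z v) x :=
  (contMDiffAt_adInv x).clm_comp_space (ContinuousLinearMap.apply ℝ E v)

theorem fderiv_fderiv_swap {m : E → E → E} {a b : E}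
    (hm : ContDiffAt ℝ ∞ (Function.uncurry m) (a, b)) (c u : E) :
    fderiv ℝ (fun y => fderiv ℝ (fun p => m p y) a) b c u =
      fderiv ℝ (fun p => fderiv ℝ (m p) b) a u c := by
  have h1 : ∀ᶠ q in 𝓝 (a, b), DifferentiableAt ℝ (Function.uncurry m) q := by
    have := (hm.of_le (by norm_cast : (1 : WithTop ℕ∞) ≤ ∞)).eventually (by simp)
    filter_upwards [this] with q hq
    exact hq.differentiableAt (by simp)
  have hD : DifferentiableAt ℝ (fderiv ℝ (Function.uncurry m)) (a, b) :=
    (hm.fderiv_right (m := 1) (by norm_cast)).differentiableAt (by simp)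
  have hs : IsSymmSndFDerivAt ℝ (Function.uncurry m) (a, b) :=
    hm.isSymmSndFDerivAt (by rw [minSmoothness_of_isRCLikeNormedField]; norm_cast)
  have e1 : (fun y => fderiv ℝ (fun p => m p y) a) =ᶠ[𝓝 b] fun y =>
      (fderiv ℝ (Function.uncurry m) (a, y)).comp (ContinuousLinearMap.inl ℝ E E) := by
    have : Tendsto (fun y : E => (a, y)) (𝓝 b) (𝓝 (a, b)) := by
      exact (Continuous.prodMk_right a).tendsto b
    filter_upwards [this.eventually h1] with y hy
    exact (HasFDerivAt.comp (𝕜 := ℝ) (f := fun e => (e, y)) a hy.hasFDerivAt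
      (hasFDerivAt_prodMk_left a y)).fderiv
  have e2 : (fun p => fderiv ℝ (m p) b) =ᶠ[𝓝 a] fun p =>
      (fderiv ℝ (Function.uncurry m) (p, b)).comp (ContinuousLinearMap.inr ℝ E E) := by
    have : Tendsto (fun p : E => (p, b)) (𝓝 a) (𝓝 (a, b)) := by
      exact (Continuous.prodMk_left b).tendsto a
    filter_upwards [this.eventually h1] with y hy
    exact (HasFDerivAt.comp (𝕜 := ℝ) (f := fun e => (y, e)) b hy.hasFDerivAt
      (hasFDerivAt_prodMk_right y b)).fderiv
  have f1 := ((compL ℝ E (E × E) E).flip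
    (ContinuousLinearMap.inl ℝ E E)).hasFDerivAt.comp b
      (hD.hasFDerivAt.comp b (hasFDerivAt_prodMk_right a b))
  have f2 := ((compL ℝ E (E × E) E).flip
    (ContinuousLinearMap.inr ℝ E E)).hasFDerivAt.comp a
      (hD.hasFDerivAt.comp a (hasFDerivAt_prodMk_left a b))
  rw [e1.fderiv_eq, e2.fderiv_eq]
  refine (congr_fun (congr_fun f1.fderiv c) u).trans
    (Eq.trans ?_ (congr_fun (congr_fun f2.fderiv u) c).symm)
  exact hs.eq _ _

theorem lDeriv_adInv_one (u c : E) :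
    lDeriv E (fun z : G => adInv E z u) 1 c = -modelBracket G c u := by
  set o := chart[E] (1 : G) 1 with ho
  have hΛ : DifferentiableAt ℝ (chartFrame E (1 : G)) o :=
    (contDiffAt_chartFrame (1 : G)).differentiableAt (by simp)
  have hN : DifferentiableAt ℝ (chartCoframe E (1 : G)) o :=
    (contDiffAt_chartCoframe (1 : G)).differentiableAt (by simp)
  have hR : DifferentiableAt ℝ (chartRightFrame E (G := G)) o :=
    contDiffAt_chartRightFrame.differentiableAt (by simp)
  have hΛo : chartFrame E (1 : G) o = .id ℝ E := by rw [ho, chartFrame_self, lTrans_one]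
  have hNo : chartCoframe E (1 : G) o = .id ℝ E := by
    have := chartCoframe_comp_chartFrame (mem_extChartAt_target (I := 𝓘(ℝ, E)) (1 : G))
    rwa [← ho, hΛo, comp_id] at this
  have hRo : chartRightFrame E (G := G) o = .id ℝ E := by
    rw [ho, chartRightFrame_eq (mem_extChartAt_target (1 : G)), extChartAt_to_inv,
      modelDeriv_chart_self, rTrans_one, id_comp]
  -- the derivative of the coframe is minus that of the frame
  have hNΛ : ∀ c v, fderiv ℝ (chartCoframe E (1 : G)) o c v =
      -fderiv ℝ (chartFrame E (1 : G)) o c v := by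
    intro c v
    have e : (fun y => chartCoframe E (1 : G) y (chartFrame E (1 : G) y v)) =ᶠ[𝓝 o]
        fun _ => v := by
      filter_upwards [target_mem_nhds (1 : G)] with y hy
      exact congr_fun (chartCoframe_comp_chartFrame hy) v
    have h1 := congr_fun (e.fderiv_eq (𝕜 := ℝ)) c
    rw [fderiv_clm_apply hN (hΛ.clm_apply (differentiableAt_const v)),
      fderiv_clm_apply hΛ (differentiableAt_const v)] at h1
    simp [hNo, hΛo] at h1
    exact eq_neg_of_add_eq_zero_left (by rw [add_comm]; exact h1)
  -- the second derivative of the product is symmetric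
  have hsym : ∀ c u, fderiv ℝ (chartRightFrame E (G := G)) o c u =
      fderiv ℝ (chartFrame E (1 : G)) o u c := by
    intro c u
    refine (fderiv_fderiv_swap (contDiffAt_chartMul (1 : G)) c u).trans ?_
    have e : (fun p => fderiv ℝ (chartMul E (1 : G) p) o) =ᶠ[𝓝 o] chartFrame E (1 : G) := by
      filter_upwards [target_mem_nhds (1 : G)] with y hy
      exact (chartFrame_eq_fderiv hy).symm
    have e' : fderiv ℝ (fun p => fderiv ℝ (chartMul E (1 : G) p) o) o =
      fderiv ℝ (chartFrame E (1 : G)) o := e.fderiv_eq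
    exact congr_fun (congr_fun e' u) c
  have hd := (contMDiffAt_adInv_apply (1 : G) u).mdiff
  rw [lDeriv_eq_fderiv hd, lTrans_one]
  have e : ((fun z : G => adInv E z u) ∘ (chart[E] (1 : G)).symm) =ᶠ[𝓝 o]
      fun y => chartCoframe E (1 : G) y (chartRightFrame E (G := G) y u) := by
    filter_upwards [target_mem_nhds (1 : G)] with y hy
    exact congr_fun (adInv_chart_symm hy) u
  have hb := lieBracket_chartFrame (1 : G) c u
  rw [lTrans_one, VectorField.lieBracket_eq, ← ho] at hb
  beta_reduce at hb
  rw [fderiv_clm_apply hΛ (differentiableAt_const _), fderiv_clm_apply hΛ (differentiableAt_const _)]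
    at hb
  simp [hΛo] at hb
  rw [← hb, e.fderiv_eq, fderiv_clm_apply hN (hR.clm_apply (differentiableAt_const u)),
      fderiv_clm_apply hR (differentiableAt_const u)]
  simp [hNo, hRo, hNΛ, hsym, sub_eq_add_neg]

theorem lDeriv_adInv (x : G) (y c : E) :
    lDeriv E (fun z : G => adInv E z y) x c = -modelBracket G c (adInv E x y) := by
  rw [← lDeriv_adInv_one]
  have hd := (contMDiffAt_adInv_apply (1 : G) (adInv E x y)).mdiff
  have h := modelDeriv_comp x (f := fun z : G => x⁻¹ * z) (E'' := E)
    (g := fun z : G => adInv E z (adInv E x y)) (by rwa [inv_mul_cancel])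
    (mdifferentiableAt_mul_left' x⁻¹ x)
  have e : ((fun z : G => adInv E z (adInv E x y)) ∘ fun z : G => x⁻¹ * z) =
      fun z : G => adInv E z y := by
    funext z
    have := adInv_mul (E := E) x (x⁻¹ * z)
    rw [mul_inv_cancel_left] at this
    exact (congr_fun this y).symm
  rw [e] at h
  rw [lDeriv, h, inv_mul_cancel, lDeriv, lTrans_one]
  exact congrArg (modelDeriv E E (fun z : G => adInv E z (adInv E x y)) 1) (lMC_lTrans x c)

theorem modelBracket_adInv (x : G) (u v : E) :
    modelBracket G (adInv E x u) (adInv E x v) = adInv E x (modelBracket G u v) := by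
  rw [← neg_inj, ← lDeriv_adInv, ← map_neg, ← lDeriv_adInv_one]
  have hd := (contMDiffAt_adInv_apply x v).mdiff
  have h := modelDeriv_comp (1 : G) (f := fun z : G => z * x) (E'' := E)
    (g := fun z : G => adInv E z v) (by rwa [one_mul])
    (mdifferentiableAt_mul_right' x 1)
  have e : ((fun z : G => adInv E z v) ∘ fun z : G => z * x) =
      fun z : G => adInv E x (adInv E z v) := by
    funext z
    exact congr_fun (adInv_mul (E := E) z x) v
  rw [e, modelDeriv_clm_comp (adInv E x) ((contMDiffAt_adInv_apply (1 : G) v).mdiff), one_mul] at h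
  rw [lDeriv, lDeriv, lTrans_one]
  refine Eq.trans ?_ (congr_fun h u).symm
  simp only [ContinuousLinearMap.comp_apply, lTrans_adInv]
  rfl

/-! ### Calculus of spinor fields in the left trivialization -/

/-- A bilinear map on finite-dimensional spaces, as a continuous bilinear map. -/
def bilinCLM [FiniteDimensional ℝ F] [FiniteDimensional ℝ F'] (f : F →ₗ[ℝ] F' →ₗ[ℝ] F'') :
    F →L[ℝ] F' →L[ℝ] F'' :=
  toContinuousLinearMap
    ((toContinuousLinearMap : (F' →ₗ[ℝ] F'') ≃ₗ[ℝ] (F' →L[ℝ] F'')).toLinearMap ∘ₗ f)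

variable (G) in
/-- The Lie bracket on the model space, as a continuous bilinear map. -/
def modelBracketL : E →L[ℝ] E →L[ℝ] E :=
  bilinCLM (mk₂ ℝ (modelBracket G) (by intro a b c; simp [modelBracket])
    (by intro r a b; simp [modelBracket]) (by intro a b c; simp [modelBracket])
    (by intro r a b; simp [modelBracket]))

theorem modelBracket_skew (a b : E) : modelBracket G b a = -modelBracket G a b := by
  simp only [modelBracket]
  rw [← lie_skew, map_neg]

/-- A spinor field is smooth if all its homogeneous components are. -/
def SpinorSmoothAt (Φ : G → Spinor E) (x : G) : Prop :=
  ∀ k, C∞[E, E [⋀^Fin k]→L[ℝ] ℂ] (fun z => Φ z k) x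

/-- The derivative of a spinor field along a left-invariant vector field. -/
def sDeriv (Φ : G → Spinor E) (x : G) (c : E) : Spinor E := fun k => lDeriv E (fun z => Φ z k) x c

/-- A spinor field in the left trivialization. -/
def leftSpinor (φ : G → Spinor E) (z : G) : Spinor E := pull (lTrans E z) (φ z)

theorem spinorSmoothAt_leftSpinor {φ : G → Spinor E} {x : G} :
    SpinorSmoothAt (leftSpinor φ) x ↔ ∀ k, FormSmoothAt (fun z => φ z k) x :=
  forall_congr' fun _ => formSmoothAt_iff.symm

theorem SpinorSmoothAt.mdiff {Φ : G → Spinor E} {x : G} (h : SpinorSmoothAt Φ x) (k : ℕ) :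
    MD[E, E [⋀^Fin k]→L[ℝ] ℂ] (fun z => Φ z k) x :=
  (h k).mdiff

theorem SpinorSmoothAt.congr {Φ Φ' : G → Spinor E} {x : G} (h : SpinorSmoothAt Φ x)
    (e : Φ' =ᶠ[𝓝 x] Φ) : SpinorSmoothAt Φ' x := fun k =>
  (h k).congr_of_eventuallyEq (e.mono fun _ hz => congrFun hz k)

theorem sDeriv_congr {Φ Φ' : G → Spinor E} {x : G} (e : Φ =ᶠ[𝓝 x] Φ') (c : E) :
    sDeriv Φ x c = sDeriv Φ' x c := by
  funext k
  have : (fun z => Φ z k) =ᶠ[𝓝 x] fun z => Φ' z k := e.mono fun _ hz => congrFun hz k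
  exact congr_fun (lDeriv_congr this) c

theorem sDeriv_const (β : Spinor E) (x : G) (c : E) : sDeriv (fun _ : G => β) x c = 0 := by
  funext k
  exact congr_fun (lDeriv_const (β k) x) c

theorem spinorSmoothAt_const (β : Spinor E) (x : G) : SpinorSmoothAt (fun _ : G => β) x :=
  fun _ => contMDiffAt_const

theorem SpinorSmoothAt.add {Φ Φ' : G → Spinor E} {x : G} (h : SpinorSmoothAt Φ x)
    (h' : SpinorSmoothAt Φ' x) : SpinorSmoothAt (fun z => Φ z + Φ' z) x := fun k =>
  (h k).add (h' k)

theorem sDeriv_add {Φ Φ' : G → Spinor E} {x : G} (h : SpinorSmoothAt Φ x)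
    (h' : SpinorSmoothAt Φ' x) (c : E) :
    sDeriv (fun z => Φ z + Φ' z) x c = sDeriv Φ x c + sDeriv Φ' x c := by
  funext k
  exact lDeriv_add (h.mdiff k) (h'.mdiff k) c

variable (E) in
/-- Scalar multiplication of forms by complex numbers, as a continuous bilinear map. -/
def formSmul (k : ℕ) : ℂ →L[ℝ] (E [⋀^Fin k]→L[ℝ] ℂ) →L[ℝ] E [⋀^Fin k]→L[ℝ] ℂ :=
  bilinCLM (mk₂ ℝ (fun (c : ℂ) (w : E [⋀^Fin k]→L[ℝ] ℂ) => c • w)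
    (fun a b w => add_smul a b w) (fun r a w => smul_assoc r a w) (fun a w w' => smul_add a w w')
    (fun r a w => smul_comm a r w))

theorem SpinorSmoothAt.smul {Φ : G → Spinor E} {f : G → ℂ} {x : G} (h : SpinorSmoothAt Φ x)
    (hf : C∞[E, ℂ] f x) : SpinorSmoothAt (fun z => f z • Φ z) x := fun k =>
  hf.bilin (formSmul E k) (h k)

theorem sDeriv_smul {Φ : G → Spinor E} {f : G → ℂ} {x : G} (h : SpinorSmoothAt Φ x)
    (hf : C∞[E, ℂ] f x) (c : E) :
    sDeriv (fun z => f z • Φ z) x c = lDeriv E f x c • Φ x + f x • sDeriv Φ x c := by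
  funext k
  exact lDeriv_bilin (formSmul E k) (hf.mdiff) (h.mdiff k) c

theorem SpinorSmoothAt.sDeriv {Φ : G → Spinor E} {x : G} (h : SpinorSmoothAt Φ x) (c : E) :
    SpinorSmoothAt (fun z => sDeriv Φ z c) x := fun k =>
  ((h k).lDeriv).clm_comp_space (ContinuousLinearMap.apply ℝ _ c)

theorem sDeriv_sDeriv_sub {Φ : G → Spinor E} {x : G} (h : SpinorSmoothAt Φ x) (c d : E) :
    sDeriv (fun z => sDeriv Φ z d) x c - sDeriv (fun z => sDeriv Φ z c) x d =
      sDeriv Φ x (modelBracket G c d) := by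
  funext k
  exact lDeriv_lDeriv_sub (h k) c d

theorem sDeriv_add_dir (Φ : G → Spinor E) (x : G) (c d : E) :
    sDeriv Φ x (c + d) = sDeriv Φ x c + sDeriv Φ x d := by
  funext k; exact map_add _ c d

theorem sDeriv_smul_dir (Φ : G → Spinor E) (x : G) (r : ℝ) (c : E) :
    sDeriv Φ x (r • c) = r • sDeriv Φ x c := by
  funext k; exact map_smul _ r c

variable (E) in
/-- Conjugation of forms, as a continuous linear map. -/
def formConj (k : ℕ) : (E [⋀^Fin k]→L[ℝ] ℂ) →L[ℝ] E [⋀^Fin k]→L[ℝ] ℂ :=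
  toContinuousLinearMap
    { toFun := fun w => (Complex.conjCLE : ℂ →L[ℝ] ℂ).compContinuousAlternatingMap w
      map_add' := fun a b => by ext v; simp
      map_smul' := fun r a => by ext v; simp }

theorem SpinorSmoothAt.conj {Φ : G → Spinor E} {x : G} (h : SpinorSmoothAt Φ x) :
    SpinorSmoothAt (fun z => (Φ z).conj) x := fun k =>
  (h k).clm_comp_space (formConj E k)

theorem sDeriv_conj {Φ : G → Spinor E} {x : G} (h : SpinorSmoothAt Φ x) (c : E) :
    sDeriv (fun z => (Φ z).conj) x c = (sDeriv Φ x c).conj := by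
  funext k
  exact lDeriv_clm_comp (formConj E k) (h.mdiff k) c

variable (E) in
/-- Exterior multiplication of forms by a covector, as a continuous bilinear map. -/
def formWedgeOne (k : ℕ) : (E →L[ℝ] ℝ) →L[ℝ] (E [⋀^Fin k]→L[ℝ] ℂ) →L[ℝ] E [⋀^Fin (k + 1)]→L[ℝ] ℂ :=
  bilinCLM (mk₂ ℝ (fun θ w => wedgeOne θ w)
    (by
      intro a b w; ext v
      simp [wedgeOne, alternatizeUncurryFin_apply, sum_add_distrib, add_smul, smul_add])
    (by
      intro r a w; ext v
      simp only [wedgeOne, alternatizeUncurryFin_apply, smul_sum,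
        ContinuousLinearMap.smulRight_apply, ContinuousAlternatingMap.smul_apply, smul_apply]
      refine sum_congr rfl fun i _ => ?_
      rw [smul_assoc, smul_comm])
    (by
      intro a w w'; ext v
      simp [wedgeOne, alternatizeUncurryFin_apply, sum_add_distrib, smul_add])
    (by
      intro r a w; ext v
      simp only [wedgeOne, alternatizeUncurryFin_apply, smul_sum,
        ContinuousLinearMap.smulRight_apply, ContinuousAlternatingMap.smul_apply]
      refine sum_congr rfl fun i _ => ?_
      rw [smul_comm _ r, smul_comm _ r]))

variable (E) in
/-- Contraction of forms, as a continuous bilinear map. -/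
def formContr (k : ℕ) : (E [⋀^Fin (k + 1)]→L[ℝ] ℂ) →L[ℝ] E →L[ℝ] E [⋀^Fin k]→L[ℝ] ℂ :=
  bilinCLM (mk₂ ℝ (fun w a => w.curryLeft a) (fun _ _ _ => rfl) (fun _ _ _ => rfl)
    (fun w => map_add w.curryLeft) (fun r w a => map_smul w.curryLeft r a))

theorem SpinorSmoothAt.contr {Φ : G → Spinor E} {a : G → E} {x : G} (h : SpinorSmoothAt Φ x)
    (ha : C∞[E, E] a x) : SpinorSmoothAt (fun z => contr (a z) (Φ z)) x := fun k => by
  simp only [contr_apply]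
  exact (h (k + 1)).bilin (formContr E k) ha

theorem SpinorSmoothAt.extMul {Φ : G → Spinor E} {θ : G → E →L[ℝ] ℝ} {x : G}
    (h : SpinorSmoothAt Φ x) (hθ : C∞[E, E →L[ℝ] ℝ] θ x) :
    SpinorSmoothAt (fun z => extMul (θ z) (Φ z)) x := fun k => by
  cases k with
  | zero => simp only [extMul_zero_apply]; exact contMDiffAt_const
  | succ k =>
    simp only [extMul_succ_apply]
    exact hθ.bilin (formWedgeOne E k) (h k)

theorem sDeriv_contr {Φ : G → Spinor E} {a : G → E} {x : G} (h : SpinorSmoothAt Φ x)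
    (ha : C∞[E, E] a x) (c : E) : sDeriv (fun z => contr (a z) (Φ z)) x c =
      contr (lDeriv E a x c) (Φ x) + contr (a x) (sDeriv Φ x c) := by
  funext k
  simp only [sDeriv, contr_apply, Pi.add_apply]
  rw [add_comm ((Φ x (k + 1)).curryLeft _)]
  exact lDeriv_bilin (formContr E k) (h.mdiff (k + 1)) (ha.mdiff) c

theorem sDeriv_extMul {Φ : G → Spinor E} {θ : G → E →L[ℝ] ℝ} {x : G} (h : SpinorSmoothAt Φ x)
    (hθ : C∞[E, E →L[ℝ] ℝ] θ x) (c : E) : sDeriv (fun z => extMul (θ z) (Φ z)) x c =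
      extMul (lDeriv E θ x c) (Φ x) + extMul (θ x) (sDeriv Φ x c) := by
  funext k
  cases k with
  | zero =>
    simp only [sDeriv, extMul_zero_apply, Pi.add_apply, add_zero]
    exact congr_fun (lDeriv_const _ x) c
  | succ k =>
    simp only [sDeriv, extMul_succ_apply, Pi.add_apply]
    exact lDeriv_bilin (formWedgeOne E k) (hθ.mdiff) (h.mdiff k) c

theorem SpinorSmoothAt.cliffordReal {Φ : G → Spinor E} {e : G → GenTangent E} {x : G}
    (h : SpinorSmoothAt Φ x) (he : C∞[E, GenTangent E] e x) :
    SpinorSmoothAt (fun z => cliffordReal (e z) (Φ z)) x := by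
  have h1 := h.contr (he.clm_comp_space (fst ℝ E (E →L[ℝ] ℝ)))
  have h2 := h.extMul (he.clm_comp_space (snd ℝ E (E →L[ℝ] ℝ)))
  refine (h1.add h2).congr (Eventually.of_forall fun z => ?_)
  simp only [cliffordReal_eq]
  rfl

theorem sDeriv_cliffordReal {Φ : G → Spinor E} {e : G → GenTangent E} {x : G}
    (h : SpinorSmoothAt Φ x) (he : C∞[E, GenTangent E] e x) (c : E) :
    sDeriv (fun z => cliffordReal (e z) (Φ z)) x c =
      cliffordReal (lDeriv E e x c) (Φ x) + cliffordReal (e x) (sDeriv Φ x c) := by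
  have e1 := he.clm_comp_space (fst ℝ E (E →L[ℝ] ℝ))
  have e2 := he.clm_comp_space (snd ℝ E (E →L[ℝ] ℝ))
  have hd := he.mdiff
  have h0 : (fun z => cliffordReal (e z) (Φ z)) = fun z =>
      contr (fst ℝ E (E →L[ℝ] ℝ) (e z)) (Φ z) +
        extMul (snd ℝ E (E →L[ℝ] ℝ) (e z)) (Φ z) := by
    funext z; rw [cliffordReal_eq]; rfl
  rw [h0, sDeriv_add (h.contr e1) (h.extMul e2), sDeriv_contr h e1, sDeriv_extMul h e2,
    lDeriv_clm_comp _ hd, lDeriv_clm_comp _ hd, cliffordReal_eq, cliffordReal_eq]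
  simp only [LinearMap.add_apply, ContinuousLinearMap.coe_fst', ContinuousLinearMap.coe_snd']
  abel

/-- The coordinates of a basis, as continuous linear forms. -/
def coordCLM {ι : Type*} (b : Basis ι ℝ E) (i : ι) : E →L[ℝ] ℝ := toContinuousLinearMap (b.coord i)

notation:max "ε(" b "," i ")" => extMul (coordCLM b i)

theorem alternatizeUncurryFin_eq_sum {ι : Type*} [Fintype ι] (b : Basis ι ℝ E) {k : ℕ}
    (T : E →L[ℝ] E [⋀^Fin k]→L[ℝ] ℂ) : alternatizeUncurryFin T =
      ∑ i, wedgeOne (coordCLM b i) (T (b i)) := by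
  have h : T = ∑ i, (coordCLM b i).smulRight (T (b i)) := by
    ext v : 1
    refine (congrArg T (b.sum_repr v)).symm.trans ?_
    rw [map_sum]
    simp [coordCLM]
  conv_lhs => rw [h]
  exact map_sum (alternatizeUncurryFinCLM ℝ E ℂ) _ _

theorem alternatizeUncurryFin_comp_eq_sum {ι : Type*} [Fintype ι] (b : Basis ι ℝ E) {k : ℕ}
    (T : E →L[ℝ] E →L[ℝ] E [⋀^Fin k]→L[ℝ] ℂ) : alternatizeUncurryFin
        (alternatizeUncurryFinCLM ℝ E ℂ ∘L T) =
      ∑ i, ∑ j, wedgeOne (coordCLM b i) (wedgeOne (coordCLM b j) (T (b i) (b j))) := by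
  rw [alternatizeUncurryFin_eq_sum b]
  refine sum_congr rfl fun i _ => ?_
  have : (alternatizeUncurryFinCLM ℝ E ℂ ∘L T) (b i) = alternatizeUncurryFin (T (b i)) := rfl
  rw [this, alternatizeUncurryFin_eq_sum b]
  exact map_sum (formWedgeOne E (k + 1) (coordCLM b i)) _ _

/-- The exterior derivative in the left trivialization. -/
theorem pull_spinorDeriv {ι : Type*} [Fintype ι] (b : Basis ι ℝ E) {φ : G → Spinor E}
    {x : G} (h : ∀ k, FormSmoothAt (fun z => φ z k) x) : pull (lTrans E x) (spinorDeriv φ x) =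
      ∑ i, ε(b, i) (sDeriv (leftSpinor φ) x (b i)) - (1 / 2 : ℂ) • ∑ i, ∑ j, ε(b, i) (ε(b, j)
          (contr (modelBracket G (b i) (b j)) (leftSpinor φ x))) := by
  funext k
  simp only [Pi.sub_apply, Pi.smul_apply, Finset.sum_apply]
  match k with
  | 0 =>
    simp only [extMul_zero_apply, sum_const_zero, smul_zero, sub_zero]
    ext v; rfl
  | 1 =>
    simp only [extMul_succ_apply, extMul_zero_apply]
    have hz : ∀ θ : E →L[ℝ] ℝ, wedgeOne θ (0 : E [⋀^Fin 0]→L[ℝ] ℂ) = 0 := fun θ =>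
      map_zero (formWedgeOne E 0 θ)
    simp only [hz, sum_const_zero, smul_zero, sub_zero]
    have := alternatizeUncurryFin_eq_sum b (lDeriv E (leftForm fun z => φ z 0) x)
    refine Eq.trans ?_ this
    ext v
    refine (formDeriv_zero_apply_lTrans (h 0) v).trans ?_
    rw [alternatizeUncurryFin_apply, Fin.sum_univ_one]
    simp only [Fin.val_zero, pow_zero, one_smul]
    exact congrArg _ (Subsingleton.elim _ _)
  | k + 2 =>
    simp only [extMul_succ_apply, contr_apply]
    let T : E →L[ℝ] E →L[ℝ] E [⋀^Fin k]→L[ℝ] ℂ :=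
      ((compL ℝ E E (E [⋀^Fin k]→L[ℝ] ℂ))
        (leftForm (fun z => φ z (k + 1)) x).curryLeft).comp (modelBracketL G)
    have h1 := alternatizeUncurryFin_eq_sum b (lDeriv E (leftForm fun z => φ z (k + 1)) x)
    have h2 := alternatizeUncurryFin_comp_eq_sum b T
    have e1 : ∑ i, wedgeOne (coordCLM b i) (sDeriv (leftSpinor φ) x (b i) (k + 1)) =
      alternatizeUncurryFin
        (lDeriv E (leftForm fun z => φ z (k + 1)) x) := h1.symm
    have e2 : ∑ i, ∑ j, wedgeOne (coordCLM b i) (wedgeOne (coordCLM b j)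
        ((leftSpinor φ x (k + 1)).curryLeft (modelBracket G (b i) (b j)))) =
        alternatizeUncurryFin
          (alternatizeUncurryFinCLM ℝ E ℂ ∘L T) := h2.symm
    rw [e1, e2]
    ext v
    refine (formDeriv_succ_apply_lTrans (h (k + 1)) v).trans ?_
    rw [ContinuousAlternatingMap.sub_apply, ContinuousAlternatingMap.smul_apply,
      ContinuousAlternatingMap.alternatizeUncurryFin_alternatizeUncurryFinCLM_comp_apply,
      alternatizeUncurryFin_apply, smul_sum]
    congr 1
    · refine sum_congr rfl fun i _ => ?_
      rw [smul_sum]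
      refine sum_congr rfl fun j _ => ?_
      have hT : ∀ a c, T a c = (leftForm (fun z => φ z (k + 1)) x).curryLeft
        (modelBracket G a c) := fun _ _ => rfl
      rw [hT, hT, modelBracket_skew (v i.castSucc) (v j.succ), map_neg,
        ContinuousAlternatingMap.neg_apply, curryLeft_apply_apply,
        sub_neg_eq_add, ← two_smul ℂ, smul_comm (1 / 2 : ℂ), smul_smul]
      norm_num

/-! ### Pairs of anticommuting Clifford maps on a quadratic Lie algebra -/

section CliffordPair

variable {S : Type*} [AddCommGroup S] [Module ℂ S] {V : Type*} [LieRing V] [LieAlgebra ℂ V]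
  {ι κ : Type*} [Fintype ι] [Fintype κ] {Q : BilinForm ℂ V} {b d : ι → V}
  {v p q s u r : V →ₗ[ℂ] End ℂ S}

theorem IsDualFrame.neg (h : IsDualFrame Q b d) : IsDualFrame (-Q) b (fun i => -d i) where
  left x := by
    conv_lhs => rw [h.left x]
    simp
  right x := by
    conv_lhs => rw [h.right x]
    simp

theorem IsDualFrame.symm (h : IsDualFrame Q b d) : IsDualFrame Q d b := ⟨h.right, h.left⟩

/-- Moving a derivation of a quadratic Lie algebra across the canonical bivector. -/
theorem IsDualFrame.sum_lie_left (h : IsDualFrame Q b d) (hs : ∀ x y, Q x y = Q y x)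
    (hi : ∀ x y z, Q ⁅x, y⁆ z = Q x ⁅y, z⁆) {A : Type*} [AddCommGroup A] [Module ℂ A]
    (F : V →ₗ[ℂ] V →ₗ[ℂ] A) (y : V) : ∑ i, F ⁅y, d i⁆ (b i) = -∑ i, F (d i) ⁅y, b i⁆ := by
  have h1 : ∀ i, F ⁅y, d i⁆ (b i) = ∑ j, Q ⁅y, d i⁆ (b j) • F (d j) (b i) := by
    intro i
    conv_lhs => rw [h.right ⁅y, d i⁆]
    simp
  have h2 : ∀ j, F (d j) ⁅y, b j⁆ = ∑ i, Q ⁅y, b j⁆ (d i) • F (d j) (b i) := by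
    intro j
    conv_lhs => rw [h.left ⁅y, b j⁆]
    simp
  rw [sum_congr rfl fun i _ => h1 i, sum_congr rfl fun i _ => h2 i, sum_comm, ← sum_neg_distrib]
  refine sum_congr rfl fun j _ => ?_
  rw [← sum_neg_distrib]
  refine sum_congr rfl fun i _ => ?_
  rw [← neg_smul]
  congr 1
  rw [hs ⁅y, b j⁆, ← hi, ← lie_skew, map_neg, LinearMap.neg_apply]

theorem IsDualFrame.sum_lie_swap (h : IsDualFrame Q b d) (hs : ∀ x y, Q x y = Q y x)
    (hi : ∀ x y z, Q ⁅x, y⁆ z = Q x ⁅y, z⁆) {A : Type*} [AddCommGroup A] [Module ℂ A]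
    (F : V →ₗ[ℂ] V →ₗ[ℂ] A) (y : V) : ∑ i, F (d i) ⁅y, b i⁆ = -∑ i, F ⁅y, b i⁆ (d i) := by
  have h1 := h.sum_lie_left hs hi F y
  let F' : V →ₗ[ℂ] V →ₗ[ℂ] A := F.comp (LieAlgebra.ad ℂ V y : V →ₗ[ℂ] V)
  have h2 : ∑ i, F ⁅y, d i⁆ (b i) = ∑ i, F ⁅y, b i⁆ (d i) := h.sum_bilin h.symm F' hs
  rw [← h2, h1, neg_neg]

/-- Two anticommuting Clifford maps, for the forms `Q` and `-Q`. -/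
structure IsCliffordPair (Q : BilinForm ℂ V) (u r : V →ₗ[ℂ] End ℂ S) : Prop where
  left : IsCliffordMap Q u
  right : IsCliffordMap (-Q) r
  anticomm : ∀ x y φ, u x (r y φ) + r y (u x φ) = 0

/-- The cubic element `∑ p(dᵢ) q(dⱼ) s([bᵢ, bⱼ])`. -/
def triElt (p q s : V →ₗ[ℂ] End ℂ S) (b d : ι → V) (φ : S) : S :=
  ∑ i, ∑ j, p (d i) (q (d j) (s ⁅b i, b j⁆ φ))

theorem triElt_swap_left (hpq : ∀ x y φ, p x (q y φ) + q y (p x φ) = 0) (φ : S) :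
    triElt p q s b d φ = triElt q p s b d φ := by
  rw [triElt, triElt, sum_comm]
  refine sum_congr rfl fun j _ => sum_congr rfl fun i _ => ?_
  rw [← lie_skew, map_neg, LinearMap.neg_apply, map_neg, map_neg,
    eq_neg_of_add_eq_zero_left (hpq (d i) (d j) _), neg_neg]

theorem triElt_swap_right (h : IsDualFrame Q b d) (hs : ∀ x y, Q x y = Q y x)
    (hi : ∀ x y z, Q ⁅x, y⁆ z = Q x ⁅y, z⁆) (hqs : ∀ x y φ, q x (s y φ) + s y (q x φ) = 0) (φ : S) :
    triElt p q s b d φ = triElt p s q b d φ := by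
  rw [triElt, triElt]
  refine sum_congr rfl fun i _ => ?_
  rw [← map_sum, ← map_sum]
  congr 1
  let F : V →ₗ[ℂ] V →ₗ[ℂ] S := mk₂ ℂ (fun x y => s x (q y φ))
    (by intros; simp) (by intros; simp) (by intros; simp) (by intros; simp)
  have := h.sum_lie_swap hs hi F (b i)
  simp only [F, LinearMap.mk₂_apply] at this
  rw [this, ← sum_neg_distrib]
  exact sum_congr rfl fun j _ => eq_neg_of_add_eq_zero_left (hqs _ _ _)

theorem triElt_self (φ : S) : triElt v v v b d φ = cubicElt v b d φ := by
  simp only [triElt, cubicElt_apply, quadElt_apply, map_sum]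

theorem triElt_neg_right (φ : S) :
    triElt p r r b d φ = -∑ i, p (d i) (quadElt r b (fun i => -d i) (b i) φ) := by
  simp only [triElt, quadElt_apply, map_sum, map_neg, LinearMap.neg_apply, sum_neg_distrib, neg_neg]

theorem triElt_neg_self (φ : S) : triElt r r r b d φ = cubicElt r b (fun i => -d i) φ := by
  rw [triElt_neg_right, cubicElt_apply]
  simp [sum_neg_distrib]

namespace IsCliffordPair

/-- The cubic terms of the twisted exterior derivative in terms of the spin connection and of the
cubic elements. -/
theorem cubic_identity (h : IsCliffordPair Q u r) (hb : IsDualFrame Q b d) (φ : S) :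
    -(1 / 2 : ℂ) • (∑ i, ∑ j, (u + r) (d i) ((u + r) (d j) ((1 / 2 : ℂ) • (u - r) ⁅b i, b j⁆ φ))) +
      (1 / 12 : ℂ) • (∑ i, ∑ j, (u + r) (d i) ((u + r) (d j) ((u + r) ⁅b i, b j⁆ φ))) =
    ∑ i, (u + r) (d i) (-(1 / 2 : ℂ) • quadElt r b (fun i => -d i) (b i) φ) -
      (1 / 6 : ℂ) • (cubicElt u b d φ + cubicElt r b (fun i => -d i) φ) := by
  have e1 : ∑ i, ∑ j, (u + r) (d i) ((u + r) (d j) ((1 / 2 : ℂ) • (u - r) ⁅b i, b j⁆ φ)) =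
      (1 / 2 : ℂ) • (triElt u u u b d φ - triElt u u r b d φ + (triElt u r u b d φ -
        triElt u r r b d φ) + (triElt r u u b d φ - triElt r u r b d φ) +
        (triElt r r u b d φ - triElt r r r b d φ)) := by
    simp only [triElt, LinearMap.add_apply, LinearMap.sub_apply, map_add, map_sub, map_smul,
      smul_add, smul_sub, sum_add_distrib, sum_sub_distrib, ← smul_sum]
    module
  have e2 : ∑ i, ∑ j, (u + r) (d i) ((u + r) (d j) ((u + r) ⁅b i, b j⁆ φ)) =
      triElt u u u b d φ + triElt u u r b d φ + (triElt u r u b d φ +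
        triElt u r r b d φ) + (triElt r u u b d φ + triElt r u r b d φ) +
        (triElt r r u b d φ + triElt r r r b d φ) := by
    simp only [triElt, LinearMap.add_apply, map_add, sum_add_distrib]
    abel
  have e3 : ∑ i, (u + r) (d i) (-(1 / 2 : ℂ) • quadElt r b (fun i => -d i) (b i) φ) =
      (1 / 2 : ℂ) • (triElt u r r b d φ + triElt r r r b d φ) := by
    simp only [triElt_neg_right, LinearMap.add_apply, map_smul, sum_add_distrib, ← smul_sum]
    module
  have hur : ∀ x y φ, u x (r y φ) + r y (u x φ) = 0 := h.anticomm
  have hru : ∀ x y φ, r x (u y φ) + u y (r x φ) = 0 := fun x y φ => by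
    rw [add_comm]; exact h.anticomm y x φ
  have hs := h.left.symm
  have hi := h.left.invariant
  have a1 : triElt u r u b d φ = triElt u u r b d φ := triElt_swap_right hb hs hi hru φ
  have a2 : triElt r u u b d φ = triElt u r u b d φ := triElt_swap_left hru φ
  have a3 : triElt r u r b d φ = triElt u r r b d φ := triElt_swap_left hru φ
  have a4 : triElt r r u b d φ = triElt r u r b d φ := triElt_swap_right hb hs hi hru φ
  rw [e1, e2, e3, a2, a1, a4, a3, ← triElt_self, ← triElt_neg_self]
  module

theorem quadElt_right_comm_left (h : IsCliffordPair Q u r) (d' : ι → V) (y z : V) (φ : S) :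
    quadElt r b d' y (u z φ) = u z (quadElt r b d' y φ) := by
  rw [quadElt_apply, quadElt_apply, map_sum]
  refine sum_congr rfl fun i _ => ?_
  have h1 := eq_neg_of_add_eq_zero_right (h.anticomm z ⁅y, b i⁆ φ)
  have h2 := eq_neg_of_add_eq_zero_right (h.anticomm z (d' i) (r ⁅y, b i⁆ φ))
  rw [h1, map_neg, h2, neg_neg]

theorem cubicElt_right_anticomm_left (h : IsCliffordPair Q u r) (d' : ι → V) (z : V) (φ : S) :
    cubicElt r b d' (u z φ) + u z (cubicElt r b d' φ) = 0 := by
  rw [cubicElt_apply, cubicElt_apply, map_sum, ← sum_add_distrib]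
  refine sum_eq_zero fun i _ => ?_
  rw [h.quadElt_right_comm_left, add_comm, h.anticomm]

theorem quadElt_left_comm_right (h : IsCliffordPair Q u r) (d' : ι → V) (y z : V) (φ : S) :
    quadElt u b d' y (r z φ) = r z (quadElt u b d' y φ) := by
  rw [quadElt_apply, quadElt_apply, map_sum]
  refine sum_congr rfl fun i _ => ?_
  have h1 := eq_neg_of_add_eq_zero_left (h.anticomm ⁅y, b i⁆ z φ)
  have h2 := eq_neg_of_add_eq_zero_left (h.anticomm (d' i) z (u ⁅y, b i⁆ φ))
  rw [h1, map_neg, h2, neg_neg]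

theorem cubicElt_left_anticomm_right (h : IsCliffordPair Q u r) (d' : ι → V) (z : V) (φ : S) :
    cubicElt u b d' (r z φ) + r z (cubicElt u b d' φ) = 0 := by
  rw [cubicElt_apply, cubicElt_apply, map_sum, ← sum_add_distrib]
  refine sum_eq_zero fun i _ => ?_
  rw [h.quadElt_left_comm_right, h.anticomm]

end IsCliffordPair

namespace IsCliffordMap

theorem quadElt_quadElt (hv : IsCliffordMap Q v) (hb : IsDualFrame Q b d) (x y : V) (φ : S) :
    quadElt v b d x (quadElt v b d y φ) - quadElt v b d y (quadElt v b d x φ) =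
      -(2 : ℂ) • quadElt v b d ⁅x, y⁆ φ := by
  have h1 : ∀ i, quadElt v b d x (v (d i) (v ⁅y, b i⁆ φ)) -
      v (d i) (v ⁅y, b i⁆ (quadElt v b d x φ)) =
      -(2 : ℂ) • (v ⁅x, d i⁆ (v ⁅y, b i⁆ φ) + v (d i) (v ⁅x, ⁅y, b i⁆⁆ φ)) := by
    intro i
    have e1 := hv.quadElt_comm hb x (d i) (v ⁅y, b i⁆ φ)
    have e2 := congrArg (v (d i)) (hv.quadElt_comm hb x ⁅y, b i⁆ φ)
    rw [map_sub, map_smul] at e2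
    rw [smul_add, ← e1, ← e2]
    abel
  rw [quadElt_apply (y := y) (φ := φ), map_sum, quadElt_apply (y := y), ← sum_sub_distrib,
    sum_congr rfl fun i _ => h1 i, ← smul_sum, sum_add_distrib]
  let F : V →ₗ[ℂ] V →ₗ[ℂ] S := mk₂ ℂ (fun a c => v a (v ⁅y, c⁆ φ))
    (by intros; simp) (by intros; simp) (by intros; simp) (by intros; simp)
  have h2 : ∑ i, v ⁅x, d i⁆ (v ⁅y, b i⁆ φ) = -∑ i, v (d i) (v ⁅y, ⁅x, b i⁆⁆ φ) :=
    hb.sum_lie_left hv.symm hv.invariant F x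
  rw [h2, quadElt_apply, neg_add_eq_sub, ← sum_sub_distrib]
  congr 1
  refine sum_congr rfl fun i _ => ?_
  rw [← map_sub, ← LinearMap.sub_apply, ← map_sub]
  congr 3
  rw [lie_lie]

/-- Quadratic elements are skew for a pairing for which the vectors are skew. -/
theorem quadElt_skew (hv : IsCliffordMap Q v) (hb : IsDualFrame Q b d) {A : Type*}
    [AddCommGroup A] [Module ℂ A] (P : S →ₗ[ℂ] S →ₗ[ℂ] A)
    (hP : ∀ x α β, P (v x α) β = -P α (v x β)) (y : V) (α β : S) :
    P (quadElt v b d y α) β = -P α (quadElt v b d y β) := by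
  rw [quadElt_apply, quadElt_apply, map_sum, map_sum, LinearMap.sum_apply]
  let F : V →ₗ[ℂ] V →ₗ[ℂ] A := mk₂ ℂ (fun a c => P α (v a (v c β)))
    (by intros; simp) (by intros; simp) (by intros; simp) (by intros; simp)
  have h2 : ∑ i, P α (v (d i) (v ⁅y, b i⁆ β)) = -∑ i, P α (v ⁅y, b i⁆ (v (d i) β)) :=
    hb.sum_lie_swap hv.symm hv.invariant F y
  rw [h2, neg_neg]
  refine sum_congr rfl fun i _ => ?_
  rw [hP, hP, neg_neg]

end IsCliffordMap

end CliffordPair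

/-! ### Three-forms acting on spinors -/

theorem sum_perm_three {A : Type*} [AddCommGroup A] (f : Fin 3 → Fin 3 → Fin 3 → A) :
    ∑ σ : Perm (Fin 3), Perm.sign σ • f (σ 0) (σ 1) (σ 2) =
      f 0 1 2 - f 0 2 1 - f 1 0 2 + f 1 2 0 + f 2 0 1 - f 2 1 0 := by
  have h : (Finset.univ : Finset (Perm (Fin 3))) = {1, swap 1 2, swap 0 1,
      swap 0 1 * swap 1 2, swap 1 2 * swap 0 1, swap 0 2} := by
    decide
  rw [h, sum_insert (by decide), sum_insert (by decide),
    sum_insert (by decide), sum_insert (by decide), sum_insert (by decide), Finset.sum_singleton]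
  have e1 : swap (1 : Fin 3) 2 0 = 0 := by decide
  have e2 : swap (0 : Fin 3) 1 2 = 2 := by decide
  have e3 : swap (0 : Fin 3) 2 1 = 1 := by decide
  have s1 : Perm.sign (swap (1 : Fin 3) 2) = -1 := by decide
  have s2 : Perm.sign (swap (0 : Fin 3) 1) = -1 := by decide
  have s3 : Perm.sign (swap (0 : Fin 3) 2) = -1 := by decide
  simp only [Perm.sign_mul, s1, s2, s3, Perm.mul_apply, e1, e2, e3,
    Equiv.swap_apply_left, Equiv.swap_apply_right, Perm.sign_one, Perm.one_apply,
    one_smul, Units.neg_smul, neg_mul_neg, one_mul]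
  abel

variable (E) in
/-- The constant function `1` as a spinor. -/
def unitSpinor : Spinor E :=
  Pi.single 0 (ContinuousAlternatingMap.constOfIsEmpty ℝ E (Fin 0) (1 : ℂ))

theorem wedge_zero_left {k l m : ℕ} (h : k + l = m) (β : E [⋀^Fin l]→L[ℝ] ℂ) :
    wedge h (0 : E [⋀^Fin k]→L[ℝ] ℂ) β = 0 := by
  have := wedge_smul_left h 0 (0 : E [⋀^Fin k]→L[ℝ] ℂ) β
  rwa [show (0 : ℂ) • (0 : E [⋀^Fin k]→L[ℝ] ℂ) = 0 by
      ext v; exact zero_mul _,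
    show (0 : ℂ) • wedge h (0 : E [⋀^Fin k]→L[ℝ] ℂ) β = 0 by ext v; exact zero_mul _] at this

theorem mixedWedge_single {k : ℕ} (w : E [⋀^Fin k]→L[ℝ] ℂ) (β : Spinor E) (l m : ℕ)
    (h : k + l = m) : mixedWedge (Pi.single k w) β m = wedge h w (β l) := by
  rw [mixedWedge_apply_total, sum_eq_single (k, l)]
  · simp [wedgeTotal, h]
  · rintro ⟨i, j⟩ hij hne
    have hi : i ≠ k := by
      rintro rfl
      have := mem_antidiagonal.1 hij
      simp only at this
      exact hne (by ext <;> simp; omega)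
    simp [wedgeTotal, Pi.single_eq_of_ne hi, wedge_zero_left]
  · intro hkl
    exact absurd (mem_antidiagonal.2 h) hkl

theorem mixedWedge_single_of_lt {k : ℕ} (w : E [⋀^Fin k]→L[ℝ] ℂ) (β : Spinor E) (m : ℕ)
    (h : m < k) : mixedWedge (Pi.single k w) β m = 0 := by
  rw [mixedWedge_apply_total]
  refine sum_eq_zero ?_
  rintro ⟨i, j⟩ hij
  have := mem_antidiagonal.1 hij
  have hi : i ≠ k := by simp only at this; omega
  simp [wedgeTotal, Pi.single_eq_of_ne hi, wedge_zero_left]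

theorem mixedWedge_unitSpinor (β : Spinor E) : mixedWedge (unitSpinor E) β = β := by
  funext m
  rw [unitSpinor, mixedWedge_single _ β m m (zero_add m),
    wedge_zero_left_apply (zero_add m) _ (β m) (β m) HEq.rfl]
  simp

theorem wedgeThree_eq (H : E [⋀^Fin 3]→L[ℝ] ℝ) (β : Spinor E) : wedgeThree H β =
      mixedWedge (Pi.single 3 (ofRealForm H)) β := by
  funext m
  match m with
  | 0 => exact (mixedWedge_single_of_lt _ _ _ (by norm_num)).symm
  | 1 => exact (mixedWedge_single_of_lt _ _ _ (by norm_num)).symm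
  | 2 => exact (mixedWedge_single_of_lt _ _ _ (by norm_num)).symm
  | k + 3 => exact (mixedWedge_single _ β k (k + 3) (Nat.add_comm 3 k)).symm

theorem pull_single {k : ℕ} (A : E →L[ℝ] E) (w : E [⋀^Fin k]→L[ℝ] ℂ) :
    pull A (Pi.single k w) = Pi.single k (w.compContinuousLinearMap A) := by
  funext m
  by_cases h : m = k
  · subst h
    ext v
    rw [pull_apply, Pi.single_eq_same, Pi.single_eq_same]; rfl
  · ext v
    rw [pull_apply, Pi.single_eq_of_ne h, Pi.single_eq_of_ne h]; rfl

theorem pull_wedgeThree (A : E →L[ℝ] E) (H : E [⋀^Fin 3]→L[ℝ] ℝ) (β : Spinor E) :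
    pull A (wedgeThree H β) = wedgeThree (H.compContinuousLinearMap A) (pull A β) := by
  rw [wedgeThree_eq, wedgeThree_eq, pull_mixedWedge, pull_single]
  rfl

theorem wedgeOne_three_apply (θ₁ θ₂ θ₃ : E →L[ℝ] ℝ) (w : E [⋀^Fin 0]→L[ℝ] ℂ) (v : Fin 3 → E) :
    wedgeOne θ₁ (wedgeOne θ₂ (wedgeOne θ₃ w)) v = (∑ σ : Perm (Fin 3), Perm.sign σ •
        ((θ₁ (v (σ 0)) * θ₂ (v (σ 1)) * θ₃ (v (σ 2)) : ℝ) : ℂ)) * w ![] := by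
  rw [sum_perm_three (fun i j k => ((θ₁ (v i) * θ₂ (v j) * θ₃ (v k) : ℝ) : ℂ))]
  have h0 : ∀ u : Fin 0 → E, u = ![] := fun u => Subsingleton.elim _ _
  simp [wedgeOne, alternatizeUncurryFin_apply, Fin.sum_univ_succ, Fin.removeNth, Fin.succAbove, h0]
  ring

theorem trilinear_eq_sum {ι : Type*} [Fintype ι] (b : Basis ι ℝ E)
    (T : ContinuousMultilinearMap ℝ (fun _ : Fin 3 => E) ℝ) (v : Fin 3 → E) :
    T v = ∑ i, ∑ j, ∑ k, T ![b i, b j, b k] *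
      (coordCLM b i (v 0) * coordCLM b j (v 1) * coordCLM b k (v 2)) := by
  classical
  have h := T.toMultilinearMap.map_sum (fun i (j : ι) => coordCLM b j (v i) • b j)
  have hv : (fun i => ∑ j, coordCLM b j (v i) • b j) = v := by funext i; exact b.sum_repr (v i)
  rw [hv] at h
  change T v = _ at h
  rw [h, ← (Fin.consEquiv fun _ : Fin 3 => ι).sum_comp, Fintype.sum_prod_type]
  refine sum_congr rfl fun i _ => ?_
  rw [← (Fin.consEquiv fun _ : Fin 2 => ι).sum_comp, Fintype.sum_prod_type]
  refine sum_congr rfl fun j _ => ?_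
  rw [← (Fin.consEquiv fun _ : Fin 1 => ι).sum_comp, Fintype.sum_prod_type]
  refine sum_congr rfl fun k _ => ?_
  rw [Fintype.sum_unique]
  refine (T.toMultilinearMap.map_smul_univ _ _).trans ?_
  rw [Fin.prod_univ_three, smul_eq_mul, mul_comm]
  refine congrArg₂ (· * ·) ?_ rfl
  change T _ = T _
  congr 1
  funext l
  fin_cases l <;> rfl

/-- The spinor of a `3`-form given by the antisymmetrization of a trilinear form. -/
theorem single_three_eq {ι : Type*} [Fintype ι] (b : Basis ι ℝ E)
    (T : ContinuousMultilinearMap ℝ (fun _ : Fin 3 => E) ℝ) :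
    (Pi.single 3 (ofRealForm (alternatization T)) : Spinor E) =
    ∑ i, ∑ j, ∑ k, (T ![b i, b j, b k] : ℂ) • ε(b, i) (ε(b, j) (ε(b, k) (unitSpinor E))) := by
  funext m
  simp only [Finset.sum_apply, Pi.smul_apply]
  have hz : ∀ (m : ℕ) (θ : E →L[ℝ] ℝ), wedgeOne θ (0 : E [⋀^Fin m]→L[ℝ] ℂ) = 0 := fun m θ =>
    map_zero (formWedgeOne E m θ)
  have hs : ∀ (m : ℕ) (c : ℂ), c • (0 : E [⋀^Fin m]→L[ℝ] ℂ) = 0 := fun m c => by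
    ext v; exact mul_zero c
  match m with
  | 0 => simp only [extMul_zero_apply, hs, sum_const_zero]; rfl
  | 1 => simp only [extMul_zero_apply, extMul_succ_apply, hz, hs, sum_const_zero]; rfl
  | 2 => simp only [extMul_zero_apply, extMul_succ_apply, hz, hs, sum_const_zero]; rfl
  | 3 =>
    ext v
    simp only [extMul_succ_apply, Pi.single_eq_same, unitSpinor,
      ContinuousAlternatingMap.sum_apply, ContinuousAlternatingMap.smul_apply,
      wedgeOne_three_apply, ContinuousLinearMap.compContinuousAlternatingMap_coe,
      Function.comp_apply, alternatization_apply_apply]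
    simp only [ContinuousAlternatingMap.constOfIsEmpty_apply, mul_one, smul_eq_mul]
    simp only [trilinear_eq_sum b T (v ∘ _), map_sum, mul_sum, Function.comp_apply]
    simp only [smul_sum, map_sum, Units.smul_def, map_zsmul]
    rw [sum_comm]
    refine sum_congr rfl fun i _ => ?_
    rw [sum_comm]
    refine sum_congr rfl fun j _ => ?_
    rw [sum_comm]
    refine sum_congr rfl fun k _ => sum_congr rfl fun σ _ => ?_
    rw [mul_smul_comm]
    congr 1
    simp
  | m + 4 =>
    have : unitSpinor E (m + 1) = 0 := rfl
    simp only [extMul_succ_apply, this, hz, hs, sum_const_zero]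
    rfl

/-! ### Complexification of real vector spaces and Lie algebras -/

section Complexification

variable {V : Type*} [AddCommGroup V] [Module ℝ V] {V' : Type*} [AddCommGroup V'] [Module ℝ V']

/-- The real part of an element of `ℂ ⊗ V`. -/
def reT : (ℂ ⊗[ℝ] V) →ₗ[ℝ] V :=
  (TensorProduct.lid ℝ V).toLinearMap ∘ₗ LinearMap.rTensor V Complex.reLm

/-- The imaginary part of an element of `ℂ ⊗ V`. -/
def imT : (ℂ ⊗[ℝ] V) →ₗ[ℝ] V :=
  (TensorProduct.lid ℝ V).toLinearMap ∘ₗ LinearMap.rTensor V Complex.imLm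

@[simp] theorem reT_tmul (c : ℂ) (v : V) : reT (c ⊗ₜ[ℝ] v) = c.re • v := by simp [reT]

@[simp] theorem imT_tmul (c : ℂ) (v : V) : imT (c ⊗ₜ[ℝ] v) = c.im • v := by simp [imT]

theorem reT_add_imT (z : ℂ ⊗[ℝ] V) : (1 : ℂ) ⊗ₜ[ℝ] reT z + I ⊗ₜ[ℝ] imT z = z := by
  induction z using induction_on with
  | zero => simp
  | tmul c v =>
    rw [reT_tmul, imT_tmul, ← smul_tmul, ← smul_tmul, ← add_tmul]
    congr 1
    apply Complex.ext <;> simp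
  | add a b ha hb =>
    rw [map_add, map_add, tmul_add, tmul_add]
    nth_rewrite 3 [← ha]
    nth_rewrite 3 [← hb]
    abel

theorem reT_conjT (z : ℂ ⊗[ℝ] V) : reT (conjT z) = reT z := by
  induction z using induction_on with
  | zero => simp
  | tmul c v => simp
  | add a b ha hb => simp [ha, hb]

theorem eq_I_tmul_of_conjT_eq_neg {z : ℂ ⊗[ℝ] V} (h : conjT z = -z) : z = I ⊗ₜ[ℝ] imT z := by
  have h1 : reT z = -reT z := by rw [← map_neg, ← h, reT_conjT]
  have h2 : reT z = 0 := by
    have : (2 : ℝ) • reT z = 0 := by rw [two_smul]; nth_rewrite 2 [h1]; abel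
    simpa using this
  conv_lhs => rw [← reT_add_imT z, h2]
  simp

theorem conjT_baseChange (T : V →ₗ[ℝ] V') (z : ℂ ⊗[ℝ] V) :
    conjT (T.baseChange ℂ z) = T.baseChange ℂ (conjT z) := by
  induction z using induction_on with
  | zero => simp
  | tmul c v => simp
  | add a b ha hb => simp only [map_add, ha, hb]

theorem baseChange_form_tmul (B : BilinForm ℝ V) (c d : ℂ) (x y : V) :
    BilinForm.baseChange ℂ B (c ⊗ₜ[ℝ] x) (d ⊗ₜ[ℝ] y) = c * d * (B x y : ℂ) := by
  simp [BilinForm.baseChange_tmul, mul_comm, mul_assoc]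

/-- An identity between real-bilinear expressions in `ℂ ⊗ V` holds if it holds on pure tensors. -/
theorem tensor_induction₂ {p : ℂ ⊗[ℝ] V → ℂ ⊗[ℝ] V' → Prop} (h0 : ∀ w, p 0 w) (h0' : ∀ z, p z 0)
    (ht : ∀ c x d y, p (c ⊗ₜ[ℝ] x) (d ⊗ₜ[ℝ] y)) (ha : ∀ z z' w, p z w → p z' w → p (z + z') w)
    (ha' : ∀ z w w', p z w → p z w' → p z (w + w')) (z : ℂ ⊗[ℝ] V) (w : ℂ ⊗[ℝ] V') : p z w := by
  induction z using induction_on with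
  | zero => exact h0 w
  | tmul c x =>
    induction w using induction_on with
    | zero => exact h0' _
    | tmul d y => exact ht c x d y
    | add a b h h' => exact ha' _ _ _ h h'
  | add a b h h' => exact ha _ _ _ h h'

theorem baseChange_form_comp (B : BilinForm ℝ V) (B' : BilinForm ℝ V')
    (T : V →ₗ[ℝ] V') (h : ∀ x y, B' (T x) (T y) = B x y) (z w : ℂ ⊗[ℝ] V) :
    BilinForm.baseChange ℂ B' (T.baseChange ℂ z) (T.baseChange ℂ w) =
      BilinForm.baseChange ℂ B z w := by
  refine tensor_induction₂ (p := fun z w => BilinForm.baseChange ℂ B' (T.baseChange ℂ z)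
    (T.baseChange ℂ w) = BilinForm.baseChange ℂ B z w) ?_ ?_ ?_ ?_ ?_ z w
  · simp
  · simp
  · intro c x d y; simp only [baseChange_tmul, baseChange_form_tmul, h]
  · intro z z' w h1 h2; simp only [map_add, LinearMap.add_apply, h1, h2]
  · intro z w w' h1 h2; simp only [map_add, h1, h2]

theorem baseChange_form_symm (B : BilinForm ℝ V) (h : ∀ x y, B x y = B y x)
    (z w : ℂ ⊗[ℝ] V) : BilinForm.baseChange ℂ B z w = BilinForm.baseChange ℂ B w z := by
  refine tensor_induction₂ (p := fun z w => BilinForm.baseChange ℂ B z w =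
      BilinForm.baseChange ℂ B w z) ?_ ?_ ?_ ?_ ?_ z w
  · simp
  · simp
  · intro c x d y; simp only [baseChange_form_tmul, h x y, mul_comm c d]
  · intro z z' w h1 h2; simp only [map_add, LinearMap.add_apply, h1, h2]
  · intro z w w' h1 h2; simp only [map_add, LinearMap.add_apply, h1, h2]

theorem baseChange_form_conjT (B : BilinForm ℝ V) (z w : ℂ ⊗[ℝ] V) :
    BilinForm.baseChange ℂ B (conjT z) (conjT w) =
      starRingEnd ℂ (BilinForm.baseChange ℂ B z w) := by
  refine tensor_induction₂ (p := fun z w => BilinForm.baseChange ℂ B (conjT z) (conjT w) =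
      starRingEnd ℂ (BilinForm.baseChange ℂ B z w)) ?_ ?_ ?_ ?_ ?_ z w
  · simp
  · simp
  · intro c x d y; simp only [conjT_tmul, baseChange_form_tmul, map_mul, Complex.conj_ofReal]
  · intro z z' w h1 h2; simp only [map_add, LinearMap.add_apply, h1, h2]
  · intro z w w' h1 h2; simp only [map_add, h1, h2]

theorem baseChange_form_self_conjT (B : BilinForm ℝ V) (h : ∀ x y, B x y = B y x)
    (z : ℂ ⊗[ℝ] V) : BilinForm.baseChange ℂ B z (conjT z) =
      ((B (reT z) (reT z) + B (imT z) (imT z) : ℝ) : ℂ) := by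
  conv_lhs => rw [← reT_add_imT z]
  simp only [map_add, conjT_tmul, LinearMap.add_apply, baseChange_form_tmul, conj_I, map_one]
  rw [h (imT z) (reT z)]
  push_cast
  linear_combination (-(B (imT z) (imT z)) : ℂ) * Complex.I_sq

theorem eq_zero_of_form_self_conjT (B : BilinForm ℝ V) (h : ∀ x y, B x y = B y x)
    (hp : ∀ x, x ≠ 0 → 0 < B x x) {z : ℂ ⊗[ℝ] V}
    (hz : BilinForm.baseChange ℂ B z (conjT z) = 0) : z = 0 := by
  rw [baseChange_form_self_conjT B h, Complex.ofReal_eq_zero] at hz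
  have hn : ∀ x, 0 ≤ B x x := fun x => by
    by_cases hx : x = 0
    · simp [hx]
    · exact (hp x hx).le
  have h0 : ∀ x, B x x = 0 → x = 0 := fun x hx => by by_contra hne; exact (hp x hne).ne' hx
  have h1 := h0 _ (le_antisymm (by linarith [hn (imT z)]) (hn (reT z)))
  have h2 := h0 _ (le_antisymm (by linarith [hn (reT z)]) (hn (imT z)))
  rw [← reT_add_imT z, h1, h2]; simp

variable {L : Type*} [LieRing L] [LieAlgebra ℝ L]

theorem lieC_add (z w w' : ℂ ⊗[ℝ] L) : ⁅z, w + w'⁆ = ⁅z, w⁆ + ⁅z, w'⁆ := lie_add z w w'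

theorem lieC_zero (z : ℂ ⊗[ℝ] L) : ⁅z, (0 : ℂ ⊗[ℝ] L)⁆ = 0 := lie_zero z

theorem conjT_lie (z w : ℂ ⊗[ℝ] L) : conjT ⁅z, w⁆ = ⁅conjT z, conjT w⁆ := by
  refine tensor_induction₂ (p := fun z w : ℂ ⊗[ℝ] L => conjT ⁅z, w⁆ = ⁅conjT z, conjT w⁆)
    ?_ ?_ ?_ ?_ ?_ z w
  · simp
  · simp [lieC_zero]
  · intro c x d y; simp [bracket_tmul]
  · intro z z' w h1 h2; simp only [add_lie, map_add, h1, h2]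
  · intro z w w' h1 h2; simp only [lieC_add, map_add, h1, h2]

theorem baseChange_lie (T : L →ₗ[ℝ] L) (h : ∀ x y, T ⁅x, y⁆ = ⁅T x, T y⁆) (z w : ℂ ⊗[ℝ] L) :
    T.baseChange ℂ ⁅z, w⁆ = ⁅T.baseChange ℂ z, T.baseChange ℂ w⁆ := by
  refine tensor_induction₂ (p := fun z w : ℂ ⊗[ℝ] L =>
    T.baseChange ℂ ⁅z, w⁆ = ⁅T.baseChange ℂ z, T.baseChange ℂ w⁆) ?_ ?_ ?_ ?_ ?_ z w
  · simp
  · simp [lieC_zero]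
  · intro c x d y; simp [bracket_tmul, h]
  · intro z z' w h1 h2; simp only [add_lie, map_add, h1, h2]
  · intro z w w' h1 h2; simp only [lieC_add, map_add, h1, h2]

theorem formC_lie (B : BilinForm ℝ L) (h : ∀ x y z, B ⁅x, y⁆ z = B x ⁅y, z⁆)
    (x y z : ℂ ⊗[ℝ] L) : formC B ⁅x, y⁆ z = formC B x ⁅y, z⁆ := by
  have key : ∀ (c : ℂ) (w : L) (x y : ℂ ⊗[ℝ] L),
      formC B ⁅x, y⁆ (c ⊗ₜ[ℝ] w) = formC B x ⁅y, c ⊗ₜ[ℝ] w⁆ := by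
    intro c w x y
    refine tensor_induction₂ (p := fun x y : ℂ ⊗[ℝ] L =>
      formC B ⁅x, y⁆ (c ⊗ₜ[ℝ] w) = formC B x ⁅y, c ⊗ₜ[ℝ] w⁆) ?_ ?_ ?_ ?_ ?_ x y
    · simp
    · simp [lieC_zero]
    · intro d x e y
      simp only [bracket_tmul, formC, baseChange_form_tmul, h]
      ring
    · intro z z' w h1 h2; simp only [add_lie, map_add, LinearMap.add_apply, h1, h2]
    · intro z w w' h1 h2; simp only [lieC_add, add_lie, map_add, LinearMap.add_apply, h1, h2]
  induction z using induction_on with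
  | zero => simp [lieC_zero]
  | tmul c w => exact key c w x y
  | add a b ha hb => simp only [lieC_add, map_add, ha, hb]

end Complexification

/-! ### The double of the Lie algebra in the left trivialization -/

/-- The form `B`, as a continuous bilinear form on the model space. -/
def modelForm (B : BilinForm ℝ Lie(E, G)) : E →L[ℝ] E →L[ℝ] ℝ :=
  bilinCLM (B.compl₁₂ (toLie G).toLinearMap (toLie G).toLinearMap)

theorem modelForm_apply (B : BilinForm ℝ Lie(E, G)) (v w : E) :
    modelForm B v w = B (toLie G v) (toLie G w) := rfl

variable (E) in
/-- The adjoint action of `g⁻¹` on the Lie algebra. -/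
def adLie (g : G) : Lie(E, G) →ₗ[ℝ] Lie(E, G) :=
  (toLie G).toLinearMap ∘ₗ (adInv E g).toLinearMap ∘ₗ (toLie G).symm.toLinearMap

theorem adLie_toLie (g : G) (v : E) : adLie E g (toLie G v) = toLie G (adInv E g v) := rfl

theorem adLie_lie (g : G) (x y : Lie(E, G)) : adLie E g ⁅x, y⁆ = ⁅adLie E g x, adLie E g y⁆ := by
  obtain ⟨v, rfl⟩ := (toLie G).surjective x
  obtain ⟨w, rfl⟩ := (toLie G).surjective y
  exact (congrArg (toLie G) (modelBracket_adInv g v w)).symm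

theorem adLie_adLie_inv (g : G) (x : Lie(E, G)) :
    adLie E g (adLie E g⁻¹ x) = x := adInv_adInv_inv g ((toLie G).symm x)

variable {B : BilinForm ℝ Lie(E, G)}

theorem IsBiinvariantMetric.thetaR_lTrans (hB : IsBiinvariantMetric B) (g : G) (v : E)
    (ξ : Lie(E, G)) : B (toLie G (rMC E g (lTrans E g v))) ξ = B (toLie G v) (adLie E g ξ) := by
  obtain ⟨w, rfl⟩ := (toLie G).surjective ξ
  have h := hB.invariant g (lTrans E g v) (rTrans E g w)
  change B (toLie G (lMC E g (lTrans E g v))) (toLie G (lMC E g (rTrans E g w))) =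
    B (toLie G (rMC E g (lTrans E g v))) (toLie G (rMC E g (rTrans E g w))) at h
  rw [lMC_lTrans, rMC_rTrans] at h
  exact h.symm

theorem IsBiinvariantMetric.adLie_form (hB : IsBiinvariantMetric B) (g : G)
    (x y : Lie(E, G)) : B (adLie E g x) (adLie E g y) = B x y := by
  obtain ⟨v, rfl⟩ := (toLie G).surjective x
  rw [adLie_toLie, ← hB.thetaR_lTrans g, lTrans_adInv, rMC_rTrans]

theorem IsBiinvariantMetric.lie_form (hB : IsBiinvariantMetric B)
    (x y z : Lie(E, G)) : B ⁅x, y⁆ z = B x ⁅y, z⁆ := by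
  obtain ⟨a, rfl⟩ := (toLie G).surjective x
  obtain ⟨c, rfl⟩ := (toLie G).surjective y
  obtain ⟨b, rfl⟩ := (toLie G).surjective z
  have hc : (fun g : G => modelForm B (adInv E g a) (adInv E g b)) = fun _ => modelForm B a b := by
    funext g; exact hB.adLie_form g (toLie G a) (toLie G b)
  have ha := contMDiffAt_adInv_apply (E := E) (1 : G) a
  have hb := contMDiffAt_adInv_apply (E := E) (1 : G) b
  have h := lDeriv_bilin (modelForm B) (ha.mdiff)
    (hb.mdiff) c
  rw [hc, lDeriv_const, lDeriv_adInv_one, lDeriv_adInv_one] at h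
  simp only [adInv_one, zero_apply, map_neg, neg_apply, ContinuousLinearMap.id_apply,
    modelForm_apply] at h
  have h1 : B ⁅toLie G a, toLie G c⁆ (toLie G b) = -B (toLie G (modelBracket G c a)) (toLie G b) := by
    rw [← lie_skew, map_neg]; rfl
  have h2 : B (toLie G a) ⁅toLie G c, toLie G b⁆ =
    B (toLie G a) (toLie G (modelBracket G c b)) := rfl
  rw [h1, h2]
  linarith

/-- The value `(ξ, ½ B(·, ξ))` of `s^L(ξ)` in the left trivialization. -/
def leftVec (B : BilinForm ℝ Lie(E, G)) : Lie(E, G) →ₗ[ℝ] GenTangent E :=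
  (toLie G).symm.toLinearMap.prod ((1 / 2 : ℝ) •
    ((toContinuousLinearMap : (E →ₗ[ℝ] ℝ) ≃ₗ[ℝ] (E →L[ℝ] ℝ)).toLinearMap ∘ₗ
      (B.compl₁₂ (toLie G).toLinearMap LinearMap.id).flip))

/-- The value `(-ξ, ½ B(·, ξ))` of `s^R(Ad_g ξ)` in the left trivialization. -/
def rightVec (B : BilinForm ℝ Lie(E, G)) : Lie(E, G) →ₗ[ℝ] GenTangent E :=
  (-(toLie G).symm.toLinearMap).prod ((1 / 2 : ℝ) •
    ((toContinuousLinearMap : (E →ₗ[ℝ] ℝ) ≃ₗ[ℝ] (E →L[ℝ] ℝ)).toLinearMap ∘ₗ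
      (B.compl₁₂ (toLie G).toLinearMap LinearMap.id).flip))

theorem leftVec_fst (ξ : Lie(E, G)) : (leftVec B ξ).1 = (toLie G).symm ξ := rfl

theorem leftVec_snd (ξ : Lie(E, G)) (v : E) : (leftVec B ξ).2 v = 1 / 2 * B (toLie G v) ξ := rfl

theorem rightVec_fst (ξ : Lie(E, G)) : (rightVec B ξ).1 = -(toLie G).symm ξ := rfl

theorem rightVec_snd (ξ : Lie(E, G)) (v : E) : (rightVec B ξ).2 v = 1 / 2 * B (toLie G v) ξ := rfl

variable (E) in
/-- The left trivialization of `T ⊕ T*`. -/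
def genLeft (g : G) : GenTangent E ≃ₗ[ℝ] GenTangent E where
  toFun e := (lMC E g e.1, e.2.comp (lTrans E g))
  invFun e := (lTrans E g e.1, e.2.comp (lMC E g))
  map_add' a b := by ext <;> simp
  map_smul' r a := by ext <;> simp
  left_inv e := by ext <;> simp
  right_inv e := by ext <;> simp

theorem genLeft_apply (g : G) (e : GenTangent E) :
    genLeft E g e = (lMC E g e.1, e.2.comp (lTrans E g)) := rfl

theorem genLeft_sL (g : G) (ξ : Lie(E, G)) : genLeft E g (sL B g ξ) = leftVec B ξ := by
  refine Prod.ext ?_ (ContinuousLinearMap.ext fun v => ?_)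
  · exact lMC_lTrans g ((toLie G).symm ξ)
  · change 1 / 2 * B (toLie G (lMC E g (lTrans E g v))) ξ = 1 / 2 * B (toLie G v) ξ
    rw [lMC_lTrans]

theorem genLeft_sR (hB : IsBiinvariantMetric B) (g : G) (ξ : Lie(E, G)) :
    genLeft E g (sR B g ξ) = rightVec B (adLie E g ξ) := by
  refine Prod.ext ?_ (ContinuousLinearMap.ext fun v => ?_)
  · change lMC E g (-rTrans E g ((toLie G).symm ξ)) = -adInv E g ((toLie G).symm ξ)
    rw [map_neg]; rfl
  · change 1 / 2 * B (toLie G (rMC E g (lTrans E g v))) ξ = 1 / 2 * B (toLie G v) (adLie E g ξ)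
    rw [hB.thetaR_lTrans]

theorem genPairing_apply (e f : GenTangent E) : genPairing e f = 1 / 2 * (e.2 f.1 + f.2 e.1) := rfl

theorem genPairing_genLeft (g : G) (e f : GenTangent E) :
    genPairing (genLeft E g e) (genLeft E g f) = genPairing e f := by
  simp [genPairing_apply, genLeft_apply]

theorem genPairing_leftVec (hB : IsBiinvariantMetric B) (x y : Lie(E, G)) :
    genPairing (leftVec B x) (leftVec B y) = 1 / 2 * B x y := by
  rw [genPairing_apply, leftVec_snd, leftVec_snd, leftVec_fst, leftVec_fst,
    apply_symm_apply, apply_symm_apply, hB.symm y x]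
  ring

theorem genPairing_rightVec (hB : IsBiinvariantMetric B) (x y : Lie(E, G)) :
    genPairing (rightVec B x) (rightVec B y) = -(1 / 2 * B x y) := by
  rw [genPairing_apply, rightVec_snd, rightVec_snd, rightVec_fst, rightVec_fst,
    map_neg (toLie G), map_neg (toLie G), apply_symm_apply,
    apply_symm_apply, map_neg, map_neg, LinearMap.neg_apply, LinearMap.neg_apply, hB.symm y x]
  ring

theorem genPairing_leftVec_rightVec (hB : IsBiinvariantMetric B)
    (x y : Lie(E, G)) : genPairing (leftVec B x) (rightVec B y) = 0 := by
  rw [genPairing_apply, leftVec_snd, rightVec_snd, leftVec_fst, rightVec_fst, map_neg, map_neg,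
    apply_symm_apply, apply_symm_apply, LinearMap.neg_apply, hB.symm y x]
  ring

/-- The Clifford action of `s^L(ξ)` in the left trivialization. -/
def cliffU (B : BilinForm ℝ Lie(E, G)) : Lieℂ(E, G) →ₗ[ℂ] End ℂ (Spinor E) :=
  clifford ∘ₗ (leftVec B).baseChange ℂ

/-- The Clifford action of `s^R(Ad_g ξ)` in the left trivialization. -/
def cliffR (B : BilinForm ℝ Lie(E, G)) : Lieℂ(E, G) →ₗ[ℂ] End ℂ (Spinor E) :=
  clifford ∘ₗ (rightVec B).baseChange ℂ

theorem cliffU_apply (x : Lieℂ(E, G)) : cliffU B x = clifford ((leftVec B).baseChange ℂ x) := rfl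

theorem cliffR_apply (x : Lieℂ(E, G)) : cliffR B x = clifford ((rightVec B).baseChange ℂ x) := rfl

theorem genPairingC_leftVec (hB : IsBiinvariantMetric B) (x y : Lieℂ(E, G)) :
    2 * genPairingC ((leftVec B).baseChange ℂ x) ((leftVec B).baseChange ℂ y) = formC B x y := by
  have h := baseChange_form_comp B ((2 : ℝ) • genPairing) (leftVec B) (fun x y => by
    rw [LinearMap.smul_apply, LinearMap.smul_apply, genPairing_leftVec hB, smul_eq_mul]; ring) x y
  rw [formC, ← h]
  refine tensor_induction₂ (p := fun z w : ℂ ⊗[ℝ] GenTangent E => 2 * genPairingC z w =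
    BilinForm.baseChange ℂ ((2 : ℝ) • genPairing) z w) ?_ ?_ ?_ ?_ ?_ _ _
  · simp
  · simp
  · intro c x d y; simp only [genPairingC, baseChange_form_tmul, LinearMap.smul_apply, smul_eq_mul]
    push_cast; ring
  · intro z z' w h1 h2; simp only [map_add, LinearMap.add_apply, mul_add, h1, h2]
  · intro z w w' h1 h2; simp only [map_add, mul_add, h1, h2]

theorem genPairingC_rightVec (hB : IsBiinvariantMetric B) (x y : Lieℂ(E, G)) :
    2 * genPairingC ((rightVec B).baseChange ℂ x) ((rightVec B).baseChange ℂ y) = -formC B x y := by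
  have h := baseChange_form_comp B ((-2 : ℝ) • genPairing) (rightVec B) (fun x y => by
    rw [LinearMap.smul_apply, LinearMap.smul_apply, genPairing_rightVec hB, smul_eq_mul]; ring) x y
  rw [formC, ← h]
  refine tensor_induction₂ (p := fun z w : ℂ ⊗[ℝ] GenTangent E => 2 * genPairingC z w =
    -BilinForm.baseChange ℂ ((-2 : ℝ) • genPairing) z w) ?_ ?_ ?_ ?_ ?_ _ _
  · simp
  · simp
  · intro c x d y; simp only [genPairingC, baseChange_form_tmul, LinearMap.smul_apply, smul_eq_mul]
    push_cast; ring
  · intro z z' w h1 h2; simp only [map_add, LinearMap.add_apply, mul_add, h1, h2]; ring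
  · intro z w w' h1 h2; simp only [map_add, mul_add, h1, h2]; ring

theorem genPairingC_leftVec_rightVec (hB : IsBiinvariantMetric B) (x y : Lieℂ(E, G)) :
    genPairingC ((leftVec B).baseChange ℂ x) ((rightVec B).baseChange ℂ y) = 0 := by
  refine tensor_induction₂ (p := fun x y : Lieℂ(E, G) =>
    genPairingC ((leftVec B).baseChange ℂ x) ((rightVec B).baseChange ℂ y) = 0) ?_ ?_ ?_ ?_ ?_ x y
  · simp
  · simp
  · intro c x d y
    simp only [genPairingC, baseChange_tmul, baseChange_form_tmul, genPairing_leftVec_rightVec hB]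
    simp
  · intro z z' w h1 h2; simp only [map_add, LinearMap.add_apply, h1, h2, add_zero]
  · intro z w w' h1 h2; simp only [map_add, h1, h2, add_zero]

theorem isCliffordPair (hB : IsBiinvariantMetric B) :
    IsCliffordPair (formC B) (cliffU B) (cliffR B) where
  left :=
    { symm := baseChange_form_symm B hB.symm
      invariant := formC_lie B hB.lie_form
      anticomm := fun x y φ => by
        rw [cliffU_apply, cliffU_apply, clifford_anticomm, genPairingC_leftVec hB] }
  right :=
    { symm := fun x y => congrArg Neg.neg (baseChange_form_symm B hB.symm x y)
      invariant := fun x y z => congrArg Neg.neg (formC_lie B hB.lie_form x y z)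
      anticomm := fun x y φ => by
        rw [cliffR_apply, cliffR_apply, clifford_anticomm, genPairingC_rightVec hB]; rfl }
  anticomm x y φ := by
    rw [cliffU_apply, cliffR_apply, clifford_anticomm, genPairingC_leftVec_rightVec hB, mul_zero,
      zero_smul']

theorem pull_clifford (g : G) (z : ℂ ⊗[ℝ] GenTangent E) (β : Spinor E) :
    pull (lTrans E g) (clifford z β) =
      clifford ((genLeft E g).toLinearMap.baseChange ℂ z) (pull (lTrans E g) β) := by
  induction z using induction_on with
  | zero => simp
  | tmul c e =>
    rw [baseChange_tmul, clifford_tmul, clifford_tmul, map_smul]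
    congr 1
    have h := pull_cliffordReal (lTrans E g) (lMC E g e.1) e.2 β
    rw [lTrans_lMC] at h
    exact h
  | add a b ha hb => simp only [map_add, LinearMap.add_apply, ha, hb]

/-- `d` is the `B`-dual of the basis `b`. -/
def IsDualOf {ι : Type*} (B : BilinForm ℝ Lie(E, G)) (b : Basis ι ℝ E) (d : ι → E) : Prop :=
  ∀ i v, B (toLie G v) (toLie G (d i)) = b.repr v i

theorem exists_isDualOf {ι : Type*} [Finite ι] (hB : IsBiinvariantMetric B)
    (b : Basis ι ℝ E) : ∃ d, IsDualOf B b d := by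
  classical
  have hinj : Function.Injective (modelForm B).flip := by
    rw [injective_iff_map_eq_zero]
    intro v hv
    by_contra hne
    have h1 := hB.pos (toLie G v) (by simpa using hne)
    have h2 : modelForm B v v = 0 := by
      have := congr_fun hv v
      simpa using this
    exact h1.ne' h2
  have hfin : finrank ℝ E = finrank ℝ (E →L[ℝ] ℝ) := by
    rw [← (toContinuousLinearMap : (E →ₗ[ℝ] ℝ) ≃ₗ[ℝ] (E →L[ℝ] ℝ)).finrank_eq]
    exact (Subspace.dual_finrank_eq (K := ℝ) (V := E)).symm
  have hsurj := (LinearMap.injective_iff_surjective_of_finrank_eq_finrank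
    (f := (modelForm B).flip.toLinearMap) hfin).1 hinj
  choose d hd using fun i => hsurj (coordCLM b i)
  exact ⟨d, fun i v => congr_fun (hd i) v⟩

variable (G) in
/-- A vector of the model space as an element of the complexified Lie algebra. -/
def toLieC : E →ₗ[ℝ] Lieℂ(E, G) := (TensorProduct.mk ℝ ℂ Lie(E, G) 1) ∘ₗ (toLie G).toLinearMap

theorem toLieC_apply (v : E) : toLieC G v = (1 : ℂ) ⊗ₜ[ℝ] toLie G v := rfl

theorem toLieC_lie (v w : E) : ⁅toLieC G v, toLieC G w⁆ = toLieC G (modelBracket G v w) := by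
  rw [toLieC_apply, toLieC_apply, bracket_tmul, one_mul]; rfl

theorem conjT_toLieC (v : E) : conjT (toLieC G v) = toLieC G v := by
  rw [toLieC_apply, conjT_tmul, map_one]

theorem formC_toLieC (v w : E) : formC B (toLieC G v) (toLieC G w) = B (toLie G v) (toLie G w) := by
  rw [toLieC_apply, toLieC_apply, formC, baseChange_form_tmul]; simp

variable {ι : Type*} [Fintype ι] {b : Basis ι ℝ E} {d : ι → E}

theorem IsDualOf.isDualFrame (hB : IsBiinvariantMetric B) (hd : IsDualOf B b d) :
    IsDualFrame (formC B) (fun i => toLieC G (b i)) (fun i => toLieC G (d i)) := by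
  have hb : ∀ v : E, v = ∑ i, B (toLie G v) (toLie G (d i)) • b i := fun v => by
    conv_lhs => rw [← b.sum_repr v]
    exact sum_congr rfl fun i _ => by rw [hd]
  have hd' : ∀ v : E, v = ∑ i, B (toLie G v) (toLie G (b i)) • d i := fun v => by
    have hz : ∀ w : E, (∀ u, B (toLie G w) (toLie G u) = 0) → w = 0 := fun w hw => by
      by_contra hne
      exact (hB.pos (toLie G w) (by simpa using hne)).ne' (hw w)
    rw [← sub_eq_zero]
    refine hz _ fun u => ?_
    have hu : ∀ w : E, B (toLie G w) (toLie G u) =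
        ∑ i, B (toLie G u) (toLie G (d i)) * B (toLie G w) (toLie G (b i)) := fun w => by
      conv_lhs => rw [hb u]
      simp only [map_sum, map_smul, smul_eq_mul]
    rw [map_sub, map_sub, LinearMap.sub_apply, sub_eq_zero, hu v, map_sum, map_sum,
      LinearMap.sum_apply]
    refine sum_congr rfl fun i _ => ?_
    rw [map_smul, map_smul, LinearMap.smul_apply, smul_eq_mul, hB.symm (toLie G (d i)), mul_comm]
  have lift : ∀ (p q : ι → E) (h : ∀ v : E, v = ∑ i, B (toLie G v) (toLie G (p i)) • q i)
      (x : Lieℂ(E, G)),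
      x = ∑ i, formC B x (toLieC G (p i)) • toLieC G (q i) := by
    intro p q h x
    induction x using induction_on with
    | zero => simp
    | tmul c v =>
      obtain ⟨v, rfl⟩ := (toLie G).surjective v
      conv_lhs => rw [h v, map_sum, tmul_sum]
      refine sum_congr rfl fun i _ => ?_
      rw [toLieC_apply, toLieC_apply, formC, baseChange_form_tmul, smul_tmul',
        map_smul, ← smul_tmul]
      congr 1
      simp [mul_comm]
    | add x y hx hy =>
      conv_lhs => rw [hx, hy, ← sum_add_distrib]
      exact sum_congr rfl fun i _ => by rw [map_add, LinearMap.add_apply, add_smul]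
  exact ⟨lift d b hb, lift b d hd'⟩

theorem add_apply_dual (hd : IsDualOf B b d) (i : ι) (φ : Spinor E) :
    (cliffU B + cliffR B) (toLieC G (d i)) φ = ε(b, i) φ := by
  have h : leftVec B (toLie G (d i)) + rightVec B (toLie G (d i)) = (0, coordCLM b i) := by
    refine Prod.ext (add_neg_cancel _) (ContinuousLinearMap.ext fun v => ?_)
    change 1 / 2 * B (toLie G v) (toLie G (d i)) + 1 / 2 * B (toLie G v) (toLie G (d i)) =
      b.repr v i
    rw [hd i v]; ring
  rw [LinearMap.add_apply, LinearMap.add_apply, cliffU_apply, cliffR_apply, toLieC_apply,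
    baseChange_tmul, baseChange_tmul, clifford_tmul, clifford_tmul]
  rw [extMul, ← h, map_add, LinearMap.add_apply]
  module

theorem sub_apply_toLieC (v : E) (φ : Spinor E) :
    (1 / 2 : ℂ) • (cliffU B (toLieC G v) φ - cliffR B (toLieC G v) φ) = contr v φ := by
  have h : leftVec B (toLie G v) - rightVec B (toLie G v) = (2 : ℝ) • (v, 0) := by
    refine Prod.ext ?_ (ContinuousLinearMap.ext fun w => ?_)
    · change v - -v = (2 : ℝ) • v
      module
    · change 1 / 2 * B (toLie G w) (toLie G v) - 1 / 2 * B (toLie G w) (toLie G v) = 2 * 0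
      ring
  have h2 : cliffordReal (leftVec B (toLie G v)) φ - cliffordReal (rightVec B (toLie G v)) φ =
      (2 : ℂ) • contr v φ := by
    rw [sub_eq_iff_eq_add'.1 h, map_add, LinearMap.add_apply, add_sub_cancel_left, map_smul]
    change (2 : ℝ) • contr v φ = _
    funext k; ext w
    change (2 : ℝ) • (contr v φ k w) = (2 : ℂ) • (contr v φ k w)
    simp
  rw [cliffU_apply, cliffR_apply, toLieC_apply,
    baseChange_tmul, baseChange_tmul, clifford_tmul, clifford_tmul]
  linear_combination (norm := module) (1 / 2 : ℂ) • h2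

/-! ### The twisted exterior derivative in the left trivialization -/

section CliffordPairPointwise

variable {S : Type*} [AddCommGroup S] [Module ℂ S] {V : Type*} [LieRing V] [LieAlgebra ℂ V]
  {ι : Type*} [Fintype ι] {Q : BilinForm ℂ V} {b d : ι → V}
  {u r : V →ₗ[ℂ] End ℂ S}

theorem IsCliffordPair.cubic_identity_pointwise (h : IsCliffordPair Q u r)
    (hb : IsDualFrame Q b d) (θ : ι → End ℂ S) (hθ : ∀ i φ, (u + r) (d i) φ = θ i φ) (φ : S) :
    -(1 / 2 : ℂ) • (∑ i, ∑ j, θ i (θ j ((1 / 2 : ℂ) • (u ⁅b i, b j⁆ φ - r ⁅b i, b j⁆ φ))))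
      + (1 / 12 : ℂ) • (∑ i, ∑ j, θ i (θ j (u ⁅b i, b j⁆ φ + r ⁅b i, b j⁆ φ))) =
    ∑ i, θ i (-(1 / 2 : ℂ) • quadElt r b (fun i => -d i) (b i) φ)
      - (1 / 6 : ℂ) • (cubicElt u b d φ + cubicElt r b (fun i => -d i) φ) := by
  simp only [← hθ]
  exact h.cubic_identity hb φ

end CliffordPairPointwise

theorem thetaL_one (v : E) : (thetaL (E := E) (1 : G) v) = toLie G v := by
  have h := lMC_lTrans (1 : G) v
  rw [lTrans_one] at h
  exact congrArg (toLie (E := E) G) h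

theorem leftForm_cartanH (x : G) : leftForm (cartanH B) x = cartanH B 1 := by
  have key : ∀ v : Fin 3 → E, cartanTrilinear B x (fun i => lTrans E x (v i)) =
      cartanTrilinear B 1 v := fun v => by
    have h : ∀ w : E, thetaL (E := E) x (lTrans E x w) = thetaL (E := E) (1 : G) w := fun w => by
      rw [thetaL_one]; exact congrArg (toLie (E := E) G) (lMC_lTrans x w)
    change B (thetaL x (lTrans E x (v 0)))
      ⁅thetaL x (lTrans E x (v 1)), thetaL x (lTrans E x (v 2))⁆ = _
    rw [h, h, h]; rfl
  ext v
  change (1 / 12 : ℝ) • alternatization (cartanTrilinear B x)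
    (fun i => lTrans E x (v i)) =
    (1 / 12 : ℝ) • alternatization (cartanTrilinear B 1) v
  rw [alternatization_apply_apply, alternatization_apply_apply]
  congr 1
  exact sum_congr rfl fun σ _ => congrArg _ (key (v ∘ σ))

theorem smoothAt_cartanH (x : G) : FormSmoothAt (cartanH B) x := by
  rw [formSmoothAt_iff, show leftForm (cartanH B) = fun _ => cartanH B 1 from
    funext leftForm_cartanH]
  exact contMDiffAt_const

theorem cartanH_one_apply (hB : IsBiinvariantMetric B) (v : Fin 3 → E) :
    cartanH B (1 : G) v = 1 / 2 * B (toLie G (v 0)) (toLie G (modelBracket G (v 1) (v 2))) := by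
  change (1 / 12 : ℝ) • alternatization (cartanTrilinear B 1) v = _
  rw [alternatization_apply_apply]
  have h1 : ∀ σ : Perm (Fin 3), cartanTrilinear B (1 : G) (v ∘ σ) =
      (fun i j k => B (toLie G (v i)) ⁅toLie G (v j), toLie G (v k)⁆) (σ 0) (σ 1) (σ 2) :=
    fun σ => by
      change B (thetaL 1 (v (σ 0))) ⁅thetaL 1 (v (σ 1)), thetaL 1 (v (σ 2))⁆ = _
      rw [thetaL_one, thetaL_one, thetaL_one]
  simp only [h1]
  rw [sum_perm_three (fun i j k => B (toLie G (v i)) ⁅toLie G (v j), toLie G (v k)⁆)]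
  have h2 : toLie G (modelBracket G (v 1) (v 2)) = ⁅toLie G (v 1), toLie G (v 2)⁆ := rfl
  rw [h2]
  have hs : ∀ x y z, B x ⁅y, z⁆ = -B x ⁅z, y⁆ := fun x y z => by rw [← lie_skew, map_neg]
  have hc : ∀ x y z, B x ⁅y, z⁆ = B z ⁅x, y⁆ := fun x y z => by rw [← hB.lie_form, hB.symm]
  generalize toLie G (v 0) = x, toLie G (v 1) = y, toLie G (v 2) = z
  rw [smul_eq_mul, hs x z y, hs y x z, hs z y x, ← hc x y z, hc y z x]
  ring

/-- The operator `d_H` in the left trivialization. -/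
def leftTwisted (B : BilinForm ℝ Lie(E, G)) (b : Basis ι ℝ E)
    (Φ : G → Spinor E) (x : G) : Spinor E :=
  ∑ i, ε(b, i) (sDeriv Φ x (b i))
    - (1 / 2 : ℂ) • (∑ i, ∑ j, ε(b, i) (ε(b, j)
        (contr (modelBracket G (b i) (b j)) (Φ x))))
    + (1 / 12 : ℂ) • (∑ i, ∑ j, ε(b, i) (ε(b, j)
        (cliffU B ⁅toLieC G (b i), toLieC G (b j)⁆ (Φ x)
          + cliffR B ⁅toLieC G (b i), toLieC G (b j)⁆ (Φ x))))

theorem wedgeThree_cartanH_one (hB : IsBiinvariantMetric B) (hd : IsDualOf B b d) (β : Spinor E) :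
    wedgeThree (cartanH B (1 : G)) β = (1 / 12 : ℂ) • (∑ i, ∑ j, ε(b, i) (ε(b, j)
        (cliffU B ⁅toLieC G (b i), toLieC G (b j)⁆ β
          + cliffR B ⁅toLieC G (b i), toLieC G (b j)⁆ β))) := by
  have hsing : (Pi.single 3 (ofRealForm
      (cartanH B (1 : G))) : Spinor E) = (1 / 12 : ℂ) • (Pi.single 3
        (ofRealForm
          (alternatization (cartanTrilinear B (1 : G)))) : Spinor E) := by
    rw [← Pi.single_smul]
    congr 1
    ext v
    change (((1 / 12 : ℝ) • alternatization
      (cartanTrilinear B (1 : G)) v : ℝ) : ℂ) =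
      (1 / 12 : ℂ) * ((alternatization
      (cartanTrilinear B (1 : G)) v : ℝ) : ℂ)
    rw [smul_eq_mul]; push_cast; ring
  rw [wedgeThree_eq, hsing, map_smul, LinearMap.smul_apply, single_three_eq b]
  simp only [map_sum, LinearMap.sum_apply, map_smul, LinearMap.smul_apply, ← extMul_mixedWedge,
    mixedWedge_unitSpinor]
  congr 1
  refine sum_congr rfl fun i _ => sum_congr rfl fun j _ => ?_
  have h1 : cliffU B ⁅toLieC G (b i), toLieC G (b j)⁆ β
          + cliffR B ⁅toLieC G (b i), toLieC G (b j)⁆ β =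
      ∑ k, (cartanTrilinear B (1 : G) ![b i, b j, b k] : ℂ) • ε(b, k) β := by
    have h2 := (hd.isDualFrame hB).right ⁅toLieC G (b i), toLieC G (b j)⁆
    rw [← LinearMap.add_apply, ← LinearMap.add_apply, h2, map_sum, LinearMap.sum_apply]
    refine sum_congr rfl fun k _ => ?_
    rw [map_smul, LinearMap.smul_apply, add_apply_dual hd]
    congr 1
    rw [formC_lie B hB.lie_form, toLieC_lie, formC_toLieC]
    change _ = ((B (thetaL (1 : G) (b i)) ⁅thetaL (1 : G) (b j), thetaL (1 : G) (b k)⁆ : ℝ) : ℂ)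
    rw [thetaL_one, thetaL_one, thetaL_one]
    rfl
  rw [h1]
  simp only [map_sum, map_smul]

theorem pull_twistedDeriv (hB : IsBiinvariantMetric B) (hd : IsDualOf B b d) {φ : G → Spinor E}
    {x : G} (h : ∀ k, FormSmoothAt (fun z => φ z k) x) :
    pull (lTrans E x) (twistedDeriv (cartanH B) φ x) = leftTwisted B b (leftSpinor φ) x := by
  rw [twistedDeriv, map_add, pull_spinorDeriv b h, pull_wedgeThree]
  have h1 : (cartanH B x).compContinuousLinearMap (lTrans E x) = cartanH B 1 := leftForm_cartanH x
  rw [h1, wedgeThree_cartanH_one hB hd]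
  rfl

/-- The flat connection on spinors for which the frames `s^L(ξ)` and `s^R(ξ)` are parallel. -/
def nabla (B : BilinForm ℝ Lie(E, G)) (b : Basis ι ℝ E)
    (d : ι → E) (Φ : G → Spinor E) (x : G) (c : E) : Spinor E :=
  sDeriv Φ x c + (-(1 / 2) : ℂ) • quadElt (cliffR B) (fun i => toLieC G (b i))
    (fun i => -toLieC G (d i)) (toLieC G c) (Φ x)

theorem leftTwisted_eq (hB : IsBiinvariantMetric B) (hd : IsDualOf B b d) (Φ : G → Spinor E)
    (x : G) : leftTwisted B b Φ x = ∑ i, ε(b, i) (nabla B b d Φ x (b i))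
      - (1 / 6 : ℂ) • (cubicElt (cliffU B) (fun i => toLieC G (b i)) (fun i => toLieC G (d i)) (Φ x)
        + cubicElt (cliffR B) (fun i => toLieC G (b i)) (fun i => -toLieC G (d i)) (Φ x)) := by
  have h := (isCliffordPair hB).cubic_identity_pointwise (hd.isDualFrame hB)
    (fun i => ε(b, i)) (fun i φ => add_apply_dual hd i φ) (Φ x)
  have h2 : ∀ i j, (1 / 2 : ℂ) • (cliffU B ⁅toLieC G (b i), toLieC G (b j)⁆ (Φ x)
      - cliffR B ⁅toLieC G (b i), toLieC G (b j)⁆ (Φ x)) =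
      contr (modelBracket G (b i) (b j)) (Φ x) := fun i j => by
    rw [toLieC_lie, sub_apply_toLieC]
  simp only [h2] at h
  have h3 : ∑ i, ε(b, i) (nabla B b d Φ x (b i)) = ∑ i, ε(b, i) (sDeriv Φ x (b i)) + ∑ i, ε(b, i)
        (-(1 / 2 : ℂ) • quadElt (cliffR B) (fun i => toLieC G (b i))
          (fun i => -toLieC G (d i)) (toLieC G (b i)) (Φ x)) := by
    rw [← sum_add_distrib]
    exact sum_congr rfl fun i _ => by rw [nabla, map_add]
  rw [h3, leftTwisted]
  linear_combination (norm := module) h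

/-! ### Calculus of the flat connection on spinors -/

section NablaCalculus

variable {V : Type*} [AddCommGroup V] [Module ℝ V] {Φ Ψ : G → Spinor E} {x : G}

theorem SpinorSmoothAt.const_smul (h : SpinorSmoothAt Φ x) (c : ℂ) :
    SpinorSmoothAt (fun z => c • Φ z) x := h.smul contMDiffAt_const

theorem sDeriv_const_smul (h : SpinorSmoothAt Φ x) (s : ℂ) (c : E) :
    sDeriv (fun z => s • Φ z) x c = s • sDeriv Φ x c := by
  rw [sDeriv_smul h contMDiffAt_const, lDeriv_const, zero_apply, zero_smul', zero_add]

theorem SpinorSmoothAt.sum {κ : Type*} (s : Finset κ) {Φ : κ → G → Spinor E}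
    (h : ∀ i ∈ s, SpinorSmoothAt (Φ i) x) : SpinorSmoothAt (fun z => ∑ i ∈ s, Φ i z) x := by
  classical
  induction s using Finset.induction_on with
  | empty => simpa using spinorSmoothAt_const (0 : Spinor E) x
  | insert a s ha ih =>
    simp only [sum_insert ha]
    exact (h a (mem_insert_self a s)).add
      (ih fun i hi => h i (mem_insert_of_mem hi))

theorem sDeriv_sum {κ : Type*} (s : Finset κ) {Φ : κ → G → Spinor E}
    (h : ∀ i ∈ s, SpinorSmoothAt (Φ i) x) (c : E) :
    sDeriv (fun z => ∑ i ∈ s, Φ i z) x c = ∑ i ∈ s, sDeriv (Φ i) x c := by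
  classical
  induction s using Finset.induction_on with
  | empty => simpa using sDeriv_const (0 : Spinor E) x c
  | insert a s ha ih =>
    simp only [sum_insert ha]
    rw [sDeriv_add (h a (mem_insert_self a s))
      (SpinorSmoothAt.sum s fun i hi => h i (mem_insert_of_mem hi)),
      ih fun i hi => h i (mem_insert_of_mem hi)]

theorem SpinorSmoothAt.clifford_baseChange (h : SpinorSmoothAt Φ x) {T : G → V →ₗ[ℝ] GenTangent E}
    (hT : ∀ v, C∞[E, GenTangent E] (fun z => T z v) x) (ζ : ℂ ⊗[ℝ] V) :
    SpinorSmoothAt (fun z => clifford ((T z).baseChange ℂ ζ) (Φ z)) x := by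
  induction ζ using induction_on with
  | zero => simpa using spinorSmoothAt_const (0 : Spinor E) x
  | tmul c v =>
    simp only [baseChange_tmul, clifford_tmul]
    exact (h.cliffordReal (hT v)).const_smul c
  | add a b ha hb =>
    simp only [map_add, add_apply]
    exact ha.add hb

theorem sDeriv_clifford_baseChange (h : SpinorSmoothAt Φ x) {T : G → V →ₗ[ℝ] GenTangent E}
    (hT : ∀ v, C∞[E, GenTangent E] (fun z => T z v) x) {c : E}
    {T' : V →ₗ[ℝ] GenTangent E} (hT' : ∀ v, lDeriv E (fun z => T z v) x c = T' v) (ζ : ℂ ⊗[ℝ] V) :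
    sDeriv (fun z => clifford ((T z).baseChange ℂ ζ) (Φ z)) x c =
      clifford (T'.baseChange ℂ ζ) (Φ x) + clifford ((T x).baseChange ℂ ζ) (sDeriv Φ x c) := by
  induction ζ using induction_on with
  | zero => simpa using sDeriv_const (0 : Spinor E) x c
  | tmul s v =>
    simp only [baseChange_tmul, clifford_tmul]
    rw [sDeriv_const_smul (h.cliffordReal (hT v)), sDeriv_cliffordReal h (hT v), hT', smul_add']
  | add a b ha hb =>
    simp only [map_add, LinearMap.add_apply]
    rw [sDeriv_add (h.clifford_baseChange hT a) (h.clifford_baseChange hT b), ha, hb]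
    abel

theorem SpinorSmoothAt.cliffU (h : SpinorSmoothAt Φ x) (y : Lieℂ(E, G)) :
    SpinorSmoothAt (fun z => cliffU B y (Φ z)) x :=
  h.clifford_baseChange (T := fun _ => leftVec B) (fun _ => contMDiffAt_const) y

theorem SpinorSmoothAt.cliffR (h : SpinorSmoothAt Φ x) (y : Lieℂ(E, G)) :
    SpinorSmoothAt (fun z => cliffR B y (Φ z)) x :=
  h.clifford_baseChange (T := fun _ => rightVec B) (fun _ => contMDiffAt_const) y

theorem sDeriv_cliffU (h : SpinorSmoothAt Φ x) (y : Lieℂ(E, G)) (c : E) :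
    sDeriv (fun z => cliffU B y (Φ z)) x c = cliffU B y (sDeriv Φ x c) := by
  have := sDeriv_clifford_baseChange h (T := fun _ => leftVec B) (fun _ => contMDiffAt_const)
    (T' := 0) (c := c) (fun v => by rw [lDeriv_const]; rfl) y
  rw [LinearMap.baseChange_zero, LinearMap.zero_apply, map_zero, LinearMap.zero_apply,
    zero_add] at this
  exact this

theorem sDeriv_cliffR (h : SpinorSmoothAt Φ x) (y : Lieℂ(E, G)) (c : E) :
    sDeriv (fun z => cliffR B y (Φ z)) x c = cliffR B y (sDeriv Φ x c) := by
  have := sDeriv_clifford_baseChange h (T := fun _ => rightVec B) (fun _ => contMDiffAt_const)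
    (T' := 0) (c := c) (fun v => by rw [lDeriv_const]; rfl) y
  rw [LinearMap.baseChange_zero, LinearMap.zero_apply, map_zero, LinearMap.zero_apply,
    zero_add] at this
  exact this

variable (E) in
/-- The complexified adjoint action of `g⁻¹`. -/
def adC (g : G) : Lieℂ(E, G) →ₗ[ℂ] Lieℂ(E, G) := (adLie E g).baseChange ℂ

theorem adC_lie (g : G) (y z : Lieℂ(E, G)) :
    adC E g ⁅y, z⁆ = ⁅adC E g y, adC E g z⁆ := baseChange_lie _ (adLie_lie g) y z

theorem conjT_adC (g : G) (y : Lieℂ(E, G)) :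
    conjT (adC E g y) = adC E g (conjT y) := conjT_baseChange _ y

theorem IsBiinvariantMetric.formC_adC (hB : IsBiinvariantMetric B) (g : G) (y z : Lieℂ(E, G)) :
    formC B (adC E g y) (adC E g z) = formC B y z :=
  baseChange_form_comp _ _ _ (hB.adLie_form g) y z

theorem adC_adC_inv (g : G) (y : Lieℂ(E, G)) : adC E g (adC E g⁻¹ y) = y := by
  rw [adC, adC, ← comp_apply, ← baseChange_comp,
    show adLie E g ∘ₗ adLie E g⁻¹ = LinearMap.id from LinearMap.ext (adLie_adLie_inv g)]
  simp

/-- The map `v ↦ (-v, ½ B(·, v))` on the model space. -/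
def rightVecCLM (B : BilinForm ℝ Lie(E, G)) : E →L[ℝ] GenTangent E :=
  toContinuousLinearMap (rightVec B ∘ₗ (toLie G).toLinearMap)

theorem contMDiffAt_rightVec_adLie (x : G) (y : Lie(E, G)) :
    C∞[E, GenTangent E] (fun z => rightVec B (adLie E z y)) x :=
  (contMDiffAt_adInv_apply x ((toLie G).symm y)).clm_comp_space (rightVecCLM B)

theorem SpinorSmoothAt.cliffR_adC (h : SpinorSmoothAt Φ x) (y : Lieℂ(E, G)) :
    SpinorSmoothAt (fun z => _root_.cliffR B (adC E z y) (Φ z)) x := by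
  have := h.clifford_baseChange (T := fun z => rightVec B ∘ₗ adLie E z)
    (fun v => contMDiffAt_rightVec_adLie x v) y
  simp only [baseChange_comp] at this
  exact this

theorem sDeriv_cliffR_adC (h : SpinorSmoothAt Φ x) (y : Lieℂ(E, G))
    (c : E) : sDeriv (fun z => cliffR B (adC E z y) (Φ z)) x c =
      -cliffR B ⁅toLieC G c, adC E x y⁆ (Φ x) + cliffR B (adC E x y) (sDeriv Φ x c) := by
  let T' : Lie(E, G) →ₗ[ℝ] GenTangent E :=
    -(rightVec B ∘ₗ LieAlgebra.ad ℝ _ (toLie G c) ∘ₗ adLie E x)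
  have hT' : ∀ v, lDeriv E (fun z => (rightVec B ∘ₗ adLie E z) v) x c = T' v := fun v => by
    have h1 := lDeriv_clm_comp (rightVecCLM B) ((contMDiffAt_adInv_apply x
      ((toLie G).symm v)).mdiff) c
    rw [lDeriv_adInv, map_neg] at h1
    exact h1
  have h2 : T'.baseChange ℂ y = -(rightVec B).baseChange ℂ ⁅toLieC G c, adC E x y⁆ := by
    induction y using induction_on with
    | zero => rw [map_zero, map_zero, lieC_zero, map_zero, neg_zero]
    | tmul s v =>
      rw [baseChange_tmul, adC, baseChange_tmul, toLieC_apply,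
        bracket_tmul, one_mul, baseChange_tmul, ← tmul_neg]
      rfl
    | add a b ha hb => rw [map_add, ha, hb, map_add, lieC_add, map_add, neg_add]
  have := sDeriv_clifford_baseChange h (T := fun z => rightVec B ∘ₗ adLie E z)
    (fun v => contMDiffAt_rightVec_adLie x v) hT' y
  simp only [baseChange_comp] at this
  refine this.trans ?_
  congr 1
  rw [h2, map_neg, LinearMap.neg_apply]
  rfl

theorem SpinorSmoothAt.quadElt (h : SpinorSmoothAt Φ x) (p q : ι → Lieℂ(E, G)) (y : Lieℂ(E, G)) :
    SpinorSmoothAt (fun z => _root_.quadElt (_root_.cliffR B) p q y (Φ z)) x := by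
  simp only [quadElt_apply]
  exact SpinorSmoothAt.sum _ fun i _ => (h.cliffR _).cliffR _

theorem sDeriv_quadElt (h : SpinorSmoothAt Φ x) (p q : ι → Lieℂ(E, G)) (y : Lieℂ(E, G)) (c : E) :
    sDeriv (fun z => quadElt (cliffR B) p q y (Φ z)) x c =
      quadElt (cliffR B) p q y (sDeriv Φ x c) := by
  simp only [quadElt_apply]
  rw [sDeriv_sum _ fun i _ => (h.cliffR _).cliffR _]
  exact sum_congr rfl fun i _ => by rw [sDeriv_cliffR (h.cliffR _), sDeriv_cliffR h]

theorem SpinorSmoothAt.nabla (h : SpinorSmoothAt Φ x) (c : E) :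
    SpinorSmoothAt (fun z => nabla B b d Φ z c) x :=
  (h.sDeriv c).add ((h.quadElt _ _ _).const_smul _)

theorem nabla_congr (e : Φ =ᶠ[𝓝 x] Ψ) (c : E) : nabla B b d Φ x c = nabla B b d Ψ x c := by
  rw [nabla, nabla, sDeriv_congr e, e.eq_of_nhds]

theorem nabla_add (h : SpinorSmoothAt Φ x) (h' : SpinorSmoothAt Ψ x) (c : E) :
    nabla B b d (fun z => Φ z + Ψ z) x c = nabla B b d Φ x c + nabla B b d Ψ x c := by
  rw [nabla, nabla, nabla, sDeriv_add h h', map_add, smul_add']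
  abel

theorem nabla_smul (h : SpinorSmoothAt Φ x) {f : G → ℂ} (hf : C∞[E, ℂ] f x) (c : E) :
    nabla B b d (fun z => f z • Φ z) x c = lDeriv E f x c • Φ x + f x • nabla B b d Φ x c := by
  rw [nabla, nabla, sDeriv_smul h hf, map_smul]
  module

theorem nabla_cliffU (hB : IsBiinvariantMetric B) (h : SpinorSmoothAt Φ x)
    (y : Lieℂ(E, G)) (c : E) :
    nabla B b d (fun z => cliffU B y (Φ z)) x c = cliffU B y (nabla B b d Φ x c) := by
  rw [nabla, nabla, sDeriv_cliffU h, map_add, map_smul, (isCliffordPair hB).quadElt_right_comm_left]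

theorem nabla_cliffR (hB : IsBiinvariantMetric B) (hd : IsDualOf B b d) (h : SpinorSmoothAt Φ x)
    (y : Lieℂ(E, G)) (c : E) : nabla B b d (fun z => cliffR B (adC E z y) (Φ z)) x c =
      cliffR B (adC E x y) (nabla B b d Φ x c) := by
  have h1 := (isCliffordPair hB).right.quadElt_comm (hd.isDualFrame hB).neg (toLieC G c)
    (adC E x y) (Φ x)
  rw [nabla, nabla, sDeriv_cliffR_adC h, map_add, map_smul]
  linear_combination (norm := module) (-(1 / 2) : ℂ) • h1

theorem nabla_nabla_sub (hB : IsBiinvariantMetric B) (hd : IsDualOf B b d)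
    (h : SpinorSmoothAt Φ x) (c c' : E) :
    nabla B b d (fun z => nabla B b d Φ z c') x c - nabla B b d (fun z => nabla B b d Φ z c) x c' =
      nabla B b d Φ x (modelBracket G c c') := by
  have h1 := (isCliffordPair hB).right.quadElt_quadElt (hd.isDualFrame hB).neg (toLieC G c)
    (toLieC G c') (Φ x)
  rw [toLieC_lie] at h1
  have h2 := sDeriv_sDeriv_sub h c c'
  have h3 : ∀ a a' : E, nabla B b d (fun z => nabla B b d Φ z a') x a =
      sDeriv (fun z => sDeriv Φ z a') x a
      + (-(1 / 2) : ℂ) • quadElt (cliffR B) (fun i => toLieC G (b i))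
        (fun i => -toLieC G (d i)) (toLieC G a') (sDeriv Φ x a)
      + (-(1 / 2) : ℂ) • quadElt (cliffR B) (fun i => toLieC G (b i))
        (fun i => -toLieC G (d i)) (toLieC G a) (sDeriv Φ x a')
      + (1 / 4 : ℂ) • quadElt (cliffR B) (fun i => toLieC G (b i))
        (fun i => -toLieC G (d i)) (toLieC G a) (quadElt (cliffR B) (fun i => toLieC G (b i))
        (fun i => -toLieC G (d i)) (toLieC G a') (Φ x)) := fun a a' => by
    have e : nabla B b d (fun z => nabla B b d Φ z a') x a =
        sDeriv (fun z => nabla B b d Φ z a') x a +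
          (-(1 / 2) : ℂ) • quadElt (cliffR B) (fun i => toLieC G (b i))
          (fun i => -toLieC G (d i)) (toLieC G a) (nabla B b d Φ x a') := rfl
    rw [e]
    simp only [nabla]
    rw [sDeriv_add (h.sDeriv a') ((h.quadElt _ _ _).const_smul _),
      sDeriv_const_smul (h.quadElt _ _ _), sDeriv_quadElt h, map_add, map_smul]
    module
  rw [h3, h3, nabla]
  linear_combination (norm := module) h2 + (1 / 4 : ℂ) • h1

theorem conj_cliffU (y : Lieℂ(E, G)) (β : Spinor E) :
    (cliffU B y β).conj = cliffU B (conjT y) β.conj := by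
  rw [cliffU_apply, conj_clifford, conjT_baseChange]; rfl

theorem conj_cliffR (y : Lieℂ(E, G)) (β : Spinor E) :
    (cliffR B y β).conj = cliffR B (conjT y) β.conj := by
  rw [cliffR_apply, conj_clifford, conjT_baseChange]; rfl

theorem Spinor.conj_sum {κ : Type*} (s : Finset κ) (f : κ → Spinor E) :
    (∑ i ∈ s, f i).conj = ∑ i ∈ s, (f i).conj := by
  classical
  induction s using Finset.induction_on with
  | empty =>
    funext k; ext v
    exact map_zero (starRingEnd ℂ)
  | insert a s ha ih => rw [sum_insert ha, conj_add, ih, sum_insert ha]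

theorem nabla_conj (h : SpinorSmoothAt Φ x) (c : E) :
    nabla B b d (fun z => (Φ z).conj) x c = (nabla B b d Φ x c).conj := by
  have hc : starRingEnd ℂ (-(1 / 2)) = -(1 / 2) := by rw [map_neg, map_div₀, map_one, map_ofNat]
  rw [nabla, nabla, sDeriv_conj h, conj_add, conj_smul, quadElt_apply,
    quadElt_apply, Spinor.conj_sum, hc]
  congr 2
  refine sum_congr rfl fun i _ => ?_
  rw [conj_cliffR, conj_cliffR, conjT_lie, conjT_toLieC, conjT_toLieC, map_neg conjT, conjT_toLieC]

/-! ### Derivative of the spinor pairing -/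

variable (E) in
/-- The components of degree at most `m`. -/
abbrev TruncSpinor (m : ℕ) : Type _ := ∀ k : Fin (m + 1), E [⋀^Fin k]→L[ℝ] ℂ

theorem Spinor.real_smul (r : ℝ) (β : Spinor E) : r • β = (r : ℂ) • β := by
  funext k; ext v
  change r • (β k v) = (r : ℂ) • (β k v)
  simp

theorem form_real_smul {k : ℕ} (r : ℝ) (w : E [⋀^Fin k]→L[ℝ] ℂ) : (r : ℂ) • w = r • w := by
  ext v
  change (r : ℂ) • (w v) = r • (w v)
  simp

/-- Extension by zero. -/
def extendSpinor (m : ℕ) : TruncSpinor E m →ₗ[ℝ] Spinor E where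
  toFun f k := if h : k < m + 1 then f ⟨k, h⟩ else 0
  map_add' f g := by
    funext k
    change (if h : k < m + 1 then (f + g) ⟨k, h⟩ else 0 : E [⋀^Fin k]→L[ℝ] ℂ) =
      (if h : k < m + 1 then f ⟨k, h⟩ else 0 : E [⋀^Fin k]→L[ℝ] ℂ) + (if h : k < m + 1 then g ⟨k, h⟩ else 0 :
          E [⋀^Fin k]→L[ℝ] ℂ)
    split_ifs
    · rfl
    · exact (add_zero _).symm
  map_smul' r f := by
    funext k
    change (if h : k < m + 1 then (r • f) ⟨k, h⟩ else 0 : E [⋀^Fin k]→L[ℝ] ℂ) =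
      r • (if h : k < m + 1 then f ⟨k, h⟩ else 0 : E [⋀^Fin k]→L[ℝ] ℂ)
    split_ifs
    · rfl
    · ext v; exact (smul_zero (r : ℝ) (A := ℂ)).symm

variable (E) in
/-- The spinor pairing as a continuous bilinear map. -/
def pairingCLM (m : ℕ) : TruncSpinor E m →L[ℝ] TruncSpinor E m →L[ℝ] E [⋀^Fin m]→L[ℝ] ℂ :=
  bilinCLM (mk₂ ℝ
    (fun (f g : TruncSpinor E m) => mixedWedge (extendSpinor m f) (revForm (extendSpinor m g)) m)
    (fun f f' g => by simp only [map_add, LinearMap.add_apply, Pi.add_apply])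
    (fun r f g => by
      rw [map_smul, Spinor.real_smul, map_smul, LinearMap.smul_apply]
      exact form_real_smul r _)
    (fun f g g' => by simp only [map_add, Pi.add_apply])
    (fun r f g => by
      rw [map_smul, Spinor.real_smul, map_smul, map_smul]
      exact form_real_smul r _))

theorem spinorPairing_eq_trunc (m : ℕ) (α β : Spinor E) :
    spinorPairing m α β = pairingCLM E m (fun k : Fin (m + 1) => α k) (fun k : Fin (m + 1) => β k) := by
  rw [spinorPairing_eq]
  change _ = mixedWedge (extendSpinor m _) (revForm (extendSpinor m _)) m
  rw [mixedWedge_apply_total, mixedWedge_apply_total]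
  refine sum_congr rfl ?_
  rintro ⟨i, j⟩ hij
  have hij' := mem_antidiagonal.1 hij
  simp only at hij'
  have h1 : ∀ γ : Spinor E, ∀ k, k < m + 1 → extendSpinor m (fun k => γ k) k = γ k :=
    fun γ k hk => by
      change (if h : k < m + 1 then γ k else 0) = γ k
      rw [dif_pos hk]
  rw [revForm_apply, revForm_apply, h1 α i (by omega), h1 β j (by omega)]

theorem contMDiffAt_spinorPairing (h : SpinorSmoothAt Φ x) (h' : SpinorSmoothAt Ψ x) (m : ℕ) :
    C∞[E, E [⋀^Fin m]→L[ℝ] ℂ] (fun z => spinorPairing m (Φ z) (Ψ z)) x := by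
  simp only [spinorPairing_eq_trunc]
  exact ContMDiffAt.bilin (pairingCLM E m) (contMDiffAt_pi_space.2 fun k => h k)
    (contMDiffAt_pi_space.2 fun k => h' k)

theorem lDeriv_trunc (h : SpinorSmoothAt Φ x) (m : ℕ) (c : E) :
    lDeriv E (fun z => (fun k => Φ z k : TruncSpinor E m)) x c =
      fun k : Fin (m + 1) => sDeriv Φ x c k := by
  have hs : C∞[E, TruncSpinor E m]
    (fun z => (fun k => Φ z k : TruncSpinor E m)) x := contMDiffAt_pi_space.2 fun k => h k
  funext k
  exact (lDeriv_clm_comp (ContinuousLinearMap.proj (R := ℝ) k)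
    (hs.mdiff) c).symm

theorem lDeriv_spinorPairing (h : SpinorSmoothAt Φ x) (h' : SpinorSmoothAt Ψ x) (m : ℕ) (c : E) :
    lDeriv E (fun z => spinorPairing m (Φ z) (Ψ z)) x c =
      spinorPairing m (sDeriv Φ x c) (Ψ x) + spinorPairing m (Φ x) (sDeriv Ψ x c) := by
  have hs : ∀ {Φ : G → Spinor E}, SpinorSmoothAt Φ x → MD[E, TruncSpinor E m] (fun z => (fun k => Φ z k : TruncSpinor E m)) x := fun {Φ} h => by
    have hs : C∞[E, TruncSpinor E m]
      (fun z => (fun k => Φ z k : TruncSpinor E m)) x := contMDiffAt_pi_space.2 fun k => h k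
    exact hs.mdiff
  simp only [spinorPairing_eq_trunc]
  rw [lDeriv_bilin (pairingCLM E m) (hs h) (hs h') c, lDeriv_trunc h, lDeriv_trunc h']

variable (E) in
/-- The spinor pairing as a complex bilinear map. -/
def pairingBilin (m : ℕ) : Spinor E →ₗ[ℂ] Spinor E →ₗ[ℂ] (E [⋀^Fin m]→L[ℝ] ℂ) :=
  mk₂ ℂ (fun α β => spinorPairing m α β)
    (fun a b c => by simp only [spinorPairing_eq, map_add, LinearMap.add_apply, Pi.add_apply])
    (fun r a b => by simp only [spinorPairing_eq, map_smul, LinearMap.smul_apply, Pi.smul_apply])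
    (fun a b c => by simp only [spinorPairing_eq, map_add, Pi.add_apply])
    (fun r a b => by simp only [spinorPairing_eq, map_smul, Pi.smul_apply])

theorem pairingBilin_apply (m : ℕ) (α β : Spinor E) :
    pairingBilin E m α β = spinorPairing m α β := rfl

theorem lDeriv_spinorPairing_nabla {n : ℕ} (hn : finrank ℝ E = 2 * n)
    (hB : IsBiinvariantMetric B) (hd : IsDualOf B b d)
    (h : SpinorSmoothAt Φ x) (h' : SpinorSmoothAt Ψ x) (c : E) :
    lDeriv E (fun z => spinorPairing (2 * n) (Φ z) (Ψ z)) x c =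
      spinorPairing (2 * n) (nabla B b d Φ x c) (Ψ x)
        + spinorPairing (2 * n) (Φ x) (nabla B b d Ψ x c) := by
  rw [lDeriv_spinorPairing h h']
  have h1 := (isCliffordPair hB).right.quadElt_skew (hd.isDualFrame hB).neg
    (pairingBilin E (2 * n)) (fun y α β => by
      rw [pairingBilin_apply, pairingBilin_apply]; exact spinorPairing_clifford hn _ α β) (toLieC G c)
    (Φ x) (Ψ x)
  simp only [← pairingBilin_apply, nabla, map_add, map_smul, LinearMap.add_apply,
    LinearMap.smul_apply]
  rw [h1]
  ext v
  simp only [ContinuousAlternatingMap.add_apply, ContinuousAlternatingMap.smul_apply,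
    ContinuousAlternatingMap.neg_apply, smul_eq_mul]
  ring

end NablaCalculus

/-! ### Polarizations -/

section Polarization

variable {L : Type*} [LieRing L] [LieAlgebra ℝ L] {B : BilinForm ℝ L} {n : ℕ}

/-- The element `∑ⱼ [xⱼ, x̄ⱼ]` attached to a unitary frame. -/
def weylElt (x : Fin n → ℂ ⊗[ℝ] L) : ℂ ⊗[ℝ] L := ∑ j, ⁅x j, conjT (x j)⁆

/-- `V` is a maximal isotropic subalgebra of `ℂ ⊗ L` with unitary basis `x`, complex conjugate
to `V'`, and normalized by the element `∑ⱼ [xⱼ, x̄ⱼ]`. -/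
structure IsPolarization (B : BilinForm ℝ L) (V V' : Submodule ℂ (ℂ ⊗[ℝ] L))
    (x : Fin n → ℂ ⊗[ℝ] L) : Prop where
  symm : ∀ y z, B y z = B z y
  conj_mem : ∀ z, z ∈ V' ↔ conjT z ∈ V
  mem : ∀ j, x j ∈ V
  isotropic : ∀ v ∈ V, ∀ w ∈ V, formC B v w = 0
  unitary : ∀ j k, formC B (x j) (conjT (x k)) = if j = k then 1 else 0
  frame : IsDualFrame (formC B) (Sum.elim x (fun j => conjT (x j)))
    (Sum.elim (fun j => conjT (x j)) x)
  lie_mem : ∀ v ∈ V, ∀ w ∈ V, ⁅v, w⁆ ∈ V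
  weyl_mem : ∀ v ∈ V, ⁅weylElt x, v⁆ ∈ V

theorem conjT_weylElt (x : Fin n → ℂ ⊗[ℝ] L) : conjT (weylElt x) = -weylElt x := by
  rw [weylElt, map_sum, ← sum_neg_distrib]
  refine sum_congr rfl fun j _ => ?_
  rw [conjT_lie, conjT_conjT]
  exact (lie_skew _ _).symm

theorem weylElt_conj (x : Fin n → ℂ ⊗[ℝ] L) : weylElt (fun j => conjT (x j)) = -weylElt x := by
  rw [← conjT_weylElt, weylElt, weylElt, map_sum]
  exact sum_congr rfl fun j _ => by rw [conjT_lie]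

namespace IsPolarization

variable {V V' : Submodule ℂ (ℂ ⊗[ℝ] L)} {x : Fin n → ℂ ⊗[ℝ] L}

theorem formC_symm (h : IsPolarization B V V' x) (y z : ℂ ⊗[ℝ] L) :
    formC B y z = formC B z y := baseChange_form_symm B h.symm y z

theorem mem_iff (h : IsPolarization B V V' x) (z : ℂ ⊗[ℝ] L) :
    z ∈ V ↔ ∀ j, formC B z (x j) = 0 := by
  refine ⟨fun hz j => h.isotropic z hz _ (h.mem j), fun hz => ?_⟩
  rw [h.frame.left z, sum_sum_type]
  refine V.add_mem (V.sum_mem fun j _ => V.smul_mem _ (h.mem j)) (V.sum_mem fun j _ => ?_)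
  rw [elim_inr, hz j, zero_smul]
  exact V.zero_mem

theorem conj (h : IsPolarization B V V' x) : IsPolarization B V' V (fun j => conjT (x j)) where
  symm := h.symm
  conj_mem z := by rw [h.conj_mem, conjT_conjT]
  mem j := by rw [h.conj_mem, conjT_conjT]; exact h.mem j
  isotropic v hv w hw := by
    rw [h.conj_mem] at hv hw
    have := h.isotropic _ hv _ hw
    rw [formC, baseChange_form_conjT] at this
    exact (map_eq_zero _).1 this
  unitary j k := by
    rw [conjT_conjT, h.formC_symm, h.unitary]
    simp [eq_comm]
  frame := by
    have hl : ∀ (f g : Fin n → ℂ ⊗[ℝ] L) (z : ℂ ⊗[ℝ] L),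
        ∑ i, formC B z (Sum.elim f g i) • Sum.elim g f i =
          ∑ i, formC B z (Sum.elim g f i) • Sum.elim f g i := fun f g z => by
      rw [sum_sum_type, sum_sum_type]
      simp only [elim_inl, elim_inr]
      rw [add_comm]
    simp only [conjT_conjT]
    exact ⟨fun z => (h.frame.left z).trans (hl _ _ z), fun z => (h.frame.right z).trans (hl _ _ z)⟩
  lie_mem v hv w hw := by
    rw [h.conj_mem] at hv hw ⊢
    rw [conjT_lie]
    exact h.lie_mem _ hv _ hw
  weyl_mem v hv := by
    rw [h.conj_mem] at hv ⊢
    rw [conjT_lie, weylElt_conj, map_neg, conjT_weylElt, neg_neg]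
    exact h.weyl_mem _ hv

theorem eq_sum (h : IsPolarization B V V' x) {v : ℂ ⊗[ℝ] L} (hv : v ∈ V) : v = ∑ j, formC B v (conjT (x j)) • x j := by
  have h1 := h.frame.left v
  rw [sum_sum_type] at h1
  simp only [elim_inl, elim_inr, (h.mem_iff v).1 hv, zero_smul, sum_const_zero, add_zero] at h1
  exact h1

end IsPolarization

end Polarization

/-! ### Dimension of the space of spinors -/

theorem Submodule.exists_ne_zero_of_finrank_eq_one {S : Type*} [AddCommGroup S] [Module ℂ S]
    (W : Submodule ℂ S) (h : finrank ℂ W = 1) : ∃ v ∈ W, v ≠ 0 := by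
  refine W.exists_mem_ne_zero_of_ne_bot ?_
  rintro rfl
  simp at h

instance finiteDimensional_spinor : FiniteDimensional ℂ (Spinor E) := by
  have hfin : ∀ k, Module.Finite ℂ (E [⋀^Fin k]→L[ℝ] ℂ) := fun k =>
    Module.Finite.of_restrictScalars_finite ℝ ℂ _
  let f : Spinor E →ₗ[ℂ] ∀ k : Fin (finrank ℝ E + 1), E [⋀^Fin k]→L[ℝ] ℂ :=
    { toFun := fun β k => β k
      map_add' := fun _ _ => rfl
      map_smul' := fun _ _ => rfl }
  refine FiniteDimensional.of_injective f ?_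
  intro α β hαβ
  funext k
  by_cases hk : k < finrank ℝ E + 1
  · exact congrFun hαβ ⟨k, hk⟩
  · rw [form_eq_zero_of_finrank_lt (by omega) (α k), form_eq_zero_of_finrank_lt (by omega) (β k)]

theorem finrank_spinor {n : ℕ} (hn : finrank ℝ E = 2 * n) : finrank ℂ (Spinor E) = 2 ^ (2 * n) := by
  let b := finBasisOfFinrankEq ℝ E hn
  have h := finrank_eq_two_pow_mul_vacuum (2 * n) (fun i => contr (b i))
    (fun i => ε(b, i)) (fun i j φ => by rw [contr_contr]; abel)
    (fun i j φ => by
      rw [contr_extMul, sub_add_cancel]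
      have : coordCLM b j (b i) = if i = j then 1 else 0 := by simp [coordCLM, Finsupp.single_apply]
      rw [this]
      split_ifs
      · module
      · rw [ofReal_zero, zero_smul'])
  have hne : unitSpinor E ≠ 0 := by
    intro h0
    have h1 := congrFun h0 0
    have h2 := congrArg (fun w => w ![]) h1
    simp [unitSpinor] at h2
  have hv : vacuum (fun i => contr (b i)) = Submodule.span ℂ {unitSpinor E} := by
    ext φ
    rw [mem_vacuum, Submodule.mem_span_singleton]
    constructor
    · intro hφ
      refine ⟨φ 0 ![], ?_⟩
      funext k
      match k with
      | 0 =>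
        ext v
        have hv : v = ![] := Subsingleton.elim _ _
        subst hv
        change φ 0 ![] * 1 = φ 0 ![]
        ring
      | k + 1 =>
        have hz : φ (k + 1) = 0 := form_zero_ext fun v => by
          have h1 : ∀ i, (φ (k + 1)).curryLeft (b i) = 0 := fun i => by
            rw [← contr_apply, hφ i]; rfl
          have h2 : (φ (k + 1)).curryLeft.toLinearMap = 0 := b.ext fun i => h1 i
          exact congr_fun h2 v
        rw [hz]
        ext v
        exact mul_zero _
    · rintro ⟨c, rfl⟩ i
      rw [map_smul]
      have : contr (b i) (unitSpinor E) = 0 := by funext k; ext v; rw [contr_apply]; rfl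
      rw [this]; funext k; ext v; exact mul_zero _
  rw [h, hv, finrank_span_singleton hne, mul_one]

/-! ### Pure spinors in the left trivialization -/

variable {n : ℕ} {V V' K K' : Submodule ℂ Lieℂ(E, G)} {x y : Fin n → Lieℂ(E, G)}

/-- The spinor `β` is annihilated by `s(V ⊕ K)` in the left trivialization at `g`. -/
def IsPureAt (B : BilinForm ℝ Lie(E, G))
    (V K : Submodule ℂ Lieℂ(E, G)) (g : G) (β : Spinor E) : Prop :=
  (∀ v ∈ V, cliffU B v β = 0) ∧ ∀ k ∈ K, cliffR B (adC E g k) β = 0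

/-- The Clifford action of the frame `s(x, y)`. -/
def pureOp (B : BilinForm ℝ Lie(E, G)) (x y : Fin n → Lieℂ(E, G)) (g : G) :
    Fin n ⊕ Fin n → End ℂ (Spinor E) :=
  Sum.elim (fun j => cliffU B (x j)) (fun j => cliffR B (adC E g (y j)))

/-- The Clifford action of the frame dual to `s(x, y)`. -/
def pureDualOp (B : BilinForm ℝ Lie(E, G)) (x y : Fin n → Lieℂ(E, G)) (g : G) :
    Fin n ⊕ Fin n → End ℂ (Spinor E) :=
  Sum.elim (fun j => cliffU B (conjT (x j))) (fun j => cliffR B (adC E g (-conjT (y j))))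

theorem cliffU_anticomm (hB : IsBiinvariantMetric B) (p q : Lieℂ(E, G))
    (β : Spinor E) : cliffU B p (cliffU B q β) + cliffU B q (cliffU B p β) = formC B p q • β :=
  (isCliffordPair hB).left.anticomm p q β

theorem cliffR_anticomm (hB : IsBiinvariantMetric B) (p q : Lieℂ(E, G))
    (β : Spinor E) : cliffR B p (cliffR B q β) + cliffR B q (cliffR B p β) = -formC B p q • β :=
  (isCliffordPair hB).right.anticomm p q β

theorem cliffU_cliffR (hB : IsBiinvariantMetric B) (p q : Lieℂ(E, G))
    (β : Spinor E) : cliffU B p (cliffR B q β) + cliffR B q (cliffU B p β) = 0 :=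
  (isCliffordPair hB).anticomm p q β

theorem pureOp_anticomm (hB : IsBiinvariantMetric B) (hx : IsPolarization B V V' x)
    (hy : IsPolarization B K K' y) (g : G) (i j : Fin n ⊕ Fin n) (β : Spinor E) :
    pureOp B x y g i (pureOp B x y g j β) + pureOp B x y g j (pureOp B x y g i β) = 0 := by
  rcases i with i | i <;> rcases j with j | j <;>
    simp only [pureOp, elim_inl, elim_inr]
  · rw [cliffU_anticomm hB, hx.isotropic _ (hx.mem i) _ (hx.mem j), zero_smul']
  · exact cliffU_cliffR hB _ _ β
  · rw [add_comm]; exact cliffU_cliffR hB _ _ β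
  · rw [cliffR_anticomm hB, hB.formC_adC, hy.isotropic _ (hy.mem i) _ (hy.mem j), neg_zero,
      zero_smul']

theorem pureOp_dual (hB : IsBiinvariantMetric B) (hx : IsPolarization B V V' x)
    (hy : IsPolarization B K K' y) (g : G) (i j : Fin n ⊕ Fin n) (β : Spinor E) :
    pureOp B x y g i (pureDualOp B x y g j β) + pureDualOp B x y g j (pureOp B x y g i β) =
      if i = j then β else 0 := by
  rcases i with i | i <;> rcases j with j | j <;>
    simp only [pureOp, pureDualOp, elim_inl, elim_inr, reduceCtorEq, if_false,
      Sum.inl.injEq, Sum.inr.injEq]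
  · rw [cliffU_anticomm hB, hx.unitary]
    split_ifs
    · module
    · exact zero_smul' β
  · exact cliffU_cliffR hB _ _ β
  · rw [add_comm]; exact cliffU_cliffR hB _ _ β
  · rw [cliffR_anticomm hB, hB.formC_adC, map_neg, neg_neg, hy.unitary]
    split_ifs
    · module
    · exact zero_smul' β

theorem isPureAt_iff (hx : IsPolarization B V V' x) (hy : IsPolarization B K K' y) (g : G)
    (β : Spinor E) : IsPureAt B V K g β ↔ ∀ i, pureOp B x y g i β = 0 := by
  constructor
  · rintro ⟨h1, h2⟩ (i | i)
    · exact h1 _ (hx.mem i)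
    · exact h2 _ (hy.mem i)
  · intro h
    have hs : ∀ c : ℂ, c • (0 : Spinor E) = 0 := fun c => by funext k; ext v; exact mul_zero c
    refine ⟨fun v hv => ?_, fun k hk => ?_⟩
    · rw [hx.eq_sum hv, map_sum, LinearMap.sum_apply]
      refine sum_eq_zero fun j _ => ?_
      rw [map_smul, LinearMap.smul_apply]
      exact (congrArg _ (h (Sum.inl j))).trans (hs _)
    · rw [hy.eq_sum hk, map_sum, map_sum, LinearMap.sum_apply]
      refine sum_eq_zero fun j _ => ?_
      rw [map_smul, map_smul, LinearMap.smul_apply]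
      exact (congrArg _ (h (Sum.inr j))).trans (hs _)

theorem finrank_pure (hn : finrank ℝ E = 2 * n) (hB : IsBiinvariantMetric B)
    (hx : IsPolarization B V V' x) (hy : IsPolarization B K K' y) (g : G) :
    finrank ℂ (vacuum (pureOp B x y g)) = 1 := by
  have h := finrank_eq_two_pow_mul_vacuum (n + n)
    (fun i => pureOp B x y g (finSumFinEquiv.symm i))
    (fun i => pureDualOp B x y g (finSumFinEquiv.symm i))
    (fun i j φ => pureOp_anticomm hB hx hy g _ _ φ)
    (fun i j φ => by rw [pureOp_dual hB hx hy]; simp only [EmbeddingLike.apply_eq_iff_eq])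
  have hv : vacuum (fun i => pureOp B x y g (finSumFinEquiv.symm i)) =
      vacuum (pureOp B x y g) := by
    ext φ
    rw [mem_vacuum, mem_vacuum]
    exact (finSumFinEquiv.symm.surjective.forall
      (p := fun i => pureOp B x y g i φ = 0)).symm
  rw [finrank_spinor hn, hv, ← two_mul] at h
  have h2 : 0 < 2 ^ (2 * n) := by positivity
  exact (Nat.eq_of_mul_eq_mul_left h2 (by rw [mul_one]; exact h)).symm

theorem exists_pure (hn : finrank ℝ E = 2 * n) (hB : IsBiinvariantMetric B)
    (hx : IsPolarization B V V' x) (hy : IsPolarization B K K' y) (g : G) :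
    ∃ β : Spinor E, β ≠ 0 ∧ IsPureAt B V K g β := by
  have h := finrank_pure hn hB hx hy g
  obtain ⟨β, hβ, hne⟩ := Submodule.exists_ne_zero_of_finrank_eq_one _ h
  exact ⟨β, hne, (isPureAt_iff hx hy g β).2 (mem_vacuum.1 hβ)⟩

theorem IsPureAt.eq_smul (hn : finrank ℝ E = 2 * n) (hB : IsBiinvariantMetric B)
    (hx : IsPolarization B V V' x) (hy : IsPolarization B K K' y) {g : G} {α β : Spinor E}
    (hα : IsPureAt B V K g α) (hne : α ≠ 0) (hβ : IsPureAt B V K g β) : ∃ c : ℂ, β = c • α := by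
  have h := finrank_pure hn hB hx hy g
  let α' : vacuum (pureOp B x y g) := ⟨α, mem_vacuum.2 ((isPureAt_iff hx hy g α).1 hα)⟩
  let β' : vacuum (pureOp B x y g) := ⟨β, mem_vacuum.2 ((isPureAt_iff hx hy g β).1 hβ)⟩
  obtain ⟨c, hc⟩ := exists_smul_eq_of_finrank_eq_one h
    (fun h0 => hne (congrArg Subtype.val h0) : α' ≠ 0) β'
  exact ⟨c, (congrArg Subtype.val hc).symm⟩

theorem IsPureAt.conj (hx : IsPolarization B V V' x) (hy : IsPolarization B K K' y) {g : G}
    {β : Spinor E} (h : IsPureAt B V K g β) : IsPureAt B V' K' g β.conj := by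
  have h0 : (0 : Spinor E).conj = 0 := by funext k; ext v; exact map_zero (starRingEnd ℂ)
  refine ⟨fun v hv => ?_, fun k hk => ?_⟩
  · have := congrArg Spinor.conj (h.1 _ ((hx.conj_mem v).1 hv))
    rwa [conj_cliffU, conjT_conjT, h0] at this
  · have := congrArg Spinor.conj (h.2 _ ((hy.conj_mem k).1 hk))
    rwa [conj_cliffR, ← conjT_adC, conjT_conjT, h0] at this

theorem IsPureAt.pairing_ne_zero (hn : finrank ℝ E = 2 * n) (hB : IsBiinvariantMetric B)
    (hx : IsPolarization B V V' x) (hy : IsPolarization B K K' y) {g : G} {β : Spinor E}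
    (h : IsPureAt B V K g β) (hne : β ≠ 0) : spinorPairing (2 * n) β β.conj ≠ 0 := by
  intro h0
  have hz : ∀ c : ℂ, c • (0 : E [⋀^Fin (2 * n)]→L[ℝ] ℂ) = 0 := fun c => by ext v; exact mul_zero c
  have hskew : ∀ i α, spinorPairing (2 * n) β (pureOp B x y g i α) =
      -spinorPairing (2 * n) (pureOp B x y g i β) α := fun i α => by
    rcases i with i | i
    · exact neg_eq_iff_eq_neg.1 (spinorPairing_clifford hn _ β α).symm
    · exact neg_eq_iff_eq_neg.1 (spinorPairing_clifford hn _ β α).symm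
  have hdd : ∀ i j φ, pureDualOp B x y g i (pureDualOp B x y g j φ)
      + pureDualOp B x y g j (pureDualOp B x y g i φ) = 0 := by
    intro i j φ
    rcases i with i | i <;> rcases j with j | j <;>
      simp only [pureDualOp, elim_inl, elim_inr]
    · rw [cliffU_anticomm hB, hx.conj.isotropic _ (hx.conj.mem i) _ (hx.conj.mem j), zero_smul']
    · exact cliffU_cliffR hB _ _ φ
    · rw [add_comm]; exact cliffU_cliffR hB _ _ φ
    · rw [cliffR_anticomm hB, hB.formC_adC, map_neg, map_neg, LinearMap.neg_apply,
        hy.conj.isotropic _ (hy.conj.mem i) _ (hy.conj.mem j), neg_zero, neg_zero, neg_zero,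
        zero_smul']
  have hℓ := linearMap_eq_zero_of_car (pureOp B x y g) (pureDualOp B x y g) hdd
    (pureOp_dual hB hx hy g) (pairingBilin E (2 * n) β) (fun i φ => by
      rw [pairingBilin_apply, hskew, (isPureAt_iff hx hy g β).1 h i, ← pairingBilin_apply,
        map_zero, LinearMap.zero_apply, neg_zero]) (fun φ hφ => by
      have hφ' := mem_vacuum.1 hφ
      have hc : IsPureAt B V K g φ.conj := by
        have : IsPureAt B V' K' g φ := (isPureAt_iff hx.conj hy.conj g φ).2 fun i => by
          rcases i with i | i
          · exact hφ' (Sum.inl i)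
          · have h1 := hφ' (Sum.inr i)
            simp only [pureDualOp, elim_inr, map_neg, LinearMap.neg_apply, neg_eq_zero] at h1
            exact h1
        exact this.conj hx.conj hy.conj
      obtain ⟨c, hc⟩ := h.eq_smul hn hB hx hy hne hc
      have h2 := congrArg Spinor.conj hc
      rw [Spinor.conj_conj, conj_smul] at h2
      rw [h2, map_smul, pairingBilin_apply, h0, hz])
  refine hne (eq_zero_of_spinorPairing_eq_zero hn β fun α => ?_)
  exact congr_fun hℓ α

/-- Every generalized tangent vector is of the form `s(p, q)`. -/
theorem exists_leftVec_add_rightVec (hB : IsBiinvariantMetric B) (z : ℂ ⊗[ℝ] GenTangent E) :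
    ∃ p q, z = (leftVec B).baseChange ℂ p + (rightVec B).baseChange ℂ q := by
  obtain ⟨d, hd⟩ := exists_isDualOf hB (finBasis ℝ E)
  induction z using induction_on with
  | zero => exact ⟨0, 0, by simp⟩
  | tmul c e =>
    let w : E := ∑ i, e.2 (finBasis ℝ E i) • d i
    have hw : ∀ v, B (toLie G v) (toLie G w) = e.2 v := fun v => by
      rw [map_sum, map_sum]
      conv_rhs => rw [← (finBasis ℝ E).sum_repr v, map_sum]
      refine sum_congr rfl fun i _ => ?_
      rw [map_smul, map_smul, map_smul, hd i v, smul_eq_mul, smul_eq_mul, mul_comm]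
    refine ⟨c ⊗ₜ toLie G (w + (1 / 2 : ℝ) • e.1), c ⊗ₜ toLie G (w - (1 / 2 : ℝ) • e.1), ?_⟩
    rw [baseChange_tmul, baseChange_tmul, ← tmul_add]
    congr 1
    refine Prod.ext ?_ (ContinuousLinearMap.ext fun v => ?_)
    · change e.1 = (w + (1 / 2 : ℝ) • e.1) + -(w - (1 / 2 : ℝ) • e.1)
      module
    · change e.2 v = 1 / 2 * B (toLie G v) (toLie G (w + (1 / 2 : ℝ) • e.1)) +
        1 / 2 * B (toLie G v) (toLie G (w - (1 / 2 : ℝ) • e.1))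
      rw [map_add, map_sub, map_add, map_sub, hw]
      ring
  | add a b ha hb =>
    obtain ⟨p, q, rfl⟩ := ha
    obtain ⟨p', q', rfl⟩ := hb
    exact ⟨p + p', q + q', by rw [map_add, map_add]; abel⟩

/-- The annihilator of a pure spinor. -/
theorem IsPureAt.clifford_eq_zero_iff (hB : IsBiinvariantMetric B)
    (hx : IsPolarization B V V' x) (hy : IsPolarization B K K' y) {g : G} {β : Spinor E}
    (h : IsPureAt B V K g β) (hne : β ≠ 0) (z : ℂ ⊗[ℝ] GenTangent E) :
    clifford z β = 0 ↔ ∃ p ∈ V, ∃ q ∈ K,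
      z = (leftVec B).baseChange ℂ p + (rightVec B).baseChange ℂ (adC E g q) := by
  constructor
  · intro hz
    obtain ⟨p, q, rfl⟩ := exists_leftVec_add_rightVec hB z
    rw [map_add, LinearMap.add_apply] at hz
    change cliffU B p β + cliffR B q β = 0 at hz
    have hs : ∀ c : ℂ, c • β = 0 → c = 0 := fun c hc => by
      by_contra hc0
      apply hne
      have h1 : c⁻¹ • c • β = 0 := by rw [hc]; funext k; ext v; exact mul_zero _
      rw [← h1]
      funext k; ext v
      change β k v = c⁻¹ * (c * β k v)
      rw [inv_mul_cancel_left₀ hc0]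
    refine ⟨p, (hx.mem_iff p).2 fun j => ?_, adC E g⁻¹ q, (hy.mem_iff _).2 fun j => ?_, ?_⟩
    · apply hs
      have h1 := congrArg (cliffU B (x j)) hz
      rw [map_add, map_zero] at h1
      rw [← cliffU_anticomm hB, h.1 _ (hx.mem j), map_zero, zero_add]
      rw [eq_neg_of_add_eq_zero_left (cliffU_cliffR hB (x j) q β), h.1 _ (hx.mem j), map_zero,
        neg_zero, add_zero] at h1
      exact h1
    · have h1 := congrArg (cliffR B (adC E g (y j))) hz
      rw [map_add, map_zero, eq_neg_of_add_eq_zero_right (cliffU_cliffR hB p (adC E g (y j)) β),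
        h.2 _ (hy.mem j), map_zero, neg_zero, zero_add] at h1
      have h2 := cliffR_anticomm hB q (adC E g (y j)) β
      rw [h.2 _ (hy.mem j), map_zero, zero_add, h1] at h2
      have h3 := neg_eq_zero.1 (hs _ h2.symm)
      rwa [← adC_adC_inv g q, hB.formC_adC] at h3
    · rw [adC_adC_inv]
  · rintro ⟨p, hp, q, hq, rfl⟩
    rw [map_add, LinearMap.add_apply]
    change cliffU B p β + cliffR B (adC E g q) β = 0
    rw [h.1 p hp, h.2 q hq, add_zero]

/-! ### Anticommutators with the twisted derivative -/

variable {Φ Ψ : G → Spinor E} {g : G}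

theorem Spinor.smul_zero' (c : ℂ) : c • (0 : Spinor E) = 0 := by funext k; ext v; exact mul_zero c

theorem Spinor.sum_smul' {κ : Type*} (s : Finset κ) (f : κ → ℂ) (β : Spinor E) :
    ∑ i ∈ s, f i • β = (∑ i ∈ s, f i) • β := by
  classical
  induction s using Finset.induction_on with
  | empty => simpa using (zero_smul' β).symm
  | insert a s ha ih => rw [sum_insert ha, sum_insert ha, ih, add_smul']

theorem Spinor.eq_zero_of_smul_eq_zero {c : ℂ} {β : Spinor E} (hne : β ≠ 0) (h : c • β = 0) :
    c = 0 := by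
  by_contra hc0
  apply hne
  have h1 : c⁻¹ • c • β = 0 := by rw [h]; exact Spinor.smul_zero' _
  rw [← h1]
  funext k; ext v
  change β k v = c⁻¹ * (c * β k v)
  rw [inv_mul_cancel_left₀ hc0]

theorem Spinor.smul_left_cancel {c c' : ℂ} {β : Spinor E} (hne : β ≠ 0) (h : c • β = c' • β) :
    c = c' := by
  rw [← sub_eq_zero]
  refine Spinor.eq_zero_of_smul_eq_zero hne ?_
  have : (c - c') • β = c • β - c' • β := by module
  rw [this, h, sub_self]

theorem extMul_cliffU (hB : IsBiinvariantMetric B) (hd : IsDualOf B b d) (i : ι)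
    (w : Lieℂ(E, G)) (β : Spinor E) : ε(b, i) (cliffU B w β) + cliffU B w (ε(b, i) β) =
      formC B (toLieC G (d i)) w • β := by
  have h1 := cliffU_anticomm hB (toLieC G (d i)) w β
  have h2 := cliffU_cliffR hB w (toLieC G (d i)) β
  rw [← add_apply_dual hd, ← add_apply_dual hd]
  simp only [LinearMap.add_apply, map_add]
  linear_combination (norm := module) h1 + h2

theorem extMul_cliffR (hB : IsBiinvariantMetric B) (hd : IsDualOf B b d) (i : ι)
    (w : Lieℂ(E, G)) (β : Spinor E) : ε(b, i) (cliffR B w β) + cliffR B w (ε(b, i) β) =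
      -formC B (toLieC G (d i)) w • β := by
  have h1 := cliffR_anticomm hB (toLieC G (d i)) w β
  have h2 := cliffU_cliffR hB (toLieC G (d i)) w β
  rw [← add_apply_dual hd, ← add_apply_dual hd]
  simp only [LinearMap.add_apply, map_add]
  linear_combination (norm := module) h1 + h2

/-- The complex linear extension to `ℂ ⊗ 𝔤` of a functional. -/
def extendFunctional (B : BilinForm ℝ Lie(E, G)) (b : Basis ι ℝ E) (d : ι → E) (a : E →L[ℝ] ℂ)
    (w : Lieℂ(E, G)) : ℂ :=
  ∑ i, a (b i) * formC B (toLieC G (d i)) w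

theorem extendFunctional_neg_right (a : E →L[ℝ] ℂ) (w : Lieℂ(E, G)) :
    extendFunctional B b d a (-w) = -extendFunctional B b d a w := by
  simp [extendFunctional]

theorem extendFunctional_neg_left (a : E →L[ℝ] ℂ) (w : Lieℂ(E, G)) :
    extendFunctional B b d (-a) w = -extendFunctional B b d a w := by
  simp [extendFunctional]

/-- A complex covector as an element of `(T ⊕ T*) ⊗ ℂ`. -/
def covectorC (b : Basis ι ℝ E) (a : E →L[ℝ] ℂ) : ℂ ⊗[ℝ] GenTangent E :=
  ∑ i, a (b i) ⊗ₜ[ℝ] ((0, coordCLM b i) : GenTangent E)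

theorem clifford_covectorC (a : E →L[ℝ] ℂ) (β : Spinor E) :
    clifford (covectorC b a) β = ∑ i, a (b i) • ε(b, i) β := by
  rw [covectorC, map_sum, LinearMap.sum_apply]
  exact sum_congr rfl fun i _ => clifford_tmul _ _ _

theorem covectorC_cliffU (hB : IsBiinvariantMetric B) (hd : IsDualOf B b d) (a : E →L[ℝ] ℂ)
    (w : Lieℂ(E, G)) (β : Spinor E) :
    clifford (covectorC b a) (cliffU B w β) + cliffU B w (clifford (covectorC b a) β) =
      extendFunctional B b d a w • β := by
  rw [clifford_covectorC, clifford_covectorC, map_sum, ← sum_add_distrib, extendFunctional,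
    ← Spinor.sum_smul']
  refine sum_congr rfl fun i _ => ?_
  rw [map_smul]
  linear_combination (norm := module) a (b i) • extMul_cliffU hB hd i w β

theorem covectorC_cliffR (hB : IsBiinvariantMetric B) (hd : IsDualOf B b d) (a : E →L[ℝ] ℂ)
    (w : Lieℂ(E, G)) (β : Spinor E) :
    clifford (covectorC b a) (cliffR B w β) + cliffR B w (clifford (covectorC b a) β) =
      -extendFunctional B b d a w • β := by
  rw [clifford_covectorC, clifford_covectorC, map_sum, ← sum_add_distrib, extendFunctional,
    ← sum_neg_distrib, ← Spinor.sum_smul']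
  refine sum_congr rfl fun i _ => ?_
  rw [map_smul]
  linear_combination (norm := module) a (b i) • extMul_cliffR hB hd i w β

theorem covectorC_covectorC (a a' : E →L[ℝ] ℂ) (β : Spinor E) :
    clifford (covectorC b a) (clifford (covectorC b a') β)
      + clifford (covectorC b a') (clifford (covectorC b a) β) = 0 := by
  simp only [clifford_covectorC, map_sum, map_smul, smul_sum]
  rw [sum_comm (f := fun i j => a' (b i) • a (b j) • _), ← sum_add_distrib]
  refine sum_eq_zero fun i _ => ?_
  rw [← sum_add_distrib]
  refine sum_eq_zero fun j _ => ?_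
  linear_combination (norm := module)
    (a (b i) * a' (b j)) • extMul_extMul (coordCLM b i) (coordCLM b j) β

theorem lieC_neg {L : Type*} [LieRing L] [LieAlgebra ℝ L] (z w : ℂ ⊗[ℝ] L) :
    ⁅z, -w⁆ = -⁅z, w⁆ := lie_neg z w

theorem IsPolarization.frame_neg (hB : IsBiinvariantMetric B) (hy : IsPolarization B K K' y)
    (g : G) : IsDualFrame (-formC B)
      (Sum.elim (fun j => adC E g (y j)) (fun j => -adC E g (conjT (y j))))
      (Sum.elim (fun j => -adC E g (conjT (y j))) (fun j => adC E g (y j))) := by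
  have key : ∀ z : Lieℂ(E, G), z = ∑ j, formC B z (adC E g (conjT (y j))) • adC E g (y j)
        + ∑ j, formC B z (adC E g (y j)) • adC E g (conjT (y j)) := fun z => by
    have h := congrArg (adC E g) (hy.frame.left (adC E g⁻¹ z))
    rw [adC_adC_inv, sum_sum_type, map_add, map_sum, map_sum] at h
    have e : ∀ w, formC B (adC E g⁻¹ z) w = formC B z (adC E g w) := fun w => by
      rw [← hB.formC_adC g, adC_adC_inv]
    simpa only [map_smul, elim_inl, elim_inr, e] using h
  constructor
  · intro z
    conv_lhs => rw [key z]
    rw [sum_sum_type]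
    simp only [elim_inl, elim_inr, LinearMap.neg_apply, map_neg, neg_neg, neg_smul, smul_neg]
  · intro z
    conv_lhs => rw [key z]
    rw [sum_sum_type, add_comm]
    simp only [elim_inl, elim_inr, LinearMap.neg_apply, map_neg, neg_neg, neg_smul, smul_neg]

/-- `∇ Φ = a ⊗ Φ` at the point `g`. -/
def IsRecurrentAt (B : BilinForm ℝ Lie(E, G))
    (b : Basis ι ℝ E) (d : ι → E) (Φ : G → Spinor E) (a : E →L[ℝ] ℂ) (g : G) : Prop :=
  ∀ c, nabla B b d Φ g c = a c • Φ g

theorem IsPureAt.cubicElt_left (hB : IsBiinvariantMetric B) (hd : IsDualOf B b d)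
    (hx : IsPolarization B V V' x) {β : Spinor E} (h : IsPureAt B V K g β) :
    cubicElt (cliffU B) (fun i => toLieC G (b i)) (fun i => toLieC G (d i)) β =
      -(3 : ℂ) • cliffU B (weylElt x) β :=
  (isCliffordPair hB).left.cubicElt_vacuum (hd.isDualFrame hB) hx.frame hx.mem hx.lie_mem h.1

theorem IsPureAt.cubicElt_right (hB : IsBiinvariantMetric B) (hd : IsDualOf B b d)
    (hy : IsPolarization B K K' y) {β : Spinor E} (h : IsPureAt B V K g β) :
    cubicElt (cliffR B) (fun i => toLieC G (b i)) (fun i => -toLieC G (d i)) β =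
      (3 : ℂ) • cliffR B (adC E g (weylElt y)) β := by
  have h1 := (isCliffordPair hB).right.cubicElt_vacuum (hd.isDualFrame hB).neg
    (K := K.map (adC E g)) (hy.frame_neg hB g)
    (fun j => Submodule.mem_map_of_mem (hy.mem j)) (by
      rintro _ ⟨k, hk, rfl⟩ _ ⟨l, hl, rfl⟩
      exact ⟨⁅k, l⁆, hy.lie_mem k hk l hl, adC_lie g k l⟩) (φ := β) (by
      rintro _ ⟨k, hk, rfl⟩
      exact h.2 k hk)
  have h2 : ∑ j, ⁅adC E g (y j), -adC E g (conjT (y j))⁆ = -adC E g (weylElt y) := by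
    rw [weylElt, map_sum, ← sum_neg_distrib]
    exact sum_congr rfl fun j _ => by rw [adC_lie, lieC_neg]
  rw [h1]
  refine (congrArg (fun w => -(3 : ℂ) • cliffR B w β) h2).trans ?_
  simp only [map_neg, LinearMap.neg_apply]
  module

theorem IsPureAt.quadElt_left (hB : IsBiinvariantMetric B) (hd : IsDualOf B b d)
    (hx : IsPolarization B V V' x) {β : Spinor E} (h : IsPureAt B V K g β)
    {w : Lieℂ(E, G)} (hw : ∀ v ∈ V, ⁅w, v⁆ ∈ V) :
    quadElt (cliffU B) (fun i => toLieC G (b i)) (fun i => toLieC G (d i)) w β =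
      -formC B (weylElt x) w • β :=
  (isCliffordPair hB).left.quadElt_vacuum (hd.isDualFrame hB) hx.frame hx.mem h.1 w
    (fun j => hw _ (hx.mem j))

theorem IsPureAt.quadElt_right (hB : IsBiinvariantMetric B) (hd : IsDualOf B b d)
    (hy : IsPolarization B K K' y) {β : Spinor E} (h : IsPureAt B V K g β)
    {w : Lieℂ(E, G)} (hw : ∀ k ∈ K, ⁅w, k⁆ ∈ K) :
    quadElt (cliffR B) (fun i => toLieC G (b i)) (fun i => -toLieC G (d i)) (adC E g w) β =
      -formC B (weylElt y) w • β := by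
  have h1 := (isCliffordPair hB).right.quadElt_vacuum (hd.isDualFrame hB).neg
    (K := K.map (adC E g)) (hy.frame_neg hB g)
    (fun j => Submodule.mem_map_of_mem (hy.mem j)) (φ := β) (by
      rintro _ ⟨k, hk, rfl⟩
      exact h.2 k hk) (adC E g w) (fun j => ⟨⁅w, y j⁆, hw _ (hy.mem j), adC_lie g w (y j)⟩)
  have h2 : ∑ j, ⁅adC E g (y j), -adC E g (conjT (y j))⁆ = -adC E g (weylElt y) := by
    rw [weylElt, map_sum, ← sum_neg_distrib]
    exact sum_congr rfl fun j _ => by rw [adC_lie, lieC_neg]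
  rw [h1]
  congr 1
  refine (congrArg (fun z => -(-formC B) z (adC E g w)) h2).trans ?_
  simp only [map_neg, LinearMap.neg_apply, neg_neg, hB.formC_adC]

/-- The twisted derivative of a pure spinor. -/
theorem leftTwisted_pure (hB : IsBiinvariantMetric B) (hd : IsDualOf B b d)
    (hx : IsPolarization B V V' x) (hy : IsPolarization B K K' y) (hp : IsPureAt B V K g (Φ g))
    {a : E →L[ℝ] ℂ} (ha : IsRecurrentAt B b d Φ a g) :
    leftTwisted B b Φ g = clifford (covectorC b a) (Φ g) + (1 / 2 : ℂ) • cliffU B (weylElt x) (Φ g)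
      - (1 / 2 : ℂ) • cliffR B (adC E g (weylElt y)) (Φ g) := by
  rw [leftTwisted_eq hB hd, hp.cubicElt_left hB hd hx, hp.cubicElt_right hB hd hy,
    clifford_covectorC]
  have : ∑ i, ε(b, i) (nabla B b d Φ g (b i)) = ∑ i, a (b i) • ε(b, i) (Φ g) :=
    sum_congr rfl fun i _ => by rw [ha, map_smul]
  rw [this]
  module

theorem leftTwisted_cliffU (hB : IsBiinvariantMetric B) (hd : IsDualOf B b d)
    (hx : IsPolarization B V V' x) (hs : SpinorSmoothAt Φ g) (hp : IsPureAt B V K g (Φ g))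
    {a : E →L[ℝ] ℂ} (ha : IsRecurrentAt B b d Φ a g) {w : Lieℂ(E, G)} (hw : ∀ v ∈ V, ⁅w, v⁆ ∈ V) :
    leftTwisted B b (fun z => cliffU B w (Φ z)) g + cliffU B w (leftTwisted B b Φ g) =
      (extendFunctional B b d a w + 1 / 2 * formC B (weylElt x) w) • Φ g := by
  have h1 : ∑ i, ε(b, i) (nabla B b d (fun z => cliffU B w (Φ z)) g (b i))
      + ∑ i, cliffU B w (ε(b, i) (nabla B b d Φ g (b i))) =
      extendFunctional B b d a w • Φ g := by
    rw [← sum_add_distrib, extendFunctional, ← Spinor.sum_smul']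
    refine sum_congr rfl fun i _ => ?_
    rw [nabla_cliffU hB hs, extMul_cliffU hB hd, ha]
    module
  have h2 := (isCliffordPair hB).left.cubicElt_anticomm (hd.isDualFrame hB) w (Φ g)
  have h3 := (isCliffordPair hB).cubicElt_right_anticomm_left
    (b := fun i => toLieC G (b i)) (fun i => -toLieC G (d i)) w (Φ g)
  rw [hp.quadElt_left hB hd hx hw] at h2
  rw [leftTwisted_eq hB hd, leftTwisted_eq hB hd, map_sub, map_sum, map_smul, map_add]
  linear_combination (norm := module) h1 - (1 / 6 : ℂ) • h2 - (1 / 6 : ℂ) • h3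

theorem leftTwisted_cliffR (hB : IsBiinvariantMetric B) (hd : IsDualOf B b d)
    (hy : IsPolarization B K K' y) (hs : SpinorSmoothAt Φ g) (hp : IsPureAt B V K g (Φ g))
    {a : E →L[ℝ] ℂ} (ha : IsRecurrentAt B b d Φ a g) {w : Lieℂ(E, G)} (hw : ∀ k ∈ K, ⁅w, k⁆ ∈ K) :
    leftTwisted B b (fun z => cliffR B (adC E z w) (Φ z)) g
        + cliffR B (adC E g w) (leftTwisted B b Φ g) =
      (-extendFunctional B b d a (adC E g w) + 1 / 2 * formC B (weylElt y) w) • Φ g := by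
  have h1 : ∑ i, ε(b, i)
        (nabla B b d (fun z => cliffR B (adC E z w) (Φ z)) g (b i))
      + ∑ i, cliffR B (adC E g w) (ε(b, i) (nabla B b d Φ g (b i))) =
      -extendFunctional B b d a (adC E g w) • Φ g := by
    rw [← sum_add_distrib, extendFunctional, ← sum_neg_distrib, ← Spinor.sum_smul']
    refine sum_congr rfl fun i _ => ?_
    rw [nabla_cliffR hB hd hs, extMul_cliffR hB hd, ha]
    module
  have h2 := (isCliffordPair hB).right.cubicElt_anticomm (hd.isDualFrame hB).neg
    (adC E g w) (Φ g)
  have h3 := (isCliffordPair hB).cubicElt_left_anticomm_right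
    (b := fun i => toLieC G (b i)) (fun i => toLieC G (d i)) (adC E g w) (Φ g)
  rw [hp.quadElt_right hB hd hy hw] at h2
  rw [leftTwisted_eq hB hd, leftTwisted_eq hB hd, map_sub, map_sum, map_smul, map_add]
  linear_combination (norm := module) h1 - (1 / 6 : ℂ) • h2 - (1 / 6 : ℂ) • h3

/-- The field of functionals `A` satisfies the Maurer–Cartan equation, i.e. it is a closed
`1`-form in the left trivialization. -/
def IsClosedFormAt (A : G → E →L[ℝ] ℂ) (g : G) : Prop :=
  ∀ c c', lDeriv E (fun z => A z c') g c - lDeriv E (fun z => A z c) g c' =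
    A g (modelBracket G c c')

theorem leftTwisted_covectorC (hB : IsBiinvariantMetric B) (hd : IsDualOf B b d)
    (hs : SpinorSmoothAt Φ g) {A : G → E →L[ℝ] ℂ}
    (hA : ∀ c, C∞[E, ℂ] (fun z => A z c) g) (hc : IsClosedFormAt A g) :
    leftTwisted B b (fun z => clifford (covectorC b (A z)) (Φ z)) g
      + clifford (covectorC b (A g)) (leftTwisted B b Φ g) = 0 := by
  have hsm : ∀ j, SpinorSmoothAt (fun z => ε(b, j) (Φ z)) g := fun j =>
    hs.extMul contMDiffAt_const
  have hder : ∀ c, sDeriv (fun z => clifford (covectorC b (A z)) (Φ z)) g c =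
      ∑ j, lDeriv E (fun z => A z (b j)) g c • ε(b, j) (Φ g)
        + clifford (covectorC b (A g)) (sDeriv Φ g c) := fun c => by
    simp only [clifford_covectorC]
    rw [sDeriv_sum _ fun j _ => (hsm j).smul (hA (b j)), ← sum_add_distrib]
    refine sum_congr rfl fun j _ => ?_
    rw [sDeriv_smul (hsm j) (hA (b j)), sDeriv_extMul hs contMDiffAt_const, lDeriv_const,
      zero_apply]
    have : extMul (0 : E →L[ℝ] ℝ) (Φ g) = 0 := by
      rw [extMul]
      change cliffordReal (0 : GenTangent E) (Φ g) = 0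
      rw [map_zero, LinearMap.zero_apply]
    rw [this, zero_add]
  have hcov : ∀ (i : ι) (β : Spinor E), clifford (covectorC b (A g)) (ε(b, i) β) =
      -ε(b, i) (clifford (covectorC b (A g)) β) := fun i β => by
    rw [clifford_covectorC, clifford_covectorC, map_sum, ← sum_neg_distrib]
    refine sum_congr rfl fun j _ => ?_
    rw [map_smul, extMul_extMul]
    module
  have hcon : ∀ (v : E) (β : Spinor E), contr v (clifford (covectorC b (A g)) β) =
      A g v • β - clifford (covectorC b (A g)) (contr v β) := fun v β => by
    rw [clifford_covectorC, clifford_covectorC, map_sum]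
    have hv : A g v = ∑ j, A g (b j) * (coordCLM b j v : ℂ) := by
      conv_lhs => rw [← b.sum_repr v, map_sum]
      refine sum_congr rfl fun j _ => ?_
      rw [map_smul, real_smul, mul_comm]; rfl
    rw [hv, ← Spinor.sum_smul', ← sum_sub_distrib]
    refine sum_congr rfl fun j _ => ?_
    rw [map_smul, contr_extMul]
    module
  have hthree : ∀ (w : Lieℂ(E, G)) (β : Spinor E),
      cliffU B w (clifford (covectorC b (A g)) β) + cliffR B w (clifford (covectorC b (A g)) β) =
        -clifford (covectorC b (A g)) (cliffU B w β + cliffR B w β) := fun w β => by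
    have e1 := covectorC_cliffU hB hd (A g) w β
    have e2 := covectorC_cliffR hB hd (A g) w β
    rw [map_add]
    linear_combination (norm := module) e1 + e2
  have hfirst : ∑ i, ∑ j, lDeriv E (fun z => A z (b j)) g (b i) • ε(b, i) (ε(b, j) (Φ g)) =
      (1 / 2 : ℂ) • ∑ i, ∑ j, A g (modelBracket G (b i) (b j)) •
        ε(b, i) (ε(b, j) (Φ g)) := by
    have hswap : ∑ i, ∑ j, lDeriv E (fun z => A z (b j)) g (b i) • ε(b, i) (ε(b, j) (Φ g)) =
        -∑ i, ∑ j, lDeriv E (fun z => A z (b i)) g (b j) •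
          ε(b, i) (ε(b, j) (Φ g)) := by
      rw [sum_comm, ← sum_neg_distrib]
      refine sum_congr rfl fun i _ => ?_
      rw [← sum_neg_distrib]
      refine sum_congr rfl fun j _ => ?_
      rw [extMul_extMul]
      module
    have hsub : ∑ i, ∑ j, A g (modelBracket G (b i) (b j)) • ε(b, i) (ε(b, j) (Φ g)) =
        ∑ i, ∑ j, lDeriv E (fun z => A z (b j)) g (b i) •
        ε(b, i) (ε(b, j) (Φ g)) -
        ∑ i, ∑ j, lDeriv E (fun z => A z (b i)) g (b j) •
          ε(b, i) (ε(b, j) (Φ g)) := by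
      rw [← sum_sub_distrib]
      refine sum_congr rfl fun i _ => ?_
      rw [← sum_sub_distrib]
      refine sum_congr rfl fun j _ => ?_
      rw [← hc (b i) (b j)]
      module
    rw [hsub]
    linear_combination (norm := module) (1 / 2 : ℂ) • hswap
  have t1 : ∑ i, ε(b, i)
        (sDeriv (fun z => clifford (covectorC b (A z)) (Φ z)) g (b i)) =
      ∑ i, ∑ j, lDeriv E (fun z => A z (b j)) g (b i) • ε(b, i) (ε(b, j) (Φ g))
      - clifford (covectorC b (A g)) (∑ i, ε(b, i) (sDeriv Φ g (b i))) := by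
    rw [map_sum, ← sum_sub_distrib]
    refine sum_congr rfl fun i _ => ?_
    rw [hder, map_add, map_sum, hcov]
    simp only [map_smul]
    abel
  have t2 : ∑ i, ∑ j, ε(b, i) (ε(b, j)
        (contr (modelBracket G (b i) (b j)) (clifford (covectorC b (A g)) (Φ g)))) =
      ∑ i, ∑ j, A g (modelBracket G (b i) (b j)) • ε(b, i) (ε(b, j) (Φ g))
      - clifford (covectorC b (A g)) (∑ i, ∑ j, ε(b, i) (ε(b, j)
        (contr (modelBracket G (b i) (b j)) (Φ g)))) := by
    rw [map_sum, ← sum_sub_distrib]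
    refine sum_congr rfl fun i _ => ?_
    rw [map_sum, ← sum_sub_distrib]
    refine sum_congr rfl fun j _ => ?_
    rw [hcon, hcov, hcov, map_sub, map_sub, map_smul, map_smul, map_neg]
    module
  have t3 : ∑ i, ∑ j, ε(b, i) (ε(b, j)
        (cliffU B ⁅toLieC G (b i), toLieC G (b j)⁆ (clifford (covectorC b (A g)) (Φ g))
          + cliffR B ⁅toLieC G (b i), toLieC G (b j)⁆ (clifford (covectorC b (A g)) (Φ g)))) =
      - clifford (covectorC b (A g)) (∑ i, ∑ j, ε(b, i) (ε(b, j)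
        (cliffU B ⁅toLieC G (b i), toLieC G (b j)⁆ (Φ g)
          + cliffR B ⁅toLieC G (b i), toLieC G (b j)⁆ (Φ g)))) := by
    rw [map_sum, ← sum_neg_distrib]
    refine sum_congr rfl fun i _ => ?_
    rw [map_sum, ← sum_neg_distrib]
    refine sum_congr rfl fun j _ => ?_
    rw [hthree, hcov, hcov, map_neg, map_neg]
    module
  rw [leftTwisted, leftTwisted, t1, t2, t3, hfirst, map_add, map_sub, map_smul, map_smul]
  module

/-! ### Frames of pure spinors and their connection forms -/

section TopForms

variable {E : Type*} [NormedAddCommGroup E] [NormedSpace ℝ E]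
  {F : Type*} [NormedAddCommGroup F] [NormedSpace ℝ F]

theorem form_ext_basis {m : ℕ} (e : Basis (Fin m) ℝ E) {w w' : E [⋀^Fin m]→L[ℝ] F}
    (h : w e = w' e) : w = w' := by
  have : w.toAlternatingMap = w'.toAlternatingMap := by
    refine Basis.ext_alternating e fun i hi => ?_
    let σ : Perm (Fin m) := Equiv.ofBijective i (Finite.injective_iff_bijective.1 hi)
    change w.toAlternatingMap (e ∘ σ) = w'.toAlternatingMap (e ∘ σ)
    rw [AlternatingMap.map_perm, AlternatingMap.map_perm]
    exact congrArg _ h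
  ext v
  exact congr_fun this v

end TopForms

variable {U : Set G}

/-- `Φ` is a smooth frame, of locally constant norm, of the line bundle of spinors annihilated by
`s(V ⊕ K)`, in the left trivialization. -/
structure IsPureFrame (B : BilinForm ℝ Lie(E, G)) (n : ℕ)
    (V K : Submodule ℂ Lieℂ(E, G)) (U : Set G) (Φ : G → Spinor E) :
    Prop where
  isOpen : IsOpen U
  smooth : ∀ z ∈ U, SpinorSmoothAt Φ z
  pure : ∀ z ∈ U, IsPureAt B V K z (Φ z)
  ne_zero : ∀ z ∈ U, Φ z ≠ 0
  norm : ∀ z ∈ U, ∀ c, lDeriv E (fun z => spinorPairing (2 * n) (Φ z) (Φ z).conj) z c = 0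

theorem nabla_zero (g : G) (c : E) : nabla B b d (fun _ : G => (0 : Spinor E)) g c = 0 := by
  rw [nabla, sDeriv_const, map_zero, Spinor.smul_zero', add_zero]

theorem IsPureFrame.nabla_pure (hB : IsBiinvariantMetric B) (hd : IsDualOf B b d)
    (h : IsPureFrame B n V K U Φ) (hg : g ∈ U) (c : E) : IsPureAt B V K g (nabla B b d Φ g c) := by
  have hU := h.isOpen.mem_nhds hg
  refine ⟨fun v hv => ?_, fun k hk => ?_⟩
  · rw [← nabla_cliffU hB (h.smooth g hg),
      nabla_congr (Ψ := fun _ => 0) (mem_of_superset hU fun z hz => (h.pure z hz).1 v hv),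
      nabla_zero]
  · rw [← nabla_cliffR hB hd (h.smooth g hg),
      nabla_congr (Ψ := fun _ => 0) (mem_of_superset hU fun z hz => (h.pure z hz).2 k hk),
      nabla_zero]

theorem nabla_add_dir (Φ : G → Spinor E) (g : G) (c c' : E) :
    nabla B b d Φ g (c + c') = nabla B b d Φ g c + nabla B b d Φ g c' := by
  rw [nabla, nabla, nabla, sDeriv_add_dir, map_add, map_add, LinearMap.add_apply]
  module

theorem nabla_smul_dir (Φ : G → Spinor E) (g : G) (r : ℝ) (c : E) :
    nabla B b d Φ g (r • c) = (r : ℂ) • nabla B b d Φ g c := by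
  rw [nabla, nabla, sDeriv_smul_dir, Spinor.real_smul]
  have h1 : toLieC G (r • c) = (r : ℂ) • toLieC G c := by
    rw [map_smul, toLieC_apply, smul_tmul', smul_tmul']
    simp
  rw [h1, map_smul, LinearMap.smul_apply]
  module

/-- The connection form `A` with `∇ Φ = A ⊗ Φ` of a frame of pure spinors. -/
def connForm (B : BilinForm ℝ Lie(E, G)) (b : Basis ι ℝ E)
    (d : ι → E) (e : Basis (Fin (2 * n)) ℝ E) (Φ : G → Spinor E) (z : G) : E →L[ℝ] ℂ :=
  toContinuousLinearMap
    { toFun := fun c => pairingBilin E (2 * n) (nabla B b d Φ z c) (Φ z).conj e /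
        pairingBilin E (2 * n) (Φ z) (Φ z).conj e
      map_add' := fun c c' => by
        rw [nabla_add_dir, map_add, LinearMap.add_apply, ContinuousAlternatingMap.add_apply,
          add_div]
      map_smul' := fun r c => by
        rw [nabla_smul_dir, map_smul, LinearMap.smul_apply, ContinuousAlternatingMap.smul_apply,
          smul_eq_mul, mul_div_assoc, RingHom.id_apply, real_smul] }

theorem connForm_apply (e : Basis (Fin (2 * n)) ℝ E) (z : G) (c : E) :
    connForm B b d e Φ z c = spinorPairing (2 * n) (nabla B b d Φ z c) (Φ z).conj e /
      spinorPairing (2 * n) (Φ z) (Φ z).conj e := rfl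

theorem IsPureFrame.pairing_basis_ne_zero (hn : finrank ℝ E = 2 * n) (hB : IsBiinvariantMetric B)
    (hx : IsPolarization B V V' x) (hy : IsPolarization B K K' y)
    (e : Basis (Fin (2 * n)) ℝ E) (h : IsPureFrame B n V K U Φ) (hg : g ∈ U) :
    spinorPairing (2 * n) (Φ g) (Φ g).conj e ≠ 0 := fun h0 =>
  (h.pure g hg).pairing_ne_zero hn hB hx hy (h.ne_zero g hg)
    (form_ext_basis e (by rw [h0]; rfl))

theorem IsPureFrame.recurrent (hn : finrank ℝ E = 2 * n) (hB : IsBiinvariantMetric B)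
    (hd : IsDualOf B b d) (hx : IsPolarization B V V' x) (hy : IsPolarization B K K' y)
    (e : Basis (Fin (2 * n)) ℝ E) (h : IsPureFrame B n V K U Φ) (hg : g ∈ U) :
    IsRecurrentAt B b d Φ (connForm B b d e Φ g) g := fun c => by
  obtain ⟨s, hs⟩ := (h.pure g hg).eq_smul hn hB hx hy (h.ne_zero g hg) (h.nabla_pure hB hd hg c)
  have hne := h.pairing_basis_ne_zero hn hB hx hy e hg
  have : connForm B b d e Φ g c = s := by
    rw [connForm_apply, hs, div_eq_iff hne, ← pairingBilin_apply, map_smul, LinearMap.smul_apply,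
      ContinuousAlternatingMap.smul_apply, smul_eq_mul, pairingBilin_apply]
  rw [this, hs]

theorem IsPureFrame.contMDiffAt_connForm (hn : finrank ℝ E = 2 * n) (hB : IsBiinvariantMetric B)
    (hx : IsPolarization B V V' x) (hy : IsPolarization B K K' y)
    (e : Basis (Fin (2 * n)) ℝ E) (h : IsPureFrame B n V K U Φ) (hg : g ∈ U) (c : E) :
    C∞[E, ℂ] (fun z => connForm B b d e Φ z c) g := by
  have h1 := (contMDiffAt_spinorPairing ((h.smooth g hg).nabla (B := B) (b := b) (d := d) c)
    (h.smooth g hg).conj (2 * n)).clm_comp_space (formEval (F := ℂ) e)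
  have h2 := (contMDiffAt_spinorPairing (h.smooth g hg)
    (h.smooth g hg).conj (2 * n)).clm_comp_space (formEval (F := ℂ) e)
  have hne := h.pairing_basis_ne_zero hn hB hx hy e hg
  rw [contMDiffAt_iff_contDiffAt_chart le_rfl] at h1 h2 ⊢
  refine (h1.mul (h2.inv ?_)).congr_of_eventuallyEq (Eventually.of_forall fun z => div_eq_mul_inv _ _)
  rw [Function.comp_apply, extChartAt_to_inv]
  exact hne

theorem IsPureFrame.conj_connForm (hn : finrank ℝ E = 2 * n) (hB : IsBiinvariantMetric B)
    (hd : IsDualOf B b d) (hx : IsPolarization B V V' x) (hy : IsPolarization B K K' y)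
    (e : Basis (Fin (2 * n)) ℝ E) (h : IsPureFrame B n V K U Φ) (hg : g ∈ U) (c : E) :
    starRingEnd ℂ (connForm B b d e Φ g c) = -connForm B b d e Φ g c := by
  have h1 := h.norm g hg c
  have h2 := h.recurrent hn hB hd hx hy e hg c
  rw [lDeriv_spinorPairing_nabla hn hB hd (h.smooth g hg) (h.smooth g hg).conj,
    nabla_conj (h.smooth g hg), h2, conj_smul, ← pairingBilin_apply, ← pairingBilin_apply,
    map_smul, map_smul, LinearMap.smul_apply] at h1
  have h3 := congrArg (fun w => w ⇑e) h1
  have h4 : (connForm B b d e Φ g c + starRingEnd ℂ (connForm B b d e Φ g c)) *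
      spinorPairing (2 * n) (Φ g) (Φ g).conj e = 0 := by
    rw [add_mul]; exact h3
  have h5 := (mul_eq_zero.1 h4).resolve_right (h.pairing_basis_ne_zero hn hB hx hy e hg)
  linear_combination h5

theorem IsPureFrame.closed_connForm (hn : finrank ℝ E = 2 * n) (hB : IsBiinvariantMetric B)
    (hd : IsDualOf B b d) (hx : IsPolarization B V V' x) (hy : IsPolarization B K K' y)
    (e : Basis (Fin (2 * n)) ℝ E) (h : IsPureFrame B n V K U Φ) (hg : g ∈ U) :
    IsClosedFormAt (connForm B b d e Φ) g := fun c c' => by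
  have hU := h.isOpen.mem_nhds hg
  have hsm := fun a => h.contMDiffAt_connForm (b := b) (d := d) hn hB hx hy e hg a
  have hrec := fun a => h.recurrent hn hB hd hx hy e hg a
  have key : ∀ a a' : E, nabla B b d (fun z => nabla B b d Φ z a') g a =
      lDeriv E (fun z => connForm B b d e Φ z a') g a • Φ g +
        (connForm B b d e Φ g a' * connForm B b d e Φ g a) • Φ g := fun a a' => by
    rw [nabla_congr (Ψ := fun z => connForm B b d e Φ z a' • Φ z)
      (mem_of_superset hU fun z hz => h.recurrent hn hB hd hx hy e hz a'),
      nabla_smul (h.smooth g hg) (hsm a'), hrec a]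
    module
  have h1 := nabla_nabla_sub hB hd (h.smooth g hg) c c'
  rw [key, key, hrec] at h1
  refine Spinor.smul_left_cancel (h.ne_zero g hg) ?_
  linear_combination (norm := module) h1

/-! ### The potential `η` with `d_H φ = η · φ` -/

/-- `A + ½ s^L(w) - ½ s^R(k)` in the left trivialization. -/
def potential (B : BilinForm ℝ Lie(E, G)) (b : Basis ι ℝ E)
    (a : E →L[ℝ] ℂ) (w k : Lieℂ(E, G)) : ℂ ⊗[ℝ] GenTangent E :=
  covectorC b a + (1 / 2 : ℂ) • (leftVec B).baseChange ℂ w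
    - (1 / 2 : ℂ) • (rightVec B).baseChange ℂ k

theorem clifford_potential (a : E →L[ℝ] ℂ) (w k : Lieℂ(E, G))
    (β : Spinor E) : clifford (potential B b a w k) β = clifford (covectorC b a) β
      + (1 / 2 : ℂ) • cliffU B w β - (1 / 2 : ℂ) • cliffR B k β := by
  rw [potential, sub_eq_add_neg, ← neg_smul, map_add, map_add, map_smul, map_smul,
    LinearMap.add_apply, LinearMap.add_apply, LinearMap.smul_apply, LinearMap.smul_apply,
    cliffU_apply, cliffR_apply]
  module

theorem two_mul_genPairingC_potential (hB : IsBiinvariantMetric B) (hd : IsDualOf B b d)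
    (a a' : E →L[ℝ] ℂ) (w k w' k' : Lieℂ(E, G)) {β : Spinor E}
    (hβ : β ≠ 0) : 2 * genPairingC (potential B b a w k) (potential B b a' w' k') =
      1 / 2 * (extendFunctional B b d a w' + extendFunctional B b d a k'
        + extendFunctional B b d a' w + extendFunctional B b d a' k)
      + 1 / 4 * (formC B w w' - formC B k k') := by
  refine Spinor.smul_left_cancel hβ ?_
  rw [← clifford_anticomm]
  have h1 := covectorC_covectorC (b := b) a a' β
  have h2 := covectorC_cliffU hB hd a w' β
  have h3 := covectorC_cliffR hB hd a k' β
  have h4 := covectorC_cliffU hB hd a' w β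
  have h5 := covectorC_cliffR hB hd a' k β
  have h6 := cliffU_anticomm hB w w' β
  have h7 := cliffR_anticomm hB k k' β
  have h8 := cliffU_cliffR hB w k' β
  have h9 := cliffU_cliffR hB w' k β
  simp only [clifford_potential, map_add, map_sub, map_smul]
  linear_combination (norm := module) h1 + (1 / 2 : ℂ) • h2 - (1 / 2 : ℂ) • h3
    + (1 / 2 : ℂ) • h4 - (1 / 2 : ℂ) • h5 + (1 / 4 : ℂ) • h6 + (1 / 4 : ℂ) • h7
    - (1 / 4 : ℂ) • h8 - (1 / 4 : ℂ) • h9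

theorem conjT_potential {a : E →L[ℝ] ℂ} (ha : ∀ c, starRingEnd ℂ (a c) = -a c)
    {w k : Lieℂ(E, G)} (hw : conjT w = -w) (hk : conjT k = -k) :
    conjT (potential B b a w k) = -potential B b a w k := by
  have hc : starRingEnd ℂ (1 / 2) = 1 / 2 := by rw [map_div₀, map_one, map_ofNat]
  have h1 : conjT (covectorC b a) = -covectorC b a := by
    rw [covectorC, map_sum, ← sum_neg_distrib]
    exact sum_congr rfl fun i _ => by rw [conjT_tmul, ha, neg_tmul]
  rw [potential, map_sub, map_add, conjT_smul, conjT_smul, hc, conjT_baseChange, conjT_baseChange,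
    hw, hk, h1, map_neg, map_neg]
  module

theorem eq_zero_of_conjT_eq_neg (hB : IsBiinvariantMetric B) (hx : IsPolarization B V V' x)
    (hy : IsPolarization B K K' y) {β : Spinor E} (hp : IsPureAt B V K g β) (hne : β ≠ 0)
    {z : ℂ ⊗[ℝ] GenTangent E} (hz : clifford z β = 0) (hc : conjT z = -z) : z = 0 := by
  obtain ⟨p, hp', q, hq, rfl⟩ := (hp.clifford_eq_zero_iff hB hx hy hne z).1 hz
  rw [map_add, conjT_baseChange, conjT_baseChange, conjT_adC] at hc
  have hsum : (leftVec B).baseChange ℂ (p + conjT p)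
      + (rightVec B).baseChange ℂ (adC E g (q + conjT q)) = 0 := by
    rw [map_add, map_add, map_add]
    linear_combination (norm := module) hc
  have zero_of : ∀ w : Lieℂ(E, G), formC B w (conjT w) = 0 → w = 0 :=
    fun w hw => eq_zero_of_form_self_conjT B hB.symm hB.pos hw
  have hp0 : p + conjT p = 0 := by
    refine zero_of _ ?_
    rw [← genPairingC_leftVec hB, eq_neg_of_add_eq_zero_left hsum, map_neg, LinearMap.neg_apply]
    have := genPairingC_leftVec_rightVec hB (conjT (p + conjT p)) (adC E g (q + conjT q))
    rw [genPairingC, baseChange_form_symm _ (fun e f => by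
      rw [genPairing_apply, genPairing_apply]; ring)] at this
    rw [genPairingC, this]; simp
  have hq0 : q + conjT q = 0 := by
    refine zero_of _ ?_
    rw [← hB.formC_adC g, ← neg_eq_zero, ← genPairingC_rightVec hB,
      eq_neg_of_add_eq_zero_right hsum, map_neg, LinearMap.neg_apply,
      genPairingC_leftVec_rightVec hB]
    simp
  have hp1 : p = 0 := by
    refine zero_of p ?_
    rw [eq_neg_of_add_eq_zero_right hp0, map_neg, hx.isotropic p hp' p hp', neg_zero]
  have hq1 : q = 0 := by
    refine zero_of q ?_
    rw [eq_neg_of_add_eq_zero_right hq0, map_neg, hy.isotropic q hq q hq, neg_zero]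
  rw [hp1, hq1]; simp

theorem leftTwisted_add (hB : IsBiinvariantMetric B) (hd : IsDualOf B b d)
    (h : SpinorSmoothAt Φ g) (h' : SpinorSmoothAt Ψ g) :
    leftTwisted B b (fun z => Φ z + Ψ z) g = leftTwisted B b Φ g + leftTwisted B b Ψ g := by
  rw [leftTwisted_eq hB hd, leftTwisted_eq hB hd, leftTwisted_eq hB hd, map_add, map_add]
  have : ∑ i, ε(b, i) (nabla B b d (fun z => Φ z + Ψ z) g (b i)) =
      ∑ i, ε(b, i) (nabla B b d Φ g (b i))
        + ∑ i, ε(b, i) (nabla B b d Ψ g (b i)) := by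
    rw [← sum_add_distrib]
    exact sum_congr rfl fun i _ => by rw [nabla_add h h', map_add]
  rw [this]
  module

theorem leftTwisted_const_smul (hB : IsBiinvariantMetric B) (hd : IsDualOf B b d)
    (h : SpinorSmoothAt Φ g) (s : ℂ) :
    leftTwisted B b (fun z => s • Φ z) g = s • leftTwisted B b Φ g := by
  rw [leftTwisted_eq hB hd, leftTwisted_eq hB hd, map_smul, map_smul]
  have : ∑ i, ε(b, i) (nabla B b d (fun z => s • Φ z) g (b i)) =
      s • ∑ i, ε(b, i) (nabla B b d Φ g (b i)) := by
    rw [smul_sum]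
    refine sum_congr rfl fun i _ => ?_
    rw [nabla_smul h contMDiffAt_const, lDeriv_const, zero_apply, zero_smul', zero_add, map_smul]
  rw [this]
  module

theorem SpinorSmoothAt.covectorC (h : SpinorSmoothAt Φ g) {A : G → E →L[ℝ] ℂ}
    (hA : ∀ c, C∞[E, ℂ] (fun z => A z c) g) :
    SpinorSmoothAt (fun z => clifford (_root_.covectorC b (A z)) (Φ z)) g := by
  simp only [clifford_covectorC]
  exact SpinorSmoothAt.sum _ fun j _ => (h.extMul contMDiffAt_const).smul (hA (b j))

/-- The twisted Lie derivative of a pure spinor along a potential. -/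
theorem leftTwisted_potential (hB : IsBiinvariantMetric B) (hd : IsDualOf B b d)
    (hx : IsPolarization B V V' x) (hy : IsPolarization B K K' y)
    (hs : SpinorSmoothAt Φ g) (hp : IsPureAt B V K g (Φ g))
    {a : E →L[ℝ] ℂ} (ha : IsRecurrentAt B b d Φ a g) {A : G → E →L[ℝ] ℂ}
    (hA : ∀ c, C∞[E, ℂ] (fun z => A z c) g) (hc : IsClosedFormAt A g)
    {w k : Lieℂ(E, G)} (hw : ∀ v ∈ V, ⁅w, v⁆ ∈ V) (hk : ∀ v ∈ K, ⁅k, v⁆ ∈ K) :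
    leftTwisted B b (fun z => clifford (potential B b (A z) w (adC E z k)) (Φ z)) g
        + clifford (potential B b (A g) w (adC E g k)) (leftTwisted B b Φ g) =
      (1 / 2 * (extendFunctional B b d a w + 1 / 2 * formC B (weylElt x) w)
        - 1 / 2 * (-extendFunctional B b d a (adC E g k) + 1 / 2 * formC B (weylElt y) k)) •
        Φ g := by
  have e1 := leftTwisted_covectorC hB hd hs hA hc
  have e2 := leftTwisted_cliffU hB hd hx hs hp ha hw
  have e3 := leftTwisted_cliffR hB hd hy hs hp ha hk
  have h1 : (fun z => clifford (potential B b (A z) w (adC E z k)) (Φ z)) =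
      fun z => (clifford (covectorC b (A z)) (Φ z) + (1 / 2 : ℂ) • cliffU B w (Φ z))
        + (-(1 / 2) : ℂ) • cliffR B (adC E z k) (Φ z) := by
    funext z
    rw [clifford_potential]
    module
  rw [h1, leftTwisted_add hB hd ((hs.covectorC hA).add ((hs.cliffU w).const_smul _))
    ((hs.cliffR_adC k).const_smul _), leftTwisted_add hB hd (hs.covectorC hA)
    ((hs.cliffU w).const_smul _), leftTwisted_const_smul hB hd (hs.cliffU w),
    leftTwisted_const_smul hB hd (hs.cliffR_adC k), clifford_potential]
  linear_combination (norm := module) e1 + (1 / 2 : ℂ) • e2 - (1 / 2 : ℂ) • e3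

/-! ### The curvature form of a normalized trivialization -/

variable (E) in
/-- The complexified left trivialization of `T ⊕ T*`. -/
def genLeftC (g : G) : (ℂ ⊗[ℝ] GenTangent E) →ₗ[ℂ] (ℂ ⊗[ℝ] GenTangent E) :=
  (genLeft E g : GenTangent E →ₗ[ℝ] GenTangent E).baseChange ℂ

theorem genLeftC_injective (g : G) : Function.Injective (genLeftC E g) := by
  have h : ∀ z, ((genLeft E g).symm : GenTangent E →ₗ[ℝ] GenTangent E).baseChange ℂ
      (genLeftC E g z) = z := fun z => by
    rw [genLeftC, ← comp_apply, ← baseChange_comp]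
    simp
  exact fun z w hzw => by rw [← h z, hzw, h w]

theorem genPairingC_genLeftC (g : G) (z w : ℂ ⊗[ℝ] GenTangent E) :
    genPairingC (genLeftC E g z) (genLeftC E g w) = genPairingC z w := by
  induction z using induction_on with
  | zero => simp
  | add a b ha hb => rw [map_add, map_add, map_add, LinearMap.add_apply, LinearMap.add_apply, ha, hb]
  | tmul r u =>
    induction w using induction_on with
    | zero => simp
    | add a b ha hb => rw [map_add, map_add, map_add, ha, hb]
    | tmul s v =>
      rw [genLeftC, baseChange_tmul, baseChange_tmul, genPairingC,
        BilinForm.baseChange_tmul, BilinForm.baseChange_tmul]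
      exact congrArg (· • (r * s)) (genPairing_genLeft g u v)

theorem genLeftC_double (hB : IsBiinvariantMetric B) (g : G) (p q : Lieℂ(E, G)) :
    genLeftC E g ((sL B g).baseChange ℂ p + (sR B g).baseChange ℂ q) =
      (leftVec B).baseChange ℂ p + (rightVec B).baseChange ℂ (adC E g q) := by
  have h1 : (genLeft E g : GenTangent E →ₗ[ℝ] GenTangent E) ∘ₗ sL B g = leftVec B :=
    LinearMap.ext fun ξ => genLeft_sL g ξ
  have h2 : (genLeft E g : GenTangent E →ₗ[ℝ] GenTangent E) ∘ₗ sR B g =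
      rightVec B ∘ₗ adLie E g := LinearMap.ext fun ξ => genLeft_sR hB g ξ
  rw [map_add, genLeftC, ← comp_apply, ← baseChange_comp, h1,
    ← comp_apply, ← baseChange_comp, h2, baseChange_comp]
  rfl

theorem mem_doubleSubspace_iff (hB : IsBiinvariantMetric B) (g : G) (z : ℂ ⊗[ℝ] GenTangent E) :
    z ∈ doubleSubspace B g V K ↔ ∃ p ∈ V, ∃ q ∈ K, genLeftC E g z =
      (leftVec B).baseChange ℂ p + (rightVec B).baseChange ℂ (adC E g q) := by
  constructor
  · rintro ⟨⟨p, q⟩, ⟨hp, hq⟩, rfl⟩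
    exact ⟨p, hp, q, hq, genLeftC_double hB g p q⟩
  · rintro ⟨p, hp, q, hq, h⟩
    exact ⟨(p, q), ⟨hp, hq⟩, genLeftC_injective g ((genLeftC_double hB g p q).trans h.symm)⟩

theorem mem_spinorKer {β : Spinor E} {z : ℂ ⊗[ℝ] GenTangent E} :
    z ∈ spinorKer β ↔ clifford z β = 0 := Iff.rfl

theorem pull_lTrans_injective (g : G) : Function.Injective (pull (lTrans E g)) :=
  fun α β h => by
    have key : ∀ α : Spinor E, pull (lMC E g) (pull (lTrans E g) α) = α :=
      fun α => by
        funext k; ext v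
        simp [pull_apply]
    rw [← key α, h, key β]

theorem isPureAt_of_spinorKer (hB : IsBiinvariantMetric B) {β : Spinor E}
    (h : spinorKer β = doubleSubspace B g V K) : IsPureAt B V K g (pull (lTrans E g) β) := by
  have key : ∀ p ∈ V, ∀ q ∈ K, clifford ((leftVec B).baseChange ℂ p
      + (rightVec B).baseChange ℂ (adC E g q)) (pull (lTrans E g) β) = 0 := by
    intro p hp q hq
    have h1 : (sL B g).baseChange ℂ p + (sR B g).baseChange ℂ q ∈ spinorKer β := by
      rw [h]; exact ⟨(p, q), ⟨hp, hq⟩, rfl⟩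
    have h2 := pull_clifford g ((sL B g).baseChange ℂ p + (sR B g).baseChange ℂ q) β
    rw [mem_spinorKer.1 h1, map_zero] at h2
    rw [← genLeftC_double hB]
    exact h2.symm
  refine ⟨fun v hv => ?_, fun k hk => ?_⟩
  · have := key v hv 0 K.zero_mem
    rwa [map_zero, map_zero, add_zero] at this
  · have := key 0 V.zero_mem k hk
    rwa [map_zero, zero_add] at this

theorem spinorKer_of_isPureAt (hB : IsBiinvariantMetric B) (hx : IsPolarization B V V' x)
    (hy : IsPolarization B K K' y) {β : Spinor E}
    (h : IsPureAt B V K g (pull (lTrans E g) β)) (hne : β ≠ 0) :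
    spinorKer β = doubleSubspace B g V K := by
  have hne' : pull (lTrans E g) β ≠ 0 := fun h0 =>
    hne (pull_lTrans_injective g (h0.trans (map_zero _).symm))
  ext z
  rw [mem_doubleSubspace_iff hB, ← h.clifford_eq_zero_iff hB hx hy hne', mem_spinorKer]
  have h2 : pull (lTrans E g) (clifford z β) =
    clifford (genLeftC E g z) (pull (lTrans E g) β) := pull_clifford g z β
  rw [← h2]
  exact ⟨fun h => by rw [h, map_zero], fun h => pull_lTrans_injective g (h.trans (map_zero _).symm)⟩

theorem leftTwisted_congr (hB : IsBiinvariantMetric B) (hd : IsDualOf B b d)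
    (e : Φ =ᶠ[𝓝 g] Ψ) : leftTwisted B b Φ g = leftTwisted B b Ψ g := by
  rw [leftTwisted_eq hB hd, leftTwisted_eq hB hd, e.eq_of_nhds]
  simp only [nabla_congr e]

theorem IsPureFrame.leftTwisted_eq_potential (hn : finrank ℝ E = 2 * n)
    (hB : IsBiinvariantMetric B) (hd : IsDualOf B b d) (hx : IsPolarization B V V' x)
    (hy : IsPolarization B K K' y) (e : Basis (Fin (2 * n)) ℝ E)
    (h : IsPureFrame B n V K U Φ) (hg : g ∈ U) :
    leftTwisted B b Φ g = clifford (potential B b (connForm B b d e Φ g) (weylElt x)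
      (adC E g (weylElt y))) (Φ g) := by
  rw [leftTwisted_pure hB hd hx hy (h.pure g hg) (h.recurrent hn hB hd hx hy e hg),
    clifford_potential]

theorem IsPureFrame.eq_potential (hn : finrank ℝ E = 2 * n)
    (hB : IsBiinvariantMetric B) (hd : IsDualOf B b d) (hx : IsPolarization B V V' x)
    (hy : IsPolarization B K K' y) (e : Basis (Fin (2 * n)) ℝ E)
    (h : IsPureFrame B n V K U Φ) (hg : g ∈ U) {u : ℂ ⊗[ℝ] GenTangent E} (hu : conjT u = -u)
    (hd' : leftTwisted B b Φ g = clifford u (Φ g)) :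
    u = potential B b (connForm B b d e Φ g) (weylElt x) (adC E g (weylElt y)) := by
  rw [← sub_eq_zero]
  refine eq_zero_of_conjT_eq_neg hB hx hy (h.pure g hg) (h.ne_zero g hg) ?_ ?_
  · rw [sub_eq_add_neg, map_add, map_neg, LinearMap.add_apply, LinearMap.neg_apply,
      ← h.leftTwisted_eq_potential hn hB hd hx hy e hg, hd', add_neg_cancel]
  · rw [map_sub, hu, conjT_potential (h.conj_connForm hn hB hd hx hy e hg) (conjT_weylElt x)]
    · abel
    · rw [conjT_adC, conjT_weylElt, map_neg]

theorem SpinorSmoothAt.potential (hs : SpinorSmoothAt Φ g) {A : G → E →L[ℝ] ℂ}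
    (hA : ∀ c, C∞[E, ℂ] (fun z => A z c) g) (w k : Lieℂ(E, G)) :
    SpinorSmoothAt (fun z => clifford (_root_.potential B b (A z) w (adC E z k)) (Φ z)) g := by
  refine (((hs.covectorC (b := b) hA).add ((hs.cliffU (B := B) w).const_smul (1 / 2))).add
    ((hs.cliffR_adC (B := B) k).const_smul (-(1 / 2)))).congr (Eventually.of_forall fun z => ?_)
  beta_reduce
  rw [clifford_potential]
  module

/-- The twisted Lie derivative of the conjugate of one frame along the potential of another. -/
theorem IsPureFrame.leftTwisted_conj (hn : finrank ℝ E = 2 * n)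
    (hB : IsBiinvariantMetric B) (hd : IsDualOf B b d) (hx : IsPolarization B V V' x)
    (hy : IsPolarization B K K' y) (e : Basis (Fin (2 * n)) ℝ E)
    (h : IsPureFrame B n V K U Φ) (hg : g ∈ U) {A : G → E →L[ℝ] ℂ}
    (hA : ∀ c, C∞[E, ℂ] (fun z => A z c) g) (hc : IsClosedFormAt A g)
    {w k : Lieℂ(E, G)} (hw : ∀ v ∈ V', ⁅w, v⁆ ∈ V') (hk : ∀ v ∈ K', ⁅k, v⁆ ∈ K') :
    leftTwisted B b (fun z => clifford (potential B b (A z) w (adC E z k)) (Φ z).conj) g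
        + clifford (potential B b (A g) w (adC E g k)) (leftTwisted B b (fun z => (Φ z).conj) g) =
      (-(1 / 2) * (extendFunctional B b d (connForm B b d e Φ g) w + 1 / 2 * formC B (weylElt x) w)
        - 1 / 2 * (extendFunctional B b d (connForm B b d e Φ g) (adC E g k)
          - 1 / 2 * formC B (weylElt y) k)) • (Φ g).conj := by
  have hrec : IsRecurrentAt B b d (fun z => (Φ z).conj) (-connForm B b d e Φ g) g := fun c => by
    rw [nabla_conj (h.smooth g hg), h.recurrent hn hB hd hx hy e hg c, conj_smul,
      h.conj_connForm hn hB hd hx hy e hg, neg_apply]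
  have key := leftTwisted_potential hB hd hx.conj hy.conj (h.smooth g hg).conj
    ((h.pure g hg).conj hx hy) hrec hA hc hw hk
  rw [key, weylElt_conj, weylElt_conj, extendFunctional_neg_left, extendFunctional_neg_left]
  simp only [map_neg, LinearMap.neg_apply]
  congr 1
  ring

theorem leftSpinor_norm {φ : G → Spinor E} {vol : G → E [⋀^Fin (2 * n)]→L[ℝ] ℝ}
    (h : (I ^ n)⁻¹ • spinorPairing (2 * n) (φ g) (φ g).conj = ofRealForm (vol g)) :
    spinorPairing (2 * n) (leftSpinor φ g) (leftSpinor φ g).conj = (I ^ n) •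
      ofRealForm (leftForm vol g) := by
  have h1 : spinorPairing (2 * n) (φ g) (φ g).conj = (I ^ n) •
      ofRealForm (vol g) := by
    rw [← h, smul_inv_smul₀ (pow_ne_zero n I_ne_zero)]
  rw [leftSpinor, pull_conj, ← pull_spinorPairing, h1]
  rfl

theorem ne_zero_of_pairing {w : E [⋀^Fin (2 * n)]→L[ℝ] ℝ} {β : Spinor E} (hw : w ≠ 0)
    (h : (I ^ n)⁻¹ • spinorPairing (2 * n) β β.conj = ofRealForm w) : β ≠ 0 := by
  rintro rfl
  rw [← pairingBilin_apply, map_zero, LinearMap.zero_apply] at h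
  refine hw (ContinuousAlternatingMap.ext fun v => ?_)
  have h4 : (0 : ℂ) = ((w v : ℝ) : ℂ) := by
    rw [← mul_zero (I ^ n)⁻¹]; exact congrArg (fun w => w v) h
  exact_mod_cast h4.symm

theorem isPureFrame_leftSpinor (hB : IsBiinvariantMetric B) (hU : IsOpen U) {φ : G → Spinor E}
    {vol : G → E [⋀^Fin (2 * n)]→L[ℝ] ℝ} (hs : ∀ z ∈ U, ∀ k, FormSmoothAt (fun y => φ y k) z)
    (hker : ∀ z ∈ U, spinorKer (φ z) = doubleSubspace B z V K)
    (hnorm : ∀ z ∈ U, (I ^ n)⁻¹ • spinorPairing (2 * n) (φ z) (φ z).conj = ofRealForm (vol z))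
    (hvol0 : ∀ z, vol z ≠ 0) (hvol : ∀ g, ∀ᶠ z in 𝓝 g, leftForm vol z = leftForm vol g) :
    IsPureFrame B n V K U (leftSpinor φ) where
  isOpen := hU
  smooth z hz := spinorSmoothAt_leftSpinor.2 (hs z hz)
  pure z hz := isPureAt_of_spinorKer hB (hker z hz)
  ne_zero z hz h0 := ne_zero_of_pairing (hvol0 z) (hnorm z hz)
    (pull_lTrans_injective z (h0.trans (map_zero _).symm))
  norm z hz c := by
    rw [lDeriv_congr (f' := fun _ => (I ^ n) •
      ofRealForm (leftForm vol z)), lDeriv_const, zero_apply]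
    filter_upwards [hvol z, hU.mem_nhds hz] with t ht htU
    rw [leftSpinor_norm (hnorm t htU), ht]

theorem leftSpinor_conj (φ : G → Spinor E) :
    (leftSpinor fun y => (φ y).conj) = fun z => (leftSpinor φ z).conj :=
  funext fun _ => (pull_conj _ _).symm

theorem pull_twistedLieDeriv (hB : IsBiinvariantMetric B) (hd : IsDualOf B b d)
    {u : G → ℂ ⊗[ℝ] GenTangent E} {φ : G → Spinor E} (hφ : SpinorSmoothAt (leftSpinor φ) g)
    {u' : G → ℂ ⊗[ℝ] GenTangent E} (hu : ∀ᶠ z in 𝓝 g, genLeftC E z (u z) = u' z)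
    (hs : SpinorSmoothAt (fun z => clifford (u' z) (leftSpinor φ z)) g) :
    pull (lTrans E g) (twistedLieDeriv (cartanH B) u φ g) =
      leftTwisted B b (fun z => clifford (u' z) (leftSpinor φ z)) g
        + clifford (u' g) (leftTwisted B b (leftSpinor φ) g) := by
  have he : (leftSpinor fun z => clifford (u z) (φ z)) =ᶠ[𝓝 g]
      fun z => clifford (u' z) (leftSpinor φ z) :=
    hu.mono fun z hz => by beta_reduce; rw [← hz]; exact pull_clifford z (u z) (φ z)
  have hcl : pull (lTrans E g) (clifford (u g) (twistedDeriv (cartanH B) φ g)) =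
    clifford (genLeftC E g (u g)) (pull (lTrans E g) (twistedDeriv (cartanH B) φ g)) :=
    pull_clifford _ _ _
  rw [twistedLieDeriv, map_add, hcl, hu.self_of_nhds,
    pull_twistedDeriv hB hd (spinorSmoothAt_leftSpinor.1 (hs.congr he)),
    pull_twistedDeriv hB hd (spinorSmoothAt_leftSpinor.1 hφ), leftTwisted_congr hB hd he]

theorem conjT_genLeftC_I (g : G) (u : GenTangent E) :
    conjT (genLeftC E g (I ⊗ₜ[ℝ] u)) = -genLeftC E g (I ⊗ₜ[ℝ] u) := by
  rw [genLeftC, conjT_baseChange, conjT_tmul, conj_I, neg_tmul, map_neg]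

/-- The scalar curvature of the generalized Kähler structure of a polarization. -/
theorem curvatureForm_eq (hn : finrank ℝ E = 2 * n) (hB : IsBiinvariantMetric B)
    (hx : IsPolarization B V V' x) {J₁ J₂ : G → GenTangent E →ₗ[ℝ] GenTangent E}
    {vol : G → E [⋀^Fin (2 * n)]→L[ℝ] ℝ} (hJ₁ : ∀ g, eigenbundle (J₁ g) = doubleSubspace B g V V)
    (hJ₂ : ∀ g, eigenbundle (J₂ g) = doubleSubspace B g V V') (hvol0 : ∀ z, vol z ≠ 0)
    (hvol : ∀ g, ∀ᶠ z in 𝓝 g, leftForm vol z = leftForm vol g)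
    (T : NormalizedTrivialization n (cartanH B) J₁ J₂ vol) (hg : g ∈ T.U) :
    (-(1 / 2) * (formC B (weylElt x) (weylElt x)).re) • vol g = T.curvatureForm g := by
  let e : Basis (Fin (2 * n)) ℝ E := finBasisOfFinrankEq ℝ E hn
  obtain ⟨d, hd⟩ := exists_isDualOf hB e
  have hU := T.isOpen.mem_nhds hg
  have hΦ : IsPureFrame B n V V T.U (leftSpinor T.φ) := isPureFrame_leftSpinor hB T.isOpen
    T.φ_smooth (fun z hz => (T.φ_ker z hz).trans (hJ₁ z)) T.φ_norm hvol0 hvol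
  have hΨ : IsPureFrame B n V V' T.U (leftSpinor T.ψ) := isPureFrame_leftSpinor hB T.isOpen
    T.ψ_smooth (fun z hz => (T.ψ_ker z hz).trans (hJ₂ z)) T.ψ_norm hvol0 hvol
  have hη : ∀ z ∈ T.U, genLeftC E z (T.η z) =
      potential B e (connForm B e d e (leftSpinor T.φ) z) (weylElt x) (adC E z (weylElt x)) :=
    fun z hz => hΦ.eq_potential hn hB hd hx hx e hz (conjT_genLeftC_I z _) (by
      rw [← pull_twistedDeriv hB hd (T.φ_smooth z hz), T.φ_deriv z hz]
      exact pull_clifford _ _ _)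
  have hζ : ∀ z ∈ T.U, genLeftC E z (T.ζ z) =
      potential B e (connForm B e d e (leftSpinor T.ψ) z) (weylElt x)
        (adC E z (weylElt fun j => conjT (x j))) :=
    fun z hz => hΨ.eq_potential hn hB hd hx hx.conj e hz (conjT_genLeftC_I z _) (by
      rw [← pull_twistedDeriv hB hd (T.ψ_smooth z hz), T.ψ_deriv z hz]
      exact pull_clifford _ _ _)
  have hw' : ∀ v ∈ V', ⁅weylElt x, v⁆ ∈ V' := fun v hv => by
    have := hx.conj.weyl_mem v hv
    rw [weylElt_conj] at this
    have h2 := V'.neg_mem this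
    rwa [neg_lie, neg_neg] at h2
  have hA := fun c => hΦ.contMDiffAt_connForm (b := e) (d := d) hn hB hx hx e hg c
  have hA' := fun c => hΨ.contMDiffAt_connForm (b := e) (d := d) hn hB hx hx.conj e hg c
  have h1 := hΨ.leftTwisted_conj hn hB hd hx hx.conj e hg hA
    (hΦ.closed_connForm hn hB hd hx hx e hg) hw' hx.weyl_mem
  have h2 := hΦ.leftTwisted_conj hn hB hd hx hx e hg hA'
    (hΨ.closed_connForm hn hB hd hx hx.conj e hg) hw' hx.conj.weyl_mem
  have h3 := two_mul_genPairingC_potential hB hd (connForm B e d e (leftSpinor T.ψ) g)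
    (connForm B e d e (leftSpinor T.φ) g) (weylElt x) (adC E g (weylElt fun j => conjT (x j)))
    (weylElt x) (adC E g (weylElt x)) (hΦ.ne_zero g hg)
  rw [← hη g hg, ← hζ g hg, genPairingC_genLeftC] at h3
  have ev : ∀ {P : G → Prop}, (∀ z ∈ T.U, P z) → ∀ᶠ z in 𝓝 g, P z := fun h => mem_of_superset hU h
  have key : ∀ {φ : G → Spinor E} {X : Spinor E} {c : ℂ},
      (I ^ n)⁻¹ • spinorPairing (2 * n) (φ g) (φ g).conj = ofRealForm (vol g) →
      pull (lTrans E g) X = c • (leftSpinor φ g).conj →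
      (I ^ n)⁻¹ • spinorPairing (2 * n) (φ g) X =
        c • ofRealForm (vol g) := by
    intro φ X c hφ hX
    have hX' : X = c • (φ g).conj := pull_lTrans_injective g (by
      rw [hX, leftSpinor, pull_conj, map_smul])
    rw [hX', ← pairingBilin_apply, map_smul, pairingBilin_apply, smul_comm, hφ]
  have k1 := key (T.ψ_norm g hg) ((pull_twistedLieDeriv hB hd (u := T.η)
    (by rw [leftSpinor_conj]; exact (hΨ.smooth g hg).conj) (ev hη)
    (by rw [leftSpinor_conj]; exact (hΨ.smooth g hg).conj.potential hA _ _)).trans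
      (by rw [leftSpinor_conj]; exact h1))
  have k2 := key (T.φ_norm g hg) ((pull_twistedLieDeriv hB hd (u := T.ζ)
    (by rw [leftSpinor_conj]; exact (hΦ.smooth g hg).conj) (ev hζ)
    (by rw [leftSpinor_conj]; exact (hΦ.smooth g hg).conj.potential hA' _ _)).trans
      (by rw [leftSpinor_conj]; exact h2))
  rw [NormalizedTrivialization.curvatureForm, k1, k2]
  rw [weylElt_conj] at h3 ⊢
  simp only [map_neg, LinearMap.neg_apply, extendFunctional_neg_right, hB.formC_adC] at h3 ⊢
  have h4 : 2 * (genPairingC (T.ζ g) (T.η g)).re = (2 * genPairingC (T.ζ g) (T.η g)).re := by simp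
  rw [h4, h3]
  ext v
  simp only [ContinuousAlternatingMap.smul_apply, ContinuousAlternatingMap.add_apply,
    ContinuousLinearMap.compContinuousAlternatingMap_coe, Function.comp_apply, smul_eq_mul,
    Complex.reCLM_apply, add_re, Complex.ofRealCLM_apply, Complex.re_mul_ofReal]
  rw [← add_mul, ← add_mul, ← add_re, ← add_re]
  have h5 : ∀ r : ℂ, -(1 / 2) * r.re = (-(1 / 2) * r).re := fun r => by rw [mul_re]; norm_num
  rw [h5]
  congr 1
  rw [← add_re]
  congr 1
  ring

/-! ### Sections of `T ⊕ T*` and the Courant bracket in the left trivialization -/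

theorem contMDiffAt_vectorField_iff {v : G → E} :
    ContMDiffAt 𝓘(ℝ, E) 𝓘(ℝ, E).tangent ∞ (fun y => (⟨y, v y⟩ : TangentBundle 𝓘(ℝ, E) G)) g ↔
      C∞[E, E] (fun y => lMC E y (v y)) g := by
  have hsrc := extChartAt_source_mem_nhds (I := 𝓘(ℝ, E)) g
  have h0 := Bundle.contMDiffAt_section (IB := 𝓘(ℝ, E)) (n := ∞) (F := E)
    (E := (TangentSpace 𝓘(ℝ, E) : G → Type _)) (s := v) g
  refine h0.trans ?_
  have h1 : (fun y => (trivializationAt E (TangentSpace 𝓘(ℝ, E)) g ⟨y, v y⟩).2) =ᶠ[𝓝 g]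
      fun y => modelDeriv E E (chart[E] g) y (v y) := by
    filter_upwards [hsrc] with y hy
    have hy' : y ∈ (chartAt E g).source := by simpa using hy
    have := TangentBundle.continuousLinearMapAt_trivializationAt (I := 𝓘(ℝ, E)) hy'
    rw [modelDeriv, ← this]
    have hb : y ∈ (trivializationAt E (TangentSpace 𝓘(ℝ, E) : G → Type _) g).baseSet := by
      simpa using hy'
    exact (congrFun (Bundle.Trivialization.coe_linearMapAt_of_mem
      (trivializationAt E (TangentSpace 𝓘(ℝ, E) : G → Type _) g) (R := ℝ) hb) (v y)).symm
  have hF : C∞[E, E →L[ℝ] E]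
      (fun y => chartFrame E g (chart[E] g y)) g :=
    (contDiffAt_chartFrame g).contMDiffAt.comp g (contMDiffAt_extChartAt)
  have hC : C∞[E, E →L[ℝ] E]
      (fun y => chartCoframe E g (chart[E] g y)) g :=
    (contDiffAt_chartCoframe g).contMDiffAt.comp g (contMDiffAt_extChartAt)
  constructor
  · intro h
    have h2 := hC.clm_apply (h.congr_of_eventuallyEq h1.symm)
    refine h2.congr_of_eventuallyEq ?_
    filter_upwards [hsrc] with y hy
    rw [chartCoframe, (chart[E] g).left_inv hy, ContinuousLinearMap.comp_apply,
      ← ContinuousLinearMap.comp_apply (modelDeriv E E _ _)]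
    have := modelDeriv_symm_comp_chart ((chart[E] g).map_source hy)
    rw [(chart[E] g).left_inv hy] at this
    rw [this, ContinuousLinearMap.id_apply]
  · intro h
    refine (hF.clm_apply h).congr_of_eventuallyEq ?_
    filter_upwards [hsrc, h1] with y hy h1y
    rw [h1y, chartFrame, (chart[E] g).left_inv hy, ContinuousLinearMap.comp_apply, lTrans_lMC]

theorem contMDiffAt_clm_iff {F : Type*} [NormedAddCommGroup F] [NormedSpace ℝ F]
    [FiniteDimensional ℝ F] {w : G → E →L[ℝ] F} : C∞[E, E →L[ℝ] F] w g ↔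
      ∀ v, C∞[E, F] (fun y => w y v) g := by
  simp only [contMDiffAt_iff_contDiffAt_chart le_rfl]
  refine ⟨fun h v => h.clm_apply contDiffAt_const, fun h => ?_⟩
  let b := finBasis ℝ E
  have key : w = fun y => ∑ i, smulRightL ℝ E F (coordCLM b i) (w y (b i)) := by
    funext y
    ext v
    have h1 : ∑ i, b.repr v i • w y (b i) = w y v := by
      conv_rhs => rw [← b.sum_repr v, map_sum]
      simp only [map_smul]
    simp [coordCLM, h1]
  have h2 : ContDiffAt ℝ ∞ (fun y => ∑ i, smulRightL ℝ E F (coordCLM b i)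
      ((w ∘ (chart[E] g).symm) y (b i))) (chart[E] g g) :=
    ContDiffAt.sum fun i _ =>
      (ContinuousLinearMap.contDiff _).contDiffAt.comp _ (h (b i))
  refine h2.congr_of_eventuallyEq (Eventually.of_forall fun y => ?_)
  exact congrFun key _

theorem sectionSmoothAt_iff {e : G → GenTangent E} : SectionSmoothAt e g ↔
      C∞[E, GenTangent E] (fun z => genLeft E z (e z)) g := by
  rw [SectionSmoothAt, contMDiffAt_vectorField_iff, formSmoothAt_iff, contMDiffAt_form_iff]
  constructor
  · rintro ⟨h1, h2⟩
    exact h1.prodMk_space (contMDiffAt_clm_iff.2 fun v => h2 fun _ => v)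
  · intro h
    refine ⟨h.clm_comp_space (fst ℝ E (E →L[ℝ] ℝ)), fun v => ?_⟩
    exact contMDiffAt_clm_iff.1 (h.clm_comp_space (snd ℝ E (E →L[ℝ] ℝ))) (v 0)

/-- The section `s(p, q)` of `T ⊕ T*`, for functions `p`, `q` with values in the model space. -/
def doubleSection (B : BilinForm ℝ Lie(E, G)) (p q : G → E) (z : G) :
    GenTangent E := sL B z (toLie G (p z)) + sR B z (toLie G (q z))

theorem genLeft_doubleSection (hB : IsBiinvariantMetric B) (p q : G → E) (z : G) :
    genLeft E z (doubleSection B p q z) = (p z - adInv E z (q z),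
      (1 / 2 : ℝ) • modelForm B (p z + adInv E z (q z))) := by
  rw [doubleSection, map_add, genLeft_sL, genLeft_sR hB, adLie_toLie]
  refine Prod.ext ?_ (ContinuousLinearMap.ext fun v => ?_)
  · rw [Prod.fst_add, leftVec_fst, rightVec_fst, LinearEquiv.symm_apply_apply,
      LinearEquiv.symm_apply_apply, sub_eq_add_neg]
  · rw [Prod.snd_add, add_apply, leftVec_snd, rightVec_snd, smul_apply, modelForm_apply, map_add,
      map_add, LinearMap.add_apply, hB.symm (toLie G v), hB.symm (toLie G v), smul_eq_mul]
    ring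

theorem eq_lTrans_of_genLeft {e : GenTangent E} {a : E} {α : E →L[ℝ] ℝ}
    (h : genLeft E g e = (a, α)) : e = (lTrans E g a, α.comp (lMC E g)) := by
  rw [← (genLeft E g).symm_apply_apply e, h]; rfl

theorem formCovector_apply (w : E [⋀^Fin 1]→L[ℝ] ℝ) (v : E) : formCovector w v = w ![v] :=
  congrArg w (funext fun i => by fin_cases i; rfl)

theorem formDeriv_covectorForm_lTrans {η β : G → E →L[ℝ] ℝ} (hη : ∀ z, η z = (β z).comp (lMC E z))
    (hβ : C∞[E, E →L[ℝ] ℝ] β g) (a c : E) :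
    formDeriv (fun y => covectorForm (η y)) g ![lTrans E g a, lTrans E g c] =
      lDeriv E β g a c - lDeriv E β g c a - β g (modelBracket G a c) := by
  have hl : leftForm (fun y => covectorForm (η y)) = fun z => covectorForm (β z) := by
    funext z; ext v
    change η z (lTrans E z (v 0)) = β z (v 0)
    rw [hη, ContinuousLinearMap.comp_apply, lMC_lTrans]
  have hs : FormSmoothAt (fun y => covectorForm (η y)) g := by
    rw [formSmoothAt_iff, hl, contMDiffAt_form_iff]
    exact fun v => contMDiffAt_clm_iff.1 hβ (v 0)
  have hd : ∀ c v, lDeriv E (fun z => covectorForm (β z)) g c v = lDeriv E β g c (v 0) := by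
    intro c v
    have h0 : C∞[E, E [⋀^Fin 1]→L[ℝ] ℝ] (fun z => covectorForm (β z)) g :=
      contMDiffAt_form_iff.2 fun v => contMDiffAt_clm_iff.1 hβ (v 0)
    have h1 := lDeriv_clm_comp (formEval (F := ℝ) v) (h0.mdiff) c
    have h2 := lDeriv_clm_comp (ContinuousLinearMap.apply ℝ ℝ (v 0))
      (hβ.mdiff) c
    exact h1.symm.trans h2
  have key := formDeriv_succ_apply_lTrans hs ![a, c]
  have e1 : (fun i => lTrans E g ((![a, c] : Fin 2 → E) i)) = ![lTrans E g a, lTrans E g c] := by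
    funext i; fin_cases i <;> rfl
  rw [e1] at key
  rw [key, hl]
  simp only [Fin.sum_univ_two, hd]
  simp [covectorForm, Fin.removeNth]
  ring

/-- The Courant bracket in the left trivialization. -/
theorem genLeft_courantBracket {H : G → E [⋀^Fin 3]→L[ℝ] ℝ} {e f : G → GenTangent E}
    {a b : G → E} {α β : G → E →L[ℝ] ℝ}
    (he : ∀ z, genLeft E z (e z) = (a z, α z)) (hf : ∀ z, genLeft E z (f z) = (b z, β z))
    (ha : C∞[E, E] a g) (hb : C∞[E, E] b g) (hα : C∞[E, E →L[ℝ] ℝ] α g)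
    (hβ : C∞[E, E →L[ℝ] ℝ] β g) : (genLeft E g (courantBracket H e f g)).1 =
        lDeriv E b g (a g) - lDeriv E a g (b g) + modelBracket G (a g) (b g) ∧
      ∀ c, (genLeft E g (courantBracket H e f g)).2 c =
        1 / 2 * (β g (lDeriv E a g c) - α g (lDeriv E b g c) - lDeriv E β g c (a g)
          + lDeriv E α g c (b g)) + lDeriv E β g (a g) c - lDeriv E α g (b g) c
          - β g (modelBracket G (a g) c) + α g (modelBracket G (b g) c)
          - leftForm H g ![a g, b g, c] := by
  have he1 : ∀ z, (e z).1 = lTrans E z (a z) := fun z => by rw [eq_lTrans_of_genLeft (he z)]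
  have hf1 : ∀ z, (f z).1 = lTrans E z (b z) := fun z => by rw [eq_lTrans_of_genLeft (hf z)]
  have he2 : ∀ z, (e z).2 = (α z).comp (lMC E z) := fun z => by rw [eq_lTrans_of_genLeft (he z)]
  have hf2 : ∀ z, (f z).2 = (β z).comp (lMC E z) := fun z => by rw [eq_lTrans_of_genLeft (hf z)]
  have ma := ha.mdifferentiableAt (by simp : (∞ : WithTop ℕ∞) ≠ 0)
  have mb := hb.mdifferentiableAt (by simp : (∞ : WithTop ℕ∞) ≠ 0)
  have mα := hα.mdifferentiableAt (by simp : (∞ : WithTop ℕ∞) ≠ 0)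
  have mβ := hβ.mdifferentiableAt (by simp : (∞ : WithTop ℕ∞) ≠ 0)
  refine ⟨?_, fun c => ?_⟩
  · have h1 := mlieBracket_lTrans ma mb
    rw [genLeft_apply, courantBracket]
    simp only [he1, hf1]
    exact (congrArg (lMC E g) h1).trans (lMC_lTrans g _)
  · have p1 : ∀ z, (f z).2 (e z).1 = β z (a z) := fun z => by
      rw [hf2, he1, ContinuousLinearMap.comp_apply, lMC_lTrans]
    have p2 : ∀ z, (e z).2 (f z).1 = α z (b z) := fun z => by
      rw [he2, hf1, ContinuousLinearMap.comp_apply, lMC_lTrans]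
    have d1 : lDeriv E (fun z => β z (a z)) g c = lDeriv E β g c (a g) + β g (lDeriv E a g c) :=
      lDeriv_bilin (ContinuousLinearMap.id ℝ (E →L[ℝ] ℝ)) mβ ma c
    have d2 : lDeriv E (fun z => α z (b z)) g c = lDeriv E α g c (b g) + α g (lDeriv E b g c) :=
      lDeriv_bilin (ContinuousLinearMap.id ℝ (E →L[ℝ] ℝ)) mα mb c
    have f1 := formDeriv_covectorForm_lTrans hf2 hβ (a g) c
    have f2 := formDeriv_covectorForm_lTrans he2 hα (b g) c
    have key : (genLeft E g (courantBracket H e f g)).2 c =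
        (lDeriv E (fun z => β z (a z)) g c + formDeriv (fun y => covectorForm (f y).2) g
          ![lTrans E g (a g), lTrans E g c])
        - (lDeriv E (fun z => α z (b z)) g c + formDeriv (fun y => covectorForm (e y).2) g
          ![lTrans E g (b g), lTrans E g c])
        - 1 / 2 * (lDeriv E (fun z => β z (a z)) g c - lDeriv E (fun z => α z (b z)) g c)
        - leftForm H g ![a g, b g, c] := by
      have e3 : (fun i => lTrans E g ((![a g, b g, c] : Fin 3 → E) i)) =
          ![lTrans E g (a g), lTrans E g (b g), lTrans E g c] := by
        funext i; fin_cases i <;> rfl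
      have e4 : leftForm H g ![a g, b g, c] =
        H g ![lTrans E g (a g), lTrans E g (b g), lTrans E g c] := congrArg (H g) e3
      rw [e4, genLeft_apply, courantBracket]
      simp only [lieDerivCovector]
      simp only [p1, p2]
      simp only [he1, hf1, ContinuousLinearMap.comp_apply, sub_apply, add_apply, smul_apply,
        smul_eq_mul, formCovector_apply]
      rfl
    rw [key, f1, f2, d1, d2]
    ring

/-! ### The Courant bracket of sections of the double -/

variable {p q p' q' : G → E}

theorem modelBracket_sub_left (u v w : E) :
    modelBracket G (u - v) w = modelBracket G u w - modelBracket G v w := by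
  simp [modelBracket, sub_lie]

theorem modelBracket_sub_right (u v w : E) :
    modelBracket G u (v - w) = modelBracket G u v - modelBracket G u w := by
  simp [modelBracket, lie_sub]

theorem modelBracket_swap (u v : E) : modelBracket G u v = -modelBracket G v u := by
  rw [modelBracket, ← lie_skew, map_neg, modelBracket]

theorem contMDiffAt_adInv_comp (hq : C∞[E, E] q g) : C∞[E, E] (fun z => adInv E z (q z)) g :=
  (contMDiffAt_adInv g).clm_apply hq

theorem lDeriv_adInv_comp (hq : C∞[E, E] q g) (c : E) : lDeriv E (fun z => adInv E z (q z)) g c =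
      adInv E g (lDeriv E q g c) - modelBracket G c (adInv E g (q g)) := by
  have h := lDeriv_bilin (ContinuousLinearMap.id ℝ (E →L[ℝ] E))
    ((contMDiffAt_adInv (E := E) g).mdiff)
    (hq.mdiff) c
  have h2 : lDeriv E (fun z : G => adInv E z) g c (q g) = -modelBracket G c (adInv E g (q g)) := by
    rw [← lDeriv_adInv]
    exact (lDeriv_clm_comp (ContinuousLinearMap.apply ℝ E (q g))
      ((contMDiffAt_adInv (E := E) g).mdiff) c).symm
  rw [sub_eq_neg_add, ← h2]
  exact h

theorem lDeriv_sub_fun {F : Type*} [NormedAddCommGroup F] [NormedSpace ℝ F] {f h : G → F}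
    (hf : MD[E, F] f g) (hh : MD[E, F] h g)
    (c : E) : lDeriv E (fun y => f y - h y) g c = lDeriv E f g c - lDeriv E h g c := by
  have h1 := lDeriv_clm_comp (-ContinuousLinearMap.id ℝ F) hh c
  have h2 := lDeriv_add hf (h := fun y => (-ContinuousLinearMap.id ℝ F) (h y))
    ((ContinuousLinearMap.mdifferentiableAt _).comp g hh) c
  rw [h1] at h2
  simpa [sub_eq_add_neg] using h2

/-- The vector part `p - Ad q` of `s(p, q)` in the left trivialization. -/
def anchorFun (p q : G → E) (z : G) : E := p z - adInv E z (q z)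

/-- `∂_a p' - ∂_b p + [p, p']`. -/
def bracketPart (a b : E) (p p' : G → E) (g : G) : E :=
  lDeriv E p' g a - lDeriv E p g b + modelBracket G (p g) (p' g)

/-- `B(p', ∂_c p) - B(p, ∂_c p')`. -/
def defect (B : BilinForm ℝ Lie(E, G)) (p p' : G → E) (g : G) (c : E) :
    ℝ := modelForm B (p' g) (lDeriv E p g c) - modelForm B (p g) (lDeriv E p' g c)

theorem genLeft_courantBracket_double (hB : IsBiinvariantMetric B)
    (hp : C∞[E, E] p g) (hq : C∞[E, E] q g) (hp' : C∞[E, E] p' g) (hq' : C∞[E, E] q' g) :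
    (genLeft E g (courantBracket (cartanH B) (doubleSection B p q) (doubleSection B p' q') g)).1 =
        bracketPart (anchorFun p q g) (anchorFun p' q' g) p p' g
          - adInv E g (bracketPart (anchorFun p q g) (anchorFun p' q' g) q q' g) ∧ ∀ c, (genLeft E g
          (courantBracket (cartanH B) (doubleSection B p q) (doubleSection B p' q') g)).2 c =
        1 / 2 * modelForm B (bracketPart (anchorFun p q g) (anchorFun p' q' g) p p' g
          + adInv E g (bracketPart (anchorFun p q g) (anchorFun p' q' g) q q' g)) c
          + 1 / 2 * (defect B p p' g c - defect B q q' g c) := by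
  have hu := contMDiffAt_adInv_comp hq
  have hu' := contMDiffAt_adInv_comp hq'
  have smooth : ∀ {r : G → E}, C∞[E, E] r g → MD[E, E] r g := fun h => h.mdiff
  obtain ⟨h1, h2⟩ := genLeft_courantBracket (H := cartanH B) (g := g)
    (a := fun z => p z - adInv E z (q z)) (b := fun z => p' z - adInv E z (q' z))
    (α := fun z => ((1 / 2 : ℝ) • modelForm B) (p z + adInv E z (q z)))
    (β := fun z => ((1 / 2 : ℝ) • modelForm B) (p' z + adInv E z (q' z)))
    (genLeft_doubleSection hB p q) (genLeft_doubleSection hB p' q') (hp.sub hu) (hp'.sub hu')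
    ((hp.add hu).clm_comp_space _) ((hp'.add hu').clm_comp_space _)
  have da : ∀ c, lDeriv E (fun z => p z - adInv E z (q z)) g c = lDeriv E p g c
      - (adInv E g (lDeriv E q g c) - modelBracket G c (adInv E g (q g))) := fun c => by
    rw [lDeriv_sub_fun (smooth hp) (smooth hu), lDeriv_adInv_comp hq]
  have db : ∀ c, lDeriv E (fun z => p' z - adInv E z (q' z)) g c = lDeriv E p' g c
      - (adInv E g (lDeriv E q' g c) - modelBracket G c (adInv E g (q' g))) := fun c => by
    rw [lDeriv_sub_fun (smooth hp') (smooth hu'), lDeriv_adInv_comp hq']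
  have dα : ∀ c, lDeriv E (fun z => ((1 / 2 : ℝ) • modelForm B) (p z + adInv E z (q z))) g c =
      ((1 / 2 : ℝ) • modelForm B) (lDeriv E p g c
        + (adInv E g (lDeriv E q g c) - modelBracket G c (adInv E g (q g)))) := fun c => by
    rw [lDeriv_clm_comp (f := fun z => p z + adInv E z (q z)) _ (smooth (hp.add hu)),
      lDeriv_add (smooth hp) (smooth hu), lDeriv_adInv_comp hq]
  have dβ : ∀ c, lDeriv E (fun z => ((1 / 2 : ℝ) • modelForm B) (p' z + adInv E z (q' z))) g c =
      ((1 / 2 : ℝ) • modelForm B) (lDeriv E p' g c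
        + (adInv E g (lDeriv E q' g c) - modelBracket G c (adInv E g (q' g)))) := fun c => by
    rw [lDeriv_clm_comp (f := fun z => p' z + adInv E z (q' z)) _ (smooth (hp'.add hu')),
      lDeriv_add (smooth hp') (smooth hu'), lDeriv_adInv_comp hq']
  have hAd : ∀ u v, modelForm B (adInv E g u) (adInv E g v) = modelForm B u v := fun u v =>
    hB.adLie_form g (toLie G u) (toLie G v)
  have hsymm : ∀ u v, modelForm B u v = modelForm B v u := fun u v => hB.symm _ _
  have hinv : ∀ u v w, modelForm B (modelBracket G u v) w = modelForm B u (modelBracket G v w) :=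
    fun u v w => hB.lie_form (toLie G u) (toLie G v) (toLie G w)
  have hH : ∀ u v w : E, leftForm (cartanH B) g ![u, v, w] =
      1 / 2 * modelForm B u (modelBracket G v w) := fun u v w => by
    rw [leftForm_cartanH, cartanH_one_apply hB]; rfl
  refine ⟨?_, fun c => ?_⟩
  · rw [h1]
    simp only [da, db, bracketPart, anchorFun, map_add, map_sub, ← modelBracket_adInv,
      modelBracket_sub_left, modelBracket_sub_right]
    rw [modelBracket_swap (p' g) (adInv E g (q g)),
      modelBracket_swap (adInv E g (q' g)) (adInv E g (q g))]
    abel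
  · rw [h2 c]
    simp only [da, db, dα, dβ, hH, bracketPart, anchorFun, defect]
    rw [← hAd (q' g), ← hAd (q g)]
    simp only [map_add, map_sub, ← modelBracket_adInv, modelBracket_sub_left,
      smul_apply, add_apply, sub_apply, smul_eq_mul]
    have tri : ∀ x y : E, modelForm B c (modelBracket G x y) = modelForm B x (modelBracket G y c) ∧
        modelForm B y (modelBracket G c x) = modelForm B x (modelBracket G y c) ∧
        modelForm B x (modelBracket G c y) = -modelForm B x (modelBracket G y c) ∧
        modelForm B y (modelBracket G x c) = -modelForm B x (modelBracket G y c) ∧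
        modelForm B c (modelBracket G y x) = -modelForm B x (modelBracket G y c) := fun x y => by
      have h1 : modelForm B c (modelBracket G x y) = modelForm B x (modelBracket G y c) := by
        rw [hsymm, hinv]
      have h2 : modelForm B y (modelBracket G c x) = modelForm B x (modelBracket G y c) := by
        rw [← h1, hsymm, hinv]
      refine ⟨h1, h2, ?_, ?_, by rw [modelBracket_swap y x, map_neg, h1]⟩
      · rw [modelBracket_swap c y, map_neg]
      · rw [modelBracket_swap x c, map_neg, h2]
    obtain ⟨a1, a2, a3, a4, a5⟩ := tri (p g) (p' g)
    obtain ⟨b1, b2, b3, b4, b5⟩ := tri (p g) (adInv E g (q' g))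
    obtain ⟨c1, c2, c3, c4, c5⟩ := tri (adInv E g (q g)) (p' g)
    obtain ⟨d1, d2, d3, d4, d5⟩ := tri (adInv E g (q g)) (adInv E g (q' g))
    simp only [hinv]
    rw [hsymm (lDeriv E p' g c), hsymm (lDeriv E p' g c), hsymm (lDeriv E p g c),
      hsymm (lDeriv E p g c), hsymm (adInv E g (lDeriv E q' g c)),
      hsymm (adInv E g (lDeriv E q' g c)), hsymm (adInv E g (lDeriv E q g c)),
      hsymm (adInv E g (lDeriv E q g c))]
    linarith

/-! ### The complex structure of a polarization -/

section PolarizationJ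

variable {L : Type*} [LieRing L] [LieAlgebra ℝ L] {B : BilinForm ℝ L} {n : ℕ}
  {V V' : Submodule ℂ (ℂ ⊗[ℝ] L)} {x : Fin n → ℂ ⊗[ℝ] L}

/-- The projection of `V ⊕ V'` to `V`. -/
def polProj (B : BilinForm ℝ L) (x : Fin n → ℂ ⊗[ℝ] L) : (ℂ ⊗[ℝ] L) →ₗ[ℂ] (ℂ ⊗[ℝ] L) :=
  ∑ j, ((formC B).flip (conjT (x j))).smulRight (x j)

theorem polProj_apply (z : ℂ ⊗[ℝ] L) : polProj B x z = ∑ j, formC B z (conjT (x j)) • x j := by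
  simp [polProj, sum_apply]

/-- The real endomorphism whose complexification is `√-1` on `V` and `-√-1` on `V'`. -/
def polJ (B : BilinForm ℝ L) (x : Fin n → ℂ ⊗[ℝ] L) : L →ₗ[ℝ] L :=
  (-2 : ℝ) • (imT ∘ₗ (polProj B x).restrictScalars ℝ ∘ₗ TensorProduct.mk ℝ ℂ L 1)

namespace IsPolarization

theorem polProj_eq_self (h : IsPolarization B V V' x) {v : ℂ ⊗[ℝ] L} (hv : v ∈ V) :
    polProj B x v = v := by
  rw [polProj_apply, ← h.eq_sum hv]

theorem polProj_eq_zero (h : IsPolarization B V V' x) {v : ℂ ⊗[ℝ] L} (hv : v ∈ V') :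
    polProj B x v = 0 := by
  rw [polProj_apply]
  exact sum_eq_zero fun j _ => by rw [h.conj.isotropic v hv _ (h.conj.mem j), zero_smul]

theorem exists_add (h : IsPolarization B V V' x) (z : ℂ ⊗[ℝ] L) : ∃ p ∈ V, ∃ q ∈ V', z = p + q := by
  refine ⟨∑ j, formC B z (conjT (x j)) • x j, V.sum_mem fun j _ => V.smul_mem _ (h.mem j),
    ∑ j, formC B z (x j) • conjT (x j), V'.sum_mem fun j _ => V'.smul_mem _ (h.conj.mem j), ?_⟩
  conv_lhs => rw [h.frame.left z, sum_sum_type]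
  simp only [elim_inl, elim_inr]

theorem one_tmul_polJ (h : IsPolarization B V V' x) {v : L} {p : ℂ ⊗[ℝ] L} (hp : p ∈ V)
    (hv : (1 : ℂ) ⊗ₜ[ℝ] v = p + conjT p) : (1 : ℂ) ⊗ₜ[ℝ] polJ B x v = I • (p - conjT p) := by
  have h1 : polProj B x ((1 : ℂ) ⊗ₜ[ℝ] v) = p := by
    rw [hv, map_add, h.polProj_eq_self hp, h.polProj_eq_zero ((h.conj_mem _).2 (by
      rwa [conjT_conjT])), add_zero]
  have h2 : polJ B x v = (-2 : ℝ) • imT p := by rw [← h1]; rfl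
  have h3 : conjT p = (1 : ℂ) ⊗ₜ[ℝ] reT p - I ⊗ₜ[ℝ] imT p := by
    conv_lhs => rw [← reT_add_imT p]
    rw [map_add, conjT_tmul, conjT_tmul, map_one, conj_I, neg_tmul, sub_eq_add_neg]
  have h4 : p - conjT p = (2 * I) ⊗ₜ[ℝ] imT p := by
    rw [h3]
    conv_lhs => rw [← reT_add_imT p]
    rw [two_mul, add_tmul]
    simp only [map_add, reT_tmul, imT_tmul]
    simp
  rw [h2, h4, tmul_smul, smul_tmul', smul_tmul']
  congr 1
  rw [smul_eq_mul, real_smul]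
  push_cast
  linear_combination (-2 : ℂ) * I_mul_I

theorem exists_real (h : IsPolarization B V V' x) (v : L) :
    ∃ p ∈ V, (1 : ℂ) ⊗ₜ[ℝ] v = p + conjT p := by
  obtain ⟨p, hp, q, hq, hv⟩ := h.exists_add ((1 : ℂ) ⊗ₜ[ℝ] v)
  refine ⟨p, hp, ?_⟩
  have h1 : p + q = conjT p + conjT q := by rw [← map_add, ← hv, conjT_tmul, map_one]
  have hq' := (h.conj_mem q).1 hq
  have hp' : conjT p ∈ V' := (h.conj_mem _).2 (by rwa [conjT_conjT])
  have h2 := congrArg (polProj B x) h1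
  rw [map_add, map_add, h.polProj_eq_self hp, h.polProj_eq_zero hq, h.polProj_eq_zero hp',
    h.polProj_eq_self hq', add_zero, zero_add] at h2
  rw [hv, h2, conjT_conjT]

theorem one_tmul_injective {u v : L} (h : (1 : ℂ) ⊗ₜ[ℝ] u = (1 : ℂ) ⊗ₜ[ℝ] v) : u = v := by
  simpa [reT_tmul] using congrArg reT h

theorem polJ_polJ (h : IsPolarization B V V' x) (v : L) : polJ B x (polJ B x v) = -v := by
  obtain ⟨p, hp, hv⟩ := h.exists_real v
  have h1 := h.one_tmul_polJ hp hv
  have h2 : (1 : ℂ) ⊗ₜ[ℝ] polJ B x v = I • p + conjT (I • p) := by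
    rw [h1, conjT_smul, conj_I]; module
  have h3 := h.one_tmul_polJ (V.smul_mem _ hp) h2
  refine one_tmul_injective ?_
  rw [h3, tmul_neg, hv, conjT_smul, conj_I, smul_sub, smul_smul, smul_smul, mul_neg, I_mul_I]
  module

theorem polJ_form (h : IsPolarization B V V' x) (u v : L) :
    B (polJ B x u) (polJ B x v) = B u v := by
  obtain ⟨p, hp, hu⟩ := h.exists_real u
  obtain ⟨q, hq, hv⟩ := h.exists_real v
  have key : ∀ u v : L, formC B ((1 : ℂ) ⊗ₜ[ℝ] u) ((1 : ℂ) ⊗ₜ[ℝ] v) = (B u v : ℂ) := fun u v => by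
    rw [formC, baseChange_form_tmul]; simp
  have h1 := key (polJ B x u) (polJ B x v)
  have h2 := key u v
  have hp' : conjT p ∈ V' := (h.conj_mem _).2 (by rwa [conjT_conjT])
  have hq' : conjT q ∈ V' := (h.conj_mem _).2 (by rwa [conjT_conjT])
  rw [h.one_tmul_polJ hp hu, h.one_tmul_polJ hq hv] at h1
  rw [hu, hv] at h2
  simp only [map_add, map_sub, map_smul, LinearMap.add_apply, LinearMap.sub_apply,
    LinearMap.smul_apply, smul_eq_mul, h.isotropic p hp q hq, h.conj.isotropic _ hp' _ hq'] at h1 h2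
  have h3 : (B (polJ B x u) (polJ B x v) : ℂ) = (B u v : ℂ) := by
    rw [← h1, ← h2]
    linear_combination (-formC B p (conjT q) - formC B (conjT p) q) * I_mul_I
  exact_mod_cast h3

theorem polJ_baseChange (h : IsPolarization B V V' x) {p q : ℂ ⊗[ℝ] L} (hp : p ∈ V) (hq : q ∈ V') :
    (polJ B x).baseChange ℂ (p + q) = I • (p - q) := by
  have key : ∀ z, (polJ B x).baseChange ℂ z = I • ((2 : ℂ) • polProj B x z - z) := by
    intro z
    induction z using induction_on with
    | zero => simp
    | add a b ha hb => rw [map_add, ha, hb, map_add]; module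
    | tmul r v =>
      obtain ⟨p, hp, hv⟩ := h.exists_real v
      have hr : r ⊗ₜ[ℝ] v = r • ((1 : ℂ) ⊗ₜ[ℝ] v) := by rw [smul_tmul', smul_eq_mul, mul_one]
      rw [hr, map_smul, baseChange_tmul, h.one_tmul_polJ hp hv, map_smul, hv, map_add,
        h.polProj_eq_self hp, h.polProj_eq_zero ((h.conj_mem _).2 (by rwa [conjT_conjT]))]
      module
  rw [key, map_add, h.polProj_eq_self hp, h.polProj_eq_zero hq]
  module

theorem eigenspace_neg_polJ (h : IsPolarization B V V' x) :
    End.eigenspace ((-polJ B x).baseChange ℂ) (-I) = V := by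
  ext z
  obtain ⟨p, hp, q, hq, rfl⟩ := h.exists_add z
  rw [End.mem_eigenspace_iff, LinearMap.baseChange_neg, LinearMap.neg_apply, h.polJ_baseChange hp hq]
  constructor
  · intro h1
    have h2 : I • ((2 : ℂ) • q) = 0 := by linear_combination (norm := module) h1
    have h3 : q = 0 := by simpa using h2
    rwa [h3, add_zero]
  · intro h1
    have h2 : q = 0 := by
      rw [← h.polProj_eq_zero hq, h.polProj_eq_self (by simpa using V.sub_mem h1 hp)]
    rw [h2]; module

theorem eigenspace_polJ (h : IsPolarization B V V' x) :
    End.eigenspace ((polJ B x).baseChange ℂ) (-I) = V' := by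
  ext z
  obtain ⟨p, hp, q, hq, rfl⟩ := h.exists_add z
  rw [End.mem_eigenspace_iff, h.polJ_baseChange hp hq]
  constructor
  · intro h1
    have h2 : I • ((2 : ℂ) • p) = 0 := by linear_combination (norm := module) h1
    have h3 : p = 0 := by simpa using h2
    rwa [h3, zero_add]
  · intro h1
    have h2 : p = 0 := by
      rw [← h.polProj_eq_self hp, h.polProj_eq_zero (by simpa using V'.sub_mem h1 hq)]
    rw [h2]; module

end IsPolarization

end PolarizationJ

/-! ### Generalized complex structures from complex structures on the double -/

theorem exists_sharp (hB : IsBiinvariantMetric B) :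
    ∃ S : (E →L[ℝ] ℝ) →L[ℝ] E, ∀ α, modelForm B (S α) = α := by
  have hinj : Function.Injective (modelForm B : E →ₗ[ℝ] E →L[ℝ] ℝ) := by
    refine (injective_iff_map_eq_zero _).2 fun v hv => ?_
    by_contra hne
    have h1 := hB.pos (toLie G v) fun h => hne ((toLie G).map_eq_zero_iff.1 h)
    have h2 : modelForm B v v = 0 := by rw [show modelForm B v = 0 from hv]; rfl
    rw [modelForm_apply] at h2
    linarith
  have hfr : finrank ℝ E = finrank ℝ (E →L[ℝ] ℝ) := by
    rw [← (toContinuousLinearMap : (E →ₗ[ℝ] ℝ) ≃ₗ[ℝ] (E →L[ℝ] ℝ)).finrank_eq]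
    exact (Subspace.dual_finrank_eq (K := ℝ) (V := E)).symm
  let T := LinearEquiv.ofBijective (modelForm B : E →ₗ[ℝ] E →L[ℝ] ℝ)
    ⟨hinj, (LinearMap.injective_iff_surjective_of_finrank_eq_finrank hfr).1 hinj⟩
  exact ⟨toContinuousLinearMap T.symm.toLinearMap, fun α => T.apply_symm_apply α⟩

theorem exists_doubleSection (hB : IsBiinvariantMetric B) (e : G → GenTangent E) :
    ∃ p q : G → E, e = doubleSection B p q ∧ ∀ g, SectionSmoothAt e g →
      C∞[E, E] p g ∧ C∞[E, E] q g := by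
  obtain ⟨S, hS⟩ := exists_sharp hB
  let P : GenTangent E →L[ℝ] E := S.comp (snd ℝ E (E →L[ℝ] ℝ))
    + (1 / 2 : ℝ) • fst ℝ E (E →L[ℝ] ℝ)
  let Q : GenTangent E →L[ℝ] E := S.comp (snd ℝ E (E →L[ℝ] ℝ))
    - (1 / 2 : ℝ) • fst ℝ E (E →L[ℝ] ℝ)
  refine ⟨fun z => P (genLeft E z (e z)), fun z => adInv E z⁻¹ (Q (genLeft E z (e z))),
    funext fun z => (genLeft E z).injective ?_, fun g hg => ?_⟩
  · rw [genLeft_doubleSection hB, adInv_adInv_inv]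
    have h1 : ∀ w : GenTangent E, P w - Q w = w.1 := fun w => by
      change (S w.2 + (1 / 2 : ℝ) • w.1) - (S w.2 - (1 / 2 : ℝ) • w.1) = w.1
      module
    have h2 : ∀ w : GenTangent E, P w + Q w = (2 : ℝ) • S w.2 := fun w => by
      change (S w.2 + (1 / 2 : ℝ) • w.1) + (S w.2 - (1 / 2 : ℝ) • w.1) = _
      module
    rw [h1, h2, map_smul, hS, smul_smul]
    norm_num
  · have h := sectionSmoothAt_iff.1 hg
    refine ⟨h.clm_comp_space P, ContMDiffAt.clm_apply (g := fun z : G => adInv E z⁻¹) ?_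
      (h.clm_comp_space Q)⟩
    exact (contMDiffAt_adInv (E := E) g⁻¹).comp g
      ((contMDiff_inv 𝓘(ℝ, E) ∞).contMDiffAt (x := g))

theorem sectionSmoothAt_doubleSection (hB : IsBiinvariantMetric B) {p q : G → E}
    (hp : C∞[E, E] p g) (hq : C∞[E, E] q g) : SectionSmoothAt (doubleSection B p q) g := by
  rw [sectionSmoothAt_iff]
  simp only [genLeft_doubleSection hB]
  exact (hp.sub (contMDiffAt_adInv_comp hq)).prodMk_space
    ((hp.add (contMDiffAt_adInv_comp hq)).clm_comp_space ((1 / 2 : ℝ) • modelForm B))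

theorem genPairing_double (hB : IsBiinvariantMetric B) (g : G) (p q p' q' : Lie(E, G)) :
    genPairing (sL B g p + sR B g q) (sL B g p' + sR B g q') = 1 / 2 * (B p p' - B q q') := by
  have h : ∀ u v, genPairing (rightVec B u) (leftVec B v) = 0 := fun u v => by
    rw [← genPairing_leftVec_rightVec hB v u, genPairing_apply, genPairing_apply]; ring
  rw [← genPairing_genLeft g]
  simp only [map_add, LinearMap.add_apply, genLeft_sL, genLeft_sR hB, genPairing_leftVec hB,
    genPairing_rightVec hB, genPairing_leftVec_rightVec hB, h, hB.adLie_form]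
  ring

theorem double_injective (hB : IsBiinvariantMetric B) (g : G) :
    Function.Injective ((sL B g).coprod (sR B g)) := by
  refine (injective_iff_map_eq_zero _).2 fun w hw => ?_
  rw [LinearMap.coprod_apply] at hw
  have h := genPairing_double hB g w.1 w.2 w.1 (-w.2)
  rw [hw, map_zero, LinearMap.zero_apply, map_neg] at h
  have h1 : ∀ u, 0 ≤ B u u := fun u => by
    by_cases hu : u = 0
    · rw [hu]; simp
    · exact (hB.pos u hu).le
  by_contra hne
  rcases not_and_or.1 (fun hc : w.1 = 0 ∧ w.2 = 0 => hne (Prod.ext hc.1 hc.2)) with h2 | h2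
  · have := hB.pos _ h2
    have := h1 w.2
    linarith
  · have := hB.pos _ h2
    have := h1 w.1
    linarith

theorem double_surjective (hB : IsBiinvariantMetric B) (g : G) :
    Function.Surjective ((sL B g).coprod (sR B g)) := fun e => by
  obtain ⟨p, q, h, -⟩ := exists_doubleSection hB fun _ => e
  exact ⟨(toLie G (p g), toLie G (q g)), (congrFun h g).symm⟩

/-- The isomorphism `s : 𝔤 ⊕ 𝔤 → T_g G ⊕ T*_g G`. -/
def doubleEquiv (hB : IsBiinvariantMetric B) (g : G) : (Lie(E, G) × Lie(E, G)) ≃ₗ[ℝ] GenTangent E :=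
  LinearEquiv.ofBijective ((sL B g).coprod (sR B g))
    ⟨double_injective hB g, double_surjective hB g⟩

/-- The field of endomorphisms of `T ⊕ T*` defined by endomorphisms of the two factors of the
double. -/
def doubleJ (hB : IsBiinvariantMetric B) (A A' : Lie(E, G) →ₗ[ℝ] Lie(E, G)) (g : G) :
    GenTangent E →ₗ[ℝ] GenTangent E :=
  (doubleEquiv hB g).toLinearMap ∘ₗ (A.prodMap A') ∘ₗ (doubleEquiv hB g).symm.toLinearMap

variable {A A' : Lie(E, G) →ₗ[ℝ] Lie(E, G)}

theorem doubleJ_apply (hB : IsBiinvariantMetric B) (g : G) (p q : Lie(E, G)) :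
    doubleJ hB A A' g (sL B g p + sR B g q) = sL B g (A p) + sR B g (A' q) := by
  have h : (doubleEquiv hB g).symm (sL B g p + sR B g q) = (p, q) := by
    rw [LinearEquiv.symm_apply_eq]; rfl
  change doubleEquiv hB g ((A.prodMap A') ((doubleEquiv hB g).symm (sL B g p + sR B g q))) = _
  rw [h]; rfl

theorem exists_double (hB : IsBiinvariantMetric B) (g : G) (e : GenTangent E) :
    ∃ p q, e = sL B g p + sR B g q := by
  obtain ⟨w, hw⟩ := double_surjective hB g e
  exact ⟨w.1, w.2, hw.symm⟩

theorem doubleC_injective (hB : IsBiinvariantMetric B) (g : G) {p q p' q' : Lieℂ(E, G)}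
    (h : (sL B g).baseChange ℂ p + (sR B g).baseChange ℂ q =
      (sL B g).baseChange ℂ p' + (sR B g).baseChange ℂ q') : p = p' ∧ q = q' := by
  have hl : ∀ p q : Lieℂ(E, G),
      ((LinearMap.fst ℝ _ _ ∘ₗ (doubleEquiv hB g).symm.toLinearMap).baseChange ℂ
        ((sL B g).baseChange ℂ p + (sR B g).baseChange ℂ q)) = p ∧
      ((LinearMap.snd ℝ _ _ ∘ₗ (doubleEquiv hB g).symm.toLinearMap).baseChange ℂ
        ((sL B g).baseChange ℂ p + (sR B g).baseChange ℂ q)) = q := by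
    intro p q
    have e1 : ∀ u, (doubleEquiv hB g).symm (sL B g u) = (u, 0) := fun u => by
      rw [LinearEquiv.symm_apply_eq]
      change sL B g u = sL B g u + sR B g 0
      rw [map_zero, add_zero]
    have e2 : ∀ u, (doubleEquiv hB g).symm (sR B g u) = (0, u) := fun u => by
      rw [LinearEquiv.symm_apply_eq]
      change sR B g u = sL B g 0 + sR B g u
      rw [map_zero, zero_add]
    have c1 : (LinearMap.fst ℝ _ _ ∘ₗ (doubleEquiv hB g).symm.toLinearMap) ∘ₗ sL B g =
      LinearMap.id := LinearMap.ext fun u => by simp [e1]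
    have c2 : (LinearMap.fst ℝ _ _ ∘ₗ (doubleEquiv hB g).symm.toLinearMap) ∘ₗ sR B g = 0 :=
      LinearMap.ext fun u => by simp [e2]
    have c3 : (LinearMap.snd ℝ _ _ ∘ₗ (doubleEquiv hB g).symm.toLinearMap) ∘ₗ sL B g = 0 :=
      LinearMap.ext fun u => by simp [e1]
    have c4 : (LinearMap.snd ℝ _ _ ∘ₗ (doubleEquiv hB g).symm.toLinearMap) ∘ₗ sR B g =
      LinearMap.id := LinearMap.ext fun u => by simp [e2]
    constructor
    · rw [map_add, ← comp_apply, ← comp_apply, ← baseChange_comp, ← baseChange_comp, c1, c2]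
      simp
    · rw [map_add, ← comp_apply, ← comp_apply, ← baseChange_comp, ← baseChange_comp, c3, c4]
      simp
  have h1 := hl p q
  rw [h] at h1
  have h2 := hl p' q'
  exact ⟨h1.1.symm.trans h2.1, h1.2.symm.trans h2.2⟩

theorem exists_doubleC (hB : IsBiinvariantMetric B) (g : G) (z : ℂ ⊗[ℝ] GenTangent E) :
    ∃ p q, z = (sL B g).baseChange ℂ p + (sR B g).baseChange ℂ q := by
  induction z using induction_on with
  | zero => exact ⟨0, 0, by simp⟩
  | tmul r e =>
    obtain ⟨p, q, rfl⟩ := exists_double hB g e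
    exact ⟨r ⊗ₜ p, r ⊗ₜ q, by simp [tmul_add]⟩
  | add a b ha hb =>
    obtain ⟨p, q, rfl⟩ := ha
    obtain ⟨p', q', rfl⟩ := hb
    exact ⟨p + p', q + q', by rw [map_add, map_add]; abel⟩

theorem eigenbundle_doubleJ (hB : IsBiinvariantMetric B) (g : G)
    (hV : End.eigenspace (A.baseChange ℂ) (-I) = V)
    (hK : End.eigenspace (A'.baseChange ℂ) (-I) = K) :
    eigenbundle (doubleJ hB A A' g) = doubleSubspace B g V K := by
  have key : ∀ p q, (doubleJ hB A A' g).baseChange ℂ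
      ((sL B g).baseChange ℂ p + (sR B g).baseChange ℂ q) =
      (sL B g).baseChange ℂ (A.baseChange ℂ p) + (sR B g).baseChange ℂ (A'.baseChange ℂ q) := by
    intro p q
    have c1 : doubleJ hB A A' g ∘ₗ sL B g = sL B g ∘ₗ A := LinearMap.ext fun u => by
      simpa using doubleJ_apply (A := A) (A' := A') hB g u 0
    have c2 : doubleJ hB A A' g ∘ₗ sR B g = sR B g ∘ₗ A' := LinearMap.ext fun u => by
      simpa using doubleJ_apply (A := A) (A' := A') hB g 0 u
    rw [map_add, ← comp_apply, ← comp_apply, ← baseChange_comp,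
      ← baseChange_comp, c1, c2, baseChange_comp, baseChange_comp]
    rfl
  ext z
  obtain ⟨p, q, rfl⟩ := exists_doubleC hB g z
  rw [eigenbundle, End.mem_eigenspace_iff, key, smul_add, ← map_smul, ← map_smul]
  constructor
  · intro h
    obtain ⟨h1, h2⟩ := doubleC_injective hB g h
    exact ⟨(p, q), ⟨by rw [← hV]; exact End.mem_eigenspace_iff.2 h1,
      by rw [← hK]; exact End.mem_eigenspace_iff.2 h2⟩, rfl⟩
  · rintro ⟨⟨p', q'⟩, ⟨hp, hq⟩, h⟩
    obtain ⟨h1, h2⟩ := doubleC_injective hB g (p := p') (q := q') h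
    rw [← hV] at hp
    rw [← hK] at hq
    rw [← h1, ← h2, End.mem_eigenspace_iff.1 hp, End.mem_eigenspace_iff.1 hq]

/-! ### Integrability and the generalized Kähler structure -/

variable (G) in
/-- `u + √-1 v`, as an element of the complexified Lie algebra. -/
def cplxLie (u v : E) : Lieℂ(E, G) := (1 : ℂ) ⊗ₜ[ℝ] toLie G u + I ⊗ₜ[ℝ] toLie G v

theorem cplxLie_eq (u v : E) : cplxLie G u v = toLieC G u + I • toLieC G v := by
  rw [cplxLie, toLieC_apply, toLieC_apply, smul_tmul', smul_eq_mul, mul_one]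

theorem formC_cplxLie (u v u' v' : E) : formC B (cplxLie G u v) (cplxLie G u' v') =
    ((modelForm B u u' - modelForm B v v' : ℝ) : ℂ)
      + ((modelForm B u v' + modelForm B v u' : ℝ) : ℂ) * I := by
  simp only [cplxLie, formC, map_add, LinearMap.add_apply, baseChange_form_tmul, modelForm_apply]
  push_cast
  linear_combination (B (toLie G v) (toLie G v') : ℂ) * I_mul_I

theorem lie_cplxLie (u v u' v' : E) : ⁅cplxLie G u v, cplxLie G u' v'⁆ =
    cplxLie G (modelBracket G u u' - modelBracket G v v')
      (modelBracket G u v' + modelBracket G v u') := by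
  have e : ∀ (r s : ℂ) (u v : E), ⁅r ⊗ₜ[ℝ] toLie G u, s ⊗ₜ[ℝ] toLie G v⁆ =
      (r * s) ⊗ₜ[ℝ] toLie G (modelBracket G u v) := fun r s u v =>
    bracket_tmul ℝ ℂ _ _ r s (toLie G u) (toLie G v)
  rw [cplxLie, cplxLie, add_lie, lieC_add, lieC_add, e, e, e, e, cplxLie, map_sub (toLie G),
    map_add (toLie G), tmul_sub, tmul_add, one_mul, one_mul, mul_one, I_mul_I, neg_tmul]
  abel

theorem lDeriv_cplxLie_mem (hx : IsPolarization B V V' x) {u v : G → E}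
    (hu : C∞[E, E] u g) (hv : C∞[E, E] v g) (h : ∀ᶠ z in 𝓝 g, cplxLie G (u z) (v z) ∈ V) (c : E) :
    cplxLie G (lDeriv E u g c) (lDeriv E v g c) ∈ V := by
  rw [hx.mem_iff]
  intro j
  let T : E × E →L[ℝ] ℂ := toContinuousLinearMap
    { toFun := fun w => formC B (cplxLie G w.1 w.2) (x j)
      map_add' := fun w w' => by
        rw [cplxLie_eq, cplxLie_eq, cplxLie_eq, ← LinearMap.add_apply, ← map_add, Prod.fst_add,
          Prod.snd_add, map_add (toLieC G), map_add (toLieC G), smul_add, add_add_add_comm]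
      map_smul' := fun r w => by
        have hr : ∀ u : E, toLieC G (r • u) = (r : ℂ) • toLieC G u := fun u => by
          rw [toLieC_apply, toLieC_apply, map_smul, smul_tmul',
            tmul_smul, smul_tmul', smul_eq_mul, mul_one, real_smul, mul_one]
        rw [cplxLie_eq, cplxLie_eq, Prod.smul_fst, Prod.smul_snd, hr, hr, smul_comm,
          ← smul_add, map_smul, LinearMap.smul_apply, RingHom.id_apply, real_smul, smul_eq_mul] }
  have hm : MD[E, E × E] (fun z => (u z, v z)) g := (hu.prodMk_space hv).mdiff
  have h1 : lDeriv E (fun z => T (u z, v z)) g c = 0 := by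
    have h0 : (fun z => T (u z, v z)) =ᶠ[𝓝 g] fun _ => 0 := h.mono fun z hz => (hx.mem_iff _).1 hz j
    rw [lDeriv_congr h0, lDeriv_const, zero_apply]
  rw [lDeriv_clm_comp T hm] at h1
  have h2 := lDeriv_clm_comp (fst ℝ E E) hm c
  have h3 := lDeriv_clm_comp (snd ℝ E E) hm c
  have h4 : lDeriv E (fun z => (u z, v z)) g c = (lDeriv E u g c, lDeriv E v g c) :=
    Prod.ext h2.symm h3.symm
  rw [h4] at h1
  exact h1

section Pair

variable {u v u' v' : G → E}

theorem bracketPart_mem (hx : IsPolarization B V V' x) (hu : C∞[E, E] u g) (hv : C∞[E, E] v g)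
    (hu' : C∞[E, E] u' g) (hv' : C∞[E, E] v' g)
    (h : ∀ᶠ z in 𝓝 g, cplxLie G (u z) (v z) ∈ V) (h' : ∀ᶠ z in 𝓝 g, cplxLie G (u' z) (v' z) ∈ V)
    (a b a' b' : E) : cplxLie G (bracketPart a a' u u' g - bracketPart b b' v v' g)
      (bracketPart a b' u v' g + bracketPart b a' v u' g) ∈ V := by
  have D := lDeriv_cplxLie_mem hx hu hv h
  have D' := lDeriv_cplxLie_mem hx hu' hv' h'
  have hl := hx.lie_mem _ h.self_of_nhds _ h'.self_of_nhds
  rw [lie_cplxLie] at hl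
  have key : cplxLie G (bracketPart a a' u u' g - bracketPart b b' v v' g)
      (bracketPart a b' u v' g + bracketPart b a' v u' g) =
      (cplxLie G (lDeriv E u' g a) (lDeriv E v' g a)
        + I • cplxLie G (lDeriv E u' g b) (lDeriv E v' g b))
      - (cplxLie G (lDeriv E u g a') (lDeriv E v g a')
        + I • cplxLie G (lDeriv E u g b') (lDeriv E v g b'))
      + cplxLie G (modelBracket G (u g) (u' g) - modelBracket G (v g) (v' g))
        (modelBracket G (u g) (v' g) + modelBracket G (v g) (u' g)) := by
    simp only [cplxLie_eq, bracketPart, map_add, map_sub, smul_add, smul_smul, I_mul_I]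
    module
  rw [key]
  exact V.add_mem (V.sub_mem (V.add_mem (D' a) (V.smul_mem _ (D' b)))
    (V.add_mem (D a') (V.smul_mem _ (D b')))) hl

theorem defect_eq (hx : IsPolarization B V V' x) (hu : C∞[E, E] u g) (hv : C∞[E, E] v g)
    (hu' : C∞[E, E] u' g) (hv' : C∞[E, E] v' g)
    (h : ∀ᶠ z in 𝓝 g, cplxLie G (u z) (v z) ∈ V) (h' : ∀ᶠ z in 𝓝 g, cplxLie G (u' z) (v' z) ∈ V)
    (c : E) : defect B u u' g c - defect B v v' g c = 0 ∧
      defect B u v' g c + defect B v u' g c = 0 := by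
  have h1 := hx.isotropic _ h'.self_of_nhds _ (lDeriv_cplxLie_mem hx hu hv h c)
  have h2 := hx.isotropic _ h.self_of_nhds _ (lDeriv_cplxLie_mem hx hu' hv' h' c)
  rw [formC_cplxLie] at h1 h2
  have r1 := congrArg Complex.re h1
  have r2 := congrArg Complex.re h2
  have i1 := congrArg Complex.im h1
  have i2 := congrArg Complex.im h2
  simp at r1 r2 i1 i2
  simp only [defect]
  constructor <;> linarith

end Pair

theorem cplx_doubleSection (p q p' q' : G → E) (z : G) :
    cplx (doubleSection B p q z) (doubleSection B p' q' z) =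
      (sL B z).baseChange ℂ (cplxLie G (p z) (p' z))
        + (sR B z).baseChange ℂ (cplxLie G (q z) (q' z)) := by
  simp only [cplx, doubleSection, cplxLie, map_add, baseChange_tmul, tmul_add]
  abel

theorem cplx_doubleSection_mem_iff (hB : IsBiinvariantMetric B) (p q p' q' : G → E) (z : G) :
    cplx (doubleSection B p q z) (doubleSection B p' q' z) ∈ doubleSubspace B z V K ↔
      cplxLie G (p z) (p' z) ∈ V ∧ cplxLie G (q z) (q' z) ∈ K := by
  rw [cplx_doubleSection]
  constructor
  · rintro ⟨⟨u, v⟩, ⟨hu, hv⟩, h⟩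
    obtain ⟨h1, h2⟩ := doubleC_injective hB z (p := u) (q := v) h
    rw [← h1, ← h2]
    exact ⟨hu, hv⟩
  · exact fun h => ⟨(_, _), h, rfl⟩

theorem isTwistedGenComplex_doubleJ (hB : IsBiinvariantMetric B) (hx : IsPolarization B V V' x)
    (hy : IsPolarization B K K' y) {A A' : Lie(E, G) →ₗ[ℝ] Lie(E, G)}
    (hV : End.eigenspace (A.baseChange ℂ) (-I) = V) (hK : End.eigenspace (A'.baseChange ℂ) (-I) = K)
    (hA : ∀ v, A (A v) = -v) (hA' : ∀ v, A' (A' v) = -v)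
    (hAB : ∀ u v, B (A u) (A v) = B u v) (hAB' : ∀ u v, B (A' u) (A' v) = B u v) :
    IsTwistedGenComplex (cartanH B) (doubleJ hB A A') where
  smooth e g he := by
    obtain ⟨p, q, rfl, h⟩ := exists_doubleSection hB e
    obtain ⟨hp, hq⟩ := h g he
    have : (fun z => doubleJ hB A A' z (doubleSection B p q z)) =
        doubleSection B (fun z => (toLie G).symm (A (toLie G (p z))))
          (fun z => (toLie G).symm (A' (toLie G (q z)))) := by
      funext z
      rw [doubleSection, doubleJ_apply]
      rfl
    rw [this]
    exact sectionSmoothAt_doubleSection hB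
      (hp.clm_comp_space (toContinuousLinearMap
        ((toLie G).symm.toLinearMap ∘ₗ A ∘ₗ (toLie G).toLinearMap)))
      (hq.clm_comp_space (toContinuousLinearMap
        ((toLie G).symm.toLinearMap ∘ₗ A' ∘ₗ (toLie G).toLinearMap)))
  sq g e := by
    obtain ⟨p, q, rfl⟩ := exists_double hB g e
    rw [doubleJ_apply, doubleJ_apply, hA, hA', map_neg, map_neg, neg_add]
  orthogonal g e f := by
    obtain ⟨p, q, rfl⟩ := exists_double hB g e
    obtain ⟨p', q', rfl⟩ := exists_double hB g f
    rw [doubleJ_apply, doubleJ_apply, genPairing_double hB, genPairing_double hB, hAB, hAB']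
  involutive U hU a b a' b' hs hab hab' g hg := by
    obtain ⟨pa, qa, rfl, ha⟩ := exists_doubleSection hB a
    obtain ⟨pb, qb, rfl, hb⟩ := exists_doubleSection hB b
    obtain ⟨pa', qa', rfl, ha'⟩ := exists_doubleSection hB a'
    obtain ⟨pb', qb', rfl, hb'⟩ := exists_doubleSection hB b'
    simp only [eigenbundle_doubleJ hB _ hV hK, cplx_doubleSection_mem_iff hB] at hab hab' ⊢
    obtain ⟨sa, sb, sa', sb'⟩ := hs g hg
    obtain ⟨spa, sqa⟩ := ha g sa
    obtain ⟨spb, sqb⟩ := hb g sb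
    obtain ⟨spa', sqa'⟩ := ha' g sa'
    obtain ⟨spb', sqb'⟩ := hb' g sb'
    have ev : ∀ {P : G → Prop}, (∀ z ∈ U, P z) → ∀ᶠ z in 𝓝 g, P z :=
      fun h => mem_of_superset (hU.mem_nhds hg) h
    have e1 := ev fun z hz => (hab z hz).1
    have e2 := ev fun z hz => (hab z hz).2
    have e1' := ev fun z hz => (hab' z hz).1
    have e2' := ev fun z hz => (hab' z hz).2
    have hmem := bracketPart_mem hx spa spb spa' spb' e1 e1' (anchorFun pa qa g) (anchorFun pb qb g)
      (anchorFun pa' qa' g) (anchorFun pb' qb' g)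
    have hmem' := bracketPart_mem hy sqa sqb sqa' sqb' e2 e2' (anchorFun pa qa g)
      (anchorFun pb qb g) (anchorFun pa' qa' g) (anchorFun pb' qb' g)
    have hdef := defect_eq hx spa spb spa' spb' e1 e1'
    have hdef' := defect_eq hy sqa sqb sqa' sqb' e2 e2'
    obtain ⟨f1, f1'⟩ := genLeft_courantBracket_double hB spa sqa spa' sqa'
    obtain ⟨f2, f2'⟩ := genLeft_courantBracket_double hB spb sqb spb' sqb'
    obtain ⟨f3, f3'⟩ := genLeft_courantBracket_double hB spa sqa spb' sqb'
    obtain ⟨f4, f4'⟩ := genLeft_courantBracket_double hB spb sqb spa' sqa'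
    have r1 := (cplx_doubleSection_mem_iff hB (V := V) (K := K)
      (fun z => bracketPart (anchorFun pa qa g) (anchorFun pa' qa' g) pa pa' g
        - bracketPart (anchorFun pb qb g) (anchorFun pb' qb' g) pb pb' g)
      (fun z => bracketPart (anchorFun pa qa g) (anchorFun pa' qa' g) qa qa' g
        - bracketPart (anchorFun pb qb g) (anchorFun pb' qb' g) qb qb' g)
      (fun z => bracketPart (anchorFun pa qa g) (anchorFun pb' qb' g) pa pb' g
        + bracketPart (anchorFun pb qb g) (anchorFun pa' qa' g) pb pa' g)
      (fun z => bracketPart (anchorFun pa qa g) (anchorFun pb' qb' g) qa qb' g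
        + bracketPart (anchorFun pb qb g) (anchorFun pa' qa' g) qb qa' g) g).2 ⟨hmem, hmem'⟩
    convert r1 using 2
    · refine (genLeft E g).injective ?_
      rw [map_sub, genLeft_doubleSection hB]
      refine Prod.ext ?_ (ContinuousLinearMap.ext fun c => ?_)
      · rw [Prod.fst_sub, f1, f2]; simp only [map_sub]; abel
      · rw [Prod.snd_sub, sub_apply, f1' c, f2' c, smul_apply, smul_eq_mul]
        simp only [map_add, map_sub, add_apply, sub_apply]
        linarith [(hdef c).1, (hdef' c).1]
    · refine (genLeft E g).injective ?_
      rw [map_add, genLeft_doubleSection hB]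
      refine Prod.ext ?_ (ContinuousLinearMap.ext fun c => ?_)
      · rw [Prod.fst_add, f3, f4]; simp only [map_add]; abel
      · rw [Prod.snd_add, add_apply, f3' c, f4' c, smul_apply, smul_eq_mul]
        simp only [map_add, map_sub, add_apply, sub_apply]
        linarith [(hdef c).2, (hdef' c).2]

theorem formDeriv_cartanH (hB : IsBiinvariantMetric B) (g : G) : formDeriv (cartanH B) g = 0 := by
  have hl : leftForm (cartanH B) = fun _ : G => cartanH B 1 := funext leftForm_cartanH
  have key : ∀ v : Fin 4 → E, formDeriv (cartanH B) g (fun i => lTrans E g (v i)) = 0 := by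
    intro v
    rw [formDeriv_succ_apply_lTrans (smoothAt_cartanH g), hl]
    have hs : ∀ a b c d : E, B (toLie G (modelBracket G a b)) (toLie G (modelBracket G c d)) =
        B (toLie G a) ⁅toLie G b, ⁅toLie G c, toLie G d⁆⁆ := fun a b c d =>
      hB.lie_form (toLie G a) (toLie G b) ⁅toLie G c, toLie G d⁆
    have hsw : ∀ a b c d : E, B (toLie G (modelBracket G a b)) (toLie G (modelBracket G c d)) =
        B (toLie G (modelBracket G c d)) (toLie G (modelBracket G a b)) := fun a b c d =>
      hB.symm _ _
    have hj := congrArg (B (toLie G (v 0))) (lie_jacobi (toLie G (v 1)) (toLie G (v 2))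
      (toLie G (v 3)))
    rw [map_add, map_add, map_zero, ← hs, ← hs, ← hs, modelBracket_swap (v 3) (v 1),
      map_neg (toLie G), map_neg] at hj
    have i1 : Finset.Ici (1 : Fin 3) = {1, 2} := rfl
    have i2 : Finset.Ici (2 : Fin 3) = {2} := rfl
    have j2 : Fin.succAbove (2 : Fin 4) ((2 : Fin 3).succAbove 1) = 1 := rfl
    have j4 : Fin.succAbove (1 : Fin 4) ((2 : Fin 3).succAbove 1) = 2 := rfl
    have j6 : Fin.succAbove (1 : Fin 4) (2 : Fin 3) = 3 := rfl
    have k1 : (2 : Fin 3).succ = 3 := rfl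
    have k2 : (1 : Fin 3).succ = 2 := rfl
    simp [lDeriv_const, Fin.sum_univ_succ, cartanH_one_apply hB, Fin.removeNth, i1, i2, j2,
      j4, j6, k1, k2, hsw (v 2) (v 3), hsw (v 1) (v 2), hsw (v 1) (v 3)]
    linarith
  ext v
  have h := key fun i => lMC E g (v i)
  simpa using h

/-- A polarization defines a generalized Kähler structure. -/
theorem isTwistedGenKahler_doubleJ (hB : IsBiinvariantMetric B) (hx : IsPolarization B V V' x) :
    IsTwistedGenKahler (cartanH B) (doubleJ hB (-polJ B x) (-polJ B x))
      (doubleJ hB (-polJ B x) (polJ B x)) where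
  smooth_form := smoothAt_cartanH
  closed_form := formDeriv_cartanH hB
  left := isTwistedGenComplex_doubleJ hB hx hx hx.eigenspace_neg_polJ hx.eigenspace_neg_polJ
    (by simp [hx.polJ_polJ]) (by simp [hx.polJ_polJ]) (by simp [hx.polJ_form])
    (by simp [hx.polJ_form])
  right := isTwistedGenComplex_doubleJ hB hx hx.conj hx.eigenspace_neg_polJ hx.eigenspace_polJ
    (by simp [hx.polJ_polJ]) (by simp [hx.polJ_polJ]) (by simp [hx.polJ_form])
    (by simp [hx.polJ_form])
  commute g e := by
    obtain ⟨p, q, rfl⟩ := exists_double hB g e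
    rw [doubleJ_apply, doubleJ_apply, doubleJ_apply, doubleJ_apply]
    simp only [LinearMap.neg_apply, map_neg]
  pos g e he := by
    obtain ⟨p, q, rfl⟩ := exists_double hB g e
    rw [doubleJ_apply, doubleJ_apply]
    have h1 : ∀ u, 0 ≤ B u u := fun u => by
      by_cases hu : u = 0
      · rw [hu]; simp
      · exact (hB.pos u hu).le
    have h2 : -(sL B g ((-polJ B x) ((-polJ B x) p)) + sR B g ((-polJ B x) (polJ B x q))) =
        sL B g p + sR B g (-q) := by
      simp [hx.polJ_polJ, add_comm]
    rw [h2, genPairing_double hB, map_neg, LinearMap.neg_apply]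
    by_cases hp : p = 0
    · have hq : q ≠ 0 := fun hq => he (by rw [hp, hq, map_zero, map_zero, add_zero])
      linarith [hB.pos q hq, h1 p]
    · linarith [hB.pos p hp, h1 q]

/-! ### Existence of normalized trivializations -/

/-- A smooth family of pure spinors with prescribed value at one point. -/
theorem exists_smooth_pure (hB : IsBiinvariantMetric B) (hx : IsPolarization B V V' x)
    (hy : IsPolarization B K K' y) (g : G) {β : Spinor E} (hβ : IsPureAt B V K g β) :
    ∃ Φ : G → Spinor E, Φ g = β ∧ (∀ z, SpinorSmoothAt Φ z) ∧ ∀ z, IsPureAt B V K z (Φ z) := by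
  have hz : ∀ z i, pureOp B x y z i (0 : Spinor E) = 0 := fun z i => map_zero _
  have key : ∀ l : List (Fin n ⊕ Fin n), ∃ Φ : G → Spinor E, Φ g = β ∧
      (∀ z, SpinorSmoothAt Φ z) ∧ ∀ z, ∀ i ∈ l, pureOp B x y z i (Φ z) = 0 := by
    intro l
    induction l with
    | nil => exact ⟨fun _ => β, rfl, spinorSmoothAt_const β, by simp⟩
    | cons j l ih =>
      obtain ⟨Φ, h1, h2, h3⟩ := ih
      refine ⟨fun z => pureOp B x y z j (pureDualOp B x y z j (Φ z)), ?_, fun z => ?_,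
        fun z i hi => ?_⟩
      · have := pureOp_dual hB hx hy g j j β
        rw [(isPureAt_iff hx hy g β).1 hβ j, map_zero, add_zero, if_pos rfl] at this
        beta_reduce
        rw [h1, this]
      · rcases j with j | j
        · exact ((h2 z).cliffU _).cliffU _
        · exact ((h2 z).cliffR_adC _).cliffR_adC _
      · have ha := pureOp_anticomm hB hx hy z
        by_cases hij : i = j
        · have h4 := ha j j (pureDualOp B x y z j (Φ z))
          rw [← two_smul ℂ] at h4
          rw [hij]
          exact (smul_eq_zero_iff_right (two_ne_zero (α := ℂ))).1 h4
        · have h5 := pureOp_dual hB hx hy z i j (Φ z)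
          rw [h3 z i ((List.mem_cons.1 hi).resolve_left hij), map_zero, add_zero, if_neg hij] at h5
          have h6 := ha i j (pureDualOp B x y z j (Φ z))
          rwa [h5, map_zero, add_zero] at h6
  obtain ⟨Φ, h1, h2, h3⟩ := key Finset.univ.toList
  exact ⟨Φ, h1, h2, fun z => (isPureAt_iff hx hy z _).2 fun i => h3 z i (by simp)⟩

/-- Reversing the right polarization of a family of pure spinors preserves its norm. -/
theorem exists_pure_reverse (hn : finrank ℝ E = 2 * n) (hB : IsBiinvariantMetric B)
    (hx : IsPolarization B V V' x) (hy : IsPolarization B K K' y)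
    (hs : ∀ z, SpinorSmoothAt Φ z) (hp : ∀ z, IsPureAt B V K z (Φ z)) :
    ∃ Ψ : G → Spinor E, (∀ z, SpinorSmoothAt Ψ z) ∧ (∀ z, IsPureAt B V K' z (Ψ z)) ∧
      ∀ z, spinorPairing (2 * n) (Ψ z) (Ψ z).conj = spinorPairing (2 * n) (Φ z) (Φ z).conj := by
  have anti : ∀ z (p q : Lieℂ(E, G)) (β : Spinor E), formC B p q = 0 →
      cliffR B (adC E z p) β = 0 → cliffR B (adC E z p) (cliffR B (adC E z q) β) = 0 := by
    intro z p q β h h0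
    have := cliffR_anticomm hB (adC E z p) (adC E z q) β
    rwa [h0, map_zero, add_zero, hB.formC_adC, h, neg_zero, zero_smul'] at this
  have key : ∀ l : List (Fin n), l.Nodup → ∃ Ψ : G → Spinor E, (∀ z, SpinorSmoothAt Ψ z) ∧
      (∀ z, ∀ v ∈ V, cliffU B v (Ψ z) = 0) ∧
      (∀ z, ∀ j ∉ l, cliffR B (adC E z (y j)) (Ψ z) = 0) ∧
      (∀ z, ∀ j ∈ l, cliffR B (adC E z (conjT (y j))) (Ψ z) = 0) ∧
      ∀ z, spinorPairing (2 * n) (Ψ z) (Ψ z).conj = spinorPairing (2 * n) (Φ z) (Φ z).conj := by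
    intro l
    induction l with
    | nil => exact fun _ => ⟨Φ, hs, fun z => (hp z).1, fun z j _ => (hp z).2 _ (hy.mem j),
        by simp, fun _ => rfl⟩
    | cons k l ih =>
      intro hl
      obtain ⟨Ψ, h1, h2, h3, h4, h5⟩ := ih (List.nodup_cons.1 hl).2
      have hk := (List.nodup_cons.1 hl).1
      have hiso : ∀ j, formC B (conjT (y j)) (conjT (y k)) = 0 := fun j =>
        hy.conj.isotropic _ (hy.conj.mem j) _ (hy.conj.mem k)
      refine ⟨fun z => cliffR B (adC E z (conjT (y k))) (Ψ z), fun z => (h1 z).cliffR_adC _,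
        fun z v hv => ?_, fun z j hj => ?_, fun z j hj => ?_, fun z => ?_⟩
      · have := cliffU_cliffR hB v (adC E z (conjT (y k))) (Ψ z)
        rwa [h2 z v hv, map_zero, add_zero] at this
      · rw [List.mem_cons, not_or] at hj
        exact anti z _ _ _ (by rw [hy.unitary, if_neg hj.1]) (h3 z j hj.2)
      · by_cases hjk : j = k
        · have h6 := cliffR_anticomm hB (adC E z (conjT (y k))) (adC E z (conjT (y k))) (Ψ z)
          rw [hB.formC_adC, hiso, neg_zero, zero_smul', ← two_smul ℂ] at h6
          rw [hjk]
          exact (smul_eq_zero_iff_right (two_ne_zero (α := ℂ))).1 h6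
        · exact anti z _ _ _ (hiso j) (h4 z j ((List.mem_cons.1 hj).resolve_left hjk))
      · have h6 := cliffR_anticomm hB (adC E z (conjT (y k))) (adC E z (y k)) (Ψ z).conj
        have h7 : cliffR B (adC E z (conjT (y k))) (Ψ z).conj = 0 := by
          have := congrArg Spinor.conj (h3 z k hk)
          rw [conj_cliffR, conjT_adC] at this
          rw [this]; funext i; ext v; exact map_zero (starRingEnd ℂ)
        rw [h7, map_zero, add_zero, hB.formC_adC, hy.formC_symm, hy.unitary, if_pos rfl] at h6
        have h8 := spinorPairing_clifford hn ((rightVec B).baseChange ℂ (adC E z (conjT (y k))))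
          (Ψ z) (cliffR B (adC E z (y k)) (Ψ z).conj)
        rw [← cliffR_apply, h6, ← pairingBilin_apply _ (Ψ z), map_smul,
          show ∀ w : E [⋀^Fin (2 * n)]→L[ℝ] ℂ, -((-1 : ℂ) • w) = w from fun w => by module] at h8
        beta_reduce
        rw [conj_cliffR, conjT_adC, conjT_conjT, h8, pairingBilin_apply, h5]
  obtain ⟨Ψ, h1, h2, -, h4, h5⟩ := key Finset.univ.toList (Finset.nodup_toList _)
  refine ⟨Ψ, h1, fun z => (isPureAt_iff hx hy.conj z _).2 ?_, h5⟩
  rintro (i | i)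
  · exact h2 z _ (hx.mem i)
  · exact h4 z i (by simp)

/-- The real number `i⁻ⁿ ⟨β, β̄⟩`, in terms of a basis. -/
def spinorNorm (e : Basis (Fin (2 * n)) ℝ E) (β : Spinor E) : ℝ :=
  ((I ^ n)⁻¹ * spinorPairing (2 * n) β β.conj e).re

theorem spinorPairing_self_conj (e : Basis (Fin (2 * n)) ℝ E) (β : Spinor E) :
    spinorPairing (2 * n) β β.conj e = I ^ n * spinorNorm e β := by
  have hI : I ^ n ≠ 0 := pow_ne_zero n I_ne_zero
  have h : starRingEnd ℂ ((I ^ n)⁻¹ * spinorPairing (2 * n) β β.conj e) =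
      (I ^ n)⁻¹ * spinorPairing (2 * n) β β.conj e := by
    rw [map_mul, conj_spinorPairing, Spinor.conj_conj, spinorPairing_symm,
      ContinuousAlternatingMap.smul_apply, smul_eq_mul, ← mul_assoc, map_inv₀, map_pow,
      conj_I, neg_pow, mul_inv]
    congr 1
    rw [mul_right_comm, inv_mul_cancel₀ (pow_ne_zero n (by norm_num)), one_mul]
  rw [spinorNorm, Complex.conj_eq_iff_re.1 h, mul_inv_cancel_left₀ hI]

theorem spinorNorm_smul (e : Basis (Fin (2 * n)) ℝ E) (c : ℂ) (β : Spinor E) :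
    spinorNorm e (c • β) = normSq c * spinorNorm e β := by
  rw [spinorNorm, conj_smul, ← pairingBilin_apply, map_smul, map_smul, LinearMap.smul_apply,
    pairingBilin_apply, ContinuousAlternatingMap.smul_apply, ContinuousAlternatingMap.smul_apply,
    spinorPairing_self_conj, smul_eq_mul, smul_eq_mul, ← mul_assoc (starRingEnd ℂ c), 
    ← Complex.normSq_eq_conj_mul_self, mul_left_comm, 
    inv_mul_cancel_left₀ (pow_ne_zero n I_ne_zero), ← Complex.ofReal_mul, ofReal_re]

theorem contMDiffAt_spinorNorm (e : Basis (Fin (2 * n)) ℝ E) (h : SpinorSmoothAt Φ g) :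
    C∞[E, ℝ] (fun z => spinorNorm e (Φ z)) g :=
  (contMDiffAt_spinorPairing h h.conj (2 * n)).clm_comp_space
    (Complex.reCLM ∘L (ContinuousLinearMap.mul ℝ ℂ (I ^ n)⁻¹) ∘L formEval (F := ℂ) e)

theorem IsPureAt.spinorNorm_ne_zero (hn : finrank ℝ E = 2 * n) (hB : IsBiinvariantMetric B)
    (hx : IsPolarization B V V' x) (hy : IsPolarization B K K' y)
    (e : Basis (Fin (2 * n)) ℝ E) {β : Spinor E} (h : IsPureAt B V K g β) (hne : β ≠ 0) :
    spinorNorm e β ≠ 0 := fun h0 =>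
  h.pairing_ne_zero hn hB hx hy hne (form_ext_basis e (by
    rw [spinorPairing_self_conj, h0, ofReal_zero, mul_zero]; rfl))

/-- The sign of the norms of the spinors annihilated by `s(V ⊕ V)` is locally constant, and there
are local frames of norm `±1`. -/
theorem exists_pureFrames (hn : finrank ℝ E = 2 * n) (hB : IsBiinvariantMetric B)
    (hx : IsPolarization B V V' x) (e : Basis (Fin (2 * n)) ℝ E) :
    ∃ ε : G → ℝ, (∀ z, |ε z| = 1) ∧ ∀ g, ∃ U : Set G, IsOpen U ∧ g ∈ U ∧ (∀ z ∈ U, ε z = ε g) ∧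
      ∃ Φ Ψ : G → Spinor E, (∀ z ∈ U, SpinorSmoothAt Φ z) ∧ (∀ z ∈ U, SpinorSmoothAt Ψ z) ∧
        (∀ z ∈ U, IsPureAt B V V z (Φ z)) ∧ (∀ z ∈ U, IsPureAt B V V' z (Ψ z)) ∧
        (∀ z ∈ U, spinorNorm e (Φ z) = ε z) ∧ ∀ z ∈ U, spinorNorm e (Ψ z) = ε z := by
  choose β hne hβ using exists_pure hn hB hx hx
  have hne' := fun z => (hβ z).spinorNorm_ne_zero hn hB hx hx e (hne z)
  have hsq : ∀ r : ℝ, r ≠ 0 → |Real.sign r| = 1 := fun r hr => by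
    rcases hr.lt_or_gt with h | h
    · simp [Real.sign_of_neg h]
    · simp [Real.sign_of_pos h]
  refine ⟨fun z => Real.sign (spinorNorm e (β z)), fun z => hsq _ (hne' z), fun g => ?_⟩
  obtain ⟨Φ, h1, h2, h3⟩ := exists_smooth_pure hB hx hx g (hβ g)
  obtain ⟨Ψ, k1, k2, k3⟩ := exists_pure_reverse hn hB hx hx h2 h3
  have hΨ : ∀ z, spinorNorm e (Ψ z) = spinorNorm e (Φ z) := fun z => by
    rw [spinorNorm, k3, spinorNorm]
  set s : ℝ := Real.sign (spinorNorm e (β g)) with hs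
  have hss : s * s = 1 := by rw [← abs_mul_abs_self, hs, hsq _ (hne' g), one_mul]
  have hsm : ∀ z, C∞[E, ℝ] (fun z => s * spinorNorm e (Φ z)) z := fun z =>
    (contMDiffAt_spinorNorm e (h2 z)).clm_comp_space (ContinuousLinearMap.mul ℝ ℝ s)
  have hc : Continuous fun z => s * spinorNorm e (Φ z) :=
    continuous_iff_continuousAt.2 fun z => (hsm z).continuousAt
  let c : G → ℂ := fun z => ((s * spinorNorm e (Φ z)) ^ (-(1 / 2) : ℝ) : ℝ)
  have hcs : ∀ z, 0 < s * spinorNorm e (Φ z) → C∞[E, ℂ] c z := fun z hz => by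
    have h4 : ContDiffAt ℝ ∞ (fun r : ℝ => r ^ (-(1 / 2) : ℝ)) (s * spinorNorm e (Φ z)) :=
      contDiffAt_id.rpow_const_of_ne hz.ne'
    exact ((h4.contMDiffAt (x := s * spinorNorm e (Φ z))).comp z (hsm z)).clm_comp_space
      ofRealCLM
  have hnorm : ∀ z, 0 < s * spinorNorm e (Φ z) → 
      normSq (c z) * spinorNorm e (Φ z) = s := fun z hz => by
    have h4 : normSq (c z) = (s * spinorNorm e (Φ z))⁻¹ := by
      rw [Complex.normSq_ofReal, ← Real.rpow_add hz, ← Real.rpow_neg_one]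
      norm_num
    have h5 : spinorNorm e (Φ z) = s * (s * spinorNorm e (Φ z)) := by rw [← mul_assoc, hss, one_mul]
    rw [h4]
    nth_rewrite 2 [h5]
    rw [mul_left_comm, inv_mul_cancel₀ hz.ne', mul_one]
  have hsign : ∀ z, 0 < s * spinorNorm e (Φ z) →
      Real.sign (spinorNorm e (β z)) = s := fun z hz => by
    obtain ⟨a, ha⟩ := (hβ z).eq_smul hn hB hx hx (hne z) (h3 z)
    have h4 : s * (normSq a * spinorNorm e (β z)) = s * spinorNorm e (Φ z) := by
      rw [ha, spinorNorm_smul]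
    have h5 : 0 < s * spinorNorm e (β z) :=
      pos_of_mul_pos_right (by linarith : 0 < normSq a * (s * spinorNorm e (β z)))
        (Complex.normSq_nonneg a)
    rcases (hne' g).lt_or_gt with h | h <;> rcases (hne' z).lt_or_gt with h' | h' <;>
      simp only [hs, Real.sign_of_neg, Real.sign_of_pos, h, h'] at h5 ⊢ <;>
      linarith
  refine ⟨{z | 0 < s * spinorNorm e (Φ z)}, isOpen_lt continuous_const hc, ?_, hsign,
    fun z => c z • Φ z, fun z => c z • Ψ z, fun z hz => (h2 z).smul (hcs z hz),
    fun z hz => (k1 z).smul (hcs z hz), fun z _ => ?_, fun z _ => ?_, fun z hz => ?_,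
    fun z hz => ?_⟩
  · rw [Set.mem_setOf_eq, h1, hs]
    rcases (hne' g).lt_or_gt with h | h <;> simp [Real.sign_of_neg, Real.sign_of_pos, h]
  · exact ⟨fun v hv => by rw [map_smul, (h3 z).1 v hv, Spinor.smul_zero'],
      fun v hv => by rw [map_smul, (h3 z).2 v hv, Spinor.smul_zero']⟩
  · exact ⟨fun v hv => by rw [map_smul, (k2 z).1 v hv, Spinor.smul_zero'],
      fun v hv => by rw [map_smul, (k2 z).2 v hv, Spinor.smul_zero']⟩
  · rw [spinorNorm_smul, hnorm z hz]; exact (hsign z hz).symm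
  · rw [spinorNorm_smul, hΨ, hnorm z hz]; exact (hsign z hz).symm

theorem exists_weylElt_eq (x : Fin n → Lieℂ(E, G)) :
    ∃ κ, weylElt x = I ⊗ₜ[ℝ] κ := ⟨_, eq_I_tmul_of_conjT_eq_neg (conjT_weylElt x)⟩

theorem imT_potential {ι : Type*} [Fintype ι] (b : Basis ι ℝ E) (a : E →L[ℝ] ℂ) (g : G)
    (κ l : Lie(E, G)) : imT (potential B b a (I ⊗ₜ[ℝ] κ) (adC E g (I ⊗ₜ[ℝ] l))) =
      ∑ i, (a (b i)).im • ((0, coordCLM b i) : GenTangent E)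
        + (1 / 2 : ℝ) • leftVec B κ - (1 / 2 : ℝ) • rightVec B (adLie E g l) := by
  have h : ∀ v : GenTangent E, imT ((1 / 2 : ℂ) • (I ⊗ₜ[ℝ] v)) = (1 / 2 : ℝ) • v :=
    fun v => by rw [smul_tmul', imT_tmul]; norm_num
  rw [potential, map_sub, map_add, covectorC, map_sum, adC, baseChange_tmul,
    baseChange_tmul, baseChange_tmul, h, h]
  simp only [imT_tmul]

/-- The spinor whose expression in the left trivialization is `Φ`. -/
def ofLeftSpinor (Φ : G → Spinor E) (z : G) : Spinor E := pull (lMC E z) (Φ z)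

theorem pull_ofLeftSpinor (Φ : G → Spinor E) (z : G) :
    pull (lTrans E z) (ofLeftSpinor Φ z) = Φ z := by
  funext k; ext v
  simp [ofLeftSpinor, pull_apply]

theorem leftSpinor_ofLeftSpinor (Φ : G → Spinor E) : leftSpinor (ofLeftSpinor Φ) = Φ :=
  funext fun z => pull_ofLeftSpinor Φ z

/-- A normalized frame of pure spinors is one half of a normalized trivialization. -/
theorem exists_trivialization (hn : finrank ℝ E = 2 * n) (hB : IsBiinvariantMetric B)
    (hx : IsPolarization B V V' x) (hy : IsPolarization B K K' y) (hU : IsOpen U)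
    (hs : ∀ z ∈ U, SpinorSmoothAt Φ z) (hp : ∀ z ∈ U, IsPureAt B V K z (Φ z))
    {vol : G → E [⋀^Fin (2 * n)]→L[ℝ] ℝ} (hvol0 : ∀ z, vol z ≠ 0)
    (hvol : ∀ g, ∀ᶠ z in 𝓝 g, leftForm vol z = leftForm vol g)
    (hnorm : ∀ z ∈ U, (I ^ n)⁻¹ • spinorPairing (2 * n) (Φ z) (Φ z).conj =
      ofRealForm (leftForm vol z)) :
    ∃ (φ : G → Spinor E) (a : G → GenTangent E), (∀ z ∈ U, ∀ k, FormSmoothAt (fun y => φ y k) z) ∧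
      (∀ z ∈ U, spinorKer (φ z) = doubleSubspace B z V K) ∧
      (∀ z ∈ U, (I ^ n)⁻¹ • spinorPairing (2 * n) (φ z) (φ z).conj =
        ofRealForm (vol z)) ∧ (∀ z ∈ U, SectionSmoothAt a z) ∧
      ∀ z ∈ U, twistedDeriv (cartanH B) φ z = clifford (I ⊗ₜ[ℝ] a z) (φ z) := by
  let e : Basis (Fin (2 * n)) ℝ E := finBasisOfFinrankEq ℝ E hn
  obtain ⟨d, hd⟩ := exists_isDualOf hB e
  have hs' : ∀ z ∈ U, ∀ k, FormSmoothAt (fun y => ofLeftSpinor Φ y k) z := fun z hz =>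
    spinorSmoothAt_leftSpinor.1 (by rw [leftSpinor_ofLeftSpinor]; exact hs z hz)
  have hnorm' : ∀ z ∈ U, (I ^ n)⁻¹ •
      spinorPairing (2 * n) (ofLeftSpinor Φ z) (ofLeftSpinor Φ z).conj =
        ofRealForm (vol z) := fun z hz => by
    rw [ofLeftSpinor, pull_conj, ← pull_spinorPairing]
    ext v
    have := congrArg (fun w => w fun i => lMC E z (v i)) (hnorm z hz)
    simpa [leftForm, Function.comp_def] using this
  have hker : ∀ z ∈ U, spinorKer (ofLeftSpinor Φ z) = doubleSubspace B z V K := fun z hz =>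
    spinorKer_of_isPureAt hB hx hy (by rw [pull_ofLeftSpinor]; exact hp z hz)
      (ne_zero_of_pairing (hvol0 z) (hnorm' z hz))
  have hF := isPureFrame_leftSpinor hB hU hs' hker hnorm' hvol0 hvol
  rw [leftSpinor_ofLeftSpinor] at hF
  let p : G → ℂ ⊗[ℝ] GenTangent E := fun z =>
    potential B e (connForm B e d e Φ z) (weylElt x) (adC E z (weylElt y))
  have hpc : ∀ z ∈ U, p z = I ⊗ₜ[ℝ] imT (p z) := fun z hz =>
    eq_I_tmul_of_conjT_eq_neg (conjT_potential (hF.conj_connForm hn hB hd hx hy e hz)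
      (conjT_weylElt x) (by rw [conjT_adC, conjT_weylElt, map_neg]))
  refine ⟨ofLeftSpinor Φ, fun z => (genLeft E z).symm (imT (p z)), hs', hker, hnorm',
    fun z hz => sectionSmoothAt_iff.2 ?_, fun z hz => pull_lTrans_injective z ?_⟩
  · obtain ⟨κ, hκ⟩ := exists_weylElt_eq x
    obtain ⟨l, hl⟩ := exists_weylElt_eq y
    simp only [apply_symm_apply, p, hκ, hl, imT_potential]
    refine ((ContMDiffAt.sum fun i _ => ?_).add contMDiffAt_const).sub
      ((contMDiffAt_rightVec_adLie z l).clm_comp_space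
        ((1 / 2 : ℝ) • ContinuousLinearMap.id ℝ (GenTangent E)))
    exact (hF.contMDiffAt_connForm hn hB hx hy e hz (e i)).clm_comp_space
      (Complex.imCLM.smulRight ((0, coordCLM e i) : GenTangent E))
  · have h1 := pull_clifford z (I ⊗ₜ[ℝ] (genLeft E z).symm (imT (p z))) (ofLeftSpinor Φ z)
    rw [baseChange_tmul, LinearEquiv.coe_coe, apply_symm_apply, ← hpc z hz, pull_ofLeftSpinor] at h1
    rw [h1, pull_twistedDeriv hB hd (hs' z hz), leftSpinor_ofLeftSpinor]
    exact hF.leftTwisted_eq_potential hn hB hd hx hy e hz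

/-- An invariant volume form, up to sign, with normalized trivializations around every point. -/
theorem exists_volume (hn : finrank ℝ E = 2 * n) (hB : IsBiinvariantMetric B)
    (hx : IsPolarization B V V' x) {J₁ J₂ : G → GenTangent E →ₗ[ℝ] GenTangent E}
    (hJ₁ : ∀ g, eigenbundle (J₁ g) = doubleSubspace B g V V)
    (hJ₂ : ∀ g, eigenbundle (J₂ g) = doubleSubspace B g V V') :
    ∃ vol : G → E [⋀^Fin (2 * n)]→L[ℝ] ℝ, (∀ g, FormSmoothAt vol g) ∧ (∀ g, vol g ≠ 0) ∧
      (∀ (g : G) (v : Fin (2 * n) → E), |leftForm vol g v| = |leftForm vol 1 v|) ∧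
      (∀ g, ∀ᶠ z in 𝓝 g, leftForm vol z = leftForm vol g) ∧
      ∀ g, ∃ T : NormalizedTrivialization n (cartanH B) J₁ J₂ vol, g ∈ T.U := by
  let e : Basis (Fin (2 * n)) ℝ E := finBasisOfFinrankEq ℝ E hn
  obtain ⟨ε, hε, h⟩ := exists_pureFrames hn hB hx e
  let w : E [⋀^Fin (2 * n)]→L[ℝ] ℝ :=
    { e.det with
      cont := by
        have : Continuous fun v : Fin (2 * n) → E => (e.toMatrix v).det :=
          Continuous.matrix_det (continuous_matrix fun i j =>
            (e.coord i).continuous_of_finiteDimensional.comp (continuous_apply j))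
        exact this }
  have hw : w e = 1 := e.det_self
  let vol : G → E [⋀^Fin (2 * n)]→L[ℝ] ℝ := fun z => (ε z • w).compContinuousLinearMap (lMC E z)
  have hleft : ∀ z, leftForm vol z = ε z • w := fun z => by
    ext v
    simp [leftForm, vol, Function.comp_def]
  have hvol : ∀ g, ∀ᶠ z in 𝓝 g, leftForm vol z = leftForm vol g := fun g => by
    obtain ⟨U, hU, hg, hc, -⟩ := h g
    filter_upwards [hU.mem_nhds hg] with z hz
    rw [hleft, hleft, hc z hz]
  have hvol0 : ∀ z, vol z ≠ 0 := fun z h0 => by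
    have h1 : (ε z • w) e = 0 := by rw [← hleft, leftForm, h0]; rfl
    rw [ContinuousAlternatingMap.smul_apply, hw, smul_eq_mul, mul_one] at h1
    simpa [h1] using hε z
  refine ⟨vol, fun g => formSmoothAt_iff.2 (contMDiffAt_const.congr_of_eventuallyEq (hvol g)),
    hvol0, fun g v => ?_, hvol, fun g => ?_⟩
  · simp [hleft, abs_mul, hε]
  · obtain ⟨U, hU, hg, -, Φ, Ψ, s1, s2, p1, p2, n1, n2⟩ := h g
    have norm : ∀ {z : G} {β : Spinor E}, spinorNorm e β = ε z →
        (I ^ n)⁻¹ • spinorPairing (2 * n) β β.conj =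
          ofRealForm (leftForm vol z) := fun {z β} hβ => by
      refine form_ext_basis e ?_
      rw [ContinuousAlternatingMap.smul_apply, spinorPairing_self_conj, smul_eq_mul,
        inv_mul_cancel_left₀ (pow_ne_zero n I_ne_zero), hβ, hleft]
      simp [hw]
    obtain ⟨φ, a, a1, a2, a3, a4, a5⟩ := exists_trivialization hn hB hx hx hU s1 p1 hvol0 hvol
      fun z hz => norm (n1 z hz)
    obtain ⟨ψ, b, b1, b2, b3, b4, b5⟩ := exists_trivialization hn hB hx hx.conj hU s2 p2 hvol0 hvol
      fun z hz => norm (n2 z hz)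
    exact ⟨⟨U, hU, φ, ψ, a1, b1, fun z hz => (a2 z hz).trans (hJ₁ z).symm,
      fun z hz => (b2 z hz).trans (hJ₂ z).symm, a3, b3, a, b, a4, b4, a5, b5⟩, hg⟩

end InvariantCalculus

/-! ### Root decomposition for an invariant inner product -/

section RootTheory

variable {L : Type*} [LieRing L] [LieAlgebra ℝ L] {B : BilinForm ℝ L}
  {𝔱 : LieSubalgebra ℝ L} {α β : 𝔱 →ₗ[ℝ] ℂ} {u v z : ℂ ⊗[ℝ] L}

/-- An invariant inner product on a real Lie algebra. -/
structure IsInvariantInner (B : BilinForm ℝ L) : Prop where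
  symm : ∀ x y, B x y = B y x
  pos : ∀ x, x ≠ 0 → 0 < B x x
  lie : ∀ x y z, B ⁅x, y⁆ z = B x ⁅y, z⁆

theorem lieC_smul (c : ℂ) (z w : ℂ ⊗[ℝ] L) : ⁅z, c • w⁆ = c • ⁅z, w⁆ := lie_smul c z w

theorem smul_lieC (c : ℂ) (z w : ℂ ⊗[ℝ] L) : ⁅c • z, w⁆ = c • ⁅z, w⁆ := smul_lie c z w

theorem lieC_skew (z w : ℂ ⊗[ℝ] L) : ⁅z, w⁆ = -⁅w, z⁆ := (lie_skew z w).symm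

theorem mem_rootSpaceC : z ∈ rootSpaceC 𝔱 α ↔ ∀ h : 𝔱, ⁅(1 : ℂ) ⊗ₜ[ℝ] (h : L), z⁆ = α h • z := by
  simp only [rootSpaceC, Submodule.mem_iInf, End.mem_eigenspace_iff]
  rfl

namespace IsInvariantInner

theorem formC_symm (hB : IsInvariantInner B) (u v : ℂ ⊗[ℝ] L) : formC B u v = formC B v u :=
  baseChange_form_symm B hB.symm u v

theorem formC_lie_right (hB : IsInvariantInner B) (w u v : ℂ ⊗[ℝ] L) :
    formC B ⁅w, u⁆ v = -formC B u ⁅w, v⁆ := by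
  rw [lieC_skew, map_neg, LinearMap.neg_apply, formC_lie B hB.lie]

theorem eq_zero (hB : IsInvariantInner B) (h : formC B z (conjT z) = 0) : z = 0 :=
  eq_zero_of_form_self_conjT B hB.symm hB.pos h

/-- The Hermitian inner product on `ℂ ⊗ L`. -/
abbrev hermCore (hB : IsInvariantInner B) : InnerProductSpace.Core ℂ (ℂ ⊗[ℝ] L) where
  inner u v := formC B (conjT u) v
  conj_inner_symm u v := by
    rw [formC, ← baseChange_form_conjT, conjT_conjT]
    exact hB.formC_symm _ _
  re_inner_nonneg u := by
    have hn : ∀ x, 0 ≤ B x x := fun x => by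
      by_cases hx : x = 0
      · simp [hx]
      · exact (hB.pos x hx).le
    rw [hB.formC_symm, formC, baseChange_form_self_conjT B hB.symm]
    exact add_nonneg (hn _) (hn _)
  add_left u v w := by rw [map_add, map_add, LinearMap.add_apply]
  smul_left u v r := by rw [conjT_smul, map_smul, LinearMap.smul_apply, smul_eq_mul]
  definite u h := hB.eq_zero (by rw [hB.formC_symm]; exact h)

theorem exists_unitary [FiniteDimensional ℝ L] (hB : IsInvariantInner B)
    (S : Submodule ℂ (ℂ ⊗[ℝ] L)) : ∃ (m : ℕ) (x : Fin m → ℂ ⊗[ℝ] L), (∀ j, x j ∈ S) ∧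
      (∀ j k, formC B (x j) (conjT (x k)) = if j = k then 1 else 0) ∧
      ∀ z ∈ S, z = ∑ j, formC B z (conjT (x j)) • x j := by
  letI c := hB.hermCore
  letI : NormedAddCommGroup (ℂ ⊗[ℝ] L) := c.toNormedAddCommGroup
  letI : InnerProductSpace ℂ (ℂ ⊗[ℝ] L) := InnerProductSpace.ofCore c.toCore
  let b := stdOrthonormalBasis ℂ S
  refine ⟨_, fun j => b j, fun j => (b j).2, fun j k => ?_, fun z hz => ?_⟩
  · rw [hB.formC_symm]
    have := orthonormal_iff_ite.1 b.orthonormal k j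
    simp only [eq_comm (a := k)] at this
    exact this
  · have := congrArg Subtype.val (b.sum_repr' ⟨z, hz⟩).symm
    rw [Submodule.coe_sum] at this
    refine this.trans (sum_congr rfl fun j _ => ?_)
    rw [hB.formC_symm]
    rfl

theorem iSup_rootSpaceC [FiniteDimensional ℝ L] (hB : IsInvariantInner B)
    (hab : ∀ h h' : 𝔱, ⁅(h : L), (h' : L)⁆ = 0) : ⨆ α, rootSpaceC 𝔱 α = ⊤ := by
  letI c := hB.hermCore
  letI : NormedAddCommGroup (ℂ ⊗[ℝ] L) := c.toNormedAddCommGroup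
  letI : InnerProductSpace ℂ (ℂ ⊗[ℝ] L) := InnerProductSpace.ofCore c.toCore
  let T : 𝔱 → End ℂ (ℂ ⊗[ℝ] L) := fun h =>
    I • LieAlgebra.ad ℂ (ℂ ⊗[ℝ] L) ((1 : ℂ) ⊗ₜ[ℝ] (h : L))
  have hT : ∀ h u, T h u = I • ⁅(1 : ℂ) ⊗ₜ[ℝ] (h : L), u⁆ := fun h u => rfl
  have hsym : ∀ h, (T h).IsSymmetric := fun h u v => by
    change formC B (conjT (T h u)) v = formC B (conjT u) (T h v)
    rw [hT, hT, conjT_smul, conjT_lie, conjT_tmul, map_one, conj_I, map_smul,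
      LinearMap.smul_apply, map_smul, hB.formC_lie_right]
    simp
  have hcomm : Pairwise (Function.onFun Commute T) := fun h h' _ => by
    refine LinearMap.ext fun u => ?_
    change T h (T h' u) = T h' (T h u)
    have h1 : ⁅(1 : ℂ) ⊗ₜ[ℝ] (h : L), (1 : ℂ) ⊗ₜ[ℝ] (h' : L)⁆ = 0 := by
      rw [bracket_tmul ℝ ℂ, hab, tmul_zero]
    have h2 : ⁅(1 : ℂ) ⊗ₜ[ℝ] (h : L), ⁅(1 : ℂ) ⊗ₜ[ℝ] (h' : L), u⁆⁆ =
        ⁅⁅(1 : ℂ) ⊗ₜ[ℝ] (h : L), (1 : ℂ) ⊗ₜ[ℝ] (h' : L)⁆, u⁆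
          + ⁅(1 : ℂ) ⊗ₜ[ℝ] (h' : L), ⁅(1 : ℂ) ⊗ₜ[ℝ] (h : L), u⁆⁆ := leibniz_lie _ _ _
    rw [h1, zero_lie, zero_add] at h2
    rw [hT, hT, hT, hT, lieC_smul, lieC_smul, h2]
  have key := LinearMap.IsSymmetric.iSup_iInf_eq_top_of_commute hsym hcomm
  rw [eq_top_iff, ← key]
  refine iSup_le fun χ => ?_
  by_cases hbot : ⨅ h, End.eigenspace (T h) (χ h) = ⊥
  · rw [hbot]; exact bot_le
  obtain ⟨w, hw, hw0⟩ := Submodule.exists_mem_ne_zero_of_ne_bot hbot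
  have hmem : ∀ u ∈ ⨅ h, End.eigenspace (T h) (χ h), ∀ h : 𝔱,
      ⁅(1 : ℂ) ⊗ₜ[ℝ] (h : L), u⁆ = (-I * χ h) • u := fun u hu h => by
    have := End.mem_eigenspace_iff.1 ((Submodule.mem_iInf _).1 hu h)
    rw [mul_smul, ← this, hT, smul_smul, neg_mul, I_mul_I, neg_neg, one_smul]
  have inj : ∀ {a b : ℂ}, a • w = b • w → a = b := fun h => smul_left_injective ℂ hw0 h
  let α : 𝔱 →ₗ[ℝ] ℂ :=
    { toFun := fun h => -I * χ h
      map_add' := fun h h' => inj (by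
        rw [add_smul, ← hmem w hw, ← hmem w hw, ← hmem w hw, show ((h + h' : 𝔱) : L) = h + h' from rfl,
          tmul_add, add_lie])
      map_smul' := fun r h => inj (by
        rw [← hmem w hw, RingHom.id_apply, real_smul, mul_smul, ← hmem w hw,
          show ((r • h : 𝔱) : L) = r • (h : L) from rfl, ← smul_lieC, smul_tmul',
          ← smul_tmul, real_smul, smul_eq_mul]) }
  exact le_iSup_of_le α fun u hu => mem_rootSpaceC.2 fun h => hmem u hu h

theorem abelian (hB : IsInvariantInner B) (h𝔱 : 𝔱.IsCartanSubalgebra) (h h' : 𝔱) :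
    ⁅(h : L), (h' : L)⁆ = 0 := by
  obtain ⟨k, hk⟩ := LieModule.exists_forall_pow_toEnd_eq_zero ℝ 𝔱 𝔱
  have key : ∀ (j : ℕ) (v : 𝔱), (LieModule.toEnd ℝ 𝔱 𝔱 h ^ (j + 1)) v = 0 → ⁅h, v⁆ = 0 := by
    intro j
    induction j with
    | zero => intro v hv; simpa using hv
    | succ j ih =>
      intro v hv
      have h1 : ⁅h, ⁅h, v⁆⁆ = 0 := ih ⁅h, v⁆ (by rw [pow_succ] at hv; exact hv)
      have h2 : ⁅(h : L), ⁅(h : L), (v : L)⁆⁆ = 0 := congrArg Subtype.val h1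
      by_contra hne
      have h3 : ⁅(h : L), (v : L)⁆ ≠ 0 := fun h0 => hne (Subtype.ext h0)
      refine (hB.pos _ h3).ne' ?_
      nth_rewrite 1 [← lie_skew]
      rw [map_neg, LinearMap.neg_apply, hB.lie, h2, map_zero, neg_zero]
  have := key k h' (by rw [pow_succ, hk, zero_mul, LinearMap.zero_apply])
  exact congrArg Subtype.val this

theorem mem_complexCartan_iff (hB : IsInvariantInner B) (h𝔱 : 𝔱.IsCartanSubalgebra) :
    z ∈ complexCartan 𝔱 ↔ z ∈ rootSpaceC 𝔱 0 := by
  constructor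
  · intro hz
    rw [complexCartan, Submodule.baseChange_eq_span] at hz
    refine Submodule.span_le.2 ?_ hz
    rintro _ ⟨h', hh', rfl⟩
    refine mem_rootSpaceC.2 fun h => ?_
    rw [LinearMap.zero_apply, zero_smul, TensorProduct.mk_apply,
      bracket_tmul ℝ ℂ, hB.abelian h𝔱 h ⟨h', hh'⟩, tmul_zero]
  · intro hz
    have h1 : ∀ h : 𝔱, (1 : ℂ) ⊗ₜ[ℝ] ⁅(h : L), reT z⁆ + I ⊗ₜ[ℝ] ⁅(h : L), imT z⁆ = 0 :=
      fun h => by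
        have := mem_rootSpaceC.1 hz h
        rwa [LinearMap.zero_apply, zero_smul, ← reT_add_imT z, lieC_add,
          bracket_tmul ℝ ℂ, bracket_tmul ℝ ℂ,
          one_mul, one_mul] at this
    have mem : ∀ v : L, (∀ h : 𝔱, ⁅(h : L), v⁆ = 0) → v ∈ 𝔱 := fun v hv => by
      rw [← h𝔱.self_normalizing]
      refine (LieSubalgebra.mem_normalizer_iff 𝔱 v).2 fun y hy => ?_
      rw [← lie_skew, hv ⟨y, hy⟩, neg_zero]
      exact 𝔱.zero_mem
    rw [← reT_add_imT z]
    refine Submodule.add_mem _ (Submodule.tmul_mem_baseChange_of_mem _ (mem _ fun h => ?_))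
      (Submodule.tmul_mem_baseChange_of_mem _ (mem _ fun h => ?_))
    · simpa using congrArg reT (h1 h)
    · simpa using congrArg imT (h1 h)

theorem form_eq_zero (hB : IsInvariantInner B) (hu : u ∈ rootSpaceC 𝔱 α) (hv : v ∈ rootSpaceC 𝔱 β)
    (h : α + β ≠ 0) : formC B u v = 0 := by
  obtain ⟨t, ht⟩ := not_forall.1 (mt (LinearMap.ext (f := α + β) (g := 0)) h)
  have h1 := hB.formC_lie_right ((1 : ℂ) ⊗ₜ[ℝ] (t : L)) u v
  rw [mem_rootSpaceC.1 hu, mem_rootSpaceC.1 hv, map_smul, map_smul, LinearMap.smul_apply,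
    smul_eq_mul, smul_eq_mul, eq_neg_iff_add_eq_zero, ← add_mul] at h1
  exact (mul_eq_zero.1 h1).resolve_left ht

theorem conjT_mem_rootSpaceC (hB : IsInvariantInner B) (hz : z ∈ rootSpaceC 𝔱 α) :
    conjT z ∈ rootSpaceC 𝔱 (-α) := by
  by_cases h0 : z = 0
  · rw [h0, map_zero]; exact Submodule.zero_mem _
  have hc : ∀ h : 𝔱, ⁅(1 : ℂ) ⊗ₜ[ℝ] (h : L), conjT z⁆ = starRingEnd ℂ (α h) • conjT z := fun h => by
    rw [← conjT_smul, ← mem_rootSpaceC.1 hz, conjT_lie, conjT_tmul, map_one]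
  refine mem_rootSpaceC.2 fun h => ?_
  have h1 := hB.formC_lie_right ((1 : ℂ) ⊗ₜ[ℝ] (h : L)) z (conjT z)
  rw [mem_rootSpaceC.1 hz, hc, map_smul, map_smul, LinearMap.smul_apply, smul_eq_mul, smul_eq_mul,
    ← neg_mul] at h1
  have h2 := mul_right_cancel₀ (fun h => h0 (hB.eq_zero h)) h1
  rw [hc]
  congr 1
  rw [LinearMap.neg_apply]
  linear_combination h2

theorem lie_mem_rootSpaceC (hu : u ∈ rootSpaceC 𝔱 α) (hv : v ∈ rootSpaceC 𝔱 β) :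
    ⁅u, v⁆ ∈ rootSpaceC 𝔱 (α + β) := mem_rootSpaceC.2 fun h => by
  have h1 : ⁅(1 : ℂ) ⊗ₜ[ℝ] (h : L), ⁅u, v⁆⁆ = ⁅⁅(1 : ℂ) ⊗ₜ[ℝ] (h : L), u⁆, v⁆
    + ⁅u, ⁅(1 : ℂ) ⊗ₜ[ℝ] (h : L), v⁆⁆ := leibniz_lie _ _ _
  rw [h1, mem_rootSpaceC.1 hu, mem_rootSpaceC.1 hv, smul_lieC, lieC_smul, LinearMap.add_apply,
    add_smul]

theorem exists_lie_eq_smul (hz : z ∈ complexCartan 𝔱) (α : 𝔱 →ₗ[ℝ] ℂ) :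
    ∃ a : ℂ, ∀ u ∈ rootSpaceC 𝔱 α, ⁅z, u⁆ = a • u := by
  rw [complexCartan, Submodule.baseChange_eq_span] at hz
  induction hz using Submodule.span_induction with
  | mem z hz =>
    obtain ⟨h, hh, rfl⟩ := hz
    exact ⟨α ⟨h, hh⟩, fun u hu => mem_rootSpaceC.1 hu ⟨h, hh⟩⟩
  | zero => exact ⟨0, fun u _ => by rw [zero_lie, zero_smul]⟩
  | add z w _ _ hz hw =>
    obtain ⟨a, ha⟩ := hz
    obtain ⟨b, hb⟩ := hw
    exact ⟨a + b, fun u hu => by rw [add_lie, ha u hu, hb u hu, add_smul]⟩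
  | smul c z _ hz =>
    obtain ⟨a, ha⟩ := hz
    exact ⟨c * a, fun u hu => by rw [smul_lieC, ha u hu, mul_smul]⟩

theorem formC_conjT_self (hB : IsInvariantInner B) (z : ℂ ⊗[ℝ] L) :
    formC B z (conjT z) = (hermNormSq B z : ℂ) := by
  have h : formC B z (conjT z) = _ := baseChange_form_self_conjT B hB.symm z
  have h' : hermNormSq B z = (formC B z (conjT z)).re := rfl
  rw [h', h, ofReal_re]

theorem hermNormSq_nonneg (hB : IsInvariantInner B) (z : ℂ ⊗[ℝ] L) : 0 ≤ hermNormSq B z := by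
  have := hB.hermCore.re_inner_nonneg z
  rwa [show hB.hermCore.inner z z = formC B (conjT z) z from rfl, hB.formC_symm,
    hB.formC_conjT_self] at this

theorem eq_zero_of_weight_zero (hB : IsInvariantInner B) (hz : z ∈ rootSpaceC 𝔱 0)
    (h : ∀ w ∈ rootSpaceC 𝔱 0, formC B z w = 0) : z = 0 :=
  hB.eq_zero (h _ (by simpa using hB.conjT_mem_rootSpaceC hz))

/-- The root spaces are one-dimensional. -/
theorem eq_smul_of_mem_rootSpaceC (hB : IsInvariantInner B) (h𝔱 : 𝔱.IsCartanSubalgebra)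
    (hα : α ≠ 0) (hu : u ∈ rootSpaceC 𝔱 α) (hn : formC B u (conjT u) = 1)
    (hz : z ∈ rootSpaceC 𝔱 α) : z = formC B z (conjT u) • u := by
  set y := z - formC B z (conjT u) • u with hy
  have hym : y ∈ rootSpaceC 𝔱 α := Submodule.sub_mem _ hz (Submodule.smul_mem _ _ hu)
  have hyu : formC B y (conjT u) = 0 := by
    rw [hy, map_sub, LinearMap.sub_apply, map_smul, LinearMap.smul_apply, hn, smul_eq_mul, mul_one,
      sub_self]
  have hc := hB.conjT_mem_rootSpaceC hu
  have h0 : ⁅conjT u, y⁆ = 0 := by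
    refine hB.eq_zero_of_weight_zero (by simpa using lie_mem_rootSpaceC hc hym) fun w hw => ?_
    obtain ⟨a, ha⟩ := exists_lie_eq_smul ((hB.mem_complexCartan_iff h𝔱).2 hw) α
    rw [formC_lie B hB.lie, lieC_skew, ha y hym, map_neg, map_smul, hB.formC_symm, hyu, smul_zero,
      neg_zero]
  set t := ⁅u, conjT u⁆ with ht
  have htm : t ∈ rootSpaceC 𝔱 0 := by simpa using lie_mem_rootSpaceC hu hc
  obtain ⟨a, ha⟩ := exists_lie_eq_smul ((hB.mem_complexCartan_iff h𝔱).2 htm) α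
  have htc : conjT t = -t := by rw [ht, conjT_lie, conjT_conjT, lieC_skew]
  have hta : a = -(hermNormSq B t : ℂ) := by
    rw [← hB.formC_conjT_self, htc, map_neg, neg_neg]
    nth_rewrite 1 [ht]
    rw [lieC_skew, map_neg, LinearMap.neg_apply, formC_lie B hB.lie, lieC_skew, ha u hu, map_neg,
      neg_neg, map_smul, hB.formC_symm, hn, smul_eq_mul, mul_one]
  have hyy : (hermNormSq B ⁅u, y⁆ : ℂ) = a * hermNormSq B y := by
    have h1 : ⁅conjT u, ⁅u, y⁆⁆ = ⁅⁅conjT u, u⁆, y⁆ + ⁅u, ⁅conjT u, y⁆⁆ := leibniz_lie _ _ _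
    rw [h0, lieC_zero, add_zero, lieC_skew (conjT u) u, neg_lie, ha y hym] at h1
    rw [← hB.formC_conjT_self, ← hB.formC_conjT_self, conjT_lie, ← neg_eq_iff_eq_neg.2
      (hB.formC_lie_right (conjT u) ⁅u, y⁆ (conjT y)), h1, map_neg, LinearMap.neg_apply, neg_neg,
      map_smul, LinearMap.smul_apply, smul_eq_mul]
  have ht0 : t ≠ 0 := fun h => hα (LinearMap.ext fun s => by
    have h1 : formC B t ((1 : ℂ) ⊗ₜ[ℝ] (s : L)) = α s := by
      rw [ht, formC_lie B hB.lie, lieC_skew, map_neg, ← hB.formC_lie_right,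
        mem_rootSpaceC.1 hu, map_smul, LinearMap.smul_apply, hn, smul_eq_mul, mul_one]
    rw [← h1, h, map_zero]; rfl)
  rw [← sub_eq_zero, ← hy]
  by_contra hy0
  have pos : ∀ w : ℂ ⊗[ℝ] L, w ≠ 0 → 0 < hermNormSq B w := fun w hw =>
    (hB.hermNormSq_nonneg w).lt_of_ne' fun h => hw (hB.eq_zero (by
      rw [hB.formC_conjT_self, h, ofReal_zero]))
  rw [hta] at hyy
  have h2 : hermNormSq B ⁅u, y⁆ = -hermNormSq B t * hermNormSq B y := by exact_mod_cast hyy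
  nlinarith [hB.hermNormSq_nonneg ⁅u, y⁆, mul_pos (pos t ht0) (pos y hy0)]

end IsInvariantInner

end RootTheory

/-! ### The polarization of a system of positive roots -/

section PositiveSystem

variable {L : Type*} [LieRing L] [LieAlgebra ℝ L] {B : BilinForm ℝ L}
  {𝔱 : LieSubalgebra ℝ L} {pos : Finset (𝔱 →ₗ[ℝ] ℂ)} {J : 𝔱 →ₗ[ℝ] 𝔱}
  {θ P : (𝔱 →ₗ[ℝ] ℂ) → ℂ ⊗[ℝ] L} {z : ℂ ⊗[ℝ] L}

open IsInvariantInner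

theorem sup_biSup_induction {S : Submodule ℂ (ℂ ⊗[ℝ] L)}
    {R : (𝔱 →ₗ[ℝ] ℂ) → Submodule ℂ (ℂ ⊗[ℝ] L)} {p : ℂ ⊗[ℝ] L → Prop}
    (hS : ∀ z ∈ S, p z) (hR : ∀ α ∈ pos, ∀ z ∈ R α, p z) (hadd : ∀ z w, p z → p w → p (z + w))
    (hz : z ∈ S ⊔ ⨆ α ∈ pos, R α) : p z := by
  obtain ⟨a, ha, b, hb, rfl⟩ := Submodule.mem_sup.1 hz
  refine hadd _ _ (hS a ha) ?_
  have h0 : p 0 := hS 0 S.zero_mem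
  refine Submodule.iSup_induction _ (motive := p) hb (fun α b hb => ?_) h0 hadd
  by_cases hα : α ∈ pos
  · rw [iSup_pos hα] at hb; exact hR α hα b hb
  · rw [iSup_neg hα, Submodule.mem_bot] at hb; rw [hb]; exact h0

theorem rootSpaceC_le_oneZero {α : 𝔱 →ₗ[ℝ] ℂ} (hα : α ∈ pos) : rootSpaceC 𝔱 α ≤ oneZero 𝔱 pos J :=
  (le_iSup₂_of_le (f := fun α _ => rootSpaceC 𝔱 α) α hα le_rfl).trans le_sup_right

theorem rootSpaceC_le_zeroOne {α : 𝔱 →ₗ[ℝ] ℂ} (hα : α ∈ pos) :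
    rootSpaceC 𝔱 (-α) ≤ zeroOne 𝔱 pos J :=
  (le_iSup₂_of_le (f := fun α _ => rootSpaceC 𝔱 (-α)) α hα le_rfl).trans le_sup_right

theorem cartanOneZero_le : cartanOneZero 𝔱 J ≤ complexCartan 𝔱 := by
  rintro _ ⟨w, -, rfl⟩; exact ⟨w, rfl⟩

theorem conjT_mem_eigenspace {w : ℂ ⊗[ℝ] 𝔱} {c : ℂ} (hw : w ∈ End.eigenspace (J.baseChange ℂ) c) :
    conjT w ∈ End.eigenspace (J.baseChange ℂ) (starRingEnd ℂ c) := by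
  rw [End.mem_eigenspace_iff] at hw ⊢
  rw [← conjT_baseChange, hw, conjT_smul]

theorem conjT_mem_oneZero (hB : IsInvariantInner B) (hz : z ∈ oneZero 𝔱 pos J) :
    conjT z ∈ zeroOne 𝔱 pos J := by
  refine sup_biSup_induction (p := fun z => conjT z ∈ zeroOne 𝔱 pos J) ?_ (fun α hα z hz =>
    rootSpaceC_le_zeroOne hα (hB.conjT_mem_rootSpaceC hz)) (fun z w h h' => ?_) hz
  · rintro _ ⟨w, hw, rfl⟩
    refine mem_sup_left ⟨conjT w, ?_, (conjT_baseChange _ w).symm⟩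
    rw [← conj_I]
    exact conjT_mem_eigenspace hw
  · rw [map_add]; exact Submodule.add_mem _ h h'

theorem conjT_mem_zeroOne (hB : IsInvariantInner B) (hz : z ∈ zeroOne 𝔱 pos J) :
    conjT z ∈ oneZero 𝔱 pos J := by
  refine sup_biSup_induction (p := fun z => conjT z ∈ oneZero 𝔱 pos J) ?_ (fun α hα z hz =>
    rootSpaceC_le_oneZero hα (by simpa using hB.conjT_mem_rootSpaceC hz)) (fun z w h h' => ?_) hz
  · rintro _ ⟨w, hw, rfl⟩
    refine mem_sup_left ⟨conjT w, ?_, (conjT_baseChange _ w).symm⟩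
    have := conjT_mem_eigenspace hw
    rwa [map_neg, conj_I, neg_neg] at this
  · rw [map_add]; exact Submodule.add_mem _ h h'

theorem IsPositiveSystem.add_ne_zero (hpos : IsPositiveSystem 𝔱 pos) {α β : 𝔱 →ₗ[ℝ] ℂ}
    (hα : α ∈ pos) (hβ : β ∈ pos) : α + β ≠ 0 := fun h => by
  rw [eq_neg_of_add_eq_zero_right h] at hβ
  rcases hpos.pos_or_neg α (hpos.isRoot α hα) with h' | h'
  · exact h'.2 hβ
  · exact h'.2 hα

theorem form_cartanOneZero (hIB : ∀ x y : 𝔱, B (J x) (J y) = B x y)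
    {u v : ℂ ⊗[ℝ] L} (hu : u ∈ cartanOneZero 𝔱 J) (hv : v ∈ cartanOneZero 𝔱 J) :
    formC B u v = 0 := by
  obtain ⟨w, hw, rfl⟩ := hu
  obtain ⟨w', hw', rfl⟩ := hv
  let B' : BilinForm ℝ 𝔱 := B.compl₁₂ 𝔱.toSubmodule.subtype 𝔱.toSubmodule.subtype
  have h1 : formC B (𝔱.toSubmodule.subtype.baseChange ℂ w) (𝔱.toSubmodule.subtype.baseChange ℂ w') =
    BilinForm.baseChange ℂ B' w w' := baseChange_form_comp B' B _ (fun _ _ => rfl) w w'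
  have h2 := baseChange_form_comp B' B' J hIB w w'
  rw [End.mem_eigenspace_iff.1 hw, End.mem_eigenspace_iff.1 hw', map_smul, map_smul,
    LinearMap.smul_apply, smul_smul, I_mul_I, smul_eq_mul] at h2
  rw [h1]
  linear_combination (-1 / 2 : ℂ) * h2

theorem oneZero_isotropic (hB : IsInvariantInner B) (h𝔱 : 𝔱.IsCartanSubalgebra)
    (hpos : IsPositiveSystem 𝔱 pos) (hIB : ∀ x y : 𝔱, B (J x) (J y) = B x y) {u v : ℂ ⊗[ℝ] L} (hu : u ∈ oneZero 𝔱 pos J)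
    (hv : v ∈ oneZero 𝔱 pos J) : formC B u v = 0 := by
  have hc : ∀ u ∈ cartanOneZero 𝔱 J, u ∈ rootSpaceC 𝔱 0 := fun u hu =>
    (hB.mem_complexCartan_iff h𝔱).1 (cartanOneZero_le hu)
  have hne : ∀ α ∈ pos, α ≠ 0 := fun α hα => (hpos.isRoot α hα).1
  have hadd : ∀ u v v', formC B u v = 0 → formC B u v' = 0 → formC B u (v + v') = 0 :=
    fun u v v' h h' => by rw [map_add, h, h', add_zero]
  refine sup_biSup_induction (p := fun u => formC B u v = 0) (fun u hu => ?_)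
    (fun α hα u hu => ?_) (fun z w h h' => by rw [map_add, LinearMap.add_apply, h, h', add_zero]) hu
  · exact sup_biSup_induction (fun v hv => form_cartanOneZero hIB hu hv)
      (fun β hβ v hv => hB.form_eq_zero (hc u hu) hv (by rw [zero_add]; exact hne β hβ))
      (hadd u) hv
  · exact sup_biSup_induction
      (fun v hv => hB.form_eq_zero hu (hc v hv) (by rw [add_zero]; exact hne α hα))
      (fun β hβ v hv => hB.form_eq_zero hu hv (hpos.add_ne_zero hα hβ)) (hadd u) hv

theorem cartan_lie_mem_oneZero (hB : IsInvariantInner B) (h𝔱 : 𝔱.IsCartanSubalgebra)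
    {u v : ℂ ⊗[ℝ] L} (hu : u ∈ complexCartan 𝔱) (hv : v ∈ oneZero 𝔱 pos J) :
    ⁅u, v⁆ ∈ oneZero 𝔱 pos J := by
  refine sup_biSup_induction (p := fun v => ⁅u, v⁆ ∈ oneZero 𝔱 pos J) (fun v hv => ?_)
    (fun α hα v hv => ?_) (fun z w h h' => by rw [lieC_add]; exact Submodule.add_mem _ h h') hv
  · obtain ⟨a, ha⟩ := exists_lie_eq_smul hu 0
    rw [ha v ((hB.mem_complexCartan_iff h𝔱).1 (cartanOneZero_le hv))]
    exact Submodule.smul_mem _ _ (mem_sup_left hv)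
  · obtain ⟨a, ha⟩ := exists_lie_eq_smul hu α
    rw [ha v hv]
    exact Submodule.smul_mem _ _ (rootSpaceC_le_oneZero hα hv)

theorem oneZero_lie_mem (hB : IsInvariantInner B) (h𝔱 : 𝔱.IsCartanSubalgebra)
    (hpos : IsPositiveSystem 𝔱 pos) {u v : ℂ ⊗[ℝ] L} (hu : u ∈ oneZero 𝔱 pos J)
    (hv : v ∈ oneZero 𝔱 pos J) : ⁅u, v⁆ ∈ oneZero 𝔱 pos J := by
  refine sup_biSup_induction (p := fun u => ⁅u, v⁆ ∈ oneZero 𝔱 pos J)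
    (fun u hu => cartan_lie_mem_oneZero hB h𝔱 (cartanOneZero_le hu) hv) (fun α hα u hu => ?_)
    (fun z w h h' => by rw [add_lie]; exact Submodule.add_mem _ h h') hu
  refine sup_biSup_induction (p := fun v => ⁅u, v⁆ ∈ oneZero 𝔱 pos J) (fun v hv => ?_)
    (fun β hβ v hv => ?_) (fun z w h h' => by rw [lieC_add]; exact Submodule.add_mem _ h h') hv
  · rw [lieC_skew]
    exact Submodule.neg_mem _ (cartan_lie_mem_oneZero hB h𝔱 (cartanOneZero_le hv)
      (rootSpaceC_le_oneZero hα hu))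
  · have hm := lie_mem_rootSpaceC hu hv
    by_cases h0 : rootSpaceC 𝔱 (α + β) = ⊥
    · rw [h0, Submodule.mem_bot] at hm
      rw [hm]; exact Submodule.zero_mem _
    · exact rootSpaceC_le_oneZero (hpos.add_mem α hα β hβ ⟨hpos.add_ne_zero hα hβ, h0⟩) hm

theorem oneZero_sup_zeroOne [FiniteDimensional ℝ L] (hB : IsInvariantInner B)
    (h𝔱 : 𝔱.IsCartanSubalgebra) (hpos : IsPositiveSystem 𝔱 pos) (hI : ∀ x, J (J x) = -x) :
    oneZero 𝔱 pos J ⊔ zeroOne 𝔱 pos J = ⊤ := by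
  rw [eq_top_iff, ← hB.iSup_rootSpaceC (hB.abelian h𝔱)]
  refine iSup_le fun α => ?_
  by_cases h0 : α = 0
  · rintro z hz
    rw [h0] at hz
    obtain ⟨w, rfl⟩ := (hB.mem_complexCartan_iff h𝔱).2 hz
    have hJ : J.baseChange ℂ (J.baseChange ℂ w) = -w := by
      rw [← comp_apply, ← baseChange_comp,
        show J ∘ₗ J = -LinearMap.id from LinearMap.ext hI, LinearMap.baseChange_neg,
        LinearMap.baseChange_id]
      rfl
    have mem : ∀ c : ℂ, c * c = -1 → (1 / 2 : ℂ) • (w - c • J.baseChange ℂ w) ∈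
        End.eigenspace (J.baseChange ℂ) c := fun c hc => by
      rw [End.mem_eigenspace_iff, map_smul, map_sub, map_smul, hJ]
      linear_combination (norm := module) (1 / 2 : ℂ) • congrArg (· • J.baseChange ℂ w) hc
    have hw : w = (1 / 2 : ℂ) • (w - I • J.baseChange ℂ w)
        + (1 / 2 : ℂ) • (w - (-I) • J.baseChange ℂ w) := by module
    have hw' := congrArg (𝔱.toSubmodule.subtype.baseChange ℂ) hw
    rw [map_add] at hw'
    rw [hw']
    exact Submodule.add_mem_sup
      (mem_sup_left ⟨_, mem I I_mul_I, rfl⟩)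
      (mem_sup_left ⟨_, mem (-I) (by rw [neg_mul_neg, I_mul_I]), rfl⟩)
  by_cases hb : rootSpaceC 𝔱 α = ⊥
  · rw [hb]; exact bot_le
  rcases hpos.pos_or_neg α ⟨h0, hb⟩ with h | h
  · exact (rootSpaceC_le_oneZero h.1).trans le_sup_left
  · have := rootSpaceC_le_zeroOne (J := J) h.1
    rw [neg_neg] at this
    exact this.trans le_sup_right

theorem IsCartanCoefficient.lie_eq (hB : IsInvariantInner B) (h𝔱 : 𝔱.IsCartanSubalgebra)
    (hP : IsCartanCoefficient B 𝔱 pos θ P) {α : 𝔱 →ₗ[ℝ] ℂ} (hα : α ∈ pos) :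
    ⁅θ α, conjT (θ α)⁆ = -((2 : ℂ) • P α) := by
  have h0 := hP.root_mem α hα
  have hm : ⁅θ α, conjT (θ α)⁆ ∈ rootSpaceC 𝔱 0 := by
    simpa using lie_mem_rootSpaceC h0 (hB.conjT_mem_rootSpaceC h0)
  have hPm := (hB.mem_complexCartan_iff h𝔱).1 (hP.mem α hα)
  rw [← sub_eq_zero, sub_neg_eq_add]
  refine hB.eq_zero_of_weight_zero (Submodule.add_mem _ hm (Submodule.smul_mem _ _ hPm))
    fun w hw => ?_
  have h1 : 2 * formC B (P α) w = formC B w ⁅conjT (θ α), θ α⁆ :=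
    hP.coeff α hα w ((hB.mem_complexCartan_iff h𝔱).2 hw)
  rw [map_add, LinearMap.add_apply, map_smul, LinearMap.smul_apply, smul_eq_mul, h1,
    lieC_skew (conjT (θ α)), map_neg, hB.formC_symm w, add_neg_cancel]

open Classical in
/-- A unitary frame of `𝔤^{1,0}` that extends the given root vectors. -/
theorem exists_unitary_oneZero [FiniteDimensional ℝ L] (hB : IsInvariantInner B)
    (h𝔱 : 𝔱.IsCartanSubalgebra) (hpos : IsPositiveSystem 𝔱 pos) 
    (hP : IsCartanCoefficient B 𝔱 pos θ P) (J : 𝔱 →ₗ[ℝ] 𝔱) :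
    ∃ (m : ℕ) (x : Fin m ⊕ pos → ℂ ⊗[ℝ] L), (∀ j, x j ∈ oneZero 𝔱 pos J) ∧
      (∀ j k, formC B (x j) (conjT (x k)) = if j = k then 1 else 0) ∧
      (∀ z ∈ oneZero 𝔱 pos J, z = ∑ j, formC B z (conjT (x j)) • x j) ∧
      ∑ j, ⁅x j, conjT (x j)⁆ = -((2 : ℂ) • ∑ α ∈ pos, P α) := by
  obtain ⟨m, y, y1, y2, y3⟩ := hB.exists_unitary (cartanOneZero 𝔱 J)
  have hy : ∀ u ∈ cartanOneZero 𝔱 J, u ∈ rootSpaceC 𝔱 0 := fun u hu =>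
    (hB.mem_complexCartan_iff h𝔱).1 (cartanOneZero_le hu)
  have hne : ∀ α ∈ pos, α ≠ 0 := fun α hα => (hpos.isRoot α hα).1
  have hθ := hP.root_mem
  have o1 : ∀ u ∈ cartanOneZero 𝔱 J, ∀ α ∈ pos, formC B u (conjT (θ α)) = 0 := fun u hu α hα =>
    hB.form_eq_zero (hy u hu) (hB.conjT_mem_rootSpaceC (hθ α hα))
      (by rw [zero_add]; exact neg_ne_zero.2 (hne α hα))
  have o2 : ∀ α ∈ pos, ∀ z ∈ rootSpaceC 𝔱 α, ∀ j, formC B z (conjT (y j)) = 0 :=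
    fun α hα z hz j => hB.form_eq_zero hz (hB.conjT_mem_rootSpaceC (hy _ (y1 j)))
      (by rw [neg_zero, add_zero]; exact hne α hα)
  have o3 : ∀ α ∈ pos, ∀ z ∈ rootSpaceC 𝔱 α, ∀ β ∈ pos, α ≠ β → formC B z (conjT (θ β)) = 0 :=
    fun α hα z hz β hβ h => hB.form_eq_zero hz (hB.conjT_mem_rootSpaceC (hθ β hβ))
      (by rw [← sub_eq_add_neg]; exact sub_ne_zero.2 h)
  refine ⟨m, Sum.elim y fun α => θ α, ?_, ?_, fun z hz => ?_, ?_⟩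
  · rintro (j | α)
    · exact mem_sup_left (y1 j)
    · exact rootSpaceC_le_oneZero α.2 (hθ α α.2)
  · rintro (j | ⟨α, hα⟩) (k | ⟨β, hβ⟩) <;>
      simp only [elim_inl, elim_inr, reduceCtorEq, if_false, Sum.inl.injEq, Sum.inr.injEq,
        Subtype.mk.injEq]
    · exact y2 j k
    · exact o1 _ (y1 j) β hβ
    · exact o2 α hα _ (hθ α hα) k
    · split_ifs with h
      · rw [← h]; exact hP.unitary α hα
      · exact o3 α hα _ (hθ α hα) β hβ h
  · simp only [sum_sum_type, elim_inl, elim_inr]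
    refine sup_biSup_induction (p := fun z => z = ∑ j, formC B z (conjT (y j)) • y j
      + ∑ α : pos, formC B z (conjT (θ α)) • θ α) (fun u hu => ?_) (fun α hα u hu => ?_)
      (fun z w h h' => ?_) hz
    · rw [← y3 u hu, sum_eq_zero fun α _ => by rw [o1 u hu α α.2, zero_smul], add_zero]
    · rw [sum_eq_zero fun j _ => by rw [o2 α hα u hu, zero_smul], zero_add,
        sum_eq_single ⟨α, hα⟩ (fun β _ h => by
          rw [o3 α hα u hu β β.2 fun h' => h (Subtype.ext h'.symm), zero_smul])
          (fun h => (h (Finset.mem_univ _)).elim)]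
      exact hB.eq_smul_of_mem_rootSpaceC h𝔱 (hne α hα) (hθ α hα) (hP.unitary α hα) hu
    · conv_lhs => rw [h, h']
      simp only [map_add, LinearMap.add_apply, add_smul, sum_add_distrib]
      abel
  · have h0 : ∀ j, ⁅y j, conjT (y j)⁆ = 0 := fun j => by
      have hc : conjT (y j) ∈ rootSpaceC 𝔱 0 := by simpa using hB.conjT_mem_rootSpaceC (hy _ (y1 j))
      obtain ⟨a, ha⟩ := exists_lie_eq_smul (cartanOneZero_le (y1 j)) 0
      have h1 := ha _ (hy _ (y1 j))
      have h2 : ⁅y j, y j⁆ = 0 := lie_self _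
      rw [ha _ hc]
      rw [h2] at h1
      by_cases hy0 : y j = 0
      · rw [hy0, map_zero, smul_zero]
      · rw [(smul_eq_zero.1 h1.symm).resolve_right hy0, zero_smul]
    simp only [sum_sum_type, elim_inl, elim_inr]
    rw [sum_eq_zero fun j _ => h0 j, zero_add, smul_sum, ← sum_neg_distrib,
      sum_coe_sort pos fun α => ⁅θ α, conjT (θ α)⁆]
    exact sum_congr rfl fun α hα => hP.lie_eq hB h𝔱 hα

theorem card_unitary_frame [FiniteDimensional ℝ L] (hB : IsInvariantInner B) {κ : Type*}
    [Fintype κ] [DecidableEq κ] {y : κ → ℂ ⊗[ℝ] L}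
    (h : ∀ j k, formC B (y j) (conjT (y k)) = if j = k then 1 else 0)
    (h0 : ∀ j k, formC B (y j) (y k) = 0)
    (hexp : ∀ z, z = ∑ j, formC B z (conjT (y j)) • y j + ∑ j, formC B z (y j) • conjT (y j)) :
    finrank ℝ L = 2 * Fintype.card κ := by
  let b : κ ⊕ κ → ℂ ⊗[ℝ] L := Sum.elim y fun j => conjT (y j)
  have h1 : ∀ j k, formC B (conjT (y j)) (y k) = if k = j then 1 else 0 := fun j k => by
    rw [hB.formC_symm, h]
  have h2 : ∀ j k, formC B (conjT (y j)) (conjT (y k)) = 0 := fun j k => by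
    rw [formC, baseChange_form_conjT]
    exact (congrArg _ (h0 j k)).trans (map_zero _)
  have hli : LinearIndependent ℂ b := by
    rw [Fintype.linearIndependent_iff]
    intro c hc
    rw [sum_sum_type] at hc
    simp only [b, elim_inl, elim_inr] at hc
    have key : ∀ w, ∑ j, c (Sum.inl j) * formC B (y j) w
        + ∑ j, c (Sum.inr j) * formC B (conjT (y j)) w = 0 := fun w => by
      have := congrArg (fun z => formC B z w) hc
      simpa only [map_add, map_sum, map_smul, LinearMap.add_apply, LinearMap.sum_apply,
        LinearMap.smul_apply, smul_eq_mul, map_zero, LinearMap.zero_apply] using this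
    rintro (k | k)
    · have := key (conjT (y k))
      simpa [h, h2] using this
    · have := key (y k)
      simpa [h0, h1] using this
  have hsp : ⊤ ≤ Submodule.span ℂ (Set.range b) := fun z _ => by
    rw [hexp z]
    exact Submodule.add_mem _
      (Submodule.sum_mem _ fun j _ => Submodule.smul_mem _ _
        (Submodule.subset_span ⟨Sum.inl j, rfl⟩))
      (Submodule.sum_mem _ fun j _ => Submodule.smul_mem _ _
        (Submodule.subset_span ⟨Sum.inr j, rfl⟩))
  have := Module.finrank_eq_card_basis (Basis.mk hli hsp)
  rw [Module.finrank_baseChange, Fintype.card_sum] at this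
  omega

open Classical in
theorem exists_isPolarization [FiniteDimensional ℝ L] {n : ℕ} (hn : finrank ℝ L = 2 * n)
    (hB : IsInvariantInner B) (h𝔱 : 𝔱.IsCartanSubalgebra) (hpos : IsPositiveSystem 𝔱 pos)
    (hI : ∀ x, J (J x) = -x) (hIB : ∀ x y : 𝔱, B (J x) (J y) = B x y)
    (hP : IsCartanCoefficient B 𝔱 pos θ P) :
    ∃ x : Fin n → ℂ ⊗[ℝ] L, IsPolarization B (oneZero 𝔱 pos J) (zeroOne 𝔱 pos J) x ∧
      weylElt x = -((2 : ℂ) • ∑ α ∈ pos, P α) := by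
  obtain ⟨m, y, y1, y2, y3, y4⟩ := exists_unitary_oneZero hB h𝔱 hpos hP J
  have hiso := fun u hu v hv => oneZero_isotropic hB h𝔱 hpos hIB (u := u) (v := v) hu hv
  have hconj : ∀ z w, formC B (conjT z) (conjT w) = starRingEnd ℂ (formC B z w) :=
    baseChange_form_conjT B
  have hexp : ∀ z, z = ∑ j, formC B z (conjT (y j)) • y j
      + ∑ j, formC B z (y j) • conjT (y j) := fun z => by
    have hz : z ∈ oneZero 𝔱 pos J ⊔ zeroOne 𝔱 pos J := by
      rw [oneZero_sup_zeroOne hB h𝔱 hpos hI]; exact Submodule.mem_top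
    obtain ⟨p, hp, q, hq, rfl⟩ := Submodule.mem_sup.1 hz
    have hq' := conjT_mem_zeroOne hB hq
    have hp1 := y3 p hp
    have hq1 := congrArg conjT (y3 _ hq')
    rw [conjT_conjT, map_sum] at hq1
    simp only [conjT_smul, ← hconj, conjT_conjT] at hq1
    conv_lhs => rw [hp1, hq1]
    refine congrArg₂ (· + ·) (sum_congr rfl fun j _ => ?_)
      (sum_congr rfl fun j _ => ?_)
    · have h0 : formC B q (conjT (y j)) = 0 := by
        rw [← conjT_conjT q, hconj, hiso _ hq' _ (y1 j), map_zero]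
      rw [map_add, LinearMap.add_apply, h0, add_zero]
    · rw [map_add, LinearMap.add_apply, hiso p hp _ (y1 j), zero_add]
  have hcard : Fintype.card (Fin m ⊕ pos) = n := Nat.eq_of_mul_eq_mul_left two_pos
    ((card_unitary_frame hB y2 (fun j k => hiso _ (y1 j) _ (y1 k)) hexp).symm.trans hn)
  let e : Fin n ≃ Fin m ⊕ pos := (Fintype.equivFinOfCardEq hcard).symm
  have hsum : ∀ f : Fin m ⊕ pos → ℂ ⊗[ℝ] L, ∑ j, f (e j) = ∑ j, f j := fun f => Equiv.sum_comp e f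
  have hw : weylElt (fun j => y (e j)) = -((2 : ℂ) • ∑ α ∈ pos, P α) :=
    (hsum fun j => ⁅y j, conjT (y j)⁆).trans y4
  have hexp' : ∀ z, z = ∑ j, formC B z (conjT (y (e j))) • y (e j)
      + ∑ j, formC B z (y (e j)) • conjT (y (e j)) := fun z => by
    rw [hsum fun j => formC B z (conjT (y j)) • y j, hsum fun j => formC B z (y j) • conjT (y j)]
    exact hexp z
  refine ⟨fun j => y (e j), ?_, hw⟩
  exact
    { symm := hB.symm
      conj_mem := fun z => ⟨conjT_mem_zeroOne hB, fun h => by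
        rw [← conjT_conjT z]; exact conjT_mem_oneZero hB h⟩
      mem := fun j => y1 _
      isotropic := hiso
      unitary := fun j k => by rw [y2]; by_cases h : j = k <;> simp [h]
      frame := ⟨fun z => by rw [sum_sum_type]; exact hexp' z, fun z => by
        rw [sum_sum_type, add_comm]; exact hexp' z⟩
      lie_mem := fun v hv w hw => oneZero_lie_mem hB h𝔱 hpos hv hw
      weyl_mem := fun v hv => by
        rw [hw]
        exact cartan_lie_mem_oneZero hB h𝔱 (Submodule.neg_mem _ (Submodule.smul_mem _ _
          (Submodule.sum_mem _ fun α hα => hP.mem α hα))) hv }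

end PositiveSystem

theorem mainTheorem2 {E G : Type*} [NormedAddCommGroup E] [NormedSpace ℝ E]
    [FiniteDimensional ℝ E] [TopologicalSpace G] [T2Space G] [CompactSpace G] [ChartedSpace E G]
    [Group G] [LieGroup 𝓘(ℝ, E) ∞ G]
    (n : ℕ) (hn : Module.finrank ℝ E = 2 * n)
    (B : LinearMap.BilinForm ℝ (GroupLieAlgebra 𝓘(ℝ, E) G)) (hB : IsBiinvariantMetric B)
    (𝔱 : LieSubalgebra ℝ (GroupLieAlgebra 𝓘(ℝ, E) G)) (h𝔱 : 𝔱.IsCartanSubalgebra)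
    (pos : Finset (𝔱 →ₗ[ℝ] ℂ)) (hpos : IsPositiveSystem 𝔱 pos)
    (I𝔱 : 𝔱 →ₗ[ℝ] 𝔱) (hI : ∀ x, I𝔱 (I𝔱 x) = -x)
    (hIB : ∀ x y : 𝔱, B (I𝔱 x) (I𝔱 y) = B x y)
    (θ P : (𝔱 →ₗ[ℝ] ℂ) → ℂ ⊗[ℝ] GroupLieAlgebra 𝓘(ℝ, E) G)
    (hP : IsCartanCoefficient B 𝔱 pos θ P) :
    ∃ Jφ Jψ : G → GenTangent E →ₗ[ℝ] GenTangent E,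
      (∀ g, eigenbundle (Jφ g) =
        doubleSubspace B g (oneZero 𝔱 pos I𝔱) (oneZero 𝔱 pos I𝔱)) ∧
      (∀ g, eigenbundle (Jψ g) =
        doubleSubspace B g (oneZero 𝔱 pos I𝔱) (zeroOne 𝔱 pos I𝔱)) ∧
      IsTwistedGenKahler (cartanH B) Jφ Jψ ∧
      ∃ vol : G → E [⋀^Fin (2 * n)]→L[ℝ] ℝ,
        (∀ g, FormSmoothAt vol g) ∧ (∀ g, vol g ≠ 0) ∧
        (∀ (g : G) (v : Fin (2 * n) → GroupLieAlgebra 𝓘(ℝ, E) G),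
          |vol g (fun i => leftField g (v i))| = |vol 1 v|) ∧
        IsScalarCurvature n (cartanH B) Jφ Jψ vol
          (fun _ => 2 * hermNormSq B (∑ α ∈ pos, P α)) := by
  have hB' : IsInvariantInner B := ⟨hB.symm, hB.pos, hB.lie_form⟩
  have : FiniteDimensional ℝ (GroupLieAlgebra 𝓘(ℝ, E) G) := inferInstanceAs (FiniteDimensional ℝ E)
  obtain ⟨x, hx, hw⟩ := exists_isPolarization (L := GroupLieAlgebra 𝓘(ℝ, E) G) hn hB' h𝔱 hpos hI
    hIB hP
  have h₁ : ∀ g, eigenbundle (doubleJ hB (-polJ B x) (-polJ B x) g) =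
      doubleSubspace B g (oneZero 𝔱 pos I𝔱) (oneZero 𝔱 pos I𝔱) := fun g =>
    eigenbundle_doubleJ hB g hx.eigenspace_neg_polJ hx.eigenspace_neg_polJ
  have h₂ : ∀ g, eigenbundle (doubleJ hB (-polJ B x) (polJ B x) g) =
      doubleSubspace B g (oneZero 𝔱 pos I𝔱) (zeroOne 𝔱 pos I𝔱) := fun g =>
    eigenbundle_doubleJ hB g hx.eigenspace_neg_polJ hx.eigenspace_polJ
  obtain ⟨vol, v1, v2, v3, v4, v5⟩ := exists_volume hn hB hx h₁ h₂
  have hS : -(1 / 2) * (formC B (weylElt x) (weylElt x)).re =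
      2 * hermNormSq B (∑ α ∈ pos, P α) := by
    have hc : conjT (∑ α ∈ pos, P α) = -∑ α ∈ pos, P α := by
      have h := conjT_weylElt x
      rw [hw, map_neg, conjT_smul, neg_inj, map_ofNat, ← smul_neg] at h
      exact smul_right_injective _ (two_ne_zero (α := ℂ)) h
    have h : hermNormSq B (∑ α ∈ pos, P α) =
      (formC B (∑ α ∈ pos, P α) (conjT (∑ α ∈ pos, P α))).re := rfl
    rw [h, hc, hw]
    simp only [map_neg, map_smul, LinearMap.neg_apply, LinearMap.smul_apply, smul_eq_mul,
      Complex.neg_re, Complex.mul_re, Complex.re_ofNat, Complex.im_ofNat]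
    ring
  refine ⟨_, _, h₁, h₂, isTwistedGenKahler_doubleJ hB hx, vol, v1, v2, fun g v => ?_, v5,
    fun T g hg => ?_⟩
  · have h := v3 g v
    have h1 : leftForm vol 1 v = vol 1 v := by rw [leftForm, lTrans_one]; rfl
    rwa [h1] at h
  · rw [← hS]
    exact curvatureForm_eq hn hB hx h₁ h₂ v2 v4 T hg

end
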